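/- **Setting.** Let $V=\mathbb R^{1,10}$ with $\eta=\mathrm{diag}(1,-1,\dots,-1)$, let $S$ be a simple module over the Clifford algebra $C\ell(V)$ with $v\cdot v=-\eta(v,v)$, let $\langle-,-\rangle$ be an $\mathfrak{so}(V)$-invariant symplectic form on $S$, and let $\kappa:\odot^2S\to V$ be the Dirac current, $\eta(\kappa(s,s),v)=\langle s,v\cdot s\rangle$. The $D=11$ Poincaré superalgebra is $\mathfrak p=\mathfrak{so}(V)\oplus S\oplus V$ (degrees $0,-1,-2$; $S$ odd), with nontrivial brackets $[A,B]=AB-BA$, $[A,s]=As$, $[A,v]=Av$, $[s,s]=\kappa(s,s)$; $\mathfrak m=S\oplus V$. Let $\mathfrak h=\mathfrak h_0\oplus S\oplus V$, with $\mathfrak h_0\subset\mathfrak{so}(V)$ a Lie subalgebra, be a maximally supersymmetric graded subalgebra of $\mathfrak p$. Let $W$ be a finite-dimensional real vector space with basis $(t_i)$, $\Lambda^\bullet=\Lambda^\bullet W$ (elements of $W$ are odd of degree $-1$) and $\mathfrak h^\Lambda=\Lambda^\bullet\otimes\mathfrak h$. A *filtered deformation* of $\mathfrak h$ parametrized by $W$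 is a Lie superalgebra structure $F$ on $\mathfrak h^\Lambda$ whose bracket is $\Lambda^\bullet$-linear (with the sign rule), preserves the $\mathbb Z$-grading of $\mathfrak h^\Lambda$, and whose components with coefficients in $\Lambda^0=\mathbb R$ are the brackets of $\mathfrak h$. *Isomorphisms* are $\Lambda^\bullet$-linear isomorphisms of Lie superalgebras preserving the grading and the filtration $F^{-i}=\bigoplus_{j\le i}\Lambda^\bullet\otimes\mathfrak h_{-j}$. Let $\varepsilon(s,s)\in\Lambda^1\otimes S$, $\epsilon(s,v)\in\Lambda^1\otimes V$, $\theta(A,s)\in\Lambda^1\otimes\mathfrak h_0$ be the first-order components of $[s,s]$, $[s,v]$, $[A,s]$, extended $\Lambda^\bullet$-linearly with the sign rule. For $\phi^i\in S^*$ and linear $X^i:S\to\mathfrak{so}(V)$ we say that $F$ is *represented by* $(\phi^i,X^i)$ if $$\varepsilon(s,s)=\sum_i t_i\otimes(-2\phi^i(s)s+2X^i_s s),\qquad \epsilon(s,v)=\sum_i t_i\otimes(-2\phi^i(s)v+X^i_s v),$$ and that $F$ *squares to zero* if for all $A\in\mathfrak h_0$, $s\in S$, $v\in V$ $$2\theta(\theta(A,s),s)-\theta(A,\varepsilon(s,s))=0,\quad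 \varepsilon(\varepsilon(s,s),s)=0,\quad 2\epsilon(s,\epsilon(s,v))-\epsilon(\varepsilon(s,s),v)=0 .$$ The first-order infinitesimal direction of $F$ *has a nilpotent representative* if some filtered deformation isomorphic to $F$ is represented by some $(\phi^i,X^i)$ and squares to zero. It is *nilpotent* if every filtered deformation isomorphic to $F$ that is represented by some $(\phi^i,X^i)$ with $X^i:S\to\mathfrak h_0^\perp$ squares to zero, where $\mathfrak h_0^\perp\subset\mathfrak{so}(V)$ is the orthogonal complement for the Killing form (for compact $\mathfrak h_0$ this says that the canonical representative squares to zero). **Theorem.** Let $F$ be a filtered deformation of $\mathfrak h$ parametrized by $W$. Suppose that either $F$ has compact stabilizer, i.e. $\mathfrak h_0$ is a compact subalgebra of $\mathfrak{so}(V)$ (it preserves a Euclidean inner product on $V$), or the infinitesimal deformation of $F$ is timelike (generic), i.e. its contraction with some $l\in W^*$ has the same class in the Spencer cohomology $H^{1,2}(\mathfrak m,\mathfrak p)$ as the cocycle $\varepsilon^\phi(s,s)=-2\phi(s)s$, $\epsilon^\phi(s,v)=-2\phi(s)v$, where $\phi=\langle u,-\rangle$ and $u\in S$ satisfies $\eta(\kappa(u,u),\kappa(u,u))>0$.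 1. If the first-order infinitesimal direction of $F$ is nilpotent, then there are $\phi^i\in S^*$ and $\mathfrak h_0$-equivariant maps $X^i:S\to\mathfrak h_0^\perp$ $(i=1,\dots,\dim W)$ such that $F$ is isomorphic to a filtered deformation with brackets $$[A,B]=AB-BA,\quad [A,v]=Av,\quad [A,s]=As,\quad [v,w]=0,$$ $$[s,s]=\kappa(s,s)-2\sum_i t_i\otimes\phi^i(s)s+2\sum_i t_i\otimes X^i_s s,\qquad [s,v]=-2\sum_i t_i\otimes\phi^i(s)v+\sum_i t_i\otimes X^i_s v .$$ 2. If the first-order infinitesimal direction of $F$ has a nilpotent representative, then the same holds with maps $X^i:S\to\mathfrak{so}(V)$ such that $[A,X^i_s]-X^i_{As}\in\mathfrak h_0$ for all $A\in\mathfrak h_0$, $s\in S$, and with $[A,s]=As+\sum_i t_i\otimes([A,X^i_s]-X^i_{As})$. In both cases $F$ is thus isomorphic to a deformation of first order (no bracket component of elements of $\mathfrak h$ has coefficients in $\Lambda^k$, $k\ge2$), and the underlying geometry is flat: in that deformation $\Lambda^{\mathrm{even}}\otimes(\mathfrak h_0\oplus V)$ is closed under the bracket, which is the undeformed one there. -/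

import Mathlib

open scoped TensorProduct

attribute [local instance 100] LieRing.ofAssociativeRing

noncomputable section

namespace Poincare11

/-! ## The `D = 11` Poincaré superalgebra -/

/-- The vector space `V = ℝ^{1,10}`. -/
abbrev V : Type := Fin 11 → ℝ

/-- The diagonal entries of the "mostly minus" Minkowski metric. -/
def sgn (a : Fin 11) : ℝ := if a = 0 then 1 else -1

/-- The Lorentzian inner product `η = diag(+1, -1, …, -1)` on `V`. -/
def eta : LinearMap.BilinForm ℝ V :=
  LinearMap.mk₂ ℝ (fun v w => ∑ a, sgn a * v a * w a)
    (fun v v' w => by simp only [Pi.add_apply, mul_add, add_mul, Finset.sum_add_distrib])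
    (fun c v w => by
      simp only [Pi.smul_apply, smul_eq_mul, Finset.mul_sum]
      exact Finset.sum_congr rfl fun _ _ => by ring)
    (fun v w w' => by simp only [Pi.add_apply, mul_add, Finset.sum_add_distrib])
    (fun c v w => by
      simp only [Pi.smul_apply, smul_eq_mul, Finset.mul_sum]
      exact Finset.sum_congr rfl fun _ _ => by ring)

/-- The quadratic form `v ↦ -η(v, v)`, so that `v · v = -η(v, v)` in the Clifford algebra. -/
def Q : QuadraticForm ℝ V := -(LinearMap.BilinMap.toQuadraticMap eta)

/-- The Clifford algebra `Cl(V)`. -/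
abbrev Cl : Type := CliffordAlgebra Q

/-- The Lorentz algebra `𝔰𝔬(V)`: the `η`-skew endomorphisms of `V`. -/
abbrev soV : LieSubalgebra ℝ (Module.End ℝ V) := skewAdjointLieSubalgebra eta

/-- The standard orthonormal basis vector `e_a`. -/
def e (a : Fin 11) : V := Pi.single a 1

section Spinors

variable {S : Type*} [AddCommGroup S] [Module ℝ S] [Module Cl S] [IsScalarTower ℝ Cl S]

/-- Clifford multiplication of a spinor by a vector. -/
def cliff (v : V) (s : S) : S := CliffordAlgebra.ι Q v • s

/-- The element `-¼ ∑ₐ ηᵃᵃ (A eₐ) · eₐ` of `Cl(V)` that represents `A ∈ 𝔰𝔬(V)` on spinors; this is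
half the Clifford product of the bivector of `A`. -/
def spinElt (A : Module.End ℝ V) : Cl :=
  (-(1 / 4) : ℝ) • ∑ a, sgn a • (CliffordAlgebra.ι Q (A (e a)) * CliffordAlgebra.ι Q (e a))

/-- The spin representation of `𝔰𝔬(V)` on `S`. -/
def spin (A : Module.End ℝ V) (s : S) : S := spinElt A • s

/-- An `𝔰𝔬(V)`-invariant symplectic form on the spinor module. -/
structure IsInvariantSymplectic (ω : S →ₗ[ℝ] S →ₗ[ℝ] ℝ) : Prop where
  alt : ω.IsAlt
  nondegenerate : ω.Nondegenerate
  invariant : ∀ A ∈ soV, ∀ s t : S, ω (spin A s) t + ω s (spin A t) = 0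

/-- The Dirac current: the symmetric bilinear map `κ : S × S → V` with
`η(κ(s, s), v) = ω(s, v · s)`. -/
def kappa (ω : S →ₗ[ℝ] S →ₗ[ℝ] ℝ) (s t : S) : V := fun a =>
  sgn a * ((ω s (cliff (e a) t) + ω t (cliff (e a) s)) / 2)

lemma eta_apply (v w : V) : eta v w = ∑ a, sgn a * v a * w a := rfl

lemma sgn_mul_self (a : Fin 11) : sgn a * sgn a = 1 := by
  unfold sgn; split_ifs <;> norm_num

lemma eta_kappa_self (ω : S →ₗ[ℝ] S →ₗ[ℝ] ℝ) (s : S) (v : V) :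
    eta (kappa ω s s) v = ω s (cliff v s) := by
  have hv : v = ∑ a, v a • e a := by
    ext b
    simp [e, Finset.sum_apply, Pi.single_apply]
  have hsum : cliff v s = ∑ a, v a • cliff (e a) s := by
    conv_lhs => rw [hv]
    simp only [cliff, map_sum, map_smul, Finset.sum_smul, smul_assoc]
  rw [hsum, eta_apply, map_sum]
  refine Finset.sum_congr rfl fun a _ => ?_
  rw [map_smul, smul_eq_mul, kappa]
  have := sgn_mul_self a
  linear_combination (ω s (cliff (e a) s)) * v a * this

end Spinors

/-! ## Maximally supersymmetric graded subalgebras `𝔥 = 𝔥₀ ⊕ S ⊕ V` -/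

/-- The vector superspace `𝔥 = 𝔥₀ ⊕ S ⊕ V`. -/
abbrev H (h₀ : LieSubalgebra ℝ soV) (S : Type*) : Type _ := h₀ × S × V

section Subalgebra

variable {S : Type*} [AddCommGroup S] [Module ℝ S] (h₀ : LieSubalgebra ℝ soV)

/-- The endomorphism of `V` given by an element of `𝔥₀`. -/
abbrev asEnd {h₀ : LieSubalgebra ℝ soV} (A : h₀) : Module.End ℝ V := ((A : soV) : Module.End ℝ V)

/-- The element of `𝔥` given by `A ∈ 𝔥₀`. -/
def inA {h₀ : LieSubalgebra ℝ soV} (A : h₀) : H h₀ S := (A, 0, 0)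
/-- The element of `𝔥` given by `s ∈ S`. -/
def inS (s : S) : H h₀ S := (0, s, 0)
/-- The element of `𝔥` given by `v ∈ V`. -/
def inV (v : V) : H h₀ S := (0, 0, v)

/-- `hGr h₀ S j` is the component `𝔥_{-j}` : `𝔥₀` for `j = 0`, `S` for `j = 1`, `V` for `j = 2`. -/
def hGr (S : Type*) [AddCommGroup S] [Module ℝ S] : ℕ → Submodule ℝ (H h₀ S)
  | 0 => (⊤ : Submodule ℝ h₀).prod ((⊥ : Submodule ℝ S).prod (⊥ : Submodule ℝ V))
  | 1 => (⊥ : Submodule ℝ h₀).prod ((⊤ : Submodule ℝ S).prod (⊥ : Submodule ℝ V))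
  | 2 => (⊥ : Submodule ℝ h₀).prod ((⊥ : Submodule ℝ S).prod (⊤ : Submodule ℝ V))
  | _ => ⊥

variable [Module Cl S] [IsScalarTower ℝ Cl S] (ω : S →ₗ[ℝ] S →ₗ[ℝ] ℝ)

/-- The Lie superbracket of `𝔥` (the restriction of that of the Poincaré superalgebra): the
nontrivial brackets are `[A, B] = AB - BA`, `[A, s] = A s`, `[A, v] = A v`, `[s, t] = κ(s, t)`. -/
def hBracket (x y : H h₀ S) : H h₀ S :=
  (⁅x.1, y.1⁆,
   spin (asEnd x.1) y.2.1 - spin (asEnd y.1) x.2.1,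
   kappa ω x.2.1 y.2.1 + asEnd x.1 y.2.2 - asEnd y.1 x.2.2)

/-- `𝔥₀` is a compact subalgebra of `𝔰𝔬(V)`: it preserves a Euclidean inner product on `V`
(equivalently, it lies in the Lie algebra of a compact subgroup of the Lorentz group). -/
def IsCompactSubalgebra : Prop :=
  ∃ g : LinearMap.BilinForm ℝ V, g.IsSymm ∧ (∀ v, v ≠ 0 → 0 < g v v) ∧
    ∀ (A : h₀) (v w : V), g (asEnd A v) w + g v (asEnd A w) = 0

/-- The orthogonal complement `𝔥₀^⊥` in `𝔰𝔬(V)` for the trace form, which is a multiple of the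
Killing form. -/
def InPerp (B : soV) : Prop :=
  ∀ A : h₀, LinearMap.trace ℝ V (asEnd A * (B : Module.End ℝ V)) = 0

end Subalgebra

/-! ## Lie superalgebras -/

/-- A real Lie superalgebra structure on the superspace with homogeneous components `P i`. -/
structure IsLieSuperbracket {L : Type*} [AddCommGroup L] [Module ℝ L]
    (P : ZMod 2 → Submodule ℝ L) (B : L →ₗ[ℝ] L →ₗ[ℝ] L) : Prop where
  even : ∀ i j, ∀ x ∈ P i, ∀ y ∈ P j, B x y ∈ P (i + j)
  skew : ∀ i j, ∀ x ∈ P i, ∀ y ∈ P j, B x y = -((-1 : ℝ) ^ (i.val * j.val) • B y x)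
  jacobi : ∀ i j, ∀ x ∈ P i, ∀ y ∈ P j, ∀ z,
    B x (B y z) = B (B x y) z + (-1 : ℝ) ^ (i.val * j.val) • B y (B x z)

/-! ## Filtered deformations parametrized by an exterior algebra -/

section Deformation

variable {S : Type*} [AddCommGroup S] [Module ℝ S] (h₀ : LieSubalgebra ℝ soV)
variable (W : Type*) [AddCommGroup W] [Module ℝ W]

/-- The superspace `𝔥^Λ = Λ^• W ⊗ 𝔥`, a left module over `Λ^• W`. -/
abbrev HL (S : Type*) [AddCommGroup S] [Module ℝ S] : Type _ := ExteriorAlgebra ℝ W ⊗[ℝ] H h₀ S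

/-- The subspace `Λ^k W ⊗ 𝔥_{-j}` of `𝔥^Λ`. -/
def piece (S : Type*) [AddCommGroup S] [Module ℝ S] (k j : ℕ) : Submodule ℝ (HL h₀ W S) :=
  Submodule.span ℝ {z | ∃ t ∈ ⋀[ℝ]^k W, ∃ x ∈ hGr h₀ S j, z = t ⊗ₜ[ℝ] x}

/-- The component of `𝔥^Λ` of `ℤ`-degree `-n`; elements of `W` have degree `-1`. -/
def degPart (S : Type*) [AddCommGroup S] [Module ℝ S] (n : ℕ) : Submodule ℝ (HL h₀ W S) :=
  ⨆ (p : ℕ × ℕ) (_ : p.1 + p.2 = n), piece h₀ W S p.1 p.2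

/-- The even and odd components of `𝔥^Λ`. -/
def parityPart (S : Type*) [AddCommGroup S] [Module ℝ S] (i : ZMod 2) : Submodule ℝ (HL h₀ W S) :=
  ⨆ (p : ℕ × ℕ) (_ : ((p.1 + p.2 : ℕ) : ZMod 2) = i), piece h₀ W S p.1 p.2

/-- The filtrand `F^{-i} = ⨁_{j ≤ i} 𝔥_{-j}^Λ`. -/
def filtPart (S : Type*) [AddCommGroup S] [Module ℝ S] (i : ℕ) : Submodule ℝ (HL h₀ W S) :=
  ⨆ (p : ℕ × ℕ) (_ : p.2 ≤ i), piece h₀ W S p.1 p.2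

variable {h₀ W}

/-- The projection `𝔥^Λ → Λ^k W ⊗ 𝔥`. -/
def comp (k : ℕ) : HL h₀ W S →ₗ[ℝ] HL h₀ W S :=
  LinearMap.rTensor (H h₀ S) (GradedAlgebra.proj (fun i : ℕ => ⋀[ℝ]^i W) k)

/-- The coefficient in `𝔥` along `1 ∈ Λ⁰ W`. -/
def coeffZero : HL h₀ W S →ₗ[ℝ] H h₀ S :=
  (TensorProduct.lid ℝ (H h₀ S)).toLinearMap ∘ₗ
    LinearMap.rTensor (H h₀ S) (ExteriorAlgebra.algebraMapInv (R := ℝ) (M := W)).toLinearMap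

/-- The contraction of the `Λ¹ W ⊗ 𝔥` component with a linear functional `l` on `W`. -/
def coeffOne (l : W →ₗ[ℝ] ℝ) : HL h₀ W S →ₗ[ℝ] H h₀ S :=
  (TensorProduct.lid ℝ (H h₀ S)).toLinearMap ∘ₗ
    LinearMap.rTensor (H h₀ S) (l ∘ₗ ExteriorAlgebra.ιInv (R := ℝ) (M := W))

/-- The inclusion `𝔥 → 𝔥^Λ`, `x ↦ 1 ⊗ x`. -/
def up (x : H h₀ S) : HL h₀ W S := (1 : ExteriorAlgebra ℝ W) ⊗ₜ[ℝ] x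

/-- A (not necessarily Lie) real bilinear bracket on `𝔥^Λ`. -/
abbrev Br (h₀ : LieSubalgebra ℝ soV) (W : Type*) [AddCommGroup W] [Module ℝ W]
    (S : Type*) [AddCommGroup S] [Module ℝ S] : Type _ :=
  HL h₀ W S →ₗ[ℝ] HL h₀ W S →ₗ[ℝ] HL h₀ W S

/-- An isomorphism of filtered Lie superalgebras over `Λ^• W` between two deformations: it is
`Λ^• W`-linear, and preserves the brackets, the `ℤ`-grading of `𝔥^Λ` (hence the parity), and the
filtration. -/
def Isomorphic (B B' : Br h₀ W S) : Prop :=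
  ∃ Φ : HL h₀ W S ≃ₗ[ExteriorAlgebra ℝ W] HL h₀ W S,
    (∀ x y, Φ (B x y) = B' (Φ x) (Φ y)) ∧
    (∀ n x, Φ x ∈ degPart h₀ W S n ↔ x ∈ degPart h₀ W S n) ∧
    (∀ i x, Φ x ∈ filtPart h₀ W S i ↔ x ∈ filtPart h₀ W S i)

variable [Module Cl S] [IsScalarTower ℝ Cl S] (ω : S →ₗ[ℝ] S →ₗ[ℝ] ℝ)

/-- A filtered deformation of `𝔥` parametrized by `W`: a Lie superalgebra supported on `𝔥^Λ` whose
bracket is `Λ^• W`-linear (in the super sense), preserves the `ℤ`-grading, and whose components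
with coefficients in `Λ⁰ W = ℝ` are those of `𝔥`. -/
structure IsFilteredDeformation (B : Br h₀ W S) : Prop where
  lie : IsLieSuperbracket (parityPart h₀ W S) B
  smul_left : ∀ (t : ExteriorAlgebra ℝ W) (x y : HL h₀ W S), B (t • x) y = t • B x y
  smul_right : ∀ (k : ℕ) (i : ZMod 2), ∀ t ∈ ⋀[ℝ]^k W, ∀ x ∈ parityPart h₀ W S i, ∀ y,
    B x (t • y) = (-1 : ℝ) ^ (k * i.val) • (t • B x y)
  graded : ∀ m n, ∀ x ∈ degPart h₀ W S m, ∀ y ∈ degPart h₀ W S n, B x y ∈ degPart h₀ W S (m + n)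
  zeroth : ∀ x y : H h₀ S, coeffZero (B (up x) (up y)) = hBracket h₀ ω x y

/-- The first-order part `𝔥 × 𝔥 → Λ¹ W ⊗ 𝔥` of the bracket. Its components are
`ε̂ : S × S → S`, `ϵ̂ : S × V → V`, `θ̂ : 𝔥₀ × S → 𝔥₀` and `μ̂ : 𝔥₀ × V → S`. -/
def first (B : Br h₀ W S) (x y : H h₀ S) : HL h₀ W S := comp 1 (B (up x) (up y))

/-- The quadratic expressions in the first-order components vanish:
`2 θ̂(θ̂(A, s), s) - θ̂(A, ε̂(s, s)) = 0`, `ε̂(ε̂(s, s), s) = 0` and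
`2 ϵ̂(s, ϵ̂(s, v)) - ϵ̂(ε̂(s, s), v) = 0`.
Here `comp 2 (B X (up y))` with `X` in `Λ¹ W ⊗ 𝔥` is the `Λ^• W`-linear extension of `first B`
evaluated on `(X, y)`, and similarly in the second argument. -/
def FirstOrderSquareZero (B : Br h₀ W S) : Prop :=
  (∀ (A : h₀) (s : S),
    (2 : ℝ) • comp 2 (B (first B (inA A) (inS h₀ s)) (up (inS h₀ s)))
      - comp 2 (B (up (inA A)) (first B (inS h₀ s) (inS h₀ s))) = 0) ∧
  (∀ s : S, comp 2 (B (first B (inS h₀ s) (inS h₀ s)) (up (inS h₀ s))) = 0) ∧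
  (∀ (s : S) (v : V),
    (2 : ℝ) • comp 2 (B (up (inS h₀ s)) (first B (inS h₀ s) (inV h₀ v)))
      - comp 2 (B (first B (inS h₀ s) (inS h₀ s)) (up (inV h₀ v))) = 0)

variable {ι : Type*} [Fintype ι] (t : Module.Basis ι ℝ W)

/-- The basis element `tᵢ ∈ Λ¹ W` times `x ∈ 𝔥`. -/
def tx (i : ι) (x : H h₀ S) : HL h₀ W S := ExteriorAlgebra.ι ℝ (t i) ⊗ₜ[ℝ] x

/-- The infinitesimal deformation of `B` is represented by the cocycle `∂(Z ⊗ φ) + ∂X`: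
`ε̂(s, s) = ∑ᵢ tᵢ ⊗ (-2 φⁱ(s) s + 2 Xⁱ_s s)` and `ϵ̂(s, v) = ∑ᵢ tᵢ ⊗ (-2 φⁱ(s) v + Xⁱ_s v)`. -/
def HasInfinitesimalForm (B : Br h₀ W S) (φ : ι → S →ₗ[ℝ] ℝ) (X : ι → S →ₗ[ℝ] soV) : Prop :=
  (∀ s : S, first B (inS h₀ s) (inS h₀ s) =
    ∑ i, tx t i (inS h₀ ((-2 * φ i s) • s + (2 : ℝ) • spin (X i s : Module.End ℝ V) s))) ∧
  (∀ (s : S) (v : V), first B (inS h₀ s) (inV h₀ v) =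
    ∑ i, tx t i (inV h₀ ((-2 * φ i s) • v + (X i s : Module.End ℝ V) v)))

/-- The first-order infinitesimal direction of `B` has a nilpotent representative: some deformation
isomorphic to `B` has its infinitesimal deformation in the form `∂(Z ⊗ φ) + ∂X` with
`X : S → 𝔰𝔬(V)`, and has vanishing quadratic expressions. -/
def HasNilpotentRepresentative (B : Br h₀ W S) : Prop :=
  ∃ (B' : Br h₀ W S) (φ : ι → S →ₗ[ℝ] ℝ) (X : ι → S →ₗ[ℝ] soV),
    IsFilteredDeformation ω B' ∧ Isomorphic B B' ∧ HasInfinitesimalForm t B' φ X ∧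
    FirstOrderSquareZero B'

/-- The first-order infinitesimal direction of `B` is nilpotent: the quadratic expressions vanish
once the infinitesimal deformation is written as `∂(Z ⊗ φ) + ∂X` with its canonical
representative `X : S → 𝔥₀^⊥`. -/
def HasNilpotentDirection (B : Br h₀ W S) : Prop :=
  ∀ (B' : Br h₀ W S) (φ : ι → S →ₗ[ℝ] ℝ) (X : ι → S →ₗ[ℝ] soV),
    IsFilteredDeformation ω B' → Isomorphic B B' → HasInfinitesimalForm t B' φ X →
    (∀ i s, InPerp h₀ (X i s)) → FirstOrderSquareZero B'

/-- The infinitesimal deformation of `B` is timelike (generic): its contraction with some linear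
functional on `W` has, in `H^{1,2}(𝔪, 𝔭)`, the class of `∂(Z ⊗ φ)` where `φ = ω(u, ·)` for a spinor
`u` with timelike Dirac current. The maps `X` and `Y` provide the coboundary. -/
def HasTimelikeDirection (B : Br h₀ W S) : Prop :=
  ∃ (l : W →ₗ[ℝ] ℝ) (u : S) (X : S →ₗ[ℝ] soV) (Y : V →ₗ[ℝ] S),
    0 < eta (kappa ω u u) (kappa ω u u) ∧
    (∀ s : S, coeffOne l (B (up (inS h₀ s)) (up (inS h₀ s))) =
      inS h₀ ((-2 * ω u s) • s + (2 : ℝ) • spin (X s : Module.End ℝ V) s - Y (kappa ω s s))) ∧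
    (∀ (s : S) (v : V), coeffOne l (B (up (inS h₀ s)) (up (inV h₀ v))) =
      inV h₀ ((-2 * ω u s) • v + (X s : Module.End ℝ V) v - kappa ω s (Y v)))

/-- All components of the bracket with coefficients in `Λ^k W`, `k ≥ 2`, vanish. -/
def IsFirstOrder (B : Br h₀ W S) : Prop :=
  ∀ (x y : H h₀ S) (k : ℕ), 2 ≤ k → comp k (B (up x) (up y)) = 0

/-- The subspace `Λ^even W ⊗ (𝔥₀ ⊕ V)` is closed under the bracket, and the bracket on it is the
undeformed one. In particular the Riemann curvature of the underlying geometry vanishes. -/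
def IsFlat (B : Br h₀ W S) : Prop :=
  ∀ (k l : ℕ), Even k → Even l → ∀ a ∈ ⋀[ℝ]^k W, ∀ b ∈ ⋀[ℝ]^l W,
    ∀ (A A' : h₀) (v v' : V),
      B (a ⊗ₜ[ℝ] ((A, 0, v) : H h₀ S)) (b ⊗ₜ[ℝ] ((A', 0, v') : H h₀ S)) =
        (a * b) ⊗ₜ[ℝ] ((⁅A, A'⁆, 0, asEnd A v' - asEnd A' v) : H h₀ S)

/-- The brackets of `B` are
`[A, A'] = AA' - A'A`, `[A, v] = A v`, `[A, s] = A s + ∑ᵢ tᵢ ⊗ θⁱ(A, s)`,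
`[s, s] = κ(s, s) - 2 ∑ᵢ tᵢ ⊗ φⁱ(s) s + 2 ∑ᵢ tᵢ ⊗ Xⁱ_s s`,
`[s, v] = -2 ∑ᵢ tᵢ ⊗ φⁱ(s) v + ∑ᵢ tᵢ ⊗ Xⁱ_s v`, `[v, w] = 0`. -/
structure HasFirstOrderBrackets (B : Br h₀ W S) (φ : ι → S →ₗ[ℝ] ℝ) (X : ι → S →ₗ[ℝ] soV)
    (θ : ι → h₀ → S → h₀) : Prop where
  AA : ∀ A A' : h₀, B (up (inA A)) (up (inA A')) = up (inA ⁅A, A'⁆)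
  AV : ∀ (A : h₀) (v : V), B (up (inA A)) (up (inV h₀ v)) = up (inV h₀ (asEnd A v))
  AS : ∀ (A : h₀) (s : S), B (up (inA A)) (up (inS h₀ s)) =
    up (inS h₀ (spin (asEnd A) s)) + ∑ i, tx t i (inA (θ i A s))
  SS : ∀ s : S, B (up (inS h₀ s)) (up (inS h₀ s)) =
    up (inV h₀ (kappa ω s s))
      - (2 : ℝ) • ∑ i, tx t i (inS h₀ (φ i s • s))
      + (2 : ℝ) • ∑ i, tx t i (inS h₀ (spin (X i s : Module.End ℝ V) s))
  SV : ∀ (s : S) (v : V), B (up (inS h₀ s)) (up (inV h₀ v)) =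
    - (2 : ℝ) • ∑ i, tx t i (inV h₀ (φ i s • v))
      + ∑ i, tx t i (inV h₀ ((X i s : Module.End ℝ V) v))
  VV : ∀ v w : V, B (up (inV h₀ v)) (up (inV h₀ w)) = 0

end Deformation

end Poincare11

end

/-! The bracket is expanded by its order in `Λ^• W`. A coefficient in `Λᵏ` has degree `-k`, so the
bracket of elements of degrees `-i` and `-j` has an order `k` part of degree `-(i + j - k)`. As `𝔥`
lives in degrees `0, -1, -2`, only orders up to four occur, and each order is treated by the part of
the Jacobi identity of the same order.

Both alternative hypotheses are used only through a timelike vector `n` annihilated by `𝔥₀`. For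
compact `𝔥₀` it maximizes `η(v, v) / g(v, v)` for an invariant Euclidean product `g`; for a timelike
direction it is `κ(u, u)`, since invariance of `φ` forces `A u = 0`. On the annihilator of `n` the
trace form is definite, so `𝔥₀` has an orthogonal projection and meets `𝔥₀^⊥` in zero.

Order one: the components `S × S → S` and `S × V → V` form a Spencer cocycle. By `exists_eq_cobdry`
and `cobdry_eq_zero` every cocycle is `∂(Z ⊗ φ) + ∂X + ∂Y` for unique `φ`, `X`, `Y`. The part `Y`
and the `𝔥₀`-component of `X` are removed by automorphisms `1 + N`. Uniqueness also determines the
brackets with `𝔥₀`: `φ` is invariant, `θ(A, s) = [A, X_s] - X_{As}`, and there is no component `𝔥₀ ×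
V → S` once `Y = 0` (`cobdry_invariance`). When `X` takes values in `𝔥₀^⊥`, so does `θ`; being
`𝔥₀`-valued as well, it vanishes.

Order two: vanishing of the quadratic expressions leaves homogeneous linear equations for the
components `γ : S × S → 𝔥₀`, `β : V × S → S`, `α : V × V → V`. Besides the coboundaries of maps `Z :
V → 𝔰𝔬(V)`, the equations leave a four-form undetermined; it is excluded because `γ` annihilates `n`
(`exists_second_order`). Here `Z` is a contraction of `γ`, hence `𝔥₀`-valued, and is removed by an
automorphism of order two that leaves order one unchanged. Orders three and four then vanish:
pairing with `n` kills `V × V → S`, an endomorphism-valued map symmetric in two arguments and skew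
in two is zero, and the spin representation is faithful.

The linear algebra rests on the spinor module. A common eigenvector of commuting words shows `dim S
≤ 32`; trace orthogonality of `2¹⁰` Clifford monomials gives equality and makes them a basis of `End
S`. The resulting Fierz expansion (`fierz`) determines a bilinear map on `S` by its contractions
with monomials, and for a symmetric map only those of cardinality 1 or 2 modulo 4 matter. The
cocycle equations thus become linear relations between functions of finite sets; in the decisive
cases these depend only on cardinality or on membership, and counting subsets finishes the argument.
-/

set_option linter.unusedSectionVars false

noncomputable section

namespace Poincare11

/-! ## Clifford families of endomorphisms and their monomials -/

section CliffordFamily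

variable {S : Type*} [AddCommGroup S] [Module ℝ S]

/-- An irreducible family of endomorphisms satisfying the Clifford relations of an orthonormal
frame of `ℝ^{1,10}`. -/
structure CliffordFamily (g : Fin 11 → Module.End ℝ S) : Prop where
  sq : ∀ a, g a * g a = (-sgn a) • (1 : Module.End ℝ S)
  anti : ∀ a b, a ≠ b → g a * g b = -(g b * g a)
  irr : ∀ U : Submodule ℝ S, (∀ a, ∀ x ∈ U, g a x ∈ U) → U = ⊥ ∨ U = ⊤

/-- The product of a list of members of a family of endomorphisms. -/
def listProd (g : Fin 11 → Module.End ℝ S) (l : List (Fin 11)) : Module.End ℝ S := (l.map g).prod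

/-- The monomial of a Clifford family indexed by a finite set, in increasing order. -/
def mon (g : Fin 11 → Module.End ℝ S) (I : Finset (Fin 11)) : Module.End ℝ S :=
  listProd g (I.sort (· ≤ ·))

/-- The sign picked up when `g a` is moved through a monomial with index set `I`. -/
def chi (I : Finset (Fin 11)) (a : Fin 11) : ℝ := (-1) ^ (I.card + if a ∈ I then 1 else 0)

lemma chi_mul_self (I : Finset (Fin 11)) (a : Fin 11) : chi I a * chi I a = 1 := by
  rw [chi, ← mul_pow]; norm_num

@[simp] lemma listProd_nil (g : Fin 11 → Module.End ℝ S) : listProd g [] = 1 := rfl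

@[simp] lemma listProd_cons (g : Fin 11 → Module.End ℝ S) (a : Fin 11) (l : List (Fin 11)) :
    listProd g (a :: l) = g a * listProd g l := by simp [listProd]

@[simp] lemma listProd_append (g : Fin 11 → Module.End ℝ S) (l l' : List (Fin 11)) :
    listProd g (l ++ l') = listProd g l * listProd g l' := by simp [listProd]

namespace CliffordFamily

variable {g : Fin 11 → Module.End ℝ S} (hg : CliffordFamily g)
include hg

lemma comm_listProd (a : Fin 11) (l : List (Fin 11)) :
    g a * listProd g l = ((-1 : ℝ) ^ (l.length + l.count a)) • (listProd g l * g a) := by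
  induction l with
  | nil => simp
  | cons b l ih =>
    by_cases hab : b = a
    · subst hab
      rw [listProd_cons, List.count_cons_self, List.length_cons, mul_assoc, ih,
        mul_smul_comm]
      congr 1
      ring
    · rw [listProd_cons, List.count_cons_of_ne (by simpa using hab), List.length_cons, ← mul_assoc,
        hg.anti a b (Ne.symm hab), neg_mul, mul_assoc, ih, mul_smul_comm, ← mul_assoc, ← neg_smul]
      congr 1
      ring

lemma listProd_mul_reverse (l : List (Fin 11)) :
    listProd g l * listProd g l.reverse = (l.map fun a => -sgn a).prod • (1 : Module.End ℝ S) := by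
  induction l with
  | nil => simp
  | cons b l ih =>
    rw [List.reverse_cons, listProd_cons, listProd_append, mul_assoc, ← mul_assoc (listProd g l), ih]
    simp only [listProd_cons, listProd_nil, mul_one, smul_mul_assoc, one_mul, mul_smul_comm, hg.sq,
      List.map_cons, List.prod_cons, smul_smul]
    congr 1
    ring

/-- Moving one factor past `n` distinct ones costs `(-1) ^ n`; these exponents add up to a
triangular number. -/
lemma listProd_reverse {l : List (Fin 11)} (hl : l.Nodup) :
    listProd g l.reverse = ((-1 : ℝ) ^ (l.length * (l.length - 1) / 2)) • listProd g l := by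
  induction l with
  | nil => simp
  | cons b l ih =>
    have hb : b ∉ l := (List.nodup_cons.1 hl).1
    rw [List.reverse_cons, listProd_append, ih (List.nodup_cons.1 hl).2, listProd_cons, listProd_cons,
      listProd_nil, mul_one, hg.comm_listProd b l, List.count_eq_zero_of_not_mem hb, smul_smul,
      smul_mul_assoc, List.length_cons, Nat.triangle_succ]
    congr 1
    rw [add_zero, pow_add, mul_assoc, ← mul_pow]
    norm_num

/-- The factor `ε` is the sign of the permutation. Only `ε * ε = 1` is recorded: later arguments use
monomials in combinations in which the sign cancels. -/
lemma listProd_perm {l l' : List (Fin 11)} (h : l.Perm l') (hl : l.Nodup) :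
    ∃ ε : ℝ, ε * ε = 1 ∧ listProd g l' = ε • listProd g l := by
  induction h with
  | nil => exact ⟨1, by simp, by simp⟩
  | cons a _ ih =>
    obtain ⟨ε, h1, h2⟩ := ih (List.nodup_cons.1 hl).2
    exact ⟨ε, h1, by simp [h2]⟩
  | swap a b l =>
    refine ⟨-1, by norm_num, ?_⟩
    have hab : a ≠ b := by rintro rfl; simp at hl
    simp only [listProd_cons, ← mul_assoc, hg.anti a b hab]
    simp
  | trans h1 _ ih1 ih2 =>
    obtain ⟨ε, e1, e2⟩ := ih1 hl
    obtain ⟨ε', e1', e2'⟩ := ih2 (h1.nodup_iff.1 hl)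
    exact ⟨ε' * ε, by linear_combination e1 * ε' * ε' + e1', by rw [e2', e2, smul_smul]⟩

lemma comm_mon (a : Fin 11) (I : Finset (Fin 11)) :
    g a * mon g I = chi I a • (mon g I * g a) := by
  rw [mon, hg.comm_listProd, chi, Finset.length_sort]
  congr 3
  split_ifs with h
  · exact List.count_eq_one_of_mem (Finset.sort_nodup _ _) ((Finset.mem_sort _).2 h)
  · exact List.count_eq_zero_of_not_mem (by rwa [Finset.mem_sort])

lemma mon_mul_of_notMem {I : Finset (Fin 11)} {a : Fin 11} (ha : a ∉ I) :
    ∃ ε : ℝ, ε * ε = 1 ∧ mon g (insert a I) = ε • (mon g I * g a) := by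
  have hp : (I.sort (· ≤ ·) ++ [a]).Perm ((insert a I).sort (· ≤ ·)) := by
    rw [List.perm_ext_iff_of_nodup ?_ (Finset.sort_nodup _ _)]
    · intro b; simp [or_comm]
    · rw [List.nodup_append]
      refine ⟨Finset.sort_nodup _ _, by simp, ?_⟩
      intro x hx y hy
      simp only [List.mem_singleton] at hy
      rintro rfl
      subst hy
      exact ha ((Finset.mem_sort _).1 hx)
  obtain ⟨ε, h1, h2⟩ := hg.listProd_perm hp (hp.nodup_iff.2 (Finset.sort_nodup _ _))
  exact ⟨ε, h1, by simpa [mon] using h2⟩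

lemma mon_mul (I : Finset (Fin 11)) (a : Fin 11) :
    ∃ ε : ℝ, ε * ε = 1 ∧ mon g I * g a = ε • mon g (symmDiff I {a}) := by
  by_cases ha : a ∈ I
  · obtain ⟨ε, h1, h2⟩ := hg.mon_mul_of_notMem (Finset.notMem_erase a I)
    rw [Finset.insert_erase ha] at h2
    have : symmDiff I {a} = I.erase a := by
      ext b; simp only [Finset.mem_symmDiff, Finset.mem_singleton, Finset.mem_erase]
      grind
    refine ⟨ε * -sgn a, by linear_combination sgn_mul_self a * ε * ε + h1, ?_⟩
    rw [h2, smul_mul_assoc, mul_assoc, hg.sq, mul_smul_comm, mul_one, smul_smul, this]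
  · obtain ⟨ε, h1, h2⟩ := hg.mon_mul_of_notMem ha
    have : symmDiff I {a} = insert a I := by
      ext b; simp only [Finset.mem_symmDiff, Finset.mem_singleton, Finset.mem_insert]
      grind
    exact ⟨ε, h1, by rw [this, h2, smul_smul, h1, one_smul]⟩

omit hg in
lemma mon_empty : mon g ∅ = 1 := by simp [mon]

/-- Two monomials whose index sets are distinguished by the sign character have trace-orthogonal
product. -/
lemma trace_mon_mul_mon {I J : Finset (Fin 11)} {a : Fin 11} (h : chi I a * chi J a = -1) :
    LinearMap.trace ℝ S (mon g I * mon g J) = 0 := by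
  have h1 : g a * (mon g I * mon g J) = -(mon g I * mon g J * g a) := by
    rw [← mul_assoc, hg.comm_mon, smul_mul_assoc, mul_assoc, hg.comm_mon, mul_smul_comm, smul_smul, h,
      neg_one_smul, mul_assoc]
  generalize mon g I * mon g J = T at h1 ⊢
  -- `T` anticommutes with `g a`, so cyclicity of the trace gives `tr (g a ² T) = -tr (T g a ²)`,
  -- while `g a ²` is a nonzero scalar.
  have h2 : LinearMap.trace ℝ S (g a * (g a * T)) = LinearMap.trace ℝ S (-(T * (g a * g a))) := by
    rw [h1, mul_neg, map_neg, map_neg, LinearMap.trace_mul_comm, mul_assoc]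
  rw [← mul_assoc, hg.sq, smul_mul_assoc, one_mul, mul_smul_comm, mul_one, map_neg, map_smul,
    smul_eq_mul] at h2
  have hs : sgn a ≠ 0 := fun h0 => by simpa [h0] using sgn_mul_self a
  have h3 : sgn a * LinearMap.trace ℝ S T = 0 := by linarith
  exact (mul_eq_zero.1 h3).resolve_left hs

/-- Such a monomial anticommutes with some generator: one in `I` if the cardinality is even, one
outside `I` if it is odd. -/
lemma trace_mon {I : Finset (Fin 11)} (h0 : I ≠ ∅) (h1 : I ≠ Finset.univ) :
    LinearMap.trace ℝ S (mon g I) = 0 := by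
  have key : ∃ a, chi I a * chi ∅ a = -1 := by
    rcases Nat.even_or_odd I.card with h | h
    · obtain ⟨a, ha⟩ := Finset.nonempty_iff_ne_empty.2 h0
      exact ⟨a, by simp [chi, ha, h.add_one.neg_one_pow]⟩
    · obtain ⟨a, ha⟩ : ∃ a, a ∉ I := by
        by_contra hcon
        push Not at hcon
        exact h1 (Finset.eq_univ_iff_forall.2 hcon)
      exact ⟨a, by simp [chi, ha, h.neg_one_pow]⟩
  obtain ⟨a, ha⟩ := key
  have := hg.trace_mon_mul_mon ha
  rwa [mon_empty, mul_one] at this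

end CliffordFamily

end CliffordFamily

/-! ## The volume element and the dimension of the spinor module -/

section CliffordFamily

variable {S : Type*} [AddCommGroup S] [Module ℝ S]

/-- The sign of the square of a monomial. -/
def sqSign (I : Finset (Fin 11)) : ℝ :=
  (-1) ^ (I.card * (I.card - 1) / 2) * ∏ a ∈ I, -sgn a

/-- A common eigenvector of commuting involutions. -/
lemma exists_common_eigenvector [Nontrivial S] (Ts : List (Module.End ℝ S))
    (hsq : ∀ T ∈ Ts, T * T = 1) (hc : ∀ T ∈ Ts, ∀ T' ∈ Ts, T * T' = T' * T) :
    ∃ x : S, x ≠ 0 ∧ ∀ T ∈ Ts, ∃ ε : ℝ, T x = ε • x := by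
  induction Ts with
  | nil => obtain ⟨x, hx⟩ := exists_ne (0 : S); exact ⟨x, hx, by simp⟩
  | cons T Ts ih =>
    obtain ⟨x, hx, hT⟩ := ih (fun A hA => hsq A (List.mem_cons_of_mem _ hA))
      (fun A hA A' hA' => hc A (List.mem_cons_of_mem _ hA) A' (List.mem_cons_of_mem _ hA'))
    -- `x + T x` is fixed by `T` and, as `T` commutes with the other involutions, keeps their
    -- eigenvalues; if it is zero, `x` itself has eigenvalue `-1`.
    by_cases h0 : x + T x = 0
    · refine ⟨x, hx, fun A hA => ?_⟩
      rcases List.mem_cons.1 hA with rfl | hA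
      · exact ⟨-1, by rw [neg_one_smul]; exact eq_neg_of_add_eq_zero_right h0⟩
      · exact hT A hA
    · refine ⟨x + T x, h0, fun A hA => ?_⟩
      rcases List.mem_cons.1 hA with rfl | hA
      · refine ⟨1, ?_⟩
        have : A (A x) = x := congrArg (fun B : Module.End ℝ S => B x) (hsq A (by simp))
        rw [map_add, this, one_smul, add_comm]
      · obtain ⟨ε, he⟩ := hT A hA
        refine ⟨ε, ?_⟩
        have : A (T x) = T (A x) := congrArg (fun B : Module.End ℝ S => B x)
          (hc A (List.mem_cons_of_mem _ hA) T (by simp))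
        rw [map_add, this, he, map_smul, smul_add]

/-- The span of the words in the `g a`, `a ∈ l`, applied to `x`. -/
def wordSpan (g : Fin 11 → Module.End ℝ S) (x : S) : List (Fin 11) → Submodule ℝ S
  | [] => Submodule.span ℝ {x}
  | a :: l => wordSpan g x l ⊔ (wordSpan g x l).map (g a)

lemma mem_wordSpan (g : Fin 11 → Module.End ℝ S) (x : S) (l : List (Fin 11)) :
    x ∈ wordSpan g x l := by
  induction l with
  | nil => exact Submodule.mem_span_singleton_self x
  | cons a l ih => exact Submodule.mem_sup_left ih

lemma wordSpan_le (g : Fin 11 → Module.End ℝ S) (x : S) (l : List (Fin 11)) {P : Submodule ℝ S}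
    (hx : x ∈ P) (hP : ∀ a ∈ l, ∀ y ∈ P, g a y ∈ P) : wordSpan g x l ≤ P := by
  induction l with
  | nil => simpa [wordSpan] using hx
  | cons a l ih =>
    have := ih fun b hb => hP b (List.mem_cons_of_mem _ hb)
    refine sup_le this (Submodule.map_le_iff_le_comap.2 fun y hy => hP a (by simp) y (this hy))

lemma finite_wordSpan (g : Fin 11 → Module.End ℝ S) (x : S) (l : List (Fin 11)) :
    Module.Finite ℝ (wordSpan g x l) ∧ Module.finrank ℝ (wordSpan g x l) ≤ 2 ^ l.length := by
  induction l with
  | nil =>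
    refine ⟨inferInstanceAs (Module.Finite ℝ (Submodule.span ℝ {x})), ?_⟩
    exact (finrank_span_le_card (R := ℝ) ({x} : Set S)).trans (by simp)
  | cons a l ih =>
    obtain ⟨h1, h2⟩ := ih
    refine ⟨inferInstanceAs (Module.Finite ℝ ↥(wordSpan g x l ⊔ (wordSpan g x l).map (g a))), ?_⟩
    have h3 := Submodule.finrank_add_le_finrank_add_finrank (wordSpan g x l)
      ((wordSpan g x l).map (g a))
    have h4 := Submodule.finrank_map_le (g a) (wordSpan g x l)
    rw [wordSpan, List.length_cons, pow_succ]
    omega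

lemma listProd_mem {g : Fin 11 → Module.End ℝ S} {U : Submodule ℝ S} {l : List (Fin 11)}
    (h : ∀ a ∈ l, ∀ y ∈ U, g a y ∈ U) {y : S} (hy : y ∈ U) : listProd g l y ∈ U := by
  induction l with
  | nil => simpa using hy
  | cons a l ih =>
    rw [listProd_cons]
    exact h a (by simp) _ (ih fun b hb => h b (List.mem_cons_of_mem _ hb))

namespace CliffordFamily

variable {g : Fin 11 → Module.End ℝ S} (hg : CliffordFamily g)
include hg

lemma listProd_sq {l : List (Fin 11)} (hl : l.Nodup) :
    listProd g l * listProd g l = ((-1 : ℝ) ^ (l.length * (l.length - 1) / 2) *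
      (l.map fun a => -sgn a).prod) • (1 : Module.End ℝ S) := by
  rw [mul_smul, ← hg.listProd_mul_reverse l, hg.listProd_reverse hl, mul_smul_comm, smul_smul,
    ← mul_pow]
  norm_num

lemma mon_sq (I : Finset (Fin 11)) : mon g I * mon g I = sqSign I • (1 : Module.End ℝ S) := by
  rw [mon, hg.listProd_sq (Finset.sort_nodup _ _), sqSign, Finset.length_sort]
  congr 2
  rw [← Multiset.prod_coe, ← Multiset.map_coe, Finset.sort_eq]
  rfl

omit hg in
lemma sqSign_mul_self (I : Finset (Fin 11)) : sqSign I * sqSign I = 1 := by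
  have h1 : (∏ a ∈ I, -sgn a) * (∏ a ∈ I, -sgn a) = 1 := by
    rw [← Finset.prod_mul_distrib]
    exact Finset.prod_eq_one fun a _ => by linear_combination sgn_mul_self a
  have h2 : ((-1 : ℝ) ^ (I.card * (I.card - 1) / 2)) * ((-1 : ℝ) ^ (I.card * (I.card - 1) / 2)) = 1 := by
    rw [← mul_pow]; norm_num
  rw [sqSign]
  linear_combination h1 * ((-1 : ℝ) ^ (I.card * (I.card - 1) / 2)) ^ 2 + h2

lemma listProd_comm (l l' : List (Fin 11)) :
    listProd g l * listProd g l' =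
      ((-1 : ℝ) ^ (l.map fun a => l'.length + l'.count a).sum) • (listProd g l' * listProd g l) := by
  induction l with
  | nil => simp
  | cons a l ih =>
    rw [listProd_cons, mul_assoc, ih, mul_smul_comm, ← mul_assoc, hg.comm_listProd, smul_mul_assoc,
      smul_smul, mul_assoc, List.map_cons, List.sum_cons, pow_add _ (_ + _)]
    congr 1
    ring

/-- The volume element acts by a sign. -/
lemma volume_eq : ∃ ε : ℝ, ε * ε = 1 ∧ mon g Finset.univ = ε • (1 : Module.End ℝ S) := by
  -- Reversing eleven factors contributes `(-1) ^ 55`, and the timelike generator contributes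
  -- another `-1`.
  have hsq : mon g Finset.univ * mon g Finset.univ = (1 : Module.End ℝ S) := by
    have : sqSign Finset.univ = 1 := by
      simp only [sqSign, Finset.card_univ, Fintype.card_fin, Fin.prod_univ_succ, sgn]
      simp [Fin.ext_iff]
      norm_num
    rw [hg.mon_sq, this, one_smul]
  have hc : ∀ a, g a * mon g Finset.univ = mon g Finset.univ * g a := fun a => by
    rw [hg.comm_mon, chi]; norm_num
  set T := mon g Finset.univ
  -- The central involution `T` has an invariant `1`-eigenspace. If this is zero then `T = -1`,
  -- because `T x + x` always lies in it.
  rcases hg.irr (LinearMap.ker (T - 1)) (fun a x hx => by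
    rw [LinearMap.mem_ker] at hx ⊢
    have h1 := congrArg (fun B : Module.End ℝ S => B x) (hc a)
    simp only [Module.End.mul_apply] at h1
    simp only [LinearMap.sub_apply, Module.End.one_apply] at hx ⊢
    rw [← h1, ← map_sub, hx, map_zero]) with h | h
  · refine ⟨-1, by norm_num, ?_⟩
    ext x
    have h2 : T x + x ∈ LinearMap.ker (T - 1) := by
      rw [LinearMap.mem_ker]
      have h1 := congrArg (fun B : Module.End ℝ S => B x) hsq
      simp only [Module.End.mul_apply, Module.End.one_apply] at h1
      simp [h1, add_comm]
    rw [h, Submodule.mem_bot] at h2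
    simpa using eq_neg_of_add_eq_zero_left h2
  · refine ⟨1, by norm_num, ?_⟩
    rw [one_smul]
    exact sub_eq_zero.1 (LinearMap.ker_eq_top.1 h)

lemma wordSpan_invariant (x : S) (l : List (Fin 11)) :
    ∀ a ∈ l, ∀ y ∈ wordSpan g x l, g a y ∈ wordSpan g x l := by
  induction l with
  | nil => simp
  | cons b l ih =>
    intro a ha y hy
    obtain ⟨u, hu, w, hw, rfl⟩ := Submodule.mem_sup.1 hy
    obtain ⟨v, hv, rfl⟩ := Submodule.mem_map.1 hw
    rw [map_add]
    by_cases hab : a = b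
    · subst hab
      have h1 := congrArg (fun B : Module.End ℝ S => B v) (hg.sq a)
      simp only [Module.End.mul_apply, LinearMap.smul_apply, Module.End.one_apply] at h1
      rw [h1]
      exact add_mem (Submodule.mem_sup_right (Submodule.mem_map_of_mem hu))
        (Submodule.mem_sup_left (Submodule.smul_mem _ _ hv))
    · have h1 := congrArg (fun B : Module.End ℝ S => B v) (hg.anti a b hab)
      simp only [Module.End.mul_apply, LinearMap.neg_apply] at h1
      have hal : a ∈ l := by
        rcases List.mem_cons.1 ha with h | h
        · exact absurd h hab
        · exact h
      rw [h1]
      exact add_mem (Submodule.mem_sup_left (ih a hal u hu))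
        (neg_mem (Submodule.mem_sup_right (Submodule.mem_map_of_mem (ih a hal v hv))))

/-- `g c` anticommutes with each letter of `l`, so the `y` in the span with `g c y` in the span are
stable under the letters; it is enough to test `x`. -/
lemma wordSpan_invariant_of_mem {x : S} {l : List (Fin 11)} {c : Fin 11} (hcl : c ∉ l)
    (hx : g c x ∈ wordSpan g x l) : ∀ y ∈ wordSpan g x l, g c y ∈ wordSpan g x l := by
  have : wordSpan g x l ≤ wordSpan g x l ⊓ (wordSpan g x l).comap (g c) := by
    refine wordSpan_le g x l ⟨mem_wordSpan g x l, hx⟩ fun a ha y hy => ?_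
    refine ⟨hg.wordSpan_invariant x l a ha y hy.1, ?_⟩
    have h1 := congrArg (fun B : Module.End ℝ S => B y)
      (hg.anti c a (fun h => hcl (h ▸ ha)))
    simp only [Module.End.mul_apply, LinearMap.neg_apply] at h1
    change g c (g a y) ∈ wordSpan g x l
    rw [h1]
    exact neg_mem (hg.wordSpan_invariant x l a ha _ hy.2)
  exact fun y hy => (this hy).2

/-- Multiplying the eigenvalue equation by `g c`, whose square is a scalar, solves it for `g c x` as
a multiple of the word `w` applied to `x`. -/
lemma mem_wordSpan_of_eigen {x : S} {l w : List (Fin 11)} {c : Fin 11} {ε : ℝ}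
    (hw : ∀ a ∈ w, a ∈ l) (he : listProd g (c :: w) x = ε • x) (hε : ε ≠ 0) :
    g c x ∈ wordSpan g x l := by
  have h1 := congrArg (g c) he
  rw [listProd_cons, map_smul, Module.End.mul_apply] at h1
  have h2 := congrArg (fun B : Module.End ℝ S => B (listProd g w x)) (hg.sq c)
  simp only [Module.End.mul_apply, LinearMap.smul_apply, Module.End.one_apply] at h2
  rw [h2] at h1
  rw [show g c x = (ε⁻¹ * -sgn c) • listProd g w x by rw [mul_smul, h1, smul_smul, inv_mul_cancel₀ hε,
    one_smul]]
  exact Submodule.smul_mem _ _ (listProd_mem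
    (fun a ha => hg.wordSpan_invariant x l a (hw a ha)) (mem_wordSpan g x l))

/-- The five words are commuting involutions: four have as supports the generators of the extended
Hamming code on `{1, …, 8}`, so they overlap evenly, and the fifth pairs the timelike generator with
a spacelike one. On a common eigenvector they express the generators `5, 6, 7, 8, 0` through `1, 2,
3, 4, 9`, and the volume element expresses the generator `10`. Hence `2⁵` words span an invariant
subspace, which is everything by irreducibility. -/
lemma exists_wordSpan_eq_top [Nontrivial S] : ∃ x : S, wordSpan g x [1, 2, 3, 4, 9] = ⊤ := by
  obtain ⟨x, hx, hT⟩ := exists_common_eigenvector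
    ([[5, 2, 3, 4], [6, 1, 3, 4], [7, 1, 2, 4], [8, 1, 2, 3], [0, 9]].map (listProd g))
    (by
      simp only [List.map_cons, List.map_nil, List.forall_mem_cons, List.not_mem_nil, IsEmpty.forall_iff,
        implies_true, and_true]
      refine ⟨?_, ?_, ?_, ?_, ?_⟩ <;> rw [hg.listProd_sq (by decide)] <;>
        simp [sgn] <;> norm_num)
    (by
      have hev : ∀ l ∈ ([[5, 2, 3, 4], [6, 1, 3, 4], [7, 1, 2, 4], [8, 1, 2, 3], [0, 9]] :
          List (List (Fin 11))), ∀ l' ∈ ([[5, 2, 3, 4], [6, 1, 3, 4], [7, 1, 2, 4], [8, 1, 2, 3],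
          [0, 9]] : List (List (Fin 11))), Even (l.map fun a => l'.length + l'.count a).sum := by
        decide
      intro T hT T' hT'
      obtain ⟨l, hl, rfl⟩ := List.mem_map.1 hT
      obtain ⟨l', hl', rfl⟩ := List.mem_map.1 hT'
      rw [hg.listProd_comm, (hev l hl l' hl').neg_one_pow, one_smul])
  simp only [List.map_cons, List.map_nil, List.forall_mem_cons, List.not_mem_nil, IsEmpty.forall_iff,
    implies_true, and_true] at hT
  have hunit : ∀ {l : List (Fin 11)} {ε : ℝ}, l.Nodup → listProd g l x = ε • x → ε ≠ 0 := by
    rintro l ε hl h rfl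
    have h1 := congrArg (fun B : Module.End ℝ S => B x) (hg.listProd_mul_reverse l)
    have h2 := congrArg (fun B : Module.End ℝ S => B x) (hg.listProd_sq hl)
    simp only [Module.End.mul_apply, LinearMap.smul_apply, Module.End.one_apply, h, zero_smul,
      map_zero] at h2
    rcases smul_eq_zero.1 h2.symm with h3 | h3
    · rcases mul_eq_zero.1 h3 with h3 | h3
      · exact absurd h3 (pow_ne_zero _ (by norm_num))
      · rw [List.prod_eq_zero_iff] at h3
        obtain ⟨a, -, ha⟩ := List.mem_map.1 h3
        have := sgn_mul_self a
        rw [neg_eq_zero.1 ha] at this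
        norm_num at this
    · exact hx h3
  obtain ⟨⟨e1, h1⟩, ⟨e2, h2⟩, ⟨e3, h3⟩, ⟨e4, h4⟩, ⟨e5, h5⟩⟩ := hT
  set l : List (Fin 11) := [1, 2, 3, 4, 9] with hl
  have hin : ∀ a ∈ l, ∀ y ∈ wordSpan g x l, g a y ∈ wordSpan g x l := hg.wordSpan_invariant x l
  have i5 := hg.wordSpan_invariant_of_mem (c := 5) (l := l) (by decide)
    (hg.mem_wordSpan_of_eigen (by decide) h1 (hunit (by decide) h1))
  have i6 := hg.wordSpan_invariant_of_mem (c := 6) (l := l) (by decide)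
    (hg.mem_wordSpan_of_eigen (by decide) h2 (hunit (by decide) h2))
  have i7 := hg.wordSpan_invariant_of_mem (c := 7) (l := l) (by decide)
    (hg.mem_wordSpan_of_eigen (by decide) h3 (hunit (by decide) h3))
  have i8 := hg.wordSpan_invariant_of_mem (c := 8) (l := l) (by decide)
    (hg.mem_wordSpan_of_eigen (by decide) h4 (hunit (by decide) h4))
  have i0 := hg.wordSpan_invariant_of_mem (c := 0) (l := l) (by decide)
    (hg.mem_wordSpan_of_eigen (by decide) h5 (hunit (by decide) h5))
  have hother : ∀ a : Fin 11, a ≠ 10 → ∀ y ∈ wordSpan g x l, g a y ∈ wordSpan g x l := by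
    intro a ha
    fin_cases a
    exacts [i0, hin 1 (by decide), hin 2 (by decide), hin 3 (by decide), hin 4 (by decide), i5, i6, i7,
      i8, hin 9 (by decide), absurd rfl ha]
  have i10 : ∀ y ∈ wordSpan g x l, g 10 y ∈ wordSpan g x l := by
    intro y hy
    -- The volume element is a sign, so `g 10` is, up to sign, the product of the other ten
    -- generators.
    obtain ⟨ε, he, hv⟩ := hg.volume_eq
    obtain ⟨δ, hd, hv'⟩ := hg.mon_mul_of_notMem (Finset.notMem_erase 10 Finset.univ)
    rw [Finset.insert_erase (Finset.mem_univ _), hv] at hv'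
    have h6 := congrArg (fun B : Module.End ℝ S => (B * B * mon g (Finset.univ.erase 10)) y) hv'
    have h7 := congrArg (fun B : Module.End ℝ S => (mon g (Finset.univ.erase 10) * B) y) hv'
    have h8 := congrArg (fun B : Module.End ℝ S => B (g 10 y)) (hg.mon_sq (Finset.univ.erase 10))
    simp only [Module.End.mul_apply, LinearMap.smul_apply, Module.End.one_apply, map_smul] at h7 h8
    rw [h8, smul_smul] at h7
    have h9 : g 10 y = (δ * sqSign (Finset.univ.erase 10) * ε) • mon g (Finset.univ.erase 10) y := by
      rw [mul_smul, h7, smul_smul, show δ * sqSign (Finset.univ.erase 10) *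
        (δ * sqSign (Finset.univ.erase 10)) = (δ * δ) *
        (sqSign (Finset.univ.erase 10) * sqSign (Finset.univ.erase 10)) by ring, hd, sqSign_mul_self]
      simp
    rw [h9]
    refine Submodule.smul_mem _ _ (listProd_mem (fun a ha => hother a ?_) hy)
    rw [Finset.mem_sort] at ha
    exact (Finset.mem_erase.1 ha).1
  refine ⟨x, (hg.irr (wordSpan g x l) fun a y hy => ?_).resolve_left fun h => hx ?_⟩
  · by_cases ha : a = 10
    · exact ha ▸ i10 y hy
    · exact hother a ha y hy
  · have := mem_wordSpan g x l
    rwa [h, Submodule.mem_bot] at this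

lemma finite [Nontrivial S] : Module.Finite ℝ S := by
  obtain ⟨x, hx⟩ := hg.exists_wordSpan_eq_top
  have h1 := (finite_wordSpan g x [1, 2, 3, 4, 9]).1
  rw [hx] at h1
  exact Module.finite_def.2 ((Submodule.fg_top ⊤).1 (Module.finite_def.1 h1))

lemma finrank_le [Nontrivial S] : Module.finrank ℝ S ≤ 32 := by
  obtain ⟨x, hx⟩ := hg.exists_wordSpan_eq_top
  have h1 := (finite_wordSpan g x [1, 2, 3, 4, 9]).2
  rw [hx, finrank_top] at h1
  simpa using h1

/-- If the cardinalities have the same parity, an element of the symmetric difference distinguishes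
the two sign characters; otherwise the index `0`, which lies in neither set, does. -/
lemma trace_mon_mul_mon_of_ne {I J : Finset (Fin 11)} (hI : 0 ∉ I) (hJ : 0 ∉ J) (h : I ≠ J) :
    LinearMap.trace ℝ S (mon g I * mon g J) = 0 := by
  rcases Nat.even_or_odd (I.card + J.card) with hp | hp
  · obtain ⟨a, ha⟩ : ∃ a, ¬ (a ∈ I ↔ a ∈ J) := by
      by_contra hcon
      push Not at hcon
      exact h (Finset.ext hcon)
    refine hg.trace_mon_mul_mon (a := a) ?_
    rw [chi, chi, ← pow_add, Odd.neg_one_pow]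
    by_cases h1 : a ∈ I <;> by_cases h2 : a ∈ J <;> simp only [h1, h2, if_true, if_false] at ha ⊢
    · simp at ha
    · have := hp.add_one; convert this using 1; ring
    · have := hp.add_one; convert this using 1; ring
    · simp at ha
  · refine hg.trace_mon_mul_mon (a := 0) ?_
    rw [chi, chi, ← pow_add, Odd.neg_one_pow]
    simpa [hI, hJ] using hp

lemma trace_mon_mul_self [Module.Finite ℝ S] (I : Finset (Fin 11)) :
    LinearMap.trace ℝ S (mon g I * mon g I) = sqSign I * Module.finrank ℝ S := by
  rw [hg.mon_sq, map_smul, LinearMap.trace_one, smul_eq_mul]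

lemma trace_mon_mul_sum (c : Finset (Fin 11) → ℝ) [Module.Finite ℝ S] {I : Finset (Fin 11)}
    (hI : 0 ∉ I) :
    LinearMap.trace ℝ S (mon g I * ∑ J ∈ (Finset.univ.erase 0).powerset, c J • mon g J) =
      c I * (sqSign I * Module.finrank ℝ S) := by
  rw [Finset.mul_sum, map_sum, Finset.sum_eq_single I]
  · rw [mul_smul_comm, map_smul, hg.trace_mon_mul_self, smul_eq_mul]
  · intro J hJ hJI
    rw [mul_smul_comm, map_smul, hg.trace_mon_mul_mon_of_ne hI ?_ (Ne.symm hJI), smul_zero]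
    rw [Finset.mem_powerset] at hJ
    exact fun h => by simpa using hJ h
  · intro h
    exact absurd (Finset.mem_powerset.2 fun a ha => by
      simp only [Finset.mem_erase, Finset.mem_univ, and_true]; rintro rfl; exact hI ha) h

/-- Only sets avoiding `0` are used: a set and its complement have proportional monomials, and
exactly one of the two avoids `0`. -/
lemma linearIndependent_mon [Nontrivial S] :
    LinearIndependent ℝ fun I : ((Finset.univ.erase (0 : Fin 11)).powerset) => mon g I.1 := by
  have := hg.finite
  rw [Fintype.linearIndependent_iff]
  intro c hc I
  have hI : 0 ∉ I.1 := fun h => by simpa using (Finset.mem_powerset.1 I.2) h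
  let c' : Finset (Fin 11) → ℝ := fun J =>
    if h : J ∈ (Finset.univ.erase (0 : Fin 11)).powerset then c ⟨J, h⟩ else 0
  have h1 := hg.trace_mon_mul_sum c' hI
  rw [← Finset.sum_coe_sort] at h1
  have h2 : ∑ J : ((Finset.univ.erase (0 : Fin 11)).powerset), c' J.1 • mon g J.1 = 0 := by
    rw [← hc]
    exact Finset.sum_congr rfl fun J _ => by simp only [c', J.2, dif_pos]
  rw [h2, mul_zero, map_zero] at h1
  have h3 : c' I.1 = c I := by simp only [c', I.2, dif_pos]
  rw [h3] at h1
  have h4 : sqSign I.1 ≠ 0 := fun h => by simpa [h] using sqSign_mul_self I.1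
  have h5 : (Module.finrank ℝ S : ℝ) ≠ 0 := by
    exact_mod_cast (Module.finrank_pos (R := ℝ) (M := S)).ne'
  exact (mul_eq_zero.1 h1.symm).resolve_right (mul_ne_zero h4 h5)

omit hg in
lemma card_index : Fintype.card ((Finset.univ.erase (0 : Fin 11)).powerset) = 1024 := by
  rw [Fintype.card_coe, Finset.card_powerset, Finset.card_erase_of_mem (Finset.mem_univ _)]
  simp

/-- The `2¹⁰` independent endomorphisms give `1024 ≤ d²`, against the upper bound `d ≤ 32`. -/
lemma finrank_eq [Nontrivial S] : Module.finrank ℝ S = 32 := by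
  have := hg.finite
  have h1 := hg.linearIndependent_mon.fintype_card_le_finrank
  rw [card_index, show Module.finrank ℝ (Module.End ℝ S) = _ from Module.finrank_linearMap ℝ ℝ S S] at h1
  have h2 := hg.finrank_le
  nlinarith

/-- Expansion of an endomorphism in spatial monomials. -/
lemma expansion [Nontrivial S] (T : Module.End ℝ S) :
    T = ∑ J ∈ (Finset.univ.erase (0 : Fin 11)).powerset,
      (sqSign J * LinearMap.trace ℝ S (mon g J * T) / 32) • mon g J := by
  have := hg.finite
  have h1 : T ∈ Submodule.span ℝ (Set.range
      fun I : ((Finset.univ.erase (0 : Fin 11)).powerset) => mon g I.1) := by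
    rw [hg.linearIndependent_mon.span_eq_top_of_card_eq_finrank' (by
      rw [card_index, show Module.finrank ℝ (Module.End ℝ S) = _ from Module.finrank_linearMap ℝ ℝ S S,
        hg.finrank_eq])]
    trivial
  obtain ⟨c, hc⟩ := (Submodule.mem_span_range_iff_exists_fun ℝ).1 h1
  let c' : Finset (Fin 11) → ℝ := fun J =>
    if h : J ∈ (Finset.univ.erase (0 : Fin 11)).powerset then c ⟨J, h⟩ else 0
  have h2 : ∑ J ∈ (Finset.univ.erase (0 : Fin 11)).powerset, c' J • mon g J = T := by
    rw [← hc, ← Finset.sum_coe_sort]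
    exact Finset.sum_congr rfl fun J _ => by simp only [c', J.2, dif_pos]
  conv_lhs => rw [← h2]
  refine Finset.sum_congr rfl fun J hJ => ?_
  have hJ0 : 0 ∉ J := fun h => by simpa using (Finset.mem_powerset.1 hJ) h
  have h3 := hg.trace_mon_mul_sum c' hJ0
  rw [h2, hg.finrank_eq] at h3
  congr 1
  rw [h3]
  push_cast
  linear_combination (-c' J) * sqSign_mul_self J

lemma eq_zero_of_trace [Nontrivial S] {T : Module.End ℝ S}
    (h : ∀ J : Finset (Fin 11), 0 ∉ J → LinearMap.trace ℝ S (mon g J * T) = 0) : T = 0 := by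
  rw [hg.expansion T]
  refine Finset.sum_eq_zero fun J hJ => ?_
  rw [h J fun h => by simpa using (Finset.mem_powerset.1 hJ) h]
  simp

end CliffordFamily

end CliffordFamily

/-! ## Orthonormal frames, Clifford multiplication and the Dirac current -/

lemma eta_comm (v w : V) : eta v w = eta w v := by
  rw [eta_apply, eta_apply]; exact Finset.sum_congr rfl fun _ _ => by ring

lemma eta_e (v : V) (a : Fin 11) : eta v (e a) = sgn a * v a := by
  simp [eta_apply, e, Pi.single_apply]

lemma eq_of_eta {v w : V} (h : ∀ u, eta v u = eta w u) : v = w := by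
  ext a
  have h1 := h (e a)
  rw [eta_e, eta_e] at h1
  have h2 : sgn a ≠ 0 := fun h0 => by simpa [h0] using sgn_mul_self a
  exact mul_left_cancel₀ h2 h1

/-- An orthonormal frame of `V`. -/
def IsFrame (E : Fin 11 → V) : Prop := ∀ a b, eta (E a) (E b) = if a = b then sgn a else 0

lemma isFrame_e : IsFrame e := fun a b => by
  rw [eta_e]
  by_cases h : a = b
  · subst h; simp [e]
  · simp [e, h, Ne.symm h]

lemma sgn_ne_zero (a : Fin 11) : sgn a ≠ 0 := fun h0 => by simpa [h0] using sgn_mul_self a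

lemma IsFrame.expand {E : Fin 11 → V} (hE : IsFrame E) (v : V) :
    v = ∑ a, (sgn a * eta v (E a)) • E a := by
  have hcoef : ∀ c : Fin 11 → ℝ, ∀ b, eta (∑ a, c a • E a) (E b) = c b * sgn b := fun c b => by
    simp [map_sum, LinearMap.sum_apply, hE _ b]
  have hli : LinearIndependent ℝ E := by
    rw [Fintype.linearIndependent_iff]
    intro c hc b
    have h1 := hcoef c b
    rw [hc, map_zero, LinearMap.zero_apply] at h1
    exact (mul_eq_zero.1 h1.symm).resolve_right (sgn_ne_zero b)
  have hsp : v ∈ Submodule.span ℝ (Set.range E) := by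
    rw [hli.span_eq_top_of_card_eq_finrank' (by simp)]; trivial
  obtain ⟨c, hc⟩ := (Submodule.mem_span_range_iff_exists_fun ℝ).1 hsp
  conv_lhs => rw [← hc]
  refine Finset.sum_congr rfl fun a _ => ?_
  rw [← hc, hcoef]
  congr 1
  linear_combination -c a * sgn_mul_self a

lemma IsFrame.sum_eta {E : Fin 11 → V} (hE : IsFrame E) (v w : V) :
    ∑ a, sgn a * eta v (E a) * eta (E a) w = eta v w := by
  conv_rhs => rw [hE.expand v]
  simp [map_sum, LinearMap.sum_apply]

lemma mem_soV {A : Module.End ℝ V} : A ∈ soV ↔ ∀ v w, eta (A v) w = -eta v (A w) := by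
  change A ∈ LinearMap.skewAdjointSubmodule eta ↔ _
  rw [LinearMap.mem_skewAdjointSubmodule]
  refine forall₂_congr fun v w => ?_
  rw [Pi.neg_apply, map_neg]

lemma soV_skew (A : soV) (v w : V) : eta ((A : Module.End ℝ V) v) w = -eta v ((A : Module.End ℝ V) w) :=
  mem_soV.1 A.2 v w

section Spinors

variable {S : Type*} [AddCommGroup S] [Module ℝ S] [Module Cl S] [IsScalarTower ℝ Cl S]

/-- Clifford multiplication as a linear map into the endomorphisms of `S`. -/
def cl : V →ₗ[ℝ] Module.End ℝ S := (Algebra.lsmul ℝ ℝ S).toLinearMap ∘ₗ CliffordAlgebra.ι Q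

lemma cl_apply (v : V) (s : S) : cl v s = cliff v s := rfl

lemma cl_mul_add (v w : V) :
    (cl v * cl w + cl w * cl v : Module.End ℝ S) = (-2 * eta v w) • 1 := by
  have h := CliffordAlgebra.ι_mul_ι_add_swap (Q := Q) v w
  have h2 : QuadraticMap.polar Q v w = -2 * eta v w := by
    simp only [QuadraticMap.polar, Q, neg_apply, LinearMap.BilinMap.toQuadraticMap_apply,
      map_add, LinearMap.add_apply, eta_comm w v]
    ring
  have h3 := congrArg (Algebra.lsmul ℝ ℝ S) h
  rw [map_add, map_mul, map_mul, h2, AlgHom.commutes, Algebra.algebraMap_eq_smul_one] at h3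
  exact h3

lemma cl_mul_self (v : V) : (cl v * cl v : Module.End ℝ S) = (-eta v v) • 1 := by
  have h := cl_mul_add (S := S) v v
  rw [← two_smul ℝ (cl v * cl v), mul_smul, neg_smul, ← smul_neg, ← neg_smul] at h
  exact smul_right_injective _ (two_ne_zero' ℝ) h

lemma cl_cl (v : V) (s : S) : cl v (cl v s) = (-eta v v) • s :=
  congrArg (fun B : Module.End ℝ S => B s) (cl_mul_self v)

lemma cl_swap (v w : V) (s : S) : cl v (cl w s) = (-2 * eta v w) • s - cl w (cl v s) := by
  have := congrArg (fun B : Module.End ℝ S => B s) (cl_mul_add v w)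
  simp only [LinearMap.add_apply, Module.End.mul_apply, LinearMap.smul_apply,
    Module.End.one_apply] at this
  rw [← this]; abel

lemma eq_zero_of_cl {v : V} (hv : eta v v ≠ 0) {s : S} (h : cl v s = 0) : s = 0 := by
  have := cl_cl v s
  rw [h, map_zero] at this
  exact (smul_eq_zero.1 this.symm).resolve_left (neg_ne_zero.2 hv)

lemma cl_injective [Nontrivial S] {v : V} (h : (cl v : Module.End ℝ S) = 0) : v = 0 := by
  refine eq_of_eta fun w => ?_
  have h1 := cl_mul_add (S := S) v w
  rw [h, zero_mul, mul_zero, add_zero] at h1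
  have := (smul_eq_zero.1 h1.symm).resolve_right one_ne_zero
  simp only [map_zero, LinearMap.zero_apply]
  linarith

lemma IsFrame.cliffordFamily [IsSimpleModule Cl S] {E : Fin 11 → V} (hE : IsFrame E) :
    CliffordFamily fun a => (cl (E a) : Module.End ℝ S) where
  sq a := by rw [cl_mul_self, hE]; simp
  anti a b hab := by
    have := cl_mul_add (S := S) (E a) (E b)
    rw [hE, if_neg hab, mul_zero, zero_smul] at this
    exact eq_neg_of_add_eq_zero_left this
  irr U hU := by
    have h1 : ∀ v : V, ∀ x ∈ U, cl v x ∈ U := fun v x hx => by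
      rw [hE.expand v, map_sum, LinearMap.sum_apply]
      refine Submodule.sum_mem _ fun a _ => ?_
      rw [map_smul, LinearMap.smul_apply]
      exact Submodule.smul_mem _ _ (hU a x hx)
    have h2 : ∀ c : Cl, ∀ x ∈ U, c • x ∈ U := fun c => by
      induction c using CliffordAlgebra.induction with
      | algebraMap r => intro x hx; rw [algebraMap_smul]; exact Submodule.smul_mem _ _ hx
      | ι v => exact h1 v
      | mul a b ha hb => intro x hx; rw [mul_smul]; exact ha _ (hb _ hx)
      | add a b ha hb => intro x hx; rw [add_smul]; exact add_mem (ha _ hx) (hb _ hx)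
    let U' : Submodule Cl S :=
      { carrier := U
        add_mem' := U.add_mem
        zero_mem' := U.zero_mem
        smul_mem' := fun c x hx => h2 c x hx }
    rcases eq_bot_or_eq_top U' with h | h
    · left
      rw [Submodule.eq_bot_iff]
      intro x hx
      have : x ∈ U' := hx
      rwa [h, Submodule.mem_bot] at this
    · right
      rw [Submodule.eq_top_iff']
      intro x
      have : x ∈ U' := by rw [h]; trivial
      exact this

lemma finite_spinor [IsSimpleModule Cl S] : Module.Finite ℝ S :=
  haveI := IsSimpleModule.nontrivial Cl S
  (isFrame_e.cliffordFamily (S := S)).finite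

lemma spinElt_add (A B : Module.End ℝ V) : spinElt (A + B) = spinElt A + spinElt B := by
  simp only [spinElt, LinearMap.add_apply, map_add, add_mul, smul_add, Finset.sum_add_distrib]

lemma spinElt_smul (c : ℝ) (A : Module.End ℝ V) : spinElt (c • A) = c • spinElt A := by
  simp only [spinElt, LinearMap.smul_apply, map_smul, smul_mul_assoc, Finset.smul_sum]
  refine Finset.sum_congr rfl fun a _ => ?_
  simp only [smul_smul]
  congr 1
  ring

/-- The spin representation as a linear map. -/
def spinL : Module.End ℝ V →ₗ[ℝ] Module.End ℝ S where
  toFun A := Algebra.lsmul ℝ ℝ S (spinElt A)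
  map_add' A B := by rw [spinElt_add, map_add]
  map_smul' c A := by rw [spinElt_smul, map_smul]; rfl

lemma spinL_apply (A : Module.End ℝ V) (s : S) : spinL A s = spin A s := rfl

lemma spinL_eq (A : Module.End ℝ V) : (spinL A : Module.End ℝ S) =
    (-(1 / 4) : ℝ) • ∑ a, sgn a • (cl (A (e a)) * cl (e a)) := by
  change Algebra.lsmul ℝ ℝ S (spinElt A) = _
  rw [spinElt, map_smul, map_sum]
  simp only [map_smul, map_mul]
  rfl

/-- The bivector of `A` is independent of the orthonormal frame: both sides expand to the same
double sum over the two frames. -/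
lemma IsFrame.spinL_eq {E : Fin 11 → V} (hE : IsFrame E) (A : Module.End ℝ V) :
    (spinL A : Module.End ℝ S) = (-(1 / 4) : ℝ) • ∑ a, sgn a • (cl (A (E a)) * cl (E a)) := by
  rw [Poincare11.spinL_eq]
  congr 1
  have h1 : ∀ a, sgn a • (cl (A (e a)) * cl (e a) : Module.End ℝ S) =
      ∑ b, (sgn a * sgn b * eta (e a) (E b)) • (cl (A (e a)) * cl (E b)) := fun a => by
    conv_lhs => rw [show cl (e a) = (cl (∑ b, (sgn b * eta (e a) (E b)) • E b) : Module.End ℝ S) by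
      rw [← hE.expand]]
    rw [map_sum, Finset.mul_sum, Finset.smul_sum]
    refine Finset.sum_congr rfl fun b _ => ?_
    rw [map_smul, mul_smul_comm, smul_smul, mul_assoc]
  have h2 : ∀ b, sgn b • (cl (A (E b)) * cl (E b) : Module.End ℝ S) =
      ∑ a, (sgn a * sgn b * eta (e a) (E b)) • (cl (A (e a)) * cl (E b)) := fun b => by
    conv_lhs => rw [show A (E b) = A (∑ a, (sgn a * eta (E b) (e a)) • e a) by
      rw [← isFrame_e.expand]]
    rw [map_sum, map_sum, Finset.sum_mul, Finset.smul_sum]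
    refine Finset.sum_congr rfl fun a _ => ?_
    rw [map_smul, map_smul, smul_mul_assoc, smul_smul, eta_comm (e a)]
    congr 1
    ring
  simp only [h1, h2]
  exact Finset.sum_comm

/-- Moving `v` through the two factors of each term produces two sums. By skewness of `A` each is
`-2` times the frame expansion of `A v`, and the prefactor `-1/4` gives `1/2 + 1/2`. -/
lemma spinL_comm_cl (A : soV) (v : V) :
    (spinL (A : Module.End ℝ V) * cl v - cl v * spinL (A : Module.End ℝ V) : Module.End ℝ S) =
      cl ((A : Module.End ℝ V) v) := by
  have hterm : ∀ a, (cl ((A : Module.End ℝ V) (e a)) * cl (e a) * cl v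
      - cl v * (cl ((A : Module.End ℝ V) (e a)) * cl (e a)) : Module.End ℝ S) =
      (-2 * eta v (e a)) • cl ((A : Module.End ℝ V) (e a))
        + (2 * eta v ((A : Module.End ℝ V) (e a))) • cl (e a) := fun a => by
    have h1 := cl_mul_add (S := S) (e a) v
    have h2 := cl_mul_add (S := S) ((A : Module.End ℝ V) (e a)) v
    have h3 : (cl (e a) * cl v : Module.End ℝ S) = (-2 * eta v (e a)) • 1 - cl v * cl (e a) := by
      rw [eta_comm v, ← h1]; abel
    have h4 : (cl ((A : Module.End ℝ V) (e a)) * cl v : Module.End ℝ S) =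
        (-2 * eta v ((A : Module.End ℝ V) (e a))) • 1 - cl v * cl ((A : Module.End ℝ V) (e a)) := by
      rw [eta_comm v, ← h2]; abel
    rw [mul_assoc, h3, mul_sub, ← mul_assoc _ (cl v), h4, sub_mul, mul_smul_comm, mul_one,
      smul_mul_assoc, one_mul, ← mul_assoc]
    module
  rw [spinL_eq, smul_mul_assoc, mul_smul_comm, ← smul_sub, Finset.sum_mul, Finset.mul_sum,
    ← Finset.sum_sub_distrib]
  have h5 : ∀ a, (sgn a • (cl ((A : Module.End ℝ V) (e a)) * cl (e a)) * cl v
      - cl v * sgn a • (cl ((A : Module.End ℝ V) (e a)) * cl (e a)) : Module.End ℝ S) =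
      (-2 : ℝ) • (cl ((A : Module.End ℝ V) ((sgn a * eta v (e a)) • e a)))
        + (-2 : ℝ) • cl ((sgn a * eta ((A : Module.End ℝ V) v) (e a)) • e a) := fun a => by
    rw [smul_mul_assoc, mul_smul_comm, ← smul_sub, hterm, soV_skew]
    simp only [map_smul]
    module
  rw [Finset.sum_congr rfl fun a _ => h5 a, Finset.sum_add_distrib, ← Finset.smul_sum, ← Finset.smul_sum,
    ← map_sum, ← map_sum, ← map_sum, ← isFrame_e.expand, ← isFrame_e.expand]
  module

lemma spin_cl (A : soV) (v : V) (s : S) :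
    spin (A : Module.End ℝ V) (cl v s) =
      cl v (spin (A : Module.End ℝ V) s) + cl ((A : Module.End ℝ V) v) s := by
  have := congrArg (fun B : Module.End ℝ S => B s) (spinL_comm_cl A v)
  simp only [LinearMap.sub_apply, Module.End.mul_apply, spinL_apply] at this
  rw [← this]; abel

lemma spinL_injective [Nontrivial S] {A : soV} (h : (spinL (A : Module.End ℝ V) : Module.End ℝ S) = 0) :
    A = 0 := by
  refine Subtype.ext (LinearMap.ext fun v => ?_)
  have h1 := spinL_comm_cl (S := S) A v
  rw [h, zero_mul, mul_zero, sub_zero] at h1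
  rw [cl_injective h1.symm]
  rfl

/-- The generator of rotations in the plane of two vectors. -/
def rot (v w : V) : soV :=
  ⟨(eta w).smulRight v - (eta v).smulRight w, mem_soV.2 fun x y => by
    simp only [LinearMap.sub_apply, LinearMap.smulRight_apply, map_sub, map_smul, LinearMap.smul_apply,
      smul_eq_mul, eta_comm x]
    ring⟩

lemma rot_apply (v w x : V) : (rot v w : Module.End ℝ V) x = eta w x • v - eta v x • w := rfl

lemma spinL_rot (v w : V) : (spinL (rot v w : Module.End ℝ V) : Module.End ℝ S) =
    (-(1 / 4) : ℝ) • (cl v * cl w - cl w * cl v) := by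
  rw [spinL_eq]
  congr 1
  have : ∀ a, sgn a • (cl ((rot v w : Module.End ℝ V) (e a)) * cl (e a) : Module.End ℝ S) =
      cl v * cl ((sgn a * eta w (e a)) • e a) - cl w * cl ((sgn a * eta v (e a)) • e a) := fun a => by
    rw [rot_apply, map_sub, map_smul, map_smul, map_smul, map_smul, sub_mul, smul_sub,
      smul_mul_assoc, smul_mul_assoc, mul_smul_comm, mul_smul_comm, smul_smul, smul_smul]
  rw [Finset.sum_congr rfl fun a _ => this a, Finset.sum_sub_distrib, ← Finset.mul_sum, ← Finset.mul_sum,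
    ← map_sum, ← map_sum, ← isFrame_e.expand, ← isFrame_e.expand]

section Symplectic

variable {ω : S →ₗ[ℝ] S →ₗ[ℝ] ℝ} (hω : IsInvariantSymplectic ω)
include hω

lemma omega_swap (s t : S) : ω s t = -ω t s := by
  have := hω.alt.neg s t
  linarith

lemma omega_spin (A : soV) (s t : S) :
    ω (spin (A : Module.End ℝ V) s) t = -ω s (spin (A : Module.End ℝ V) t) :=
  eq_neg_of_add_eq_zero_left (hω.invariant _ A.2 s t)

lemma eq_zero_of_omega {s : S} (h : ∀ t, ω s t = 0) : s = 0 := hω.nondegenerate.1 s h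

/-- For orthogonal `v` and `w` the rotation `rot v w` acts on spinors as `-1/2` times the product `v
w`, so invariance of `ω` makes this product skew; reversing the anticommuting factors absorbs the
sign. -/
lemma omega_cl_cl {v w : V} (h : eta v w = 0) (s t : S) :
    ω (cl v (cl w s)) t = ω s (cl w (cl v t)) := by
  have h1 := omega_spin hω (rot v w) s t
  rw [← spinL_apply, ← spinL_apply, spinL_rot] at h1
  simp only [LinearMap.smul_apply, LinearMap.sub_apply, Module.End.mul_apply, map_smul, map_sub,
    cl_swap w v, eta_comm w v, h, mul_zero, zero_smul, zero_sub, smul_eq_mul, map_neg,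
    LinearMap.neg_apply] at h1
  rw [cl_swap w v, eta_comm w v, h, mul_zero, zero_smul, zero_sub, map_neg]
  linarith

lemma omega_listProd_even {E : Fin 11 → V} (hE : IsFrame E) : ∀ (l : List (Fin 11)), Even l.length → l.Nodup →
    ∀ s t : S, ω (listProd (fun a => cl (E a)) l s) t = ω s (listProd (fun a => cl (E a)) l.reverse t)
  | [], _, _ => fun s t => by simp
  | [_], h, _ => by simp at h
  | a :: b :: l, h, hl => fun s t => by
    have hab : a ≠ b := by rintro rfl; simp at hl
    have ih := omega_listProd_even hE l (by simpa [Nat.even_add_one] using h)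
      (List.nodup_cons.1 (List.nodup_cons.1 hl).2).2
    simp only [listProd_cons, List.reverse_cons, listProd_append, listProd_nil, Module.End.mul_apply,
      mul_one]
    rw [omega_cl_cl hω (by rw [hE, if_neg hab]), ih]

/-- Clifford multiplication is skew for the symplectic form. -/
lemma omega_cl [IsSimpleModule Cl S] (v : V) (s t : S) : ω (cl v s) t = -ω s (cl v t) := by
  have hg := isFrame_e.cliffordFamily (S := S)
  -- Invariance only concerns even products. Since the volume element is a scalar, `e a` acts as a
  -- multiple of the product of the other ten basis vectors; the adjoint of that product is its
  -- reversal, with sign `(-1) ^ 45`.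
  have key : ∀ a, ω (cl (e a) s) t = -ω s (cl (e a) t) := fun a => by
    obtain ⟨ε, -, hv⟩ := hg.volume_eq
    obtain ⟨δ, hd, hv'⟩ := hg.mon_mul_of_notMem (Finset.notMem_erase a Finset.univ)
    rw [Finset.insert_erase (Finset.mem_univ _), hv] at hv'
    set M := mon (fun a => (cl (e a) : Module.End ℝ S)) (Finset.univ.erase a) with hM
    have h1 : (cl (e a) : Module.End ℝ S) = (sqSign (Finset.univ.erase a) * δ * ε) • M := by
      have h2 := congrArg (fun B => (sqSign (Finset.univ.erase a) * δ) • (M * B)) hv'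
      simp only [mul_smul_comm, mul_one, ← mul_assoc, hM, hg.mon_sq, smul_mul_assoc, one_mul,
        smul_smul] at h2
      rw [hM, h2, show sqSign (Finset.univ.erase a) * δ * δ * sqSign (Finset.univ.erase a) =
        (δ * δ) * (sqSign (Finset.univ.erase a) * sqSign (Finset.univ.erase a)) by ring, hd,
        CliffordFamily.sqSign_mul_self, one_mul, one_smul]
    have hlen : ((Finset.univ.erase a).sort (· ≤ ·)).length = 10 := by
      rw [Finset.length_sort, Finset.card_erase_of_mem (Finset.mem_univ _)]; simp
    have h3 : ω (M s) t = -ω s (M t) := by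
      rw [hM, mon, omega_listProd_even hω isFrame_e _ (by rw [hlen]; decide) (Finset.sort_nodup _ _),
        hg.listProd_reverse (Finset.sort_nodup _ _), hlen]
      norm_num
    rw [h1]
    simp only [LinearMap.smul_apply, map_smul, h3, smul_neg]
  rw [isFrame_e.expand v]
  simp only [map_sum, map_smul, LinearMap.sum_apply, LinearMap.smul_apply, key, smul_neg,
    Finset.sum_neg_distrib]

end Symplectic

/-- The Dirac current as a bilinear map. -/
def kappaL (ω : S →ₗ[ℝ] S →ₗ[ℝ] ℝ) : S →ₗ[ℝ] S →ₗ[ℝ] V :=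
  LinearMap.mk₂ ℝ (kappa ω)
    (fun s s' t => by
      ext a; simp only [kappa, ← cl_apply, map_add, LinearMap.add_apply, Pi.add_apply]; ring)
    (fun c s t => by
      ext a; simp only [kappa, ← cl_apply, map_smul, LinearMap.smul_apply, Pi.smul_apply, smul_eq_mul]
      ring)
    (fun s t t' => by
      ext a; simp only [kappa, ← cl_apply, map_add, LinearMap.add_apply, Pi.add_apply]; ring)
    (fun c s t => by
      ext a; simp only [kappa, ← cl_apply, map_smul, LinearMap.smul_apply, Pi.smul_apply, smul_eq_mul]
      ring)

lemma kappaL_apply (ω : S →ₗ[ℝ] S →ₗ[ℝ] ℝ) (s t : S) : kappaL ω s t = kappa ω s t := rfl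

section Current

variable [IsSimpleModule Cl S] {ω : S →ₗ[ℝ] S →ₗ[ℝ] ℝ} (hω : IsInvariantSymplectic ω)
include hω

lemma omega_cl_symm (v : V) (s t : S) : ω s (cl v t) = ω t (cl v s) := by
  rw [omega_swap hω, omega_cl hω, neg_neg]

lemma eta_kappaL (s t : S) (v : V) : eta (kappaL ω s t) v = ω s (cl v t) := by
  have h1 : ∀ a, eta (kappaL ω s t) (e a) = ω s (cl (e a) t) := fun a => by
    rw [eta_e, kappaL_apply, kappa, ← cl_apply, ← cl_apply, omega_cl_symm hω _ t s]
    linear_combination ω s (cl (e a) t) * sgn_mul_self a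
  rw [isFrame_e.expand v]
  simp only [map_sum, map_smul, LinearMap.sum_apply, LinearMap.smul_apply, h1]

lemma kappaL_comm (s t : S) : kappaL ω s t = kappaL ω t s :=
  eq_of_eta fun u => by rw [eta_kappaL hω, eta_kappaL hω, omega_cl_symm hω]

lemma kappaL_spin (A : soV) (s t : S) :
    kappaL ω (spin (A : Module.End ℝ V) s) t + kappaL ω s (spin (A : Module.End ℝ V) t) =
      (A : Module.End ℝ V) (kappaL ω s t) := by
  refine eq_of_eta fun u => ?_
  rw [map_add, LinearMap.add_apply, eta_kappaL hω, eta_kappaL hω, soV_skew, eta_kappaL hω,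
    omega_spin hω, spin_cl, map_add]
  ring

end Current

end Spinors

/-! ## Contraction with the symplectic form -/

section Contraction

variable {S : Type*} [AddCommGroup S] [Module ℝ S] [Module Cl S] [IsScalarTower ℝ Cl S]
variable [Module.Finite ℝ S] {E : Type*} [AddCommGroup E] [Module ℝ E]

/-- A basis of the spinor module. -/
def bas (S : Type*) [AddCommGroup S] [Module ℝ S] [Module.Finite ℝ S] :
    Module.Basis (Fin (Module.finrank ℝ S)) ℝ S := Module.finBasis ℝ S

open Classical in
/-- The symplectic dual basis of `bas S`. -/
def dualBas (ω : S →ₗ[ℝ] S →ₗ[ℝ] ℝ) (i : Fin (Module.finrank ℝ S)) : S :=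
  if h : ∃ d, ω d = (bas S).coord i then h.choose else 0

/-- An endomorphism that is skew for a bilinear form. -/
def IsSkewOp (ω : S →ₗ[ℝ] S →ₗ[ℝ] ℝ) (M : Module.End ℝ S) : Prop := ∀ s t, ω (M s) t = -ω s (M t)

/-- The contraction of a bilinear map with (the bivector of) an endomorphism. -/
def contr (ω : S →ₗ[ℝ] S →ₗ[ℝ] ℝ) (f : S →ₗ[ℝ] S →ₗ[ℝ] E) : Module.End ℝ S →ₗ[ℝ] E where
  toFun M := ∑ i, f (bas S i) (M (dualBas ω i))
  map_add' M N := by simp only [LinearMap.add_apply, map_add, Finset.sum_add_distrib]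
  map_smul' c M := by simp only [LinearMap.smul_apply, map_smul, Finset.smul_sum, RingHom.id_apply]

lemma contr_apply (ω : S →ₗ[ℝ] S →ₗ[ℝ] ℝ) (f : S →ₗ[ℝ] S →ₗ[ℝ] E) (M : Module.End ℝ S) :
    contr ω f M = ∑ i, f (bas S i) (M (dualBas ω i)) := rfl

variable {ω : S →ₗ[ℝ] S →ₗ[ℝ] ℝ} (hω : IsInvariantSymplectic ω)
include hω

lemma omega_dualBas (i : Fin (Module.finrank ℝ S)) : ω (dualBas ω i) = (bas S).coord i := by
  have h : ∃ d, ω d = (bas S).coord i := by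
    have hinj : Function.Injective ω := (injective_iff_map_eq_zero ω).2 fun s hs =>
      eq_zero_of_omega hω fun t => by rw [hs]; rfl
    have hfin : Module.finrank ℝ S = Module.finrank ℝ (S →ₗ[ℝ] ℝ) :=
      (Subspace.dual_finrank_eq (K := ℝ) (V := S)).symm
    exact (LinearMap.injective_iff_surjective_of_finrank_eq_finrank hfin).1 hinj _
  rw [dualBas, dif_pos h]
  exact h.choose_spec

lemma sum_dual_smul (L : S →ₗ[ℝ] E) (u : S) :
    ∑ i, ω (dualBas ω i) u • L (bas S i) = L u := by
  conv_rhs => rw [← (bas S).sum_repr u, map_sum]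
  refine Finset.sum_congr rfl fun i _ => ?_
  rw [omega_dualBas hω, map_smul]
  rfl

lemma sum_bas_eq (u : S) : ∑ i, ω u (bas S i) • dualBas ω i = u := by
  refine sub_eq_zero.1 (eq_zero_of_omega hω fun t => ?_)
  have h := sum_dual_smul hω (ω u) t
  rw [map_sub, LinearMap.sub_apply, ← h, map_sum, LinearMap.sum_apply, sub_eq_zero]
  refine Finset.sum_congr rfl fun i _ => ?_
  rw [map_smul, LinearMap.smul_apply, smul_eq_mul, smul_eq_mul, mul_comm]

lemma sum_bas_smul (L : S →ₗ[ℝ] E) (u : S) : ∑ i, ω u (bas S i) • L (dualBas ω i) = L u := by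
  conv_rhs => rw [← sum_bas_eq hω u, map_sum]
  simp only [map_smul]

lemma sum_bas_smul' (L : S →ₗ[ℝ] E) (u : S) : ∑ i, ω (bas S i) u • L (dualBas ω i) = -L u := by
  rw [← sum_bas_smul hω L u, ← Finset.sum_neg_distrib]
  exact Finset.sum_congr rfl fun i _ => by rw [omega_swap hω, neg_smul]

lemma sum_dual_smul' (L : S →ₗ[ℝ] E) (u : S) :
    ∑ i, ω u (dualBas ω i) • L (bas S i) = -L u := by
  rw [← sum_dual_smul hω L u, ← Finset.sum_neg_distrib]
  exact Finset.sum_congr rfl fun i _ => by rw [omega_swap hω, neg_smul]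

lemma sum_omega_dual (N : Module.End ℝ S) :
    ∑ i, ω (dualBas ω i) (N (bas S i)) = LinearMap.trace ℝ S N := by
  rw [LinearMap.trace_eq_matrix_trace ℝ (bas S), Matrix.trace]
  refine Finset.sum_congr rfl fun i _ => ?_
  rw [omega_dualBas hω, Matrix.diag_apply, LinearMap.toMatrix_apply]
  rfl

/-- Expanding `M d_i` in the basis turns both sides into sums with coefficients `ω(d_j, M d_i)`,
which change by the factor `-c` when `i` and `j` are exchanged. -/
lemma sum_swap_of_adjoint (f : S →ₗ[ℝ] S →ₗ[ℝ] E) {M : Module.End ℝ S} {c : ℝ}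
    (hM : ∀ s t, ω (M s) t = c * ω s (M t)) :
    ∑ i, f (M (dualBas ω i)) (bas S i) = -c • ∑ i, f (bas S i) (M (dualBas ω i)) := by
  have h1 : ∀ i, f (M (dualBas ω i)) (bas S i) =
      ∑ j, ω (dualBas ω j) (M (dualBas ω i)) • f (bas S j) (bas S i) := fun i =>
    (sum_dual_smul hω (f.flip (bas S i)) (M (dualBas ω i))).symm
  have h2 : ∀ i, f (bas S i) (M (dualBas ω i)) =
      ∑ j, ω (dualBas ω j) (M (dualBas ω i)) • f (bas S i) (bas S j) := fun i =>
    (sum_dual_smul hω (f (bas S i)) (M (dualBas ω i))).symm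
  simp only [h1, h2]
  rw [Finset.sum_comm, Finset.smul_sum]
  refine Finset.sum_congr rfl fun i _ => ?_
  rw [Finset.smul_sum]
  refine Finset.sum_congr rfl fun j _ => ?_
  rw [omega_swap hω, hM, smul_smul]
  congr 1
  ring

lemma sum_swap (f : S →ₗ[ℝ] S →ₗ[ℝ] E) {M : Module.End ℝ S} (hM : IsSkewOp ω M) :
    ∑ i, f (M (dualBas ω i)) (bas S i) = ∑ i, f (bas S i) (M (dualBas ω i)) := by
  rw [sum_swap_of_adjoint hω f (c := -1) fun s t => by rw [hM]; ring]
  simp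

lemma sum_omega_bas (N : Module.End ℝ S) :
    ∑ i, ω (bas S i) (N (dualBas ω i)) = -LinearMap.trace ℝ S N := by
  have h1 : ∀ i, ω (bas S i) (N (dualBas ω i)) =
      ∑ j, ω (dualBas ω j) (N (dualBas ω i)) * ω (bas S i) (bas S j) := fun i =>
    (sum_dual_smul hω (ω (bas S i)) (N (dualBas ω i))).symm
  simp only [h1]
  rw [Finset.sum_comm, ← sum_omega_dual hω, ← Finset.sum_neg_distrib]
  refine Finset.sum_congr rfl fun j _ => ?_
  have h2 := sum_bas_smul' hω ((ω (dualBas ω j)).comp N) (bas S j)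
  simp only [LinearMap.comp_apply, smul_eq_mul] at h2
  rw [← h2]
  exact Finset.sum_congr rfl fun i _ => mul_comm _ _

/-- The spinor representing a linear functional: `ω(s, rep F) = F s`. -/
lemma omega_rep (F : S →ₗ[ℝ] ℝ) (s : S) : ω s (-∑ i, F (bas S i) • dualBas ω i) = F s := by
  have h1 := sum_dual_smul hω F s
  rw [map_neg, map_sum, ← h1, ← Finset.sum_neg_distrib]
  refine Finset.sum_congr rfl fun i _ => ?_
  rw [map_smul, smul_eq_mul, smul_eq_mul, omega_swap hω]
  ring

variable [IsSimpleModule Cl S]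

lemma isSkewOp_cl (v : V) : IsSkewOp ω (cl v) := omega_cl hω v

/-- For `k` factors, skewness contributes `(-1) ^ k` and restoring the order contributes `(-1) ^ (k
(k - 1) / 2)`. -/
lemma isSkewOp_mon {E : Fin 11 → V} (hE : IsFrame E) (I : Finset (Fin 11)) (s t : S) :
    ω (mon (fun a => cl (E a)) I s) t =
      (-1) ^ (I.card * (I.card + 1) / 2) * ω s (mon (fun a => cl (E a)) I t) := by
  have hrev : ∀ (l : List (Fin 11)) (s t : S), ω (listProd (fun a => cl (E a)) l s) t =
      (-1) ^ l.length * ω s (listProd (fun a => cl (E a)) l.reverse t) := by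
    intro l
    induction l with
    | nil => intro s t; simp
    | cons a l ih =>
      intro s t
      rw [listProd_cons, Module.End.mul_apply, omega_cl hω, ih, List.reverse_cons, listProd_append,
        listProd_cons, listProd_nil, mul_one, Module.End.mul_apply, List.length_cons, pow_succ]
      ring
  have hg := hE.cliffordFamily (S := S)
  rw [mon, hrev, hg.listProd_reverse (Finset.sort_nodup _ _), LinearMap.smul_apply, map_smul,
    smul_eq_mul, ← mul_assoc, ← pow_add, Finset.length_sort]
  congr 2
  rcases Nat.eq_zero_or_pos I.card with h | h
  · simp [h]
  · obtain ⟨n, hn⟩ : ∃ n, I.card = n + 1 := ⟨I.card - 1, by omega⟩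
    rw [hn, Nat.add_sub_cancel]
    have : (n + 1) * (n + 1 + 1) = (n + 1) * n + (n + 1) * 2 := by ring
    rw [this, Nat.add_mul_div_right _ _ (by norm_num)]
    ring

lemma trace_cl_mul_cl (v w : V) : LinearMap.trace ℝ S (cl v * cl w) = -32 * eta v w := by
  have := IsSimpleModule.nontrivial Cl S
  have h := congrArg (LinearMap.trace ℝ S) (cl_mul_add (S := S) v w)
  rw [map_add, LinearMap.trace_mul_comm ℝ (cl w), map_smul, LinearMap.trace_one,
    (isFrame_e.cliffordFamily (S := S)).finrank_eq, smul_eq_mul] at h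
  push_cast at h
  linarith

end Contraction

/-- Polarization of a cubic map. -/
lemma polarize_cubic {S E : Type*} [AddCommGroup S] [AddCommGroup E] [Module ℝ E]
    (F : S → S → S → E) (h1 : ∀ s s' t z, F (s + s') t z = F s t z + F s' t z)
    (h3 : ∀ s t z z', F s t (z + z') = F s t z + F s t z')
    (hsymm : ∀ s t z, F s t z = F t s z) (h : ∀ s, F s s s = 0) (s t z : S) :
    F s t z + F t z s + F z s t = 0 := by
  have h2 : ∀ s t t' z, F s (t + t') z = F s t z + F s t' z := fun s t t' z => by
    rw [hsymm, h1, hsymm t, hsymm t']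
  have e1 := h (s + t + z)
  have e2 := h (s + t)
  have e3 := h (t + z)
  have e4 := h (s + z)
  have e5 := h s
  have e6 := h t
  have e7 := h z
  simp only [h1, h2, h3, hsymm t s, hsymm z s, hsymm z t] at e1 e2 e3 e4 ⊢
  -- The third difference of `s ↦ F s s s` is the sum over all permutations of the arguments, which
  -- by symmetry is twice the cyclic sum.
  linear_combination (norm := module) (1 / 2 : ℝ) • (e1 - e2 - e3 - e4 + e5 + e6 + e7)

/-! ## The Spencer cohomology group `H^{1,2}(𝔪, 𝔭)` -/

/-- A function on finite sets of given cardinality that is invariant under exchanges of one element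
is constant. -/
lemma eq_of_exchange {α E : Type*} [DecidableEq α] (F : Finset α → E) (n : ℕ)
    (h : ∀ (K : Finset α) (a b : α), K.card + 1 = n → a ∉ K → b ∉ K → F (insert a K) = F (insert b K))
    {I J : Finset α} (hI : I.card = n) (hJ : J.card = n) : F I = F J := by
  induction hk : (I \ J).card generalizing I with
  | zero =>
    rw [Finset.card_eq_zero, Finset.sdiff_eq_empty_iff_subset] at hk
    rw [Finset.eq_of_subset_of_card_le hk (by omega)]
  | succ k ih =>
    -- Exchanging an element of `I \ J` for one of `J \ I` makes `I \ J` smaller.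
    obtain ⟨a, ha⟩ := Finset.card_pos.1 (by omega : 0 < (I \ J).card)
    have hJI : (J \ I).card = (I \ J).card := by
      have h1 := Finset.card_sdiff_add_card_inter I J
      have h2 := Finset.card_sdiff_add_card_inter J I
      rw [Finset.inter_comm] at h2
      omega
    obtain ⟨b, hb⟩ := Finset.card_pos.1 (by omega : 0 < (J \ I).card)
    rw [Finset.mem_sdiff] at ha hb
    have hbK : b ∉ I.erase a := fun h => hb.2 (Finset.mem_of_mem_erase h)
    have hc : (I.erase a).card + 1 = n := by rw [Finset.card_erase_add_one ha.1, hI]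
    rw [← Finset.insert_erase ha.1, h _ a b hc (Finset.notMem_erase a I) hbK]
    refine ih (by rw [Finset.card_insert_of_notMem hbK, hc]) ?_
    have : insert b (I.erase a) \ J = (I \ J).erase a := by
      ext x
      clear ih h hbK hc hk hJI
      simp only [Finset.mem_sdiff, Finset.mem_insert, Finset.mem_erase]
      by_cases hx : x = b
      · subst hx; simp [hb.1, hb.2]
      · tauto
    rw [this, Finset.card_erase_of_mem (Finset.mem_sdiff.2 ha), hk]
    rfl

/-! ### Contraction of the cocycle condition and the Fierz expansion -/

section FirstOrder

variable {S : Type*} [AddCommGroup S] [Module ℝ S] [Module Cl S] [IsScalarTower ℝ Cl S]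
variable [Module.Finite ℝ S]

/-- The partial contraction of the trilinear form `ω(f(z, x), y)` in `x` and `y` with an endomorphism,
as a spinor. -/
def partialContr (ω : S →ₗ[ℝ] S →ₗ[ℝ] ℝ) (f : S →ₗ[ℝ] S →ₗ[ℝ] S) : Module.End ℝ S →ₗ[ℝ] S where
  toFun N := ∑ j, (∑ i, ω (f (bas S j) (bas S i)) (N (dualBas ω i))) • dualBas ω j
  map_add' N N' := by simp only [LinearMap.add_apply, map_add, Finset.sum_add_distrib, add_smul]
  map_smul' c N := by
    simp only [LinearMap.smul_apply, map_smul, ← Finset.smul_sum, smul_assoc, RingHom.id_apply]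

variable {ω : S →ₗ[ℝ] S →ₗ[ℝ] ℝ} (hω : IsInvariantSymplectic ω)
include hω

lemma omega_partialContr (f : S →ₗ[ℝ] S →ₗ[ℝ] S) (N : Module.End ℝ S) (z : S) :
    ω (partialContr ω f N) z = ∑ i, ω (f z (bas S i)) (N (dualBas ω i)) := by
  have h := omega_rep hω (∑ i, (ω.flip (N (dualBas ω i))).comp (f.flip (bas S i))) z
  simp only [LinearMap.sum_apply, LinearMap.comp_apply, LinearMap.flip_apply] at h
  rw [← h, omega_swap hω, map_neg]
  rfl

variable [IsSimpleModule Cl S]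

/-- The contraction of the cocycle condition of `H^{1,2}(𝔪, 𝔭)` with an endomorphism. -/
lemma cocycle_contraction {ε : S →ₗ[ℝ] S →ₗ[ℝ] S} (hε : ∀ s t, ε s t = ε t s) {ϵ : S →ₗ[ℝ] V →ₗ[ℝ] V}
    (h : ∀ s, kappaL ω (ε s s) s = ϵ s (kappaL ω s s)) {ψ : V → V → S}
    (hψ : ∀ s v w, ω s (ψ v w) = eta (ϵ s v) w) {M : Module.End ℝ S} (hM : IsSkewOp ω M) (v : V) :
    (2 : ℝ) • partialContr ω ε (cl v * M) = cl v (contr ω ε M) - ψ (contr ω (kappaL ω) M) v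
      + (2 : ℝ) • ∑ a, sgn a • cl (e a) (M (ψ (e a) v)) := by
  have hpol := polarize_cubic (fun s t z => kappaL ω (ε s t) z - ϵ z (kappaL ω s t))
    (fun s s' t z => by simp only [map_add, LinearMap.add_apply]; abel)
    (fun s t z z' => by simp only [map_add, LinearMap.add_apply]; abel)
    (fun s t z => by rw [hε, kappaL_comm hω s t])
    (fun s => by rw [h, sub_self])
  rw [← sub_eq_zero]
  refine eq_zero_of_omega hω fun z => ?_
  -- The polarized cocycle condition at `(b_i, M d_i, z)`, paired with `v`; summing over `i` gives
  -- the contraction.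
  have hi : ∀ i, ω (ε (bas S i) (M (dualBas ω i))) (cl v z)
      - eta (ϵ z (kappaL ω (bas S i) (M (dualBas ω i)))) v
      + ω (ε z (M (dualBas ω i))) (cl v (bas S i))
      - eta (ϵ (bas S i) (kappaL ω z (M (dualBas ω i)))) v
      + ω (ε z (bas S i)) (cl v (M (dualBas ω i)))
      - eta (ϵ (M (dualBas ω i)) (kappaL ω z (bas S i))) v = 0 := fun i => by
    have := congrArg (fun x => eta x v) (hpol (bas S i) (M (dualBas ω i)) z)
    simp only [map_add, map_sub, LinearMap.add_apply, LinearMap.sub_apply, eta_kappaL hω, map_zero,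
      LinearMap.zero_apply, hε _ z, kappaL_comm hω (M (dualBas ω i)) z] at this
    linarith
  have hsum := Finset.sum_eq_zero (s := Finset.univ) fun i _ => hi i
  simp only [Finset.sum_sub_distrib, Finset.sum_add_distrib] at hsum
  -- Since `M` is skew, the two terms in which `z` sits in `ε` agree, and so do the two in which it
  -- sits in `κ`. This is the origin of both factors 2 in the statement.
  have s1 := sum_swap hω (ω.compl₁₂ (ε z) (cl v)) hM
  have s2 := sum_swap hω ((ϵ.compl₂ (kappaL ω z)).compr₂ (eta v)) hM
  simp only [LinearMap.compl₁₂_apply, LinearMap.compr₂_apply, LinearMap.compl₂_apply,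
    eta_comm v] at s1 s2
  rw [s1, s2] at hsum
  have s3 : ∑ i, eta (ϵ (bas S i) (kappaL ω z (M (dualBas ω i)))) v =
      ∑ a, sgn a * ω (cl (e a) (M (ψ (e a) v))) z := by
    have h1 : ∀ i, eta (ϵ (bas S i) (kappaL ω z (M (dualBas ω i)))) v =
        ∑ a, sgn a * (ω (bas S i) (ψ (e a) v) * ω z (cl (e a) (M (dualBas ω i)))) := fun i => by
      conv_lhs => rw [isFrame_e.expand (kappaL ω z (M (dualBas ω i)))]
      simp only [map_sum, map_smul, LinearMap.sum_apply, LinearMap.smul_apply, eta_kappaL hω, hψ,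
        smul_eq_mul]
      exact Finset.sum_congr rfl fun a _ => by ring
    simp only [h1]
    rw [Finset.sum_comm]
    refine Finset.sum_congr rfl fun a _ => ?_
    rw [← Finset.mul_sum]
    have h2 := sum_bas_smul' hω ((ω z).comp ((cl (e a)).comp M)) (ψ (e a) v)
    simp only [LinearMap.comp_apply, smul_eq_mul] at h2
    rw [h2, omega_swap hω (cl (e a) _)]
  have s4 : ∑ i, ω (ε (bas S i) (M (dualBas ω i))) (cl v z) = -ω (cl v (contr ω ε M)) z := by
    rw [omega_cl hω, neg_neg, contr_apply, map_sum, LinearMap.sum_apply]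
  have s5 : ∑ i, eta (ϵ z (kappaL ω (bas S i) (M (dualBas ω i)))) v =
      -ω (ψ (contr ω (kappaL ω) M) v) z := by
    rw [omega_swap hω, neg_neg, hψ, contr_apply]
    simp only [map_sum, LinearMap.sum_apply]
  have s6 := omega_partialContr hω ε (cl v * M) z
  simp only [Module.End.mul_apply] at s6
  rw [s3, s4, s5, ← s6] at hsum
  simp only [map_add, map_sub, map_smul, map_sum, LinearMap.add_apply, LinearMap.sub_apply,
    LinearMap.smul_apply, LinearMap.sum_apply, smul_eq_mul]
  linarith

lemma contr_kappaL (M : Module.End ℝ S) (u : V) :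
    eta (contr ω (kappaL ω) M) u = -LinearMap.trace ℝ S (cl u * M) := by
  rw [contr_apply, map_sum, LinearMap.sum_apply, ← sum_omega_bas hω]
  exact Finset.sum_congr rfl fun i _ => eta_kappaL hω _ _ _

/-- The factor is `dim S = 32`, which enters through the trace of `cl u * cl c`. -/
lemma contr_kappaL_cl (c : V) : contr ω (kappaL ω) (cl c) = (32 : ℝ) • c :=
  eq_of_eta fun u => by
    rw [contr_kappaL hω, trace_cl_mul_cl hω, map_smul, LinearMap.smul_apply, smul_eq_mul, eta_comm u]
    ring

/-- Exchanging the slots of `f` changes the sign of the contraction because `M` is self-adjoint, and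
changes nothing because `f` is symmetric. -/
lemma contr_eq_zero_of_selfAdjoint {E : Type*} [AddCommGroup E] [Module ℝ E]
    {f : S →ₗ[ℝ] S →ₗ[ℝ] E} (hf : ∀ s t, f s t = f t s) {M : Module.End ℝ S}
    (hM : ∀ s t, ω (M s) t = ω s (M t)) : contr ω f M = 0 := by
  have h1 := sum_swap_of_adjoint hω f (c := 1) (fun s t => by rw [hM, one_mul])
  simp only [hf (M _)] at h1
  rw [neg_smul, one_smul] at h1
  have h2 : (2 : ℝ) • ∑ i, f (bas S i) (M (dualBas ω i)) = 0 := by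
    rw [two_smul]
    nth_rewrite 1 [h1]
    exact neg_add_cancel _
  exact (smul_eq_zero.1 h2).resolve_left two_ne_zero

lemma contr_smulRight {E : Type*} [AddCommGroup E] [Module ℝ E]
    (f : S →ₗ[ℝ] S →ₗ[ℝ] E) (s t : S) : contr ω f ((ω t).smulRight s) = -f t s := by
  have := sum_dual_smul' hω (f.flip s) t
  simp only [LinearMap.flip_apply] at this
  rw [← this, contr_apply]
  simp only [LinearMap.smulRight_apply, map_smul]

/-- Fierz expansion of a bilinear map. -/
lemma fierz {E : Type*} [AddCommGroup E] [Module ℝ E] {F : Fin 11 → V} (hF : IsFrame F)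
    (f : S →ₗ[ℝ] S →ₗ[ℝ] E) (s t : S) :
    f t s = -∑ J ∈ (Finset.univ.erase (0 : Fin 11)).powerset,
      (sqSign J * ω t (mon (fun a => cl (F a)) J s) / 32) •
        contr ω f (mon (fun a => cl (F a)) J) := by
  have := IsSimpleModule.nontrivial Cl S
  -- The rank-one operator `x ↦ ω(t, x) s` is expanded in monomials; its trace against `mon J` is
  -- `ω(t, mon J s)`.
  have h1 := (hF.cliffordFamily (S := S)).expansion ((ω t).smulRight s)
  have h2 := congrArg (contr ω f) h1
  rw [contr_smulRight hω, map_sum] at h2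
  rw [← neg_eq_iff_eq_neg, h2]
  refine Finset.sum_congr rfl fun J _ => ?_
  rw [map_smul]
  congr 3
  have h3 : mon (fun a => cl (F a)) J * (ω t).smulRight s =
      (ω t).smulRight (mon (fun a => (cl (F a) : Module.End ℝ S)) J s) := by
    ext x; simp
  rw [h3, LinearMap.trace_smulRight]

/-- Applying the Fierz expansion to `f(z, b_i)` makes the sum over `i` a completeness relation. The
remaining sign is that of the adjoint of `mon J`. -/
lemma partialContr_eq_sum (f : S →ₗ[ℝ] S →ₗ[ℝ] S) (N : Module.End ℝ S) (z : S) :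
    ω (partialContr ω f N) z = -∑ J ∈ (Finset.univ.erase (0 : Fin 11)).powerset,
      (sqSign J * (-1) ^ (J.card * (J.card + 1) / 2) / 32) *
        ω (contr ω f (mon (fun a => cl (e a)) J)) (N (mon (fun a => cl (e a)) J z)) := by
  rw [omega_partialContr hω]
  simp only [fun i => fierz hω isFrame_e f (bas S i) z, map_neg, map_sum, map_smul, LinearMap.neg_apply,
    LinearMap.sum_apply, LinearMap.smul_apply, Finset.sum_neg_distrib]
  rw [Finset.sum_comm]
  congr 1
  refine Finset.sum_congr rfl fun J _ => ?_
  have h1 := sum_bas_smul hω ((ω (contr ω f (mon (fun a => cl (e a)) J))).comp N)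
    (mon (fun a => cl (e a)) J z)
  simp only [LinearMap.comp_apply, smul_eq_mul, isSkewOp_mon hω isFrame_e] at h1
  rw [← h1, Finset.mul_sum]
  refine Finset.sum_congr rfl fun i _ => ?_
  have h2 : ((-1 : ℝ) ^ (J.card * (J.card + 1) / 2)) * (-1) ^ (J.card * (J.card + 1) / 2) = 1 := by
    rw [← mul_pow]; norm_num
  rw [smul_eq_mul]
  linear_combination (-(sqSign J * ω z (mon (fun a => cl (e a)) J (bas S i)) *
    ω (contr ω f (mon (fun a => cl (e a)) J)) (N (dualBas ω i)) / 32)) * h2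

end FirstOrder

/-! ### Normalized values on monomials as functions of finite sets -/

section Reduction

variable {S : Type*} [AddCommGroup S] [Module ℝ S]

namespace CliffordFamily

variable {g : Fin 11 → Module.End ℝ S} (hg : CliffordFamily g)
include hg

/-- Up to sign, complementary index sets have the same monomial. -/
lemma mon_compl [Nontrivial S] (K : Finset (Fin 11)) :
    ∃ ε : ℝ, ε * ε = 1 ∧ mon g Kᶜ = ε • mon g K := by
  induction K using Finset.induction_on with
  | empty =>
    obtain ⟨ε, h1, h2⟩ := hg.volume_eq
    exact ⟨ε, h1, by rw [Finset.compl_empty, h2, mon_empty]⟩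
  | insert a K ha ih =>
    obtain ⟨ε, h1, h2⟩ := ih
    obtain ⟨ε', h1', h2'⟩ := hg.mon_mul_of_notMem ha
    obtain ⟨ε'', h1'', h2''⟩ := hg.mon_mul Kᶜ a
    have hs : symmDiff Kᶜ {a} = (insert a K)ᶜ := by
      ext x
      by_cases hx : x = a
      · subst hx; simp [Finset.mem_symmDiff, ha]
      · simp [Finset.mem_symmDiff, hx]
    refine ⟨ε * ε' * ε'', ?_, ?_⟩
    · linear_combination (ε' * ε') * (ε'' * ε'') * h1 + (ε'' * ε'') * h1' + h1''
    · rw [hs, h2, smul_mul_assoc] at h2''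
      rw [h2', smul_smul, show ε * ε' * ε'' * ε' = ε'' * ε by linear_combination (ε * ε'') * h1',
        mul_smul, h2'', smul_smul, h1'', one_smul]

lemma mon_apply_injective (I : Finset (Fin 11)) {x y : S} (h : mon g I x = mon g I y) : x = y := by
  have h1 : ∀ z, mon g I (mon g I z) = sqSign I • z := fun z =>
    congrArg (fun B : Module.End ℝ S => B z) (hg.mon_sq I)
  have h2 : sqSign I • x = sqSign I • y := by rw [← h1, ← h1, h]
  refine smul_right_injective S (fun h0 => ?_) h2
  have := sqSign_mul_self I
  rw [h0] at this
  norm_num at this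

end CliffordFamily

/-- A linear map on endomorphisms, evaluated at a monomial and normalized. -/
def monPart (g : Fin 11 → Module.End ℝ S) (F : Module.End ℝ S →ₗ[ℝ] S) (I : Finset (Fin 11)) : S :=
  sqSign I • mon g I (F (mon g I))

namespace CliffordFamily

variable {g : Fin 11 → Module.End ℝ S} (hg : CliffordFamily g)
include hg

lemma mon_monPart (F : Module.End ℝ S →ₗ[ℝ] S) (I : Finset (Fin 11)) :
    mon g I (monPart g F I) = F (mon g I) := by
  have h1 : ∀ z, mon g I (mon g I z) = sqSign I • z := fun z =>
    congrArg (fun B : Module.End ℝ S => B z) (hg.mon_sq I)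
  rw [monPart, map_smul, h1, smul_smul, sqSign_mul_self, one_smul]

/-- The monomial enters `monPart` twice, so the unknown sign relating the monomials of `I` and `Iᶜ`
cancels. -/
lemma monPart_compl [Nontrivial S] (F : Module.End ℝ S →ₗ[ℝ] S) (I : Finset (Fin 11)) :
    monPart g F Iᶜ = monPart g F I := by
  obtain ⟨ε, h1, h2⟩ := hg.mon_compl I
  refine hg.mon_apply_injective Iᶜ ?_
  rw [hg.mon_monPart, h2, map_smul, LinearMap.smul_apply, hg.mon_monPart]

/-- If `F₂` is obtained from `F₁` by multiplication with `g a`, their monomial parts agree. -/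
lemma monPart_symmDiff (F₁ F₂ : Module.End ℝ S →ₗ[ℝ] S) (I : Finset (Fin 11)) (a : Fin 11)
    (h : (2 : ℝ) • F₂ (g a * mon g I) = g a (F₁ (mon g I))) :
    monPart g F₁ I = (2 : ℝ) • monPart g F₂ (symmDiff I {a}) := by
  obtain ⟨ε, h1, h2⟩ := hg.mon_mul I a
  have h3 : mon g (symmDiff I {a}) = (ε * chi I a) • (g a * mon g I) := by
    rw [hg.comm_mon, h2, smul_smul, smul_smul]
    rw [show ε * chi I a * chi I a * ε = 1 by linear_combination (chi_mul_self I a) * (ε * ε) + h1,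
      one_smul]
  refine hg.mon_apply_injective (symmDiff I {a}) ?_
  rw [map_smul, hg.mon_monPart, h3, map_smul, smul_comm, h, LinearMap.smul_apply,
    Module.End.mul_apply, hg.mon_monPart]

end CliffordFamily

end Reduction

/-! ### Adjoints of monomials and vanishing of contraction-free cocycles -/

section FirstOrder

variable {S : Type*} [AddCommGroup S] [Module ℝ S] [Module Cl S] [IsScalarTower ℝ Cl S]
variable [Module.Finite ℝ S] [IsSimpleModule Cl S]
variable {ω : S →ₗ[ℝ] S →ₗ[ℝ] ℝ} (hω : IsInvariantSymplectic ω)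
include hω

lemma isSkewOp_mon_iff {F : Fin 11 → V} (hF : IsFrame F) {I : Finset (Fin 11)}
    (h : I.card % 4 = 1 ∨ I.card % 4 = 2) : IsSkewOp ω (mon (fun a => (cl (F a) : Module.End ℝ S)) I) := by
  intro s t
  have h1 : Odd (I.card * (I.card + 1) / 2) := by
    obtain ⟨q, r, hq⟩ : ∃ q r, I.card = 4 * q + r ∧ (r = 1 ∨ r = 2) :=
      ⟨I.card / 4, I.card % 4, by omega, h⟩
    rcases hq with ⟨hq, rfl | rfl⟩ <;> rw [hq]
    · rw [show (4 * q + 1) * (4 * q + 1 + 1) = 2 * (2 * (4 * q * q + 3 * q) + 1) by ring,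
        Nat.mul_div_cancel_left _ two_pos]
      exact ⟨_, rfl⟩
    · rw [show (4 * q + 2) * (4 * q + 2 + 1) = 2 * (2 * (4 * q * q + 5 * q + 1) + 1) by ring,
        Nat.mul_div_cancel_left _ two_pos]
      exact ⟨_, rfl⟩
  rw [isSkewOp_mon hω hF, h1.neg_one_pow, neg_one_mul]

lemma mon_selfAdjoint {F : Fin 11 → V} (hF : IsFrame F) {I : Finset (Fin 11)}
    (h : ¬ (I.card % 4 = 1 ∨ I.card % 4 = 2)) (s t : S) :
    ω (mon (fun a => (cl (F a) : Module.End ℝ S)) I s) t =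
      ω s (mon (fun a => (cl (F a) : Module.End ℝ S)) I t) := by
  have h1 : Even (I.card * (I.card + 1) / 2) := by
    obtain ⟨q, r, hq⟩ : ∃ q r, I.card = 4 * q + r ∧ (r = 0 ∨ r = 3) :=
      ⟨I.card / 4, I.card % 4, by omega, by omega⟩
    rcases hq with ⟨hq, rfl | rfl⟩ <;> rw [hq]
    · rw [show (4 * q + 0) * (4 * q + 0 + 1) = 2 * (2 * (4 * q * q + q)) by ring,
        Nat.mul_div_cancel_left _ two_pos]
      exact even_two_mul _
    · rw [show (4 * q + 3) * (4 * q + 3 + 1) = 2 * (2 * (4 * q * q + 7 * q + 3)) by ring,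
        Nat.mul_div_cancel_left _ two_pos]
      exact even_two_mul _
  rw [isSkewOp_mon hω hF, h1.neg_one_pow, one_mul]

/-- A symmetric bilinear map on spinors whose contractions satisfy the cocycle condition of
`H^{1,2}(𝔪, 𝔭)` vanishes if its partial trace does. -/
lemma eq_zero_of_contraction {f : S →ₗ[ℝ] S →ₗ[ℝ] S} (hf : ∀ s t, f s t = f t s)
    (h : ∀ (v : V) (M : Module.End ℝ S), IsSkewOp ω M →
      (2 : ℝ) • partialContr ω f (cl v * M) = cl v (contr ω f M))
    (h1 : partialContr ω f 1 = 0) : f = 0 := by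
  have := IsSimpleModule.nontrivial Cl S
  have hg := isFrame_e.cliffordFamily (S := S)
  set g : Fin 11 → Module.End ℝ S := fun a => cl (e a) with hgdef
  set w := monPart g (contr ω f) with hw
  set z := monPart g (partialContr ω f) with hz
  -- In terms of normalized values the hypothesis `h` is free of signs: adding or removing any
  -- single index relates `w` to `2 z`.
  have hwz : ∀ (I : Finset (Fin 11)) (a : Fin 11), (I.card % 4 = 1 ∨ I.card % 4 = 2) →
      w I = (2 : ℝ) • z (symmDiff I {a}) := fun I a hI =>
    hg.monPart_symmDiff _ _ I a (h (e a) _ (isSkewOp_mon_iff hω isFrame_e hI))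
  have hins : ∀ (K : Finset (Fin 11)) (a : Fin 11), a ∉ K → symmDiff (insert a K) {a} = K := by
    intro K a ha
    ext x
    by_cases hx : x = a
    · subst hx; simp [Finset.mem_symmDiff, ha]
    · simp [Finset.mem_symmDiff, hx]
  have hins' : ∀ (K : Finset (Fin 11)) (a : Fin 11), a ∉ K → symmDiff K {a} = insert a K := by
    intro K a ha
    rw [← hins K a ha, symmDiff_symmDiff_cancel_right, hins K a ha]
  have hzc : ∀ K, z Kᶜ = z K := hg.monPart_compl _
  have hz0 : z ∅ = 0 := by
    rw [hz, monPart, CliffordFamily.mon_empty, h1, map_zero, smul_zero]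
  have w_other : ∀ I : Finset (Fin 11), ¬ (I.card % 4 = 1 ∨ I.card % 4 = 2) → w I = 0 := by
    intro I hI
    rw [hw, monPart, contr_eq_zero_of_selfAdjoint hω hf (mon_selfAdjoint hω isFrame_e hI), map_zero,
      smul_zero]
  -- Removing the only element leads to `z ∅`, which vanishes with the partial trace. For ten
  -- elements, adding the missing one leads to the complement of `∅`.
  have w_one : ∀ I : Finset (Fin 11), I.card = 1 → w I = 0 := by
    intro I hI
    obtain ⟨a, rfl⟩ := Finset.card_eq_one.1 hI
    rw [hwz _ a (by simp), symmDiff_self, Finset.bot_eq_empty, hz0, smul_zero]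
  have w_ten : ∀ I : Finset (Fin 11), I.card = 10 → w I = 0 := by
    intro I hI
    obtain ⟨a, ha⟩ := Finset.card_eq_one.1 (by rw [Finset.card_compl, hI]; simp : Iᶜ.card = 1)
    have ha' : a ∉ I := by rw [← Finset.mem_compl, ha]; simp
    rw [hwz I a (by omega), hins' I a ha', ← hzc, ← compl_compl (insert a I), Finset.compl_insert, ha]
    simp [hz0]
  have w_pair : ∀ a b, a ≠ b → w {a, b} = (2 : ℝ) • z {b} := by
    intro a b hab
    rw [hwz _ a (by rw [Finset.card_pair hab]; simp), hins _ _ (by simpa using hab)]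
  -- Either element of a pair may be removed, so `z` is constant on singletons, and with it `w` on
  -- pairs and on their complements.
  have z_single : ∀ a b, z {a} = z {b} := by
    intro a b
    by_cases hab : a = b
    · rw [hab]
    · have h2 := w_pair a b hab
      rw [Finset.pair_comm, w_pair b a (Ne.symm hab)] at h2
      exact smul_right_injective S (two_ne_zero' ℝ) h2
  have w_two : ∀ I : Finset (Fin 11), I.card = 2 → w I = (2 : ℝ) • z {0} := by
    intro I hI
    obtain ⟨a, b, hab, rfl⟩ := Finset.card_eq_two.1 hI
    rw [w_pair a b hab, z_single b 0]
  have w_nine : ∀ I : Finset (Fin 11), I.card = 9 → w I = (2 : ℝ) • z {0} := by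
    intro I hI
    obtain ⟨a, b, hab, hc⟩ := Finset.card_eq_two.1 (by rw [Finset.card_compl, hI]; simp : Iᶜ.card = 2)
    have ha' : a ∉ I := by rw [← Finset.mem_compl, hc]; simp
    rw [hwz I a (by omega), hins' I a ha', ← hzc, Finset.compl_insert, hc,
      Finset.erase_insert (by simpa using hab), z_single b 0]
  set I₀ : Finset (Fin 11) := {0, 1, 2, 3, 4} with hI₀
  -- Five-element sets differing in one element share a four-element subset, where `2 z` takes the
  -- common value.
  have w_five : ∀ I : Finset (Fin 11), I.card = 5 → w I = w I₀ := by
    intro I hI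
    refine eq_of_exchange w 5 (fun K a b hK ha hb => ?_) hI (by decide)
    rw [hwz _ a (by rw [Finset.card_insert_of_notMem ha, hK]; simp), hins K a ha,
      hwz _ b (by rw [Finset.card_insert_of_notMem hb, hK]; simp), hins K b hb]
  have w_six : ∀ I : Finset (Fin 11), I.card = 6 → w I = w I₀ := by
    intro I hI
    have hc : Iᶜ.card = 5 := by rw [Finset.card_compl, hI]; simp
    obtain ⟨a, ha⟩ := Finset.card_pos.1 (by omega : 0 < I.card)
    rw [← w_five Iᶜ hc, hwz I a (by omega), hwz Iᶜ a (by omega), hins' Iᶜ a (by simpa using ha),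
      ← hzc (insert a Iᶜ), Finset.compl_insert, compl_compl]
    conv_lhs => rw [← Finset.insert_erase ha]
    rw [hins _ _ (Finset.notMem_erase a I)]
  -- Now `w` depends only on the cardinality, with two unknown spinors left. Two Fierz sums will
  -- determine them.
  set G : ℕ → S := fun n => if n = 2 ∨ n = 9 then (2 : ℝ) • z {0} else if n = 5 ∨ n = 6 then w I₀
    else 0 with hG
  have hwG : ∀ I, w I = G I.card := by
    intro I
    have hle : I.card ≤ 11 := (Finset.card_le_univ I).trans (by simp)
    by_cases h2 : I.card = 2
    · rw [w_two I h2, h2]; simp [hG]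
    by_cases h9 : I.card = 9
    · rw [w_nine I h9, h9]; simp [hG]
    by_cases h5 : I.card = 5
    · rw [w_five I h5, h5]; simp [hG]
    by_cases h6 : I.card = 6
    · rw [w_six I h6, h6]; simp [hG]
    have h0 : G I.card = 0 := by simp [hG, h2, h9, h5, h6]
    rw [h0]
    by_cases hI1 : I.card = 1
    · exact w_one I hI1
    by_cases hI10 : I.card = 10
    · exact w_ten I hI10
    · exact w_other I (by omega)
  have hmw : ∀ I, mon g I (w I) = contr ω f (mon g I) := hg.mon_monPart _
  have hterm : ∀ (J : Finset (Fin 11)) (N : Module.End ℝ S) (c : ℝ) (hc : ∀ s t, ω (N s) t = c * ω s (N t))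
      (y : S), (sqSign J * (-1) ^ (J.card * (J.card + 1) / 2) / 32) *
        ω (contr ω f (mon g J)) (N (mon g J y)) * c = sqSign J / 32 * ω (mon g J (N (mon g J (w J)))) y := by
    intro J N c hc y
    rw [hmw, isSkewOp_mon hω isFrame_e, hc]
    ring
  have hc0 : ∀ I : Finset (Fin 11), (Finset.univ.erase (0 : Fin 11)).card = 10 := fun _ => by simp
  -- The Fierz sum for the vanishing `partialContr ω f 1`. Counting subsets of the ten spatial
  -- indices: `55 = 45 + 10` for cardinalities 2 and 9, and `462 = 252 + 210` for 5 and 6.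
  have sum1 : (55 : ℝ) • ((2 : ℝ) • z {0}) + (462 : ℝ) • w I₀ = 0 := by
    have hs : ∑ J ∈ (Finset.univ.erase (0 : Fin 11)).powerset, w J = 0 := by
      refine eq_zero_of_omega hω fun y => ?_
      have h2 := partialContr_eq_sum hω f 1 y
      rw [h1, map_zero, LinearMap.zero_apply, zero_eq_neg] at h2
      rw [map_sum, LinearMap.sum_apply]
      have h3 := congrArg (fun r => (32 : ℝ) * r) h2
      simp only [mul_zero, Finset.mul_sum] at h3
      rw [← h3]
      refine Finset.sum_congr rfl fun J _ => ?_
      have h4 := hterm J 1 1 (fun s t => by simp) y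
      rw [Module.End.one_apply, mul_one] at h4
      rw [show (mon g J ((1 : Module.End ℝ S) (mon g J (w J)))) = sqSign J • w J from
        congrArg (fun B : Module.End ℝ S => B (w J)) (hg.mon_sq J), map_smul, LinearMap.smul_apply,
        smul_eq_mul] at h4
      rw [Module.End.one_apply, h4]
      linear_combination -(ω (w J) y) * CliffordFamily.sqSign_mul_self J
    simp only [hwG] at hs
    rw [Finset.sum_powerset_apply_card, hc0 ∅] at hs
    simp only [Finset.sum_range_succ, Finset.sum_range_zero, hG] at hs
    norm_num [Nat.choose] at hs
    rw [← hs]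
    module
  -- The Fierz sum for `partialContr ω f (g 0)`. Passing `g 0` through `mon J` gives `(-1) ^ |J|`,
  -- so the counts become `45 - 10` and `-252 + 210`; the factor 32 is the Fierz denominator.
  have sum2 : (35 : ℝ) • ((2 : ℝ) • z {0}) - (42 : ℝ) • w I₀ = (32 : ℝ) • z {0} := by
    have hs : (32 : ℝ) • z {0} =
        ∑ J ∈ (Finset.univ.erase (0 : Fin 11)).powerset, (-1 : ℝ) ^ J.card • w J := by
      have hm0 : mon g {0} = g 0 := by simp [mon]
      refine hg.mon_apply_injective {0} (sub_eq_zero.1 (eq_zero_of_omega hω fun y => ?_))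
      rw [map_smul, hg.mon_monPart, hm0, map_sub, LinearMap.sub_apply, map_smul, LinearMap.smul_apply,
        smul_eq_mul, partialContr_eq_sum hω f (g 0) y, map_sum, map_sum, LinearMap.sum_apply, mul_neg,
        Finset.mul_sum, ← neg_add', neg_eq_zero, ← Finset.sum_add_distrib]
      refine Finset.sum_eq_zero fun J hJ => ?_
      have h4 := hterm J (g 0) (-1) (fun s t => by rw [hgdef, omega_cl hω]; ring) y
      have h0J : (0 : Fin 11) ∉ J := fun h => by simpa using Finset.mem_powerset.1 hJ h
      have h5 : mon g J (g 0 (mon g J (w J))) = ((-1) ^ J.card * sqSign J) • g 0 (w J) := by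
        have h6 := congrArg (fun B : Module.End ℝ S => mon g J (B (w J))) (hg.comm_mon 0 J)
        have h7 := congrArg (fun B : Module.End ℝ S => B (g 0 (w J))) (hg.mon_sq J)
        simp only [Module.End.mul_apply, LinearMap.smul_apply, map_smul, Module.End.one_apply] at h6 h7
        rw [h6, h7, smul_smul, chi, if_neg h0J, add_zero]
      rw [h5, map_smul, LinearMap.smul_apply, smul_eq_mul] at h4
      rw [map_smul, map_smul, LinearMap.smul_apply, smul_eq_mul]
      linear_combination (-32 : ℝ) * h4 - ((-1 : ℝ) ^ J.card) * ω (g 0 (w J)) y * CliffordFamily.sqSign_mul_self J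
    simp only [hwG] at hs
    rw [Finset.sum_powerset_apply_card (fun n => (-1 : ℝ) ^ n • G n), hc0 ∅] at hs
    rw [hs]
    simp only [Finset.sum_range_succ, Finset.sum_range_zero, hG]
    norm_num [Nat.choose]
    module
  have hz00 : z {0} = 0 := by
    -- The multiples `3` and `33` eliminate `w I₀`, since `3 · 462 = 33 · 42`; what remains is `3 ·
    -- 110 + 33 · 38`.
    have : (1584 : ℝ) • z {0} = 0 := by
      linear_combination (norm := module) (3 : ℝ) • sum1 + (33 : ℝ) • sum2
    exact (smul_eq_zero.1 this).resolve_left (by norm_num)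
  have hw0 : w I₀ = 0 := by
    rw [hz00, smul_zero, smul_zero, zero_add] at sum1
    exact (smul_eq_zero.1 sum1).resolve_left (by norm_num)
  have hG0 : ∀ n, G n = 0 := fun n => by simp [hG, hz00, hw0]
  refine LinearMap.ext fun t => LinearMap.ext fun s => ?_
  rw [fierz hω isFrame_e f s t, LinearMap.zero_apply, LinearMap.zero_apply, neg_eq_zero]
  refine Finset.sum_eq_zero fun J _ => ?_
  change _ • contr ω f (mon g J) = 0
  rw [← hmw, hwG, hG0, map_zero, smul_zero]

end FirstOrder

lemma coe_soV_add (A B : soV) : ((A + B : soV) : Module.End ℝ V) = A + B := rfl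

lemma coe_soV_smul (c : ℝ) (A : soV) : ((c • A : soV) : Module.End ℝ V) = c • (A : Module.End ℝ V) := rfl

/-! ### Coboundaries and the computation of the cohomology group -/

section FirstOrder

variable {S : Type*} [AddCommGroup S] [Module ℝ S] [Module Cl S] [IsScalarTower ℝ Cl S]

/-- A family of skew endomorphisms as a linear map into `𝔰𝔬(V)`. -/
def toSoV {E : Type*} [AddCommGroup E] [Module ℝ E] (L : E →ₗ[ℝ] Module.End ℝ V)
    (h : ∀ s v, eta (L s v) v = 0) : E →ₗ[ℝ] soV where
  toFun s := ⟨L s, mem_soV.2 fun v w => by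
    have h1 := h s (v + w)
    simp only [map_add, LinearMap.add_apply, h, zero_add, add_zero] at h1
    rw [eta_comm v]
    linarith⟩
  map_add' s t := Subtype.ext (map_add L s t)
  map_smul' c s := Subtype.ext (map_smul L c s)

lemma toSoV_apply {E : Type*} [AddCommGroup E] [Module ℝ E] (L : E →ₗ[ℝ] Module.End ℝ V)
    (h : ∀ s v, eta (L s v) v = 0) (s : E) : ((toSoV L h s : soV) : Module.End ℝ V) = L s := rfl

/-- The component `S × S → S` of the coboundary `∂(Z ⊗ φ) + ∂X + ∂Y`. -/
def cobdrySS (ω : S →ₗ[ℝ] S →ₗ[ℝ] ℝ) (φ : S →ₗ[ℝ] ℝ) (X : S →ₗ[ℝ] soV) (Y : V →ₗ[ℝ] S) :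
    S →ₗ[ℝ] S →ₗ[ℝ] S :=
  LinearMap.mk₂ ℝ (fun s t => spinL (X s : Module.End ℝ V) t + spinL (X t : Module.End ℝ V) s
      - φ s • t - φ t • s - Y (kappaL ω s t))
    (fun s s' t => by
      simp only [map_add, LinearMap.add_apply, add_smul, smul_add, coe_soV_add]; abel)
    (fun c s t => by
      simp only [map_smul, LinearMap.smul_apply, coe_soV_smul, smul_eq_mul, mul_smul]
      module)
    (fun s t t' => by
      simp only [map_add, LinearMap.add_apply, add_smul, smul_add, coe_soV_add]; abel)
    (fun c s t => by
      simp only [map_smul, LinearMap.smul_apply, coe_soV_smul, smul_eq_mul, mul_smul]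
      module)

lemma cobdrySS_apply (ω : S →ₗ[ℝ] S →ₗ[ℝ] ℝ) (φ : S →ₗ[ℝ] ℝ) (X : S →ₗ[ℝ] soV) (Y : V →ₗ[ℝ] S)
    (s t : S) : cobdrySS ω φ X Y s t = spin (X s : Module.End ℝ V) t + spin (X t : Module.End ℝ V) s
      - φ s • t - φ t • s - Y (kappaL ω s t) := rfl

/-- The component `S × V → V` of the coboundary `∂(Z ⊗ φ) + ∂X + ∂Y`. -/
def cobdrySV (ω : S →ₗ[ℝ] S →ₗ[ℝ] ℝ) (φ : S →ₗ[ℝ] ℝ) (X : S →ₗ[ℝ] soV) (Y : V →ₗ[ℝ] S) :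
    S →ₗ[ℝ] V →ₗ[ℝ] V :=
  LinearMap.mk₂ ℝ (fun s v => (-2 * φ s) • v + (X s : Module.End ℝ V) v - kappaL ω s (Y v))
    (fun s s' t => by
      simp only [map_add, LinearMap.add_apply, mul_add, add_smul, coe_soV_add]; abel)
    (fun c s t => by
      simp only [map_smul, LinearMap.smul_apply, coe_soV_smul, smul_eq_mul]
      module)
    (fun s t t' => by simp only [map_add, smul_add]; abel)
    (fun c s t => by simp only [map_smul]; module)

lemma cobdrySV_apply (ω : S →ₗ[ℝ] S →ₗ[ℝ] ℝ) (φ : S →ₗ[ℝ] ℝ) (X : S →ₗ[ℝ] soV) (Y : V →ₗ[ℝ] S)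
    (s : S) (v : V) : cobdrySV ω φ X Y s v =
      (-2 * φ s) • v + (X s : Module.End ℝ V) v - kappaL ω s (Y v) := rfl

variable {ω : S →ₗ[ℝ] S →ₗ[ℝ] ℝ}

lemma cobdry_add (φ φ' : S →ₗ[ℝ] ℝ) (X X' : S →ₗ[ℝ] soV) (Y Y' : V →ₗ[ℝ] S) :
    cobdrySS ω (φ + φ') (X + X') (Y + Y') = cobdrySS ω φ X Y + cobdrySS ω φ' X' Y' ∧
      cobdrySV ω (φ + φ') (X + X') (Y + Y') = cobdrySV ω φ X Y + cobdrySV ω φ' X' Y' := by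
  constructor
  · ext s t
    simp only [cobdrySS_apply, LinearMap.add_apply, coe_soV_add, ← spinL_apply, map_add,
      add_smul]
    abel
  · refine LinearMap.ext fun s => LinearMap.ext fun v => ?_
    simp only [cobdrySV_apply, LinearMap.add_apply, coe_soV_add, map_add, mul_add, add_smul]
    abel

variable [IsSimpleModule Cl S] (hω : IsInvariantSymplectic ω)
include hω

lemma cobdrySS_comm (φ : S →ₗ[ℝ] ℝ) (X : S →ₗ[ℝ] soV) (Y : V →ₗ[ℝ] S) (s t : S) :
    cobdrySS ω φ X Y s t = cobdrySS ω φ X Y t s := by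
  rw [cobdrySS_apply, cobdrySS_apply, kappaL_comm hω]
  abel

/-- Coboundaries satisfy the cocycle condition: the `X` terms agree by equivariance of `κ`, the `φ`
terms agree directly, and the `Y` terms agree by symmetry of `κ`. -/
lemma kappa_cobdry (φ : S →ₗ[ℝ] ℝ) (X : S →ₗ[ℝ] soV) (Y : V →ₗ[ℝ] S) (s : S) :
    kappaL ω (cobdrySS ω φ X Y s s) s = cobdrySV ω φ X Y s (kappaL ω s s) := by
  have h := kappaL_spin hω (X s) s s
  rw [kappaL_comm hω s] at h
  rw [cobdrySS_apply, cobdrySV_apply, ← h, kappaL_comm hω s (Y _)]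
  simp only [map_add, map_sub, map_smul, LinearMap.add_apply, LinearMap.sub_apply,
    LinearMap.smul_apply]
  module

/-- The Lorentz rotation `X` for which the coboundary of `(ω(u, -), X, -2 γ u)` has no component
`S × V → V`. -/
def currentRot (u : S) : S →ₗ[ℝ] soV :=
  -- Skewness holds because `η(κ(s, v u), v) = ω(s, v v u) = -η(v, v) ω(s, u)`, which cancels the
  -- multiple of the identity.
  toSoV ((2 : ℝ) • (ω u).smulRight (1 : Module.End ℝ V)
      - (2 : ℝ) • (LinearMap.lcomp ℝ V (cl.flip u)).comp (kappaL ω)) fun s v => by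
    simp only [LinearMap.sub_apply, LinearMap.smul_apply, LinearMap.smulRight_apply, LinearMap.comp_apply,
      LinearMap.lcomp_apply, Module.End.one_apply, LinearMap.flip_apply, map_sub, map_smul,
      eta_kappaL hω, cl_cl]
    rw [omega_swap hω u s]
    simp only [smul_eq_mul]
    ring

lemma currentRot_apply (u s : S) (v : V) : (currentRot hω u s : Module.End ℝ V) v =
    (2 * ω u s) • v - (2 : ℝ) • kappaL ω s (cl v u) := by
  rw [currentRot, toSoV_apply]
  simp only [LinearMap.sub_apply, LinearMap.smul_apply, LinearMap.smulRight_apply, LinearMap.comp_apply,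
      LinearMap.lcomp_apply, Module.End.one_apply, LinearMap.flip_apply, smul_smul]

lemma cobdrySV_currentRot (u : S) :
    cobdrySV ω (ω u) (currentRot hω u) ((-2 : ℝ) • cl.flip u) = 0 := by
  refine LinearMap.ext fun s => LinearMap.ext fun v => ?_
  rw [cobdrySV_apply, currentRot_apply]
  simp only [LinearMap.smul_apply, LinearMap.flip_apply, map_smul, LinearMap.zero_apply]
  module

variable [Module.Finite ℝ S]

lemma trace_spinL (A : soV) : LinearMap.trace ℝ S (spinL (A : Module.End ℝ V)) = 0 := by
  rw [spinL_eq, map_smul, map_sum]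
  refine smul_eq_zero_of_right _ (Finset.sum_eq_zero fun a _ => ?_)
  have h := soV_skew A (e a) (e a)
  rw [eta_comm (e a)] at h
  rw [map_smul, trace_cl_mul_cl hω, show eta ((A : Module.End ℝ V) (e a)) (e a) = 0 by linarith]
  simp

lemma partialContr_one (f : S →ₗ[ℝ] S →ₗ[ℝ] S) (z : S) :
    ω (partialContr ω f 1) z = -LinearMap.trace ℝ S (f z) := by
  rw [omega_partialContr hω, ← sum_omega_dual hω, ← Finset.sum_neg_distrib]
  exact Finset.sum_congr rfl fun i _ => by rw [Module.End.one_apply, omega_swap hω]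

lemma sum_cl_cl_e (s : S) : ∑ a, sgn a • (cl (e a) (cl (e a) s)) = (-11 : ℝ) • s := by
  have : ∀ a, sgn a • (cl (e a) (cl (e a) s)) = (-1 : ℝ) • s := fun a => by
    rw [cl_cl, isFrame_e, if_pos rfl, smul_smul, mul_neg, sgn_mul_self]
  simp only [this, Finset.sum_const, Finset.card_univ, Fintype.card_fin]
  module

/-- The trace detects `u`, since the constant is nonzero. It is the sum `11/2 - 121/2 - 32 - 1 +
22`: the first two come from the rotation at the varying argument, the next two from the `φ` terms,
the last from `Y`; the rotation at `z` is traceless. -/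
lemma trace_cobdrySS_currentRot (u z : S) :
    LinearMap.trace ℝ S (cobdrySS ω (ω u) (currentRot hω u) ((-2 : ℝ) • cl.flip u) z) =
      -66 * ω u z := by
  have := IsSimpleModule.nontrivial Cl S
  have key : cobdrySS ω (ω u) (currentRot hω u) ((-2 : ℝ) • cl.flip u) z =
      spinL (currentRot hω u z : Module.End ℝ V) + (11 / 2 : ℝ) • (ω u).smulRight z
      + (1 / 2 : ℝ) • ∑ a, ∑ b, (sgn a * sgn b) • (ω.flip (cl (e b) (cl (e a) u))).smulRight
          (cl (e b) (cl (e a) z))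
      - (ω u z) • (1 : Module.End ℝ S) - (ω u).smulRight z
      + (2 : ℝ) • ∑ a, sgn a • ((ω z).comp (cl (e a))).smulRight (cl (e a) u) := by
    refine LinearMap.ext fun t => ?_
    have h1 : spin (currentRot hω u t : Module.End ℝ V) z = (11 / 2 : ℝ) • ω u t • z
        + (1 / 2 : ℝ) • ∑ a, ∑ b, (sgn a * sgn b) • ω t (cl (e b) (cl (e a) u)) •
          cl (e b) (cl (e a) z) := by
      rw [← spinL_apply, spinL_eq]
      simp only [LinearMap.smul_apply, LinearMap.sum_apply, Module.End.mul_apply, currentRot_apply,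
        map_sub, map_smul, LinearMap.sub_apply, smul_sub, Finset.sum_sub_distrib]
      have h2 : ∀ a, sgn a • (2 * ω u t) • cl (e a) (cl (e a) z) =
          (2 * ω u t) • sgn a • cl (e a) (cl (e a) z) := fun a => smul_comm _ _ _
      simp only [h2]
      rw [← Finset.smul_sum, sum_cl_cl_e hω]
      have h3 : ∀ a, sgn a • (2 : ℝ) • cl (kappaL ω t (cl (e a) u)) (cl (e a) z) =
          (2 : ℝ) • ∑ b, (sgn a * sgn b) • ω t (cl (e b) (cl (e a) u)) • cl (e b) (cl (e a) z) :=
        fun a => by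
          conv_lhs => rw [isFrame_e.expand (kappaL ω t (cl (e a) u))]
          simp only [map_sum, map_smul, LinearMap.sum_apply, LinearMap.smul_apply, eta_kappaL hω]
          rw [smul_comm, Finset.smul_sum]
          congr 1
          exact Finset.sum_congr rfl fun b _ => by simp only [smul_smul]; congr 1; ring
      simp only [h3]
      rw [← Finset.smul_sum]
      module
    have h2 : cl (kappaL ω z t) u = ∑ a, sgn a • ω z (cl (e a) t) • cl (e a) u := by
      conv_lhs => rw [isFrame_e.expand (kappaL ω z t)]
      simp only [map_sum, map_smul, LinearMap.sum_apply, LinearMap.smul_apply, eta_kappaL hω, smul_smul]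
    rw [cobdrySS_apply, h1]
    simp only [LinearMap.add_apply, LinearMap.sub_apply, LinearMap.smul_apply, LinearMap.sum_apply,
      LinearMap.smulRight_apply, LinearMap.comp_apply, LinearMap.flip_apply, Module.End.one_apply, h2,
      spinL_apply]
    module
  rw [key]
  simp only [map_add, map_sub, map_smul, map_sum, trace_spinL hω, LinearMap.trace_smulRight,
    LinearMap.trace_one, (isFrame_e.cliffordFamily (S := S)).finrank_eq, LinearMap.comp_apply,
    LinearMap.flip_apply, smul_eq_mul]
  have h1 : ∀ a b, sgn a * sgn b * ω (cl (e b) (cl (e a) z)) (cl (e b) (cl (e a) u)) = ω z u := by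
    intro a b
    rw [omega_cl hω, cl_cl, isFrame_e, if_pos rfl, map_smul, omega_cl hω, cl_cl, isFrame_e,
      if_pos rfl, map_smul]
    simp only [smul_eq_mul]
    linear_combination (sgn b * sgn b * ω z u) * sgn_mul_self a + (ω z u) * sgn_mul_self b
  have h2 : ∀ a, sgn a * ω z (cl (e a) (cl (e a) u)) = -ω z u := fun a => by
    rw [cl_cl, isFrame_e, if_pos rfl, map_smul, smul_eq_mul]
    linear_combination -(ω z u) * sgn_mul_self a
  simp only [h1, h2, Finset.sum_const, Finset.card_univ, Fintype.card_fin]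
  rw [omega_swap hω z u]
  norm_num
  ring

/-- A cocycle without component `S × V → V` is the canonical coboundary of a spinor. -/
lemma exists_spinor_of_cocycle {f : S →ₗ[ℝ] S →ₗ[ℝ] S} (hf : ∀ s t, f s t = f t s)
    (h : ∀ s, kappaL ω (f s s) s = 0) :
    ∃ u, f = cobdrySS ω (ω u) (currentRot hω u) ((-2 : ℝ) • cl.flip u) := by
  -- The only spinor for which the difference `f'` has zero partial trace, by the value `-66` above.
  set u := (1 / 66 : ℝ) • partialContr ω f 1 with hu
  refine ⟨u, sub_eq_zero.1 ?_⟩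
  set f' := f - cobdrySS ω (ω u) (currentRot hω u) ((-2 : ℝ) • cl.flip u) with hf'
  have hsymm : ∀ s t, f' s t = f' t s := fun s t => by
    simp only [hf', LinearMap.sub_apply, hf s t, cobdrySS_comm hω _ _ _ s t]
  have hco : ∀ s, kappaL ω (f' s s) s = (0 : S →ₗ[ℝ] V →ₗ[ℝ] V) s (kappaL ω s s) := fun s => by
    simp only [hf', LinearMap.sub_apply, map_sub, h, kappa_cobdry hω, cobdrySV_currentRot hω,
      LinearMap.zero_apply, sub_self]
  refine eq_zero_of_contraction hω hsymm (fun v M hM => ?_) (eq_zero_of_omega hω fun z => ?_)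
  · have := cocycle_contraction hω hsymm hco (ψ := fun _ _ => 0) (fun s v w => by simp) hM v
    simpa using this
  · rw [partialContr_one hω, hf', LinearMap.sub_apply, map_sub, trace_cobdrySS_currentRot hω]
    have h2 := partialContr_one hω f z
    rw [hu, map_smul, LinearMap.smul_apply, smul_eq_mul, h2]
    ring

omit hω [IsSimpleModule Cl S] in
lemma exists_spinorRep (hω : IsInvariantSymplectic ω) (ϵ : S →ₗ[ℝ] V →ₗ[ℝ] V) :
    ∃ ψ : V →ₗ[ℝ] V →ₗ[ℝ] S, ∀ s v w, ω s (ψ v w) = eta (ϵ s v) w := by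
  refine ⟨LinearMap.mk₂ ℝ (fun v w => -∑ i, eta (ϵ (bas S i) v) w • dualBas ω i)
    (fun v v' w => by
      simp only [map_add, LinearMap.add_apply, add_smul, Finset.sum_add_distrib]; abel)
    (fun c v w => by
      simp only [map_smul, LinearMap.smul_apply, smul_assoc, ← Finset.smul_sum, smul_neg])
    (fun v w w' => by
      simp only [map_add, add_smul, Finset.sum_add_distrib]; abel)
    (fun c v w => by
      simp only [map_smul, smul_assoc, ← Finset.smul_sum, smul_neg]), fun s v w => ?_⟩
  rw [LinearMap.mk₂_apply]
  exact omega_rep hω ((eta.flip w).comp (ϵ.flip v)) s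

/-- The cohomology group `H^{1,2}(𝔪, 𝔭)`: every cocycle is of the form `∂(Z ⊗ φ) + ∂X + ∂Y`. -/
theorem exists_eq_cobdry {ε : S →ₗ[ℝ] S →ₗ[ℝ] S} (hε : ∀ s t, ε s t = ε t s) {ϵ : S →ₗ[ℝ] V →ₗ[ℝ] V}
    (h : ∀ s, kappaL ω (ε s s) s = ϵ s (kappaL ω s s)) :
    ∃ (φ : S →ₗ[ℝ] ℝ) (X : S →ₗ[ℝ] soV) (Y : V →ₗ[ℝ] S),
      ε = cobdrySS ω φ X Y ∧ ϵ = cobdrySV ω φ X Y := by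
  obtain ⟨ψ, hψ⟩ := exists_spinorRep hω ϵ
  set lam := partialContr ω ε with hlam
  set Ψ : V →ₗ[ℝ] S := ∑ a, sgn a • (cl (e a)).comp (ψ (e a)) with hΨ
  set Y : V →ₗ[ℝ] S := (-(1 / 36) : ℝ) • ((contr ω ε).comp cl - (2 : ℝ) • Ψ) with hY
  have hΨ' : ∀ v, Ψ v = ∑ a, sgn a • cl (e a) (ψ (e a) v) := fun v => by
    simp only [hΨ, LinearMap.sum_apply, LinearMap.smul_apply, LinearMap.comp_apply]
  -- The contracted cocycle condition for `M = cl v`: `36 = 32 + 4`, with 32 from the contraction of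
  -- `κ` and 4 from commuting `v` past `e a` in the last sum. The map `Y` is defined so that this
  -- formula holds.
  have h36 : ∀ v, (36 : ℝ) • ψ v v = (-36 : ℝ) • cl v (Y v) + (2 * eta v v) • lam 1 := fun v => by
    have h1 := cocycle_contraction hω hε h hψ (isSkewOp_cl hω v) v
    have h2 : ∑ a, sgn a • cl (e a) (cl v (ψ (e a) v)) = (-2 : ℝ) • ψ v v - cl v (Ψ v) := by
      have h3 : ∑ a, (sgn a * eta v (e a)) • ψ (e a) v = ψ v v := by
        have h4 := congrArg (fun x => ψ x v) (isFrame_e.expand v)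
        simp only [map_sum, map_smul, LinearMap.sum_apply, LinearMap.smul_apply] at h4
        exact h4.symm
      rw [hΨ', map_sum, ← h3, Finset.smul_sum, ← Finset.sum_sub_distrib]
      refine Finset.sum_congr rfl fun a _ => ?_
      rw [cl_swap, map_smul, eta_comm (e a)]
      module
    rw [contr_kappaL_cl hω, cl_mul_self, map_smul, h2, map_smul, LinearMap.smul_apply] at h1
    have h4 : cl v (Y v) = (-(1 / 36) : ℝ) • (cl v (contr ω ε (cl v)) - (2 : ℝ) • cl v (Ψ v)) := by
      simp only [hY, LinearMap.smul_apply, LinearMap.sub_apply, LinearMap.comp_apply, map_smul, map_sub]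
    rw [h4]
    linear_combination (norm := module) h1
  set u₀ : S := (1 / 36 : ℝ) • lam 1 with hu₀
  -- Paired with `s`, the formula `h36` gives the symmetric part of `ϵ s`; subtracting the `u₀` and
  -- `Y` contributions leaves a skew endomorphism.
  set X : S →ₗ[ℝ] soV := toSoV (ϵ + (2 : ℝ) • (ω u₀).smulRight (1 : Module.End ℝ V)
      + (LinearMap.lcomp ℝ V Y).comp (kappaL ω)) (fun s v => by
    have h5 := congrArg (ω s) (h36 v)
    simp only [map_smul, map_add, smul_eq_mul, hψ] at h5
    simp only [LinearMap.add_apply, LinearMap.smul_apply, LinearMap.smulRight_apply, LinearMap.comp_apply,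
      LinearMap.lcomp_apply, Module.End.one_apply, map_add, map_smul, eta_kappaL hω, hu₀, smul_eq_mul]
    rw [omega_swap hω (lam 1) s]
    linear_combination (1 / 36 : ℝ) * h5) with hX
  have hXa : ∀ s v, (X s : Module.End ℝ V) v = ϵ s v + (2 * ω u₀ s) • v + kappaL ω s (Y v) :=
    fun s v => by
      rw [hX, toSoV_apply]
      simp only [LinearMap.add_apply, LinearMap.smul_apply, LinearMap.smulRight_apply,
        LinearMap.comp_apply, LinearMap.lcomp_apply, Module.End.one_apply, smul_smul]
  have hϵ : ϵ = cobdrySV ω (ω u₀) X Y := by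
    refine LinearMap.ext fun s => LinearMap.ext fun v => ?_
    rw [cobdrySV_apply, hXa]
    module
  -- The remaining cocycle has no component `S × V → V`.
  obtain ⟨u, hu⟩ := exists_spinor_of_cocycle hω (f := ε - cobdrySS ω (ω u₀) X Y)
    (fun s t => by simp only [LinearMap.sub_apply, hε s t, cobdrySS_comm hω _ _ _ s t])
    (fun s => by
      simp only [LinearMap.sub_apply, map_sub, kappa_cobdry hω, ← hϵ, h, sub_self])
  refine ⟨ω u₀ + ω u, X + currentRot hω u, Y + (-2 : ℝ) • cl.flip u, ?_, ?_⟩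
  · rw [(cobdry_add _ _ _ _ _ _).1, ← hu, add_sub_cancel]
  · rw [(cobdry_add _ _ _ _ _ _).2, cobdrySV_currentRot hω, ← hϵ, add_zero]

/-- The representation of cocycles of `H^{1,2}(𝔪, 𝔭)` is unique. -/
theorem cobdry_eq_zero {φ : S →ₗ[ℝ] ℝ} {X : S →ₗ[ℝ] soV} {Y : V →ₗ[ℝ] S}
    (h1 : cobdrySS ω φ X Y = 0) (h2 : cobdrySV ω φ X Y = 0) : φ = 0 ∧ X = 0 ∧ Y = 0 := by
  obtain ⟨u, hu⟩ : ∃ u, φ = ω u := ⟨∑ i, φ (bas S i) • dualBas ω i, by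
    ext s
    have := omega_rep hω φ s
    rw [omega_swap hω, map_neg, LinearMap.neg_apply, neg_neg] at this
    exact this.symm⟩
  subst hu
  have h2' : ∀ s v, (-2 * ω u s) • v + (X s : Module.End ℝ V) v - kappaL ω s (Y v) = 0 := fun s v => by
    rw [← cobdrySV_apply, h2]; rfl
  have hY : Y = (-2 : ℝ) • cl.flip u := by
    -- Pairing the component at `e a` with `e a` removes the skew `X` and determines `e a · Y (e
    -- a)`.
    have hYe : ∀ a, Y (e a) = (-2 : ℝ) • cl (e a) u := fun a => by
      have h3 : cl (e a) (Y (e a)) - (2 * sgn a) • u = 0 := by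
        refine eq_zero_of_omega hω fun s => ?_
        have h4 := congrArg (fun x => eta x (e a)) (h2' s (e a))
        have h5 := soV_skew (X s) (e a) (e a)
        rw [eta_comm (e a)] at h5
        simp only [map_add, map_sub, map_smul, LinearMap.add_apply, LinearMap.sub_apply,
          LinearMap.smul_apply, eta_kappaL hω, map_zero, LinearMap.zero_apply, isFrame_e a a, if_true,
          smul_eq_mul] at h4 ⊢
        rw [omega_swap hω _ s]
        linear_combination h4 - (1 / 2 : ℝ) * h5
      have h6 := congrArg (cl (e a)) h3
      rw [map_sub, cl_cl, map_zero, isFrame_e, if_pos rfl, map_smul] at h6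
      have h7 := congrArg (fun x => -sgn a • x) h6
      simp only [smul_sub, smul_smul, smul_zero] at h7
      rw [show -sgn a * -sgn a = 1 by linear_combination sgn_mul_self a,
        show -sgn a * (2 * sgn a) = -2 by linear_combination (-2 : ℝ) * sgn_mul_self a] at h7
      linear_combination (norm := module) h7
    refine LinearMap.ext fun v => ?_
    rw [isFrame_e.expand v]
    simp only [map_sum, map_smul, hYe, LinearMap.smul_apply, LinearMap.flip_apply]
  have hX : X = currentRot hω u := by
    refine LinearMap.ext fun s => Subtype.ext (LinearMap.ext fun v => ?_)
    rw [currentRot_apply]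
    have h3 := h2' s v
    rw [hY, LinearMap.smul_apply, LinearMap.flip_apply, map_smul] at h3
    linear_combination (norm := module) h3
  have hu : u = 0 := eq_zero_of_omega hω fun z => by
    have h3 := trace_cobdrySS_currentRot hω u z
    rw [← hX, ← hY, h1, LinearMap.zero_apply, map_zero] at h3
    linarith
  subst hu
  refine ⟨by simp, ?_, by rw [hY]; ext; simp⟩
  rw [hX]
  refine LinearMap.ext fun s => Subtype.ext (LinearMap.ext fun v => ?_)
  rw [currentRot_apply]
  simp

end FirstOrder

/-! ## The second-order components -/

/-- A timelike vector is proportional to the timelike vector of an orthonormal frame. -/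
lemma exists_isFrame {n : V} (hn : 0 < eta n n) : ∃ E : Fin 11 → V, IsFrame E ∧ ∃ c : ℝ, E 0 = c • n := by
  -- `d n` is a unit timelike vector in the same half-cone as `e 0`, so that `m = d n + e 0` cannot
  -- be null.
  obtain ⟨d, hd, hd0⟩ : ∃ d : ℝ, d * d * eta n n = 1 ∧ 0 ≤ d * n 0 := by
    have hs : √(eta n n) ≠ 0 := (Real.sqrt_pos.2 hn).ne'
    have hss := Real.mul_self_sqrt hn.le
    have h1 : (√(eta n n))⁻¹ * (√(eta n n))⁻¹ * eta n n = 1 := by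
      nth_rewrite 3 [← hss]
      field_simp
    rcases le_total 0 (n 0) with h | h
    · exact ⟨(√(eta n n))⁻¹, h1, mul_nonneg (inv_nonneg.2 (Real.sqrt_nonneg _)) h⟩
    · refine ⟨-(√(eta n n))⁻¹, by linarith, ?_⟩
      rw [neg_mul_comm]
      exact mul_nonneg (inv_nonneg.2 (Real.sqrt_nonneg _)) (by linarith)
  set m : V := d • n + e 0 with hm
  have he0 : eta n (e 0) = n 0 := by rw [eta_e]; simp [sgn]
  have hmm : eta m m = 2 * (1 + d * n 0) := by
    simp only [hm, map_add, map_smul, LinearMap.add_apply, LinearMap.smul_apply, smul_eq_mul,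
      eta_comm (e 0) n, he0, isFrame_e 0 0, if_true, sgn]
    linear_combination hd
  have hmm0 : eta m m ≠ 0 := by rw [hmm]; positivity
  have hm0 : eta (e 0) m = 1 + d * n 0 := by
    simp only [hm, map_add, map_smul, smul_eq_mul, eta_comm (e 0) n, he0, isFrame_e 0 0, if_true, sgn]
    ring
  -- The reflection in the hyperplane orthogonal to `m`, which sends `e 0` to `-d n`.
  refine ⟨fun a => e a - (2 * eta (e a) m / eta m m) • m, fun a b => ?_, -d, ?_⟩
  · simp only [map_sub, map_smul, LinearMap.sub_apply, LinearMap.smul_apply, smul_eq_mul,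
      isFrame_e a b, eta_comm m (e b)]
    field_simp
    ring
  · have h2 : 2 * eta (e 0) m / eta m m = 1 := by rw [hm0, ← hmm, div_self hmm0]
    change e 0 - (2 * eta (e 0) m / eta m m) • m = -d • n
    rw [h2, one_smul, hm]
    module

/-! ### Trace identities for the second-order components -/

section SecondOrder

variable {S : Type*} [AddCommGroup S] [Module ℝ S] [Module Cl S] [IsScalarTower ℝ Cl S]

/-- The spin representation of `𝔰𝔬(V)` as a linear map. -/
def spinSo : soV →ₗ[ℝ] Module.End ℝ S := spinL ∘ₗ soV.toSubmodule.subtype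

lemma spinSo_apply (A : soV) (s : S) : spinSo A s = spin (A : Module.End ℝ V) s := rfl

/-- The matrix coefficients of elements of `𝔰𝔬(V)`. -/
def soCoef (v w : V) : soV →ₗ[ℝ] ℝ where
  toFun A := eta ((A : Module.End ℝ V) v) w
  map_add' A B := by rw [coe_soV_add, LinearMap.add_apply, map_add, LinearMap.add_apply]
  map_smul' c A := by rw [coe_soV_smul, LinearMap.smul_apply, map_smul]; rfl

lemma soCoef_apply (v w : V) (A : soV) : soCoef v w A = eta ((A : Module.End ℝ V) v) w := rfl

lemma soCoef_swap (v w : V) (A : soV) : soCoef v w A = -soCoef w v A := by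
  rw [soCoef_apply, soCoef_apply, soV_skew, eta_comm]

lemma eq_zero_of_soCoef {A : soV} (h : ∀ v w, soCoef v w A = 0) : A = 0 :=
  Subtype.ext (LinearMap.ext fun v => eq_of_eta fun w => by
    rw [← soCoef_apply, h]; simp)

variable [Module.Finite ℝ S]
variable {ω : S →ₗ[ℝ] S →ₗ[ℝ] ℝ} (hω : IsInvariantSymplectic ω)
variable {γ : S →ₗ[ℝ] S →ₗ[ℝ] soV} {β : V →ₗ[ℝ] Module.End ℝ S} {α : V →ₗ[ℝ] V →ₗ[ℝ] V}
variable [IsSimpleModule Cl S]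

include hω

/-- Contracting the polarization of `hb` with `M` gives two terms containing `β`. They agree because
`M` is skew, and each is a trace. -/
lemma soCoef_contr (hγ : ∀ s t, γ s t = γ t s)
    (hb : ∀ s v, (γ s s : Module.End ℝ V) v = (-2 : ℝ) • kappaL ω s (β v s) - α (kappaL ω s s) v)
    {M : Module.End ℝ S} (hM : IsSkewOp ω M) (v w : V) :
    soCoef v w (contr ω γ M) =
      2 * LinearMap.trace ℝ S (cl w * β v * M) - eta (α (contr ω (kappaL ω) M) v) w := by
  have hpol : ∀ s t, (γ s t : Module.End ℝ V) v =
      -kappaL ω s (β v t) - kappaL ω t (β v s) - α (kappaL ω s t) v := fun s t => by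
    have h1 := hb (s + t) v
    have h2 := hb s v
    have h3 := hb t v
    simp only [map_add, LinearMap.add_apply, hγ t s, coe_soV_add, kappaL_comm hω t s] at h1
    linear_combination (norm := module) (1 / 2 : ℝ) • (h1 - h2 - h3)
  have h1 := sum_swap hω (ω.compl₁₂ LinearMap.id (cl w * β v)) hM
  simp only [LinearMap.compl₁₂_apply, LinearMap.id_apply] at h1
  have h2 := sum_omega_bas hω (cl w * β v * M)
  simp only [Module.End.mul_apply] at h1 h2
  rw [contr_apply, map_sum]
  simp only [soCoef_apply, hpol, map_sub, map_neg, LinearMap.sub_apply, LinearMap.neg_apply,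
    eta_kappaL hω, Finset.sum_sub_distrib, Finset.sum_neg_distrib, h1, h2]
  rw [contr_apply, map_sum, LinearMap.sum_apply, map_sum, LinearMap.sum_apply]
  ring

/-- Contracting the polarized cubic identity `ha` with `cl c` gives an operator identity on `S`, in
which `h0` removes one of the `γ` terms. Multiplying by an arbitrary `R` and taking traces makes it
linear in traces of `β` and in matrix coefficients of contractions of `γ`, which `soCoef_contr` in
turn expresses through `β` and `α`. -/
lemma trace_identity (hγ : ∀ s t, γ s t = γ t s)
    (ha : ∀ s, spin (γ s s : Module.End ℝ V) s = -β (kappaL ω s s) s)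
    (h0 : ∀ c, contr ω γ (cl c) = 0) {F : Fin 11 → V} (hF : IsFrame F) (c : V) (R : Module.End ℝ S) :
    32 * LinearMap.trace ℝ S (β c * R)
      - 1 / 2 * ∑ a, ∑ b, sgn a * sgn b *
          soCoef (F a) (F b) (contr ω γ (R * cl (F b) * cl (F a) * cl c))
      - 2 * ∑ a, sgn a * LinearMap.trace ℝ S (β (F a) * cl c * cl (F a) * R) = 0 := by
  set G : Module.End ℝ S := ∑ i, (LinearMap.applyₗ (cl c (dualBas ω i))) ∘ₗ spinSo ∘ₗ (γ.flip (bas S i))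
    with hG
  have hGz : ∀ z, G z = ∑ i, spinSo (γ z (bas S i)) (cl c (dualBas ω i)) := fun z => by
    simp only [hG, LinearMap.sum_apply]; rfl
  have hpol := polarize_cubic (fun s t z => spinSo (γ s t) z + β (kappaL ω s t) z)
    (fun s s' t z => by simp only [map_add, LinearMap.add_apply]; abel)
    (fun s t z z' => by simp only [map_add]; abel)
    (fun s t z => by rw [hγ, kappaL_comm hω s t])
    (fun s => by rw [spinSo_apply, ha, neg_add_cancel])
  have hop : (32 : ℝ) • β c + (2 : ℝ) • G - (2 : ℝ) • ∑ a, sgn a • (β (F a) * cl c * cl (F a)) = 0 := by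
    refine LinearMap.ext fun z => ?_
    have hsum := Finset.sum_eq_zero (s := Finset.univ) fun i _ =>
      hpol (bas S i) (cl c (dualBas ω i)) z
    simp only [hγ _ z, kappaL_comm hω (cl c _) z, Finset.sum_add_distrib] at hsum
    have hM := isSkewOp_cl hω c
    have s1 := sum_swap hω (LinearMap.compl₂ (LinearMap.flip (spinSo ∘ₗ γ z)) LinearMap.id) hM
    have s2 := sum_swap hω (LinearMap.compl₂ (LinearMap.flip (β ∘ₗ kappaL ω z)) LinearMap.id) hM
    simp only [LinearMap.compl₂_apply, LinearMap.flip_apply, LinearMap.comp_apply, LinearMap.id_apply]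
      at s1 s2
    have s3 : ∑ i, spinSo (γ (bas S i) (cl c (dualBas ω i))) z = 0 := by
      have h1 := congrArg (fun A => spinSo A z) (h0 c)
      simpa only [contr_apply, map_sum, LinearMap.sum_apply, map_zero, LinearMap.zero_apply] using h1
    have s4 : ∑ i, β (kappaL ω (bas S i) (cl c (dualBas ω i))) z = (32 : ℝ) • β c z := by
      have h1 := congrArg (fun A => β A z) (contr_kappaL_cl hω c)
      simpa only [contr_apply, map_sum, LinearMap.sum_apply, map_smul, LinearMap.smul_apply] using h1
    have s5 : ∑ i, β (kappaL ω z (bas S i)) (cl c (dualBas ω i)) =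
        -∑ a, sgn a • β (F a) (cl c (cl (F a) z)) := by
      have h1 : ∀ i, β (kappaL ω z (bas S i)) (cl c (dualBas ω i)) =
          ∑ a, sgn a • -(ω (cl (F a) z) (bas S i) • β (F a) (cl c (dualBas ω i))) := fun i => by
        conv_lhs => rw [hF.expand (kappaL ω z (bas S i))]
        simp only [map_sum, map_smul, LinearMap.sum_apply, LinearMap.smul_apply, eta_kappaL hω]
        refine Finset.sum_congr rfl fun a _ => ?_
        rw [omega_cl hω (F a) z]
        module
      simp only [h1]
      rw [Finset.sum_comm, ← Finset.sum_neg_distrib]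
      refine Finset.sum_congr rfl fun a _ => ?_
      rw [← Finset.smul_sum, Finset.sum_neg_distrib]
      have h2 := sum_bas_smul hω ((β (F a)).comp (cl c)) (cl (F a) z)
      simp only [LinearMap.comp_apply] at h2
      rw [h2, smul_neg]
    rw [s3, s4] at hsum
    have s6 : ∑ i, spinSo (γ z (cl c (dualBas ω i))) (bas S i) = G z := by
      rw [hGz, s1]
    have s7 : ∑ i, β (kappaL ω z (cl c (dualBas ω i))) (bas S i) =
        ∑ i, β (kappaL ω z (bas S i)) (cl c (dualBas ω i)) := s2.symm
    rw [s6, s7, ← hGz, s5] at hsum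
    simp only [LinearMap.add_apply, LinearMap.sub_apply, LinearMap.smul_apply, LinearMap.sum_apply,
      Module.End.mul_apply, LinearMap.zero_apply]
    linear_combination (norm := module) hsum
  -- The spin action is written out in the frame, and the sum over the trace index moves `R` and the
  -- two generators into the contraction of `γ`.
  have htr : LinearMap.trace ℝ S (G * R) = -(1 / 4) * ∑ a, ∑ b, sgn a * sgn b *
      soCoef (F a) (F b) (contr ω γ (R * cl (F b) * cl (F a) * cl c)) := by
    have hspin : ∀ (A : soV) (s : S), spinSo A s = (-(1 / 4) : ℝ) • ∑ a, ∑ b,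
        (sgn a * sgn b * soCoef (F a) (F b) A) • cl (F b) (cl (F a) s) := fun A s => by
      change spinL (A : Module.End ℝ V) s = _
      rw [hF.spinL_eq]
      simp only [LinearMap.smul_apply, LinearMap.sum_apply, Module.End.mul_apply]
      congr 1
      refine Finset.sum_congr rfl fun a _ => ?_
      conv_lhs => rw [hF.expand ((A : Module.End ℝ V) (F a))]
      simp only [map_sum, map_smul, LinearMap.sum_apply, LinearMap.smul_apply, Finset.smul_sum, smul_smul]
      exact Finset.sum_congr rfl fun b _ => by rw [soCoef_apply, mul_assoc]
    have h1 := sum_omega_bas hω (G * R)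
    rw [← neg_eq_iff_eq_neg] at h1
    have h2 : ∀ i, ∑ j, ω (bas S j) (spinSo (γ (R (dualBas ω j)) (bas S i)) (cl c (dualBas ω i))) =
        1 / 4 * ∑ a, ∑ b, sgn a * sgn b * soCoef (F a) (F b)
          (γ (bas S i) ((R * cl (F b) * cl (F a) * cl c : Module.End ℝ S) (dualBas ω i))) := fun i => by
      simp only [hspin, map_smul, map_sum, smul_eq_mul]
      rw [← Finset.mul_sum, Finset.sum_comm, Finset.mul_sum, Finset.mul_sum]
      refine Finset.sum_congr rfl fun a _ => ?_
      rw [Finset.sum_comm, Finset.mul_sum, Finset.mul_sum]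
      refine Finset.sum_congr rfl fun b _ => ?_
      have h3 := sum_bas_smul' hω ((soCoef (F a) (F b)).comp ((γ.flip (bas S i)).comp R))
        (cl (F b) (cl (F a) (cl c (dualBas ω i))))
      simp only [LinearMap.comp_apply, LinearMap.flip_apply, smul_eq_mul] at h3
      simp only [Module.End.mul_apply]
      rw [hγ (bas S i), ← neg_eq_iff_eq_neg.2 h3, Finset.mul_sum, ← Finset.sum_neg_distrib,
        Finset.mul_sum, Finset.mul_sum]
      exact Finset.sum_congr rfl fun j _ => by ring
    rw [← h1]
    simp only [Module.End.mul_apply, hGz, map_sum]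
    rw [Finset.sum_comm]
    simp only [h2]
    rw [← Finset.mul_sum, Finset.sum_comm, neg_mul_eq_neg_mul]
    congr 1
    refine Finset.sum_congr rfl fun a _ => ?_
    rw [Finset.sum_comm]
    refine Finset.sum_congr rfl fun b _ => ?_
    rw [contr_apply, map_sum, Finset.mul_sum]
  have h1 := congrArg (fun T => LinearMap.trace ℝ S (T * R)) hop
  simp only [add_mul, sub_mul, smul_mul_assoc, Finset.sum_mul, map_add, map_sub, map_smul, map_sum,
    zero_mul, map_zero, smul_eq_mul, htr] at h1
  linarith

end SecondOrder

/-- A signed count of ordered pairs in a finite set. -/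
lemma sum_signed_pairs {α : Type*} [Fintype α] [DecidableEq α] (P : Finset α) (c : α) :
    ∑ a, ∑ b, (if a ≠ b ∧ a ∈ P ∧ b ∈ P then (if c = a ∨ c = b then (-1 : ℝ) else 1) else 0) =
      P.card * (P.card - 1) - if c ∈ P then 4 * ((P.card : ℝ) - 1) else 0 := by
  have h : ∀ a b, (if a ≠ b ∧ a ∈ P ∧ b ∈ P then (if c = a ∨ c = b then (-1 : ℝ) else 1) else 0) =
      (if a ∈ P then (1 : ℝ) else 0) * (if b ∈ P then (1 : ℝ) else 0)
      - 2 * ((if c = a then (if a ∈ P then (1 : ℝ) else 0) else 0) * (if b ∈ P then (1 : ℝ) else 0))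
      - 2 * ((if a ∈ P then (1 : ℝ) else 0) * (if c = b then (if b ∈ P then (1 : ℝ) else 0) else 0))
      - (if a = b then (if a ∈ P then (1 : ℝ) else 0) else 0)
      + 4 * (if a = b then (if c = a then (if a ∈ P then (1 : ℝ) else 0) else 0) else 0) := by
    intro a b
    by_cases hab : a = b
    · subst hab
      by_cases hc : c = a <;> by_cases ha : a ∈ P <;> (simp [hc, ha]; try norm_num)
    · by_cases hc : c = a
      · have hcb : c ≠ b := hc ▸ hab
        by_cases ha : a ∈ P <;> by_cases hb : b ∈ P <;> (simp [hab, hc, ha, hb]; try norm_num)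
      · by_cases hcb : c = b <;> by_cases ha : a ∈ P <;> by_cases hb : b ∈ P <;>
          (simp_all; try norm_num)
  simp only [h, Finset.sum_add_distrib, Finset.sum_sub_distrib, ← Finset.mul_sum, ← Finset.sum_mul]
  simp
  split_ifs <;> ring

/-! ### Solution of the second-order equations -/

section SecondOrder

variable {S : Type*} [AddCommGroup S] [Module ℝ S] [Module Cl S] [IsScalarTower ℝ Cl S]
variable [Module.Finite ℝ S]
variable {ω : S →ₗ[ℝ] S →ₗ[ℝ] ℝ} (hω : IsInvariantSymplectic ω)
variable {γ : S →ₗ[ℝ] S →ₗ[ℝ] soV} {β : V →ₗ[ℝ] Module.End ℝ S} {α : V →ₗ[ℝ] V →ₗ[ℝ] V}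
variable [IsSimpleModule Cl S]

include hω

/-- The contraction is measured by traces of `mon J` against vectors, and `mon J * cl (F a)` is
traceless unless `J` is `{a}` or its complement. -/
lemma contr_kappaL_mon {F : Fin 11 → V} (hF : IsFrame F) {J : Finset (Fin 11)} (h1 : J.card ≠ 1)
    (h10 : J.card ≠ 10) : contr ω (kappaL ω) (mon (fun a => cl (F a)) J) = 0 := by
  have hg := hF.cliffordFamily (S := S)
  refine eq_of_eta fun u => ?_
  rw [contr_kappaL hω, map_zero, LinearMap.zero_apply, neg_eq_zero, LinearMap.trace_mul_comm,
    hF.expand u]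
  simp only [map_sum, map_smul, Finset.mul_sum, mul_smul_comm]
  refine Finset.sum_eq_zero fun a _ => smul_eq_zero_of_right _ ?_
  obtain ⟨ε, -, h⟩ := hg.mon_mul J a
  rw [h, map_smul, hg.trace_mon, smul_zero]
  · intro h0
    rw [← Finset.bot_eq_empty, symmDiff_eq_bot] at h0
    rw [h0] at h1
    simp at h1
  · intro h0
    have h2 : J = {a}ᶜ := by
      rw [← symmDiff_symmDiff_cancel_right {a} J, h0, ← Finset.top_eq_univ, top_symmDiff]
      rfl
    rw [h2, Finset.card_compl] at h10
    simp at h10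

set_option maxHeartbeats 1000000 in
/-- The second-order components vanish if the contraction of `γ` with vectors vanishes and `γ` takes
values in the stabilizer of a timelike vector. -/
lemma second_order_eq_zero (hγ : ∀ s t, γ s t = γ t s)
    (ha : ∀ s, spin (γ s s : Module.End ℝ V) s = -β (kappaL ω s s) s)
    (hb : ∀ s v, (γ s s : Module.End ℝ V) v = (-2 : ℝ) • kappaL ω s (β v s) - α (kappaL ω s s) v)
    (hα : ∀ v w, α v w = -α w v)
    (h0 : ∀ c, contr ω γ (cl c) = 0) {F : Fin 11 → V} (hF : IsFrame F)
    (hF0 : ∀ s t, (γ s t : Module.End ℝ V) (F 0) = 0) : γ = 0 ∧ β = 0 ∧ α = 0 := by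
  have := IsSimpleModule.nontrivial Cl S
  have hg := hF.cliffordFamily (S := S)
  set g : Fin 11 → Module.End ℝ S := fun a => cl (F a) with hgdef
  set tr := LinearMap.trace ℝ S with htr
  have hsq : ∀ a, g a * g a = (-sgn a) • (1 : Module.End ℝ S) := hg.sq
  have hco : ∀ {M : Module.End ℝ S}, IsSkewOp ω M → contr ω (kappaL ω) M = 0 → ∀ v w,
      soCoef v w (contr ω γ M) = 2 * tr (β v * M * cl w) := fun hM hk v w => by
    rw [soCoef_contr hω hγ hb hM, hk, map_zero, LinearMap.zero_apply, map_zero, LinearMap.zero_apply,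
      sub_zero, mul_assoc (cl w), LinearMap.trace_mul_comm ℝ (cl w)]
  -- Skewness of the endomorphism `contr ω γ M` of `V` becomes skewness of the trace in `v` and `w`.
  have hS : ∀ {M : Module.End ℝ S}, IsSkewOp ω M → contr ω (kappaL ω) M = 0 → ∀ v w,
      tr (β v * M * cl w) + tr (β w * M * cl v) = 0 := fun {M} hM hk v w => by
    have h1 := soCoef_swap v w (contr ω γ M)
    rw [hco hM hk, hco hM hk] at h1
    linarith
  -- As `γ` annihilates `F 0`, so does every contraction of it.
  have hS0 : ∀ {M : Module.End ℝ S}, IsSkewOp ω M → contr ω (kappaL ω) M = 0 → ∀ w,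
      tr (β (F 0) * M * cl w) = 0 := fun {M} hM hk w => by
    have h1 := hco hM hk (F 0) w
    rw [contr_apply, map_sum] at h1
    simp only [soCoef_apply, hF0, map_zero, LinearMap.zero_apply, Finset.sum_const_zero] at h1
    linarith
  -- For `M = cl c` the contraction of `γ` vanishes by `h0`, and skewness of `α` takes the place of
  -- that of the endomorphism.
  have h1 : ∀ c v w, tr (β v * cl c * cl w) + tr (β c * cl v * cl w) = 0 := fun c v w => by
    have e1 := soCoef_contr hω hγ hb (isSkewOp_cl hω c) v w
    have e2 := soCoef_contr hω hγ hb (isSkewOp_cl hω v) c w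
    rw [h0, map_zero, contr_kappaL_cl hω, map_smul, LinearMap.smul_apply, map_smul,
      LinearMap.smul_apply, mul_assoc (cl w), LinearMap.trace_mul_comm ℝ (cl w), ← htr] at e1 e2
    rw [hα v c, map_neg, LinearMap.neg_apply, smul_eq_mul] at e2
    rw [smul_eq_mul] at e1
    linarith
  have hβ1 : ∀ v, tr (β v * cl v * cl v) = 0 := fun v => by have := h1 v v v; linarith
  have hskew : ∀ {J : Finset (Fin 11)}, (J.card % 4 = 1 ∨ J.card % 4 = 2) → IsSkewOp ω (mon g J) :=
    fun h => isSkewOp_mon_iff hω hF h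
  have hkap : ∀ {J : Finset (Fin 11)}, J.card ≠ 1 → J.card ≠ 10 → contr ω (kappaL ω) (mon g J) = 0 :=
    fun h h' => contr_kappaL_mon hω hF h h'
  have hnon : ∀ {J : Finset (Fin 11)}, ¬ (J.card % 4 = 1 ∨ J.card % 4 = 2) → contr ω γ (mon g J) = 0 :=
    fun h => contr_eq_zero_of_selfAdjoint hω hγ (mon_selfAdjoint hω hF h)
  -- These numbers determine `β`: if all of them vanish, then `g a * β (F a)` is trace-orthogonal to
  -- every monomial.
  set U : Finset (Fin 11) → Fin 11 → ℝ := fun D a => sgn a * tr (β (F a) * mon g D * g a) with hU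
  -- products of two generators with a monomial
  have hpair : ∀ (D : Finset (Fin 11)) (a b : Fin 11), ∃ ε : ℝ,
      mon g D * g a * g b = ε • mon g (symmDiff (symmDiff D {a}) {b}) := fun D a b => by
    obtain ⟨ε, -, e1⟩ := hg.mon_mul D a
    obtain ⟨ε', -, e2⟩ := hg.mon_mul (symmDiff D {a}) b
    exact ⟨ε * ε', by rw [e1, smul_mul_assoc, e2, smul_smul]⟩
  have hDab : ∀ (D : Finset (Fin 11)) (a b : Fin 11), a ≠ b → tr (β (F a) * (mon g D * g a * g b) * g b) =
      -(sgn b * sgn a * U D a) := fun D a b hab => by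
    have e1 : β (F a) * (mon g D * g a * g b) * g b = (-sgn b) • (β (F a) * mon g D * g a) := by
      rw [mul_assoc (β (F a)), mul_assoc (mon g D * g a), hsq, mul_smul_comm, mul_one, mul_smul_comm,
        mul_assoc (β (F a))]
    rw [e1, map_smul, smul_eq_mul]
    simp only [hU]
    linear_combination (-(sgn b) * tr (β (F a) * mon g D * g a)) * (sgn_mul_self a).symm
  have hDba : ∀ (D : Finset (Fin 11)) (a b : Fin 11), a ≠ b → tr (β (F b) * (mon g D * g a * g b) * g a) =
      sgn b * sgn a * U D b := fun D a b hab => by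
    rw [mul_assoc (mon g D), hg.anti a b hab, mul_neg, mul_neg, neg_mul, map_neg,
      ← mul_assoc (mon g D), hDab D b a hab.symm]
    ring
  have hin : ∀ {D : Finset (Fin 11)} {a : Fin 11}, a ∈ D → symmDiff D {a} = D.erase a := by
    intro D a ha
    ext x
    by_cases hx : x = a
    · subst hx; simp [Finset.mem_symmDiff, ha]
    · simp [Finset.mem_symmDiff, hx]
  have hout : ∀ {D : Finset (Fin 11)} {a : Fin 11}, a ∉ D → symmDiff D {a} = insert a D := by
    intro D a ha
    ext x
    by_cases hx : x = a
    · subst hx; simp [Finset.mem_symmDiff, ha]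
    · simp [Finset.mem_symmDiff, hx]
  have hcin : ∀ {D : Finset (Fin 11)} {a b : Fin 11}, a ≠ b → a ∈ D → b ∈ D →
      (symmDiff (symmDiff D {a}) {b}).card + 2 = D.card := fun {D a b} hab ha hb => by
    have hb' : b ∈ D.erase a := Finset.mem_erase.2 ⟨hab.symm, hb⟩
    have e1 := Finset.card_erase_add_one ha
    have e2 := Finset.card_erase_add_one hb'
    rw [hin ha, hin hb']
    omega
  have hcout : ∀ {D : Finset (Fin 11)} {a b : Fin 11}, a ≠ b → a ∉ D → b ∉ D →
      (symmDiff (symmDiff D {a}) {b}).card = D.card + 2 := fun {D a b} hab ha hb => by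
    have hb' : b ∉ insert a D := by simp [hab.symm, hb]
    have e1 := Finset.card_insert_of_notMem ha
    have e2 := Finset.card_insert_of_notMem hb'
    rw [hout ha, hout hb']
    omega
  have hcmix : ∀ {D : Finset (Fin 11)} {a b : Fin 11}, a ≠ b → ¬ (a ∈ D ↔ b ∈ D) →
      (symmDiff (symmDiff D {a}) {b}).card = D.card := fun {D a b} hab h => by
    by_cases ha : a ∈ D
    · have hb : b ∉ D.erase a := fun hb => h (by simp [ha, Finset.mem_of_mem_erase hb])
      rw [hin ha, hout hb, Finset.card_insert_of_notMem hb, Finset.card_erase_add_one ha]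
    · have hb : b ∈ insert a D := Finset.mem_insert_of_mem (not_not.1 fun hb => h (iff_of_false ha hb))
      rw [hout ha, hin hb, Finset.card_erase_of_mem hb, Finset.card_insert_of_notMem ha]
      rfl
  have hsmul : ∀ {M : Module.End ℝ S} (ε : ℝ), IsSkewOp ω M → contr ω (kappaL ω) M = 0 →
      IsSkewOp ω (ε • M) ∧ contr ω (kappaL ω) (ε • M) = 0 := fun ε hM hk =>
    ⟨fun s t => by simp only [LinearMap.smul_apply, map_smul, hM s t, smul_neg],
      by rw [map_smul, hk, smul_zero]⟩
  -- the product of two generators with a monomial is skew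
  have hgood : ∀ (D : Finset (Fin 11)) (a b : Fin 11), (D.card = 0 ∨ D.card = 3 ∨ D.card = 4) → a ≠ b →
      (a ∈ D ↔ b ∈ D) → ¬ (a ∈ D ∧ D.card = 3) →
      IsSkewOp ω (mon g D * g a * g b) ∧ contr ω (kappaL ω) (mon g D * g a * g b) = 0 := by
    intro D a b hD hab hs h3
    obtain ⟨ε, hε⟩ := hpair D a b
    rw [hε]
    by_cases haD : a ∈ D
    · have hc := hcin hab haD (hs.1 haD)
      have h3' : D.card ≠ 3 := fun h => h3 ⟨haD, h⟩
      exact hsmul ε (hskew (by omega)) (hkap (by omega) (by omega))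
    · have hc := hcout hab haD (fun h => haD (hs.2 h))
      exact hsmul ε (hskew (by omega)) (hkap (by omega) (by omega))
  have hbad : ∀ (D : Finset (Fin 11)) (a b : Fin 11), a ≠ b → a ∈ D → b ∈ D → D.card = 3 →
      ∃ (ε : ℝ) (c : Fin 11), c ≠ a ∧ c ≠ b ∧ mon g D * g a * g b = ε • g c := by
    intro D a b hab ha hb hD
    obtain ⟨ε, hε⟩ := hpair D a b
    have hc := hcin hab ha hb
    obtain ⟨c, hc⟩ := Finset.card_eq_one.1 (by omega : (symmDiff (symmDiff D {a}) {b}).card = 1)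
    have hcm : c ∈ symmDiff (symmDiff D {a}) {b} := by rw [hc]; simp
    rw [hin ha, hin (Finset.mem_erase.2 ⟨hab.symm, hb⟩)] at hcm
    refine ⟨ε, c, fun h => ?_, fun h => ?_, ?_⟩
    · simp [h] at hcm
    · simp [h] at hcm
    · rw [hε, hc]; simp [mon]
  -- The skewness `hS` for `M = mon D * g a * g b` shows that `U D` depends only on membership in
  -- `D`. If `D` has three elements including `a` and `b`, then `M` is a multiple of a vector and
  -- `h1` replaces `hS`.
  have hconst : ∀ (D : Finset (Fin 11)) (a b : Fin 11), (D.card = 0 ∨ D.card = 3 ∨ D.card = 4) →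
      (a ∈ D ↔ b ∈ D) → U D a = U D b := by
    intro D a b hD hs
    by_cases hab : a = b
    · rw [hab]
    have key : tr (β (F a) * (mon g D * g a * g b) * g b) +
        tr (β (F b) * (mon g D * g a * g b) * g a) = 0 := by
      by_cases h3 : a ∈ D ∧ D.card = 3
      · obtain ⟨ε, c, hca, hcb, hM⟩ := hbad D a b hab h3.1 (hs.1 h3.1) h3.2
        have e1 := h1 (F b) (F a) (F c)
        rw [hM, mul_smul_comm, smul_mul_assoc, mul_smul_comm, smul_mul_assoc, map_smul, map_smul,
          mul_assoc, hg.anti c b hcb, mul_assoc, hg.anti c a hca, mul_neg, mul_neg, map_neg, map_neg,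
          ← mul_assoc, ← mul_assoc, smul_eq_mul, smul_eq_mul]
        linear_combination (-ε) * e1
      · obtain ⟨hM, hk⟩ := hgood D a b hD hab hs h3
        exact hS hM hk (F a) (F b)
    rw [hDab D a b hab, hDba D a b hab] at key
    have e2 : sgn b * sgn a ≠ 0 := mul_ne_zero (sgn_ne_zero b) (sgn_ne_zero a)
    have e3 : sgn b * sgn a * (U D b - U D a) = 0 := by linarith
    have e4 := (mul_eq_zero.1 e3).resolve_left e2
    linarith
  -- If exactly one of `a`, `b` lies in `D`, the product again has cardinality 0, 3 or 4, hence is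
  -- self-adjoint and contracts `γ` to zero.
  have hval : ∀ (D : Finset (Fin 11)) (a b : Fin 11), (D.card = 0 ∨ D.card = 3 ∨ D.card = 4) → a ≠ b →
      soCoef (F a) (F b) (contr ω γ (mon g D * g a * g b)) =
        if (a ∈ D ↔ b ∈ D) ∧ ¬ (a ∈ D ∧ D.card = 3) then -2 * (sgn a * sgn b * U D a) else 0 := by
    intro D a b hD hab
    by_cases hs : a ∈ D ↔ b ∈ D
    · by_cases h3 : a ∈ D ∧ D.card = 3
      · obtain ⟨ε, c, -, -, hM⟩ := hbad D a b hab h3.1 (hs.1 h3.1) h3.2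
        rw [if_neg (fun h => h.2 h3), hM, map_smul, h0, smul_zero, map_zero]
      · obtain ⟨hM, hk⟩ := hgood D a b hD hab hs h3
        rw [if_pos ⟨hs, h3⟩, hco hM hk]
        have := hDab D a b hab
        simp only [hgdef] at this ⊢
        rw [this]
        ring
    · obtain ⟨ε, hε⟩ := hpair D a b
      have hc := hcmix hab hs
      rw [if_neg (fun h => hs h.1), hε, map_smul, hnon (by omega), smul_zero, map_zero]
  -- `trace_identity` for `R = mon D * g c`. The coefficient is `34 = 32 + 2`, the 2 being the term
  -- `a = c` of the last sum, which has its own sign.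
  have heq : ∀ (D : Finset (Fin 11)) (c : Fin 11), (D.card = 0 ∨ D.card = 3 ∨ D.card = 4) →
      34 * U D c + (∑ a, ∑ b, if a ≠ b ∧ (a ∈ D ↔ b ∈ D) ∧ ¬ (a ∈ D ∧ D.card = 3) then
        (if c = a ∨ c = b then (-1 : ℝ) else 1) * U D a else 0)
      - 2 * ∑ a, (if a = c then 0 else chi D a * chi D c * U D a) = 0 := by
    intro D c hD
    have hsgn : ∀ a, sgn a * sgn a = 1 := sgn_mul_self
    have key := trace_identity hω hγ ha h0 hF (F c) (mon g D * cl (F c))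
    have t1 : tr (β (F c) * (mon g D * cl (F c))) = sgn c * U D c := by
      rw [← mul_assoc]
      simp only [hU]
      linear_combination (-tr (β (F c) * mon g D * g c)) * hsgn c
    have t2 : ∀ a b, sgn a * sgn b * soCoef (F a) (F b)
        (contr ω γ (mon g D * cl (F c) * cl (F b) * cl (F a) * cl (F c))) =
        sgn c * (-2) * (if a ≠ b ∧ (a ∈ D ↔ b ∈ D) ∧ ¬ (a ∈ D ∧ D.card = 3) then
        (if c = a ∨ c = b then (-1 : ℝ) else 1) * U D a else 0) := by
      intro a b
      by_cases hab : a = b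
      · subst hab
        have := soCoef_swap (F a) (F a)
          (contr ω γ (mon g D * cl (F c) * cl (F a) * cl (F a) * cl (F c)))
        rw [if_neg (fun h => h.1 rfl)]
        rw [show soCoef (F a) (F a) (contr ω γ (mon g D * cl (F c) * cl (F a) * cl (F a) * cl (F c))) = 0
          by linarith]
        ring
      · have hprod : mon g D * g c * g b * g a * g c =
            (sgn c * (if c = a ∨ c = b then (-1 : ℝ) else 1)) • (mon g D * g a * g b) := by
          by_cases hca : c = a
          · subst hca
            rw [if_pos (Or.inl rfl), mul_assoc (mon g D * g c * g b), hsq, mul_smul_comm, mul_one]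
            congr 1
            ring
          · by_cases hcb : c = b
            · subst hcb
              rw [if_pos (Or.inr rfl), mul_assoc (mon g D), hsq, mul_smul_comm, mul_one, smul_mul_assoc,
                smul_mul_assoc]
              congr 1
              ring
            · rw [if_neg (fun h => h.elim hca hcb), mul_assoc (mon g D * g c * g b), hg.anti a c (Ne.symm hca), mul_neg,
                ← mul_assoc, mul_assoc (mon g D * g c), hg.anti b c (Ne.symm hcb), mul_neg, neg_mul,
                neg_neg, ← mul_assoc, mul_assoc (mon g D), hsq, mul_smul_comm, mul_one, smul_mul_assoc,
                smul_mul_assoc, mul_assoc, hg.anti b a (Ne.symm hab), mul_neg, ← mul_assoc]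
              module
        change sgn a * sgn b * soCoef (F a) (F b) (contr ω γ (mon g D * g c * g b * g a * g c)) = _
        rw [hprod, map_smul, map_smul, hval D a b hD hab, smul_eq_mul]
        simp only [ne_eq, hab, not_false_eq_true, true_and]
        have hq : sgn a * sgn b * (sgn a * sgn b) = 1 := by
          linear_combination (sgn b * sgn b) * hsgn a + hsgn b
        generalize (if c = a ∨ c = b then (-1 : ℝ) else 1) = σ
        split_ifs
        · linear_combination (sgn c * σ * (-2) * U D a) * hq
        · ring
    have t3 : ∀ a, sgn a * tr (β (F a) * cl (F c) * cl (F a) * (mon g D * cl (F c))) =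
        sgn c * (if a = c then 0 else chi D a * chi D c * U D a) - if a = c then sgn c * U D c else 0 := by
      intro a
      change sgn a * tr (β (F a) * g c * g a * (mon g D * g c)) = _
      by_cases hac : a = c
      · subst hac
        rw [if_pos rfl, if_pos rfl, mul_assoc (β (F a)), hsq, mul_smul_comm, mul_one, smul_mul_assoc,
          map_smul, smul_eq_mul, ← mul_assoc (β (F a))]
        simp only [hU]
        ring
      · have e1 : β (F a) * g c * g a * (mon g D * g c) =
            (sgn c * chi D a * chi D c) • (β (F a) * mon g D * g a) := by
          rw [mul_assoc (β (F a)), hg.anti c a (Ne.symm hac), mul_neg, neg_mul, ← mul_assoc (β (F a)),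
            mul_assoc _ (g c), ← mul_assoc (g c), hg.comm_mon, smul_mul_assoc, mul_assoc (mon g D), hsq,
            mul_smul_comm, mul_smul_comm, mul_one, mul_smul_comm, mul_assoc (β (F a)), hg.comm_mon,
            mul_smul_comm, ← mul_assoc]
          module
        rw [if_neg hac, if_neg hac, e1, map_smul, smul_eq_mul]
        simp only [hU]
        ring
    simp only [t1, t2, t3, ← htr, Finset.sum_sub_distrib, ← Finset.mul_sum, Finset.sum_ite_eq',
      Finset.mem_univ, if_true] at key
    refine (mul_eq_zero.1 (?_ : sgn c * _ = 0)).resolve_left (sgn_ne_zero c)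
    linear_combination key
  -- With the value `x` on `D` and `y` off `D` the sums are counts of pairs. Completing the last sum
  -- by its omitted term `a = c` raises 34 to 36.
  have heq' : ∀ (D : Finset (Fin 11)) (x y : ℝ), (D.card = 0 ∨ D.card = 3 ∨ D.card = 4) →
      (∀ a, U D a = if a ∈ D then x else y) → ∀ c,
      36 * U D c + (if D.card = 3 then 0 else x) *
        (D.card * (D.card - 1) - if c ∈ D then 4 * ((D.card : ℝ) - 1) else 0)
      + y * ((11 - D.card) * (10 - D.card) - if c ∈ D then 0 else 4 * (10 - (D.card : ℝ)))
      - 2 * (if c ∈ D then 1 else -1) * (D.card * x - (11 - D.card) * y) = 0 := by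
    intro D x y hD hxy c
    have hcc : (Dᶜ.card : ℝ) = 11 - D.card := by
      rw [Finset.card_compl, Nat.cast_sub (Finset.card_le_univ D)]; simp
    have e1 := sum_signed_pairs D c
    have e2 := sum_signed_pairs Dᶜ c
    rw [hcc] at e2
    have e3 : (∑ a, ∑ b, if a ≠ b ∧ (a ∈ D ↔ b ∈ D) ∧ ¬ (a ∈ D ∧ D.card = 3) then
        (if c = a ∨ c = b then (-1 : ℝ) else 1) * U D a else 0) =
        (if D.card = 3 then 0 else x) * (∑ a, ∑ b, (if a ≠ b ∧ a ∈ D ∧ b ∈ D then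
          (if c = a ∨ c = b then (-1 : ℝ) else 1) else 0)) +
        y * (∑ a, ∑ b, (if a ≠ b ∧ a ∈ Dᶜ ∧ b ∈ Dᶜ then
          (if c = a ∨ c = b then (-1 : ℝ) else 1) else 0)) := by
      simp only [Finset.mul_sum, ← Finset.sum_add_distrib]
      refine Finset.sum_congr rfl fun a _ => Finset.sum_congr rfl fun b _ => ?_
      rw [hxy]
      generalize (if c = a ∨ c = b then (-1 : ℝ) else 1) = σ
      by_cases hab : a = b
      · simp [hab]
      · by_cases ha : a ∈ D <;> by_cases hb : b ∈ D <;> by_cases h3 : D.card = 3 <;>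
          simp [hab, ha, hb, h3, mul_comm]
    have e4 : ∑ a, (if a = c then 0 else chi D a * chi D c * U D a) =
        (if c ∈ D then 1 else -1) * (D.card * x - (11 - D.card) * y) - U D c := by
      have e5 : ∀ a, (if a = c then 0 else chi D a * chi D c * U D a) =
          (if c ∈ D then (1 : ℝ) else -1) * ((if a ∈ D then (1 : ℝ) else 0) * x
            - (if a ∈ Dᶜ then (1 : ℝ) else 0) * y) - if a = c then U D c else 0 := fun a => by
        have hch : chi D a * chi D c = (if a ∈ D then (-1) else 1) * if c ∈ D then (-1) else 1 := by
          have hpp : ((-1 : ℝ) ^ D.card) * (-1) ^ D.card = 1 := by rw [← mul_pow]; norm_num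
          rw [chi, chi, pow_add, pow_add, mul_mul_mul_comm, hpp]
          by_cases ha : a ∈ D <;> by_cases hc : c ∈ D <;> simp [ha, hc]
        rw [hxy, hxy, hch]
        by_cases hac : a = c
        · subst hac
          by_cases ha : a ∈ D <;> simp [ha]
        · by_cases ha : a ∈ D <;> by_cases hc : c ∈ D <;> simp [hac, ha, hc]
      have e6 : ∀ P : Finset (Fin 11), ∑ a, (if a ∈ P then (1 : ℝ) else 0) = P.card := fun P => by simp
      simp only [e5, Finset.sum_sub_distrib, ← Finset.mul_sum, ← Finset.sum_mul, Finset.sum_ite_eq',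
        Finset.mem_univ, if_true, e6, hcc]
    have e6 := heq D c hD
    rw [e3, e4, e1, e2] at e6
    have e7 : (if c ∈ Dᶜ then 4 * ((11 : ℝ) - D.card - 1) else 0) =
        if c ∈ D then 0 else 4 * (10 - (D.card : ℝ)) := by
      by_cases hc : c ∈ D <;> simp [hc]; ring
    rw [e7] at e6
    linear_combination e6
  have hUnon : ∀ (D : Finset (Fin 11)), (D.card = 0 ∨ D.card = 3 ∨ D.card = 4) → ∀ a, U D a = 0 := by
    intro D hD
    obtain ⟨y0, hy0⟩ : ∃ y0, y0 ∉ D := by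
      by_contra! h
      rw [Finset.eq_univ_iff_forall.2 h] at hD
      simp at hD
    have hex : ∃ x y, ∀ a, U D a = if a ∈ D then x else y := by
      by_cases hne : D.Nonempty
      · obtain ⟨x0, hx0⟩ := hne
        refine ⟨U D x0, U D y0, fun a => ?_⟩
        split_ifs with h
        · exact hconst D a x0 hD (iff_of_true h hx0)
        · exact hconst D a y0 hD (iff_of_false h hy0)
      · rw [Finset.not_nonempty_iff_eq_empty] at hne
        exact ⟨0, U D y0, fun a => by
          rw [if_neg (by rw [hne]; simp)]
          exact hconst D a y0 hD (iff_of_false (by rw [hne]; simp) hy0)⟩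
    obtain ⟨x, y, hxy⟩ := hex
    have hout := heq' D x y hD hxy y0
    rw [hxy] at hout
    simp only [hy0, if_false] at hout
    -- For `|D| = 0` the equation is `84 y = 0`. For `|D| = 3` the indices outside and inside `D`
    -- give `48 y + 6 x = 0` and `30 x + 72 y = 0`. For `|D| = 4` there is only `x = -2 y`.
    have hres : y = 0 ∧ (D.card ≠ 0 → x = 0) := by
      rcases hD with hD | hD | hD
      · rw [hD] at hout
        norm_num at hout
        exact ⟨by linarith, fun h => absurd hD h⟩
      · obtain ⟨x0, hx0⟩ := Finset.card_pos.1 (by omega : 0 < D.card)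
        have hin := heq' D x y (by omega) hxy x0
        rw [hxy] at hin
        simp only [hx0, if_true, hD] at hin
        rw [hD] at hout
        norm_num at hout hin
        exact ⟨by linarith, fun _ => by linarith⟩
      · rw [hD] at hout
        norm_num at hout
        -- For four indices a one-parameter freedom, the four-form part of the cohomology, survives
        -- the linear equations. It vanishes because `γ` annihilates the timelike `F 0`.
        have h00 : U D 0 = 0 := by
          obtain ⟨b, hb0, hb⟩ : ∃ b, (0 : Fin 11) ≠ b ∧ ((0 : Fin 11) ∈ D ↔ b ∈ D) := by
            by_cases h0D : (0 : Fin 11) ∈ D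
            · obtain ⟨b, hb⟩ := Finset.card_pos.1
                (by rw [Finset.card_erase_of_mem h0D]; omega : 0 < (D.erase 0).card)
              rw [Finset.mem_erase] at hb
              exact ⟨b, hb.1.symm, iff_of_true h0D hb.2⟩
            · obtain ⟨b, hb⟩ := Finset.card_pos.1
                (by rw [Finset.card_erase_of_mem (by simpa using h0D), Finset.card_compl, hD]; simp :
                  0 < (Dᶜ.erase 0).card)
              rw [Finset.mem_erase, Finset.mem_compl] at hb
              exact ⟨b, hb.1.symm, iff_of_false h0D hb.2⟩
          obtain ⟨hM, hk⟩ := hgood D 0 b (by omega) hb0 hb (by omega)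
          have e1 := hDab D 0 b hb0
          rw [hS0 hM hk (F b), zero_eq_neg] at e1
          exact (mul_eq_zero.1 e1).resolve_left (mul_ne_zero (sgn_ne_zero b) (sgn_ne_zero 0))
        rw [hxy] at h00
        split_ifs at h00 with h
        · exact ⟨by linarith, fun _ => h00⟩
        · exact ⟨h00, fun _ => by linarith⟩
    intro a
    rw [hxy]
    split_ifs with h
    · exact hres.2 (Finset.card_pos.2 ⟨a, h⟩).ne'
    · exact hres.1
  -- Complements reduce to at most five indices. Cardinalities 2 and 5 are skew and follow from `hS`
  -- with equal arguments; cardinality 1 follows from `h1`.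
  have hU0 : ∀ (D : Finset (Fin 11)) (a : Fin 11), tr (β (F a) * mon g D * g a) = 0 := by
    have hle : ∀ D : Finset (Fin 11), D.card ≤ 5 → ∀ a, tr (β (F a) * mon g D * g a) = 0 := by
      intro D hD a
      by_cases hD1 : D.card = 1
      · obtain ⟨c, rfl⟩ := Finset.card_eq_one.1 hD1
        have hm : mon g {c} = g c := by simp [mon]
        have e1 : tr (β (F a) * g a * g c) = 0 := by
          have e2 := h1 (F a) (F a) (F c)
          change tr (β (F a) * g a * g c) + tr (β (F a) * g a * g c) = 0 at e2
          linarith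
        rw [hm]
        by_cases hca : c = a
        · rw [hca] at e1 ⊢
          exact e1
        · rw [mul_assoc, hg.anti c a hca, mul_neg, map_neg, ← mul_assoc, e1, neg_zero]
      · by_cases hD2 : D.card = 2 ∨ D.card = 5
        · have := hS (hskew (by omega)) (hkap (J := D) hD1 (by omega)) (F a) (F a)
          change tr (β (F a) * mon g D * g a) + tr (β (F a) * mon g D * g a) = 0 at this
          linarith
        · exact (mul_eq_zero.1 (hUnon D (by omega) a)).resolve_left (sgn_ne_zero a)
    intro D a
    by_cases hD : D.card ≤ 5
    · exact hle D hD a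
    · obtain ⟨ε, -, hε⟩ := hg.mon_compl Dᶜ
      rw [compl_compl] at hε
      rw [hε, mul_smul_comm, smul_mul_assoc, map_smul,
        hle Dᶜ (by rw [Finset.card_compl, Fintype.card_fin]; omega), smul_zero]
  have hβe : ∀ a, β (F a) = 0 := by
    intro a
    have e1 : g a * β (F a) = 0 := hg.eq_zero_of_trace fun J _ => by
      have e2 := hU0 J a
      rw [mul_assoc, htr, LinearMap.trace_mul_comm, mul_assoc] at e2
      exact e2
    have e2 : (-sgn a) • β (F a) = 0 := by
      rw [← one_mul (β (F a)), ← smul_mul_assoc, ← hsq, mul_assoc, e1, mul_zero]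
    exact (smul_eq_zero.1 e2).resolve_left (neg_ne_zero.2 (sgn_ne_zero a))
  have hβ0 : β = 0 := LinearMap.ext fun v => by
    rw [hF.expand v, map_sum]
    simp only [map_smul, hβe, smul_zero, Finset.sum_const_zero, LinearMap.zero_apply]
  have hγJ : ∀ J : Finset (Fin 11), contr ω γ (mon g J) = 0 := by
    have hne : ∀ J : Finset (Fin 11), J.card ≠ 10 → contr ω γ (mon g J) = 0 := by
      intro J h10
      by_cases hJ1 : J.card = 1
      · obtain ⟨c, rfl⟩ := Finset.card_eq_one.1 hJ1
        have hm : mon g {c} = g c := by simp [mon]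
        rw [hm, h0]
      · by_cases hs : J.card % 4 = 1 ∨ J.card % 4 = 2
        · refine eq_zero_of_soCoef fun v w => ?_
          rw [hco (hskew hs) (hkap hJ1 h10), hβ0]
          simp
        · exact hnon hs
    intro J
    by_cases h10 : J.card = 10
    · obtain ⟨ε, -, hε⟩ := hg.mon_compl Jᶜ
      rw [compl_compl] at hε
      rw [hε, map_smul, hne Jᶜ (by rw [Finset.card_compl, Fintype.card_fin]; omega), smul_zero]
    · exact hne J h10
  have hγ0 : γ = 0 := LinearMap.ext fun t => LinearMap.ext fun s => by
    rw [fierz hω hF γ s t, LinearMap.zero_apply, LinearMap.zero_apply, neg_eq_zero]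
    refine Finset.sum_eq_zero fun J _ => ?_
    change _ • contr ω γ (mon g J) = 0
    rw [hγJ, smul_zero]
  refine ⟨hγ0, hβ0, LinearMap.ext fun c => LinearMap.ext fun v => ?_⟩
  have e1 : ∀ s, α (kappaL ω s s) v = 0 := fun s => by
    have := hb s v
    rw [hγ0, hβ0] at this
    simpa using this.symm
  have e2 : ∀ s t, α (kappaL ω s t) v = 0 := fun s t => by
    have := e1 (s + t)
    simp only [map_add, LinearMap.add_apply, e1, kappaL_comm hω t s, zero_add, add_zero] at this
    rw [← two_smul ℝ] at this
    exact (smul_eq_zero.1 this).resolve_left two_ne_zero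
  have e3 := congrArg (fun x => α x v) (contr_kappaL_cl hω c)
  simp only [contr_apply, map_sum, LinearMap.sum_apply, e2, Finset.sum_const_zero, map_smul,
    LinearMap.smul_apply] at e3
  exact (smul_eq_zero.1 e3.symm).resolve_left (by norm_num)

/-- The second-order components are those of a Lorentz rotation depending linearly on vectors. -/
theorem exists_second_order (hγ : ∀ s t, γ s t = γ t s)
    (ha : ∀ s, spin (γ s s : Module.End ℝ V) s = -β (kappaL ω s s) s)
    (hb : ∀ s v, (γ s s : Module.End ℝ V) v = (-2 : ℝ) • kappaL ω s (β v s) - α (kappaL ω s s) v)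
    (hα : ∀ v w, α v w = -α w v) {n : V} (hn : 0 < eta n n)
    (hγn : ∀ s t, (γ s t : Module.End ℝ V) n = 0) :
    ∃ Z : V →ₗ[ℝ] soV, (∀ P : Submodule ℝ soV, (∀ s t, γ s t ∈ P) → ∀ v, Z v ∈ P) ∧
      (∀ v s, β v s = spin (Z v : Module.End ℝ V) s) ∧ (∀ s t, γ s t = -Z (kappaL ω s t)) ∧
      ∀ v w, α v w = (Z v : Module.End ℝ V) w - (Z w : Module.End ℝ V) v := by
  -- Since `κ` contracts with `cl c` to `32 c`, this choice makes the contraction of `γ + Z ∘ κ`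
  -- with every vector vanish.
  set Z : V →ₗ[ℝ] soV := (-(1 / 32) : ℝ) • (contr ω γ).comp cl with hZ
  have hZP : ∀ P : Submodule ℝ soV, (∀ s t, γ s t ∈ P) → ∀ v, Z v ∈ P := fun P hP v => by
    rw [hZ, LinearMap.smul_apply, LinearMap.comp_apply, contr_apply]
    exact P.smul_mem _ (P.sum_mem fun i _ => hP _ _)
  -- As a combination of values of `γ`, `Z` inherits every linear condition on them; in particular
  -- it fixes `n`, as the vanishing lemma requires.
  have hZn : ∀ v, (Z v : Module.End ℝ V) n = 0 := hZP
    (LinearMap.ker ((LinearMap.applyₗ n).comp soV.toSubmodule.subtype)) hγn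
  obtain ⟨F, hF, d, hd⟩ := exists_isFrame hn
  set L : V →ₗ[ℝ] V →ₗ[ℝ] V := soV.toSubmodule.subtype.comp Z with hL
  have hLa : ∀ v w, L v w = (Z v : Module.End ℝ V) w := fun _ _ => rfl
  obtain ⟨h1, h2, h3⟩ := second_order_eq_zero hω (γ := γ + (kappaL ω).compr₂ Z) (β := β - spinSo.comp Z)
    (α := α - L + L.flip)
    (fun s t => by
      simp only [LinearMap.add_apply, LinearMap.compr₂_apply, hγ s t, kappaL_comm hω s t])
    (fun s => by
      simp only [LinearMap.add_apply, LinearMap.compr₂_apply, LinearMap.sub_apply, LinearMap.comp_apply,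
        spinSo_apply, coe_soV_add, ← spinL_apply, map_add]
      rw [spinL_apply, ha]
      abel)
    (fun s v => by
      simp only [LinearMap.add_apply, LinearMap.compr₂_apply, LinearMap.sub_apply, LinearMap.comp_apply,
        spinSo_apply, coe_soV_add, hb, LinearMap.flip_apply, hLa, map_sub]
      have := kappaL_spin hω (Z v) s s
      rw [kappaL_comm hω _ s] at this
      rw [← this]
      module)
    (fun v w => by
      simp only [LinearMap.add_apply, LinearMap.sub_apply, LinearMap.flip_apply, hα v w]
      abel)
    (fun c => by
      have e1 : contr ω (γ + (kappaL ω).compr₂ Z) (cl c) =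
          contr ω γ (cl c) + Z (contr ω (kappaL ω) (cl c)) := by
        simp only [contr_apply, map_sum, LinearMap.add_apply, LinearMap.compr₂_apply,
          Finset.sum_add_distrib]
      rw [e1, contr_kappaL_cl hω, map_smul, hZ, LinearMap.smul_apply, LinearMap.comp_apply]
      module)
    hF
    (fun s t => by
      rw [hd, map_smul, LinearMap.add_apply, LinearMap.add_apply, LinearMap.compr₂_apply, coe_soV_add,
        LinearMap.add_apply, hγn, hZn, add_zero, smul_zero])
  refine ⟨Z, hZP, fun v s => ?_, fun s t => ?_, fun v w => ?_⟩
  · have := congrArg (fun T => T v s) h2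
    simp only [LinearMap.sub_apply, LinearMap.comp_apply, LinearMap.zero_apply, spinSo_apply] at this
    exact sub_eq_zero.1 this
  · have := congrArg (fun T => T s t) h1
    simp only [LinearMap.add_apply, LinearMap.compr₂_apply, LinearMap.zero_apply] at this
    exact eq_neg_of_add_eq_zero_left this
  · have := congrArg (fun T => T v w) h3
    simp only [LinearMap.add_apply, LinearMap.sub_apply, LinearMap.flip_apply, LinearMap.zero_apply, hLa]
      at this
    linear_combination (norm := module) this

end SecondOrder

/-! ## Stabilizers of timelike vectors -/

lemma IsFrame.trace_eq {F : Fin 11 → V} (hF : IsFrame F) (T : Module.End ℝ V) :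
    LinearMap.trace ℝ V T = ∑ a, sgn a * eta (T (F a)) (F a) := by
  have h : T = ∑ a, (sgn a • eta (F a)).smulRight (T (F a)) := LinearMap.ext fun v => by
    conv_lhs => rw [hF.expand v]
    simp only [map_sum, map_smul, LinearMap.sum_apply, LinearMap.smulRight_apply, LinearMap.smul_apply,
      smul_eq_mul, eta_comm v]
  conv_lhs => rw [h]
  simp only [map_sum, LinearMap.trace_smulRight, LinearMap.smul_apply, smul_eq_mul, eta_comm (F _)]

/-- In a frame whose timelike vector is proportional to `n`, only spacelike components of `w`
remain. -/
lemma eta_nonpos_of_orthogonal {n w : V} (hn : 0 < eta n n) (h : eta w n = 0) : eta w w ≤ 0 ∧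
    (eta w w = 0 → w = 0) := by
  obtain ⟨F, hF, d, hd⟩ := exists_isFrame hn
  have h0 : eta w (F 0) = 0 := by rw [hd, map_smul, h, smul_zero]
  have h1 : eta w w = -∑ a, eta w (F a) * eta w (F a) := by
    rw [← hF.sum_eta w w, ← Finset.sum_neg_distrib]
    refine Finset.sum_congr rfl fun a _ => ?_
    rw [eta_comm (F a) w]
    by_cases ha : a = 0
    · rw [ha, h0]; ring
    · rw [sgn, if_neg ha]; ring
  refine ⟨by rw [h1]; exact neg_nonpos.2 (Finset.sum_nonneg fun a _ => mul_self_nonneg _), fun h2 => ?_⟩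
  rw [h1, neg_eq_zero, Finset.sum_eq_zero_iff_of_nonneg fun a _ => mul_self_nonneg _] at h2
  rw [hF.expand w]
  refine Finset.sum_eq_zero fun a ha => ?_
  rw [mul_self_eq_zero.1 (h2 a ha), mul_zero, zero_smul]

/-- The trace form is negative definite on the stabilizer of a timelike vector. -/
lemma eq_zero_of_trace_sq {n : V} (hn : 0 < eta n n) {A : soV} (hA : (A : Module.End ℝ V) n = 0)
    (h : LinearMap.trace ℝ V ((A : Module.End ℝ V) * (A : Module.End ℝ V)) = 0) : A = 0 := by
  obtain ⟨F, hF, d, hd⟩ := exists_isFrame hn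
  have hA0 : (A : Module.End ℝ V) (F 0) = 0 := by rw [hd, map_smul, hA, smul_zero]
  have hort : ∀ v, eta ((A : Module.End ℝ V) v) n = 0 := fun v => by rw [soV_skew, hA, map_zero, neg_zero]
  -- The trace of `A²` is minus a sum of nonnegative terms, as each `A (F a)` is orthogonal to `n`.
  have h1 : ∑ a, -eta ((A : Module.End ℝ V) (F a)) ((A : Module.End ℝ V) (F a)) = 0 := by
    rw [hF.trace_eq, ← neg_eq_zero, ← Finset.sum_neg_distrib] at h
    rw [← h]
    refine Finset.sum_congr rfl fun a _ => ?_
    rw [Module.End.mul_apply, soV_skew A _ (F a)]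
    by_cases ha : a = 0
    · rw [ha, hA0]; simp
    · rw [sgn, if_neg ha]; ring
  rw [Finset.sum_eq_zero_iff_of_nonneg fun a _ =>
    neg_nonneg.2 (eta_nonpos_of_orthogonal hn (hort _)).1] at h1
  refine Subtype.ext (LinearMap.ext fun v => ?_)
  rw [hF.expand v, map_sum]
  refine (Finset.sum_eq_zero fun a ha => ?_).trans (by simp)
  rw [map_smul, (eta_nonpos_of_orthogonal hn (hort _)).2 (neg_eq_zero.1 (h1 a ha)), smul_zero]

/-- A compact subalgebra of the Lorentz algebra fixes a timelike vector. -/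
lemma IsCompactSubalgebra.exists_timelike {h₀ : LieSubalgebra ℝ soV} (hc : IsCompactSubalgebra h₀) :
    ∃ n : V, 0 < eta n n ∧ ∀ A : h₀, asEnd A n = 0 := by
  obtain ⟨g, hsymm, hpos, hinv⟩ := hc
  have hgc : ∀ b : LinearMap.BilinForm ℝ V, Continuous fun v => b v v := fun b => by
    have h : ∀ v, b v v = ∑ a, v a * b (e a) v := fun v => by
      have hv : v = ∑ a, v a • e a := by
        ext b; simp [e, Finset.sum_apply, Pi.single_apply]
      have h1 := congrArg (fun x => b x v) hv
      simpa only [map_sum, map_smul, LinearMap.sum_apply, LinearMap.smul_apply, smul_eq_mul] using h1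
    simp only [h]
    exact continuous_finsetSum _ fun a _ => (continuous_apply a).mul
      (LinearMap.continuous_of_finiteDimensional (b (e a)))
  have hne : ∀ v ∈ Metric.sphere (0 : V) 1, v ≠ 0 := fun v hv h0 => by
    rw [h0] at hv; simp at hv
  -- A maximizer of the quotient `η(v, v) / g(v, v)`, which is invariant under scaling; the maximum
  -- is positive because `e 0` is timelike.
  obtain ⟨n, hn1, hmax⟩ := (isCompact_sphere (0 : V) 1).exists_isMaxOn
    (NormedSpace.sphere_nonempty.2 zero_le_one)
    (f := fun v => eta v v / g v v)
    ((hgc eta).continuousOn.div (hgc g).continuousOn fun v hv => (hpos v (hne v hv)).ne')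
  set M := eta n n / g n n with hM
  have hle : ∀ v, 0 ≤ M * g v v - eta v v := by
    intro v
    by_cases hv : v = 0
    · simp [hv]
    · have h1 := hmax (show ‖v‖⁻¹ • v ∈ Metric.sphere (0 : V) 1 by
        rw [mem_sphere_zero_iff_norm, norm_smul, norm_inv, norm_norm,
          inv_mul_cancel₀ (norm_ne_zero_iff.2 hv)])
      have hk : ‖v‖⁻¹ ≠ 0 := inv_ne_zero (norm_ne_zero_iff.2 hv)
      simp only [Set.mem_ofPred_eq, map_smul, LinearMap.smul_apply, smul_eq_mul] at h1
      rw [mul_div_mul_left _ _ hk, mul_div_mul_left _ _ hk, div_le_iff₀ (hpos v hv)] at h1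
      linarith
  have hn0 := hne n hn1
  have hgn := hpos n hn0
  have hMn : M * g n n = eta n n := by rw [hM]; field_simp
  have hM0 : 0 < M := by
    have h1 := hle (e 0)
    have h2 : eta (e 0) (e 0) = 1 := by rw [isFrame_e]; simp [sgn]
    have he : e 0 ≠ 0 := fun h => by rw [h] at h2; simp at h2
    have h3 := hpos _ he
    by_contra hneg
    nlinarith
  -- The nonnegative form `M g - η` vanishes at `n`, so by the discriminant its linear term along
  -- `w` vanishes.
  have hcrit : ∀ w, M * g n w = eta n w := by
    intro w
    have h1 : ∀ t : ℝ, 0 ≤ (M * g w w - eta w w) * (t * t) + (2 * (M * g n w - eta n w)) * t + 0 := by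
      intro t
      have h2 := hle (n + t • w)
      have h3 : g w n = g n w := (hsymm.eq n w).symm
      simp only [map_add, map_smul, LinearMap.add_apply, LinearMap.smul_apply, smul_eq_mul, h3,
        eta_comm w n] at h2
      linarith
    have h4 := discrim_le_zero h1
    rw [discrim] at h4
    have h5 : (M * g n w - eta n w) ^ 2 ≤ 0 := by linarith
    have h6 := pow_eq_zero_iff (two_ne_zero) |>.1 (le_antisymm h5 (sq_nonneg _))
    linarith
  have hnpos : 0 < eta n n := by rw [← hMn]; positivity
  refine ⟨n, hnpos, fun A => ?_⟩
  by_contra hA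
  -- `A` is skew for both forms, so `η(A n, A n) = M g(A n, A n)`. As `A n` is orthogonal to `n`,
  -- the left side is nonpositive, while the right side is positive unless `A n = 0`.
  have h1 : eta (asEnd A n) (asEnd A n) = M * g (asEnd A n) (asEnd A n) := by
    rw [soV_skew, ← hcrit]
    have h2 := hinv A n (asEnd A n)
    linear_combination (-M) * h2
  have h2 : eta (asEnd A n) n = 0 := by
    have h3 := soV_skew (A : soV) n n
    rw [eta_comm n] at h3
    linarith
  have h3 := (eta_nonpos_of_orthogonal hnpos h2).1
  rw [h1] at h3
  have h4 := hpos _ hA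
  nlinarith

/-- The projection onto the stabilizer of a timelike vector along its orthogonal complement. -/
lemma exists_projection {h₀ : LieSubalgebra ℝ soV} {n : V} (hn : 0 < eta n n)
    (h : ∀ A : h₀, asEnd A n = 0) : ∃ P : soV →ₗ[ℝ] h₀, ∀ X, InPerp h₀ (X - (P X : soV)) := by
  let T : soV →ₗ[ℝ] soV →ₗ[ℝ] ℝ := LinearMap.mk₂ ℝ
    (fun X A => LinearMap.trace ℝ V ((A : Module.End ℝ V) * (X : Module.End ℝ V)))
    (fun X X' A => by rw [coe_soV_add, mul_add, map_add])
    (fun c X A => by rw [coe_soV_smul, mul_smul_comm, map_smul])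
    (fun X A A' => by rw [coe_soV_add, add_mul, map_add])
    (fun c X A => by rw [coe_soV_smul, smul_mul_assoc, map_smul])
  let i : h₀ →ₗ[ℝ] soV := h₀.toSubmodule.subtype
  let D : soV →ₗ[ℝ] Module.Dual ℝ h₀ := (LinearMap.lcomp ℝ ℝ i).comp T
  -- Definiteness of the trace form on the annihilator of `n` makes its restriction to `𝔥₀`
  -- nondegenerate.
  have hinj : Function.Injective (D.comp i) := (injective_iff_map_eq_zero _).2 fun A hA =>
    Subtype.ext (eq_zero_of_trace_sq hn (h A) (congrArg (fun F : Module.Dual ℝ h₀ => F A) hA))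
  have hfin : Module.finrank ℝ h₀ = Module.finrank ℝ (Module.Dual ℝ h₀) :=
    (Subspace.dual_finrank_eq (K := ℝ) (V := h₀)).symm
  let eqv := LinearEquiv.ofInjectiveOfFinrankEq (D.comp i) hinj hfin
  refine ⟨eqv.symm.toLinearMap.comp D, fun X A => ?_⟩
  have h1 : D (i (eqv.symm (D X))) = D X := eqv.apply_symm_apply (D X)
  have h2 : D (X - i (eqv.symm (D X))) = 0 := by rw [map_sub, h1, sub_self]
  exact congrArg (fun F : Module.Dual ℝ h₀ => F A) h2

/-- Invariance of the trace form moves the bracket with `A` onto the test element. -/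
lemma InPerp.lie {h₀ : LieSubalgebra ℝ soV} {X : soV} (hX : InPerp h₀ X) (A : h₀) :
    InPerp h₀ ⁅(A : soV), X⁆ := fun A' => by
  have h1 := hX ⁅A', A⁆
  have h2 : ((⁅(A : soV), X⁆ : soV) : Module.End ℝ V) =
      asEnd A * (X : Module.End ℝ V) - (X : Module.End ℝ V) * asEnd A := rfl
  have h3 : asEnd ⁅A', A⁆ = asEnd A' * asEnd A - asEnd A * asEnd A' := rfl
  rw [h3, sub_mul, map_sub] at h1
  rw [h2, mul_sub, map_sub, ← mul_assoc, ← mul_assoc, LinearMap.trace_mul_comm ℝ (_ * _) (asEnd A),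
    ← mul_assoc]
  exact h1

lemma InPerp.sub {h₀ : LieSubalgebra ℝ soV} {X Y : soV} (hX : InPerp h₀ X) (hY : InPerp h₀ Y) :
    InPerp h₀ (X - Y) := fun A => by
  have : ((X - Y : soV) : Module.End ℝ V) = X - Y := rfl
  rw [this, mul_sub, map_sub, hX, hY, sub_zero]

lemma InPerp.eq_zero {h₀ : LieSubalgebra ℝ soV} {n : V} (hn : 0 < eta n n)
    (h : ∀ A : h₀, asEnd A n = 0) {A : h₀} (hA : InPerp h₀ A) : A = 0 :=
  Subtype.ext (eq_zero_of_trace_sq hn (h A) (hA A))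

/-! ### Action of the stabilizer on cocycles, and the third-order components -/

section Invariance

variable {S : Type*} [AddCommGroup S] [Module ℝ S] [Module Cl S] [IsScalarTower ℝ Cl S]
variable [Module.Finite ℝ S] [IsSimpleModule Cl S]
variable {ω : S →ₗ[ℝ] S →ₗ[ℝ] ℝ} (hω : IsInvariantSymplectic ω)
include hω

/-- `A` acts as a derivation on the two Clifford factors of `B` and on the spinor. The action on the
factors replaces `B` by `[A, B]`, once `hskew` moves `A` from the frame vector into the argument of
`B`. -/
lemma spin_lie (A B : soV) (s : S) : spin ((⁅A, B⁆ : soV) : Module.End ℝ V) s =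
    spin (A : Module.End ℝ V) (spin (B : Module.End ℝ V) s)
      - spin (B : Module.End ℝ V) (spin (A : Module.End ℝ V) s) := by
  have hB : ∀ s : S, spin (B : Module.End ℝ V) s =
      (-(1 / 4) : ℝ) • ∑ a, sgn a • cl ((B : Module.End ℝ V) (e a)) (cl (e a) s) := fun s => by
    rw [← spinL_apply, spinL_eq]
    simp only [LinearMap.smul_apply, LinearMap.sum_apply, Module.End.mul_apply]
  have hAB : spin ((⁅A, B⁆ : soV) : Module.End ℝ V) s = (-(1 / 4) : ℝ) • ∑ a, sgn a •
      (cl ((A : Module.End ℝ V) ((B : Module.End ℝ V) (e a))) (cl (e a) s)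
        - cl ((B : Module.End ℝ V) ((A : Module.End ℝ V) (e a))) (cl (e a) s)) := by
    rw [← spinL_apply, spinL_eq]
    simp only [LinearMap.smul_apply, LinearMap.sum_apply, Module.End.mul_apply]
    congr 1
    refine Finset.sum_congr rfl fun a _ => ?_
    rw [← LinearMap.sub_apply, ← map_sub]
    rfl
  have hskew : ∑ a, sgn a • cl ((B : Module.End ℝ V) (e a)) (cl ((A : Module.End ℝ V) (e a)) s) =
      -∑ a, sgn a • cl ((B : Module.End ℝ V) ((A : Module.End ℝ V) (e a))) (cl (e a) s) := by
    have h1 : ∀ a, sgn a • cl ((B : Module.End ℝ V) (e a)) (cl ((A : Module.End ℝ V) (e a)) s) =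
        ∑ b, (sgn a * sgn b * eta ((A : Module.End ℝ V) (e a)) (e b)) •
          cl ((B : Module.End ℝ V) (e a)) (cl (e b) s) := fun a => by
      conv_lhs => rw [isFrame_e.expand ((A : Module.End ℝ V) (e a))]
      simp only [map_sum, map_smul, LinearMap.sum_apply, LinearMap.smul_apply, Finset.smul_sum, smul_smul,
        mul_assoc]
    have h2 : ∀ b, sgn b • cl ((B : Module.End ℝ V) ((A : Module.End ℝ V) (e b))) (cl (e b) s) =
        ∑ a, (sgn a * sgn b * eta ((A : Module.End ℝ V) (e b)) (e a)) •
          cl ((B : Module.End ℝ V) (e a)) (cl (e b) s) := fun b => by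
      conv_lhs => rw [isFrame_e.expand ((A : Module.End ℝ V) (e b))]
      simp only [map_sum, map_smul, LinearMap.sum_apply, LinearMap.smul_apply, Finset.smul_sum, smul_smul]
      exact Finset.sum_congr rfl fun a _ => by congr 1; ring
    simp only [h1, h2]
    rw [Finset.sum_comm, ← Finset.sum_neg_distrib]
    refine Finset.sum_congr rfl fun b _ => ?_
    rw [← Finset.sum_neg_distrib]
    refine Finset.sum_congr rfl fun a _ => ?_
    rw [soV_skew A (e a), eta_comm (e a)]
    module
  have hA : spin (A : Module.End ℝ V) (spin (B : Module.End ℝ V) s) =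
      (-(1 / 4) : ℝ) • ∑ a, sgn a • (cl ((B : Module.End ℝ V) (e a)) (cl (e a) (spin (A : Module.End ℝ V) s))
        + cl ((B : Module.End ℝ V) (e a)) (cl ((A : Module.End ℝ V) (e a)) s)
        + cl ((A : Module.End ℝ V) ((B : Module.End ℝ V) (e a))) (cl (e a) s)) := by
    rw [hB, ← spinL_apply, map_smul, map_sum]
    congr 1
    refine Finset.sum_congr rfl fun a _ => ?_
    rw [map_smul, spinL_apply, spin_cl, spin_cl, map_add]
  rw [hA, hAB, hB]
  simp only [smul_add, smul_sub, Finset.sum_add_distrib, Finset.sum_sub_distrib]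
  rw [hskew]
  module

/-- The infinitesimal action of an element of `𝔥₀` on a cocycle that is trivialized by the first-order
components of the action. -/
lemma cobdry_invariance {φ : S →ₗ[ℝ] ℝ} {X : S →ₗ[ℝ] soV} {Y : V →ₗ[ℝ] S} (A : soV)
    (θ : S →ₗ[ℝ] soV) (μ : V →ₗ[ℝ] S)
    (h1 : ∀ s, spin (A : Module.End ℝ V) (cobdrySS ω φ X Y s s)
      - (2 : ℝ) • cobdrySS ω φ X Y (spin (A : Module.End ℝ V) s) s =
      (2 : ℝ) • spin (θ s : Module.End ℝ V) s - μ (kappaL ω s s))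
    (h2 : ∀ s v, (A : Module.End ℝ V) (cobdrySV ω φ X Y s v)
      - cobdrySV ω φ X Y (spin (A : Module.End ℝ V) s) v
      - cobdrySV ω φ X Y s ((A : Module.End ℝ V) v) =
      (θ s : Module.End ℝ V) v - kappaL ω s (μ v)) (s : S) (v : V) :
    φ (spin (A : Module.End ℝ V) s) = 0 ∧ θ s = ⁅A, X s⁆ - X (spin (A : Module.End ℝ V) s) ∧
      μ v = spin (A : Module.End ℝ V) (Y v) - Y ((A : Module.End ℝ V) v) := by
  set a : Module.End ℝ S := spinL (A : Module.End ℝ V) with ha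
  have haa : ∀ s, spin (A : Module.End ℝ V) s = a s := fun _ => rfl
  set adA : soV →ₗ[ℝ] soV := (LieModule.toEnd ℝ soV soV A) with had
  have hadA : ∀ B, adA B = ⁅A, B⁆ := fun _ => rfl
  -- The transform of the triple `(φ, X, Y)` under `A`, minus `(0, θ, μ)`, has zero coboundary by
  -- hypothesis; uniqueness then makes it vanish.
  set φ' : S →ₗ[ℝ] ℝ := -(φ.comp a) with hφ'
  set X' : S →ₗ[ℝ] soV := adA.comp X - X.comp a - θ with hX'
  set Y' : V →ₗ[ℝ] S := a.comp Y - Y.comp (A : Module.End ℝ V) - μ with hY'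
  have hlie : ∀ s v, ((⁅A, X s⁆ : soV) : Module.End ℝ V) v =
      (A : Module.End ℝ V) ((X s : Module.End ℝ V) v) - (X s : Module.End ℝ V) ((A : Module.End ℝ V) v) :=
    fun s v => rfl
  have hκ : ∀ s t, (A : Module.End ℝ V) (kappaL ω s t) = kappaL ω (a s) t + kappaL ω s (a t) :=
    fun s t => (kappaL_spin hω A s t).symm
  have hcoe : ∀ B B' : soV, ((B - B' : soV) : Module.End ℝ V) = B - B' := fun _ _ => rfl
  have e1 : ∀ s, cobdrySS ω φ' X' Y' s s = 0 := fun s => by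
    have h := h1 s
    have hl := spin_lie hω A (X s) s
    simp only [cobdrySS_apply, ← spinL_apply, ← ha, hX', hY', hφ', LinearMap.sub_apply, LinearMap.neg_apply,
      LinearMap.comp_apply, hadA, hcoe, map_sub, map_add, map_smul, hκ, kappaL_comm hω s (a s)] at h hl ⊢
    linear_combination (norm := module) h + (2 : ℝ) • hl
  have e2 : cobdrySV ω φ' X' Y' = 0 := LinearMap.ext fun s => LinearMap.ext fun v => by
    have h := h2 s v
    simp only [cobdrySV_apply, haa, hX', hY', hφ', LinearMap.sub_apply, LinearMap.neg_apply,
      LinearMap.comp_apply, hadA, hcoe, map_sub, map_add, map_smul, hκ, hlie, LinearMap.zero_apply] at h ⊢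
    linear_combination (norm := module) h
  have e3 : cobdrySS ω φ' X' Y' = 0 := LinearMap.ext fun s => LinearMap.ext fun t => by
    have h := e1 (s + t)
    simp only [map_add, LinearMap.add_apply, e1, cobdrySS_comm hω _ _ _ t s, zero_add, add_zero] at h
    rw [← two_smul ℝ] at h
    exact (smul_eq_zero.1 h).resolve_left two_ne_zero
  obtain ⟨r1, r2, r3⟩ := cobdry_eq_zero hω e3 e2
  refine ⟨?_, ?_, ?_⟩
  · have := congrArg (fun F => F s) r1
    simpa [hφ', haa] using this
  · have := congrArg (fun F => F s) r2
    simp only [hX', LinearMap.sub_apply, LinearMap.comp_apply, hadA, LinearMap.zero_apply] at this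
    exact (sub_eq_zero.1 this).symm
  · have := congrArg (fun F => F v) r3
    simp only [hY', LinearMap.sub_apply, LinearMap.comp_apply, LinearMap.zero_apply] at this
    exact (sub_eq_zero.1 this).symm

omit [Module.Finite ℝ S] in
/-- The third-order components vanish. -/
lemma third_order_eq_zero {σ : V → V → S} {ρ : S → V → soV} {n : V} (hn : 0 < eta n n)
    (hρ : ∀ s v, (ρ s v : Module.End ℝ V) n = 0)
    (h : ∀ s v w, kappaL ω s (σ v w) = (ρ s v : Module.End ℝ V) w - (ρ s w : Module.End ℝ V) v) :
    (∀ v w, σ v w = 0) ∧ ∀ s v, ρ s v = 0 := by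
  have hort : ∀ s v w, eta ((ρ s v : Module.End ℝ V) w) n = 0 := fun s v w => by
    rw [soV_skew, hρ, map_zero, neg_zero]
  -- The values of `ρ` are orthogonal to `n`, so pairing with `n` leaves `ω(s, n · σ(v, w)) = 0`,
  -- and Clifford multiplication by `n` is injective.
  have hσ : ∀ v w, σ v w = 0 := fun v w => by
    refine eq_zero_of_cl hn.ne' (eq_zero_of_omega hω fun s => ?_)
    have h1 := congrArg (fun x => eta x n) (h s v w)
    simp only [map_sub, LinearMap.sub_apply, hort, eta_kappaL hω, sub_zero] at h1
    rw [omega_swap hω, h1, neg_zero]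
  refine ⟨hσ, fun s v => Subtype.ext (LinearMap.ext fun w => eq_of_eta fun u => ?_)⟩
  -- What is left is symmetric in `v, w` and skew in `w, u`, hence zero, as in the uniqueness of a
  -- torsion-free metric connection.
  have h1 : ∀ v w u, eta ((ρ s v : Module.End ℝ V) w) u = eta ((ρ s w : Module.End ℝ V) v) u :=
    fun v w u => by
      have h2 := h s v w
      rw [hσ, map_zero] at h2
      rw [sub_eq_zero.1 h2.symm]
  have h2 : ∀ v w u, eta ((ρ s v : Module.End ℝ V) w) u = -eta ((ρ s v : Module.End ℝ V) u) w :=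
    fun v w u => by rw [soV_skew, eta_comm]
  have a1 := h1 v w u
  have a2 := h2 w v u
  have a3 := h1 w u v
  have a4 := h2 u w v
  have a5 := h1 u v w
  have a6 := h2 v u w
  have : eta ((ρ s v : Module.End ℝ V) w) u = 0 := by linarith
  rw [this]
  simp

end Invariance

/-! ## Homogeneous components of `Λ ⊗ M` -/

namespace Grassmann

variable {W : Type*} [AddCommGroup W] [Module ℝ W] {M : Type*} [AddCommGroup M] [Module ℝ M]

/-- The tensor product `Λ^• W ⊗ M`. -/
abbrev HL (W : Type*) [AddCommGroup W] [Module ℝ W] (M : Type*) [AddCommGroup M] [Module ℝ M] :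
    Type _ := ExteriorAlgebra ℝ W ⊗[ℝ] M

/-- The subspace `Λ^k W ⊗ G j` of `Λ^• W ⊗ M`. -/
def piece (G : ℕ → Submodule ℝ M) (W : Type*) [AddCommGroup W] [Module ℝ W] (k j : ℕ) :
    Submodule ℝ (HL W M) :=
  Submodule.span ℝ {z | ∃ t ∈ ⋀[ℝ]^k W, ∃ x ∈ G j, z = t ⊗ₜ[ℝ] x}

/-- The elements of total degree `n`. -/
def degPart (G : ℕ → Submodule ℝ M) (W : Type*) [AddCommGroup W] [Module ℝ W] (n : ℕ) :
    Submodule ℝ (HL W M) :=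
  ⨆ (p : ℕ × ℕ) (_ : p.1 + p.2 = n), piece G W p.1 p.2

/-- The elements of parity `i`. -/
def parityPart (G : ℕ → Submodule ℝ M) (W : Type*) [AddCommGroup W] [Module ℝ W] (i : ZMod 2) :
    Submodule ℝ (HL W M) :=
  ⨆ (p : ℕ × ℕ) (_ : ((p.1 + p.2 : ℕ) : ZMod 2) = i), piece G W p.1 p.2

/-- The filtrands of the filtration induced by the grading of `M`. -/
def filtPart (G : ℕ → Submodule ℝ M) (W : Type*) [AddCommGroup W] [Module ℝ W] (i : ℕ) :
    Submodule ℝ (HL W M) :=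
  ⨆ (p : ℕ × ℕ) (_ : p.2 ≤ i), piece G W p.1 p.2

/-- The projection onto `Λ^k W ⊗ M`. -/
def comp (k : ℕ) : HL W M →ₗ[ℝ] HL W M :=
  LinearMap.rTensor M (GradedAlgebra.proj (fun i : ℕ => ⋀[ℝ]^i W) k)

/-- The inclusion `x ↦ 1 ⊗ x`. -/
def up (x : M) : HL W M := (1 : ExteriorAlgebra ℝ W) ⊗ₜ[ℝ] x

/-- The contraction of `Λ ⊗ M` with a linear functional on `Λ`. -/
def coef (l : ExteriorAlgebra ℝ W →ₗ[ℝ] ℝ) : HL W M →ₗ[ℝ] M :=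
  (TensorProduct.lid ℝ (M)).toLinearMap ∘ₗ LinearMap.rTensor (M) l

lemma coef_tmul (l : ExteriorAlgebra ℝ W →ₗ[ℝ] ℝ) (τ : ExteriorAlgebra ℝ W) (x : M) :
    coef l (τ ⊗ₜ[ℝ] x) = l τ • x := by
  simp [coef]

lemma coef_ext {z z' : HL W M} (h : ∀ l, coef l z = coef l z') : z = z' := by
  classical
  refine (TensorProduct.equivFinsuppOfBasisLeft
    (Module.Basis.ofVectorSpace ℝ (ExteriorAlgebra ℝ W))).injective (Finsupp.ext fun i => ?_)
  rw [TensorProduct.equivFinsuppOfBasisLeft_apply, TensorProduct.equivFinsuppOfBasisLeft_apply]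
  exact h _

/-- The coefficient along `1 ∈ Λ⁰ W`. -/
def coeffZero : HL W M →ₗ[ℝ] M :=
  coef (ExteriorAlgebra.algebraMapInv (R := ℝ) (M := W)).toLinearMap

/-- The contraction of the component in `Λ¹ W ⊗ M` with a linear functional on `W`. -/
def coeffOne (l : W →ₗ[ℝ] ℝ) : HL W M →ₗ[ℝ] M :=
  coef (l ∘ₗ ExteriorAlgebra.ιInv (R := ℝ) (M := W))

/-- The element `tᵢ ⊗ x`. -/
def tx {ι : Type*} (t : Module.Basis ι ℝ W) (i : ι) (x : M) : HL W M :=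
  ExteriorAlgebra.ι ℝ (t i) ⊗ₜ[ℝ] x

lemma coeffZero_eq_coef (z : HL W M) :
    coeffZero z = coef (ExteriorAlgebra.algebraMapInv (R := ℝ) (M := W)).toLinearMap z := rfl

lemma coeffOne_eq_coef (l : W →ₗ[ℝ] ℝ) (z : HL W M) :
    coeffOne l z = coef (l ∘ₗ ExteriorAlgebra.ιInv (R := ℝ) (M := W)) z := rfl

variable {G : ℕ → Submodule ℝ M}

lemma induction {p : HL W M → Prop} (hadd : ∀ z z', p z → p z' → p (z + z'))
    (h : ∀ i, ∀ τ ∈ ⋀[ℝ]^i W, ∀ x : M, p (τ ⊗ₜ[ℝ] x)) (z : HL W M) : p z := by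
  induction z using TensorProduct.induction_on with
  | zero => simpa using h 0 0 (zero_mem _) 0
  | add z z' hz hz' => exact hadd _ _ hz hz'
  | tmul τ x =>
    refine DirectSum.Decomposition.inductionOn (fun i : ℕ => ⋀[ℝ]^i W)
      (motive := fun τ => p (τ ⊗ₜ[ℝ] x)) ?_ (fun {i} τ => h i τ τ.2 x) (fun τ τ' hτ hτ' => ?_) τ
    · simpa using h 0 0 (zero_mem _) x
    · rw [TensorProduct.add_tmul]; exact hadd _ _ hτ hτ'

lemma induction_homogeneous (hG : ⨆ j, G j = ⊤) {p : HL W M → Prop}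
    (hadd : ∀ z z', p z → p z' → p (z + z'))
    (h : ∀ i, ∀ τ ∈ ⋀[ℝ]^i W, ∀ j, ∀ x ∈ G j, p (τ ⊗ₜ[ℝ] x)) (z : HL W M) : p z := by
  induction z using induction with
  | hadd z z' hz hz' => exact hadd _ _ hz hz'
  | h i τ hτ x =>
    have hx : x ∈ ⨆ j, G j := hG ▸ Submodule.mem_top
    induction hx using Submodule.iSup_induction' with
    | mem j x hx => exact h i τ hτ j x hx
    | zero => simpa using h i τ hτ 0 0 (zero_mem _)
    | add x y _ _ hx hy => rw [TensorProduct.tmul_add]; exact hadd _ _ hx hy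

lemma tmul_eq_smul_up (τ : ExteriorAlgebra ℝ W) (x : M) : τ ⊗ₜ[ℝ] x = τ • up x := by
  rw [up, TensorProduct.smul_tmul', smul_eq_mul, mul_one]

lemma comp_tmul (k : ℕ) (τ : ExteriorAlgebra ℝ W) (x : M) :
    comp k (τ ⊗ₜ[ℝ] x) = GradedAlgebra.proj (fun i : ℕ => ⋀[ℝ]^i W) k τ ⊗ₜ[ℝ] x := rfl

lemma comp_tmul_same {i : ℕ} {τ : ExteriorAlgebra ℝ W} (hτ : τ ∈ ⋀[ℝ]^i W) (x : M) :
    comp i (τ ⊗ₜ[ℝ] x) = τ ⊗ₜ[ℝ] x := by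
  rw [comp_tmul, GradedAlgebra.proj_apply, DirectSum.decompose_of_mem_same (fun i : ℕ => ⋀[ℝ]^i W) hτ]

lemma comp_tmul_ne {i k : ℕ} {τ : ExteriorAlgebra ℝ W} (hτ : τ ∈ ⋀[ℝ]^i W) (x : M)
    (h : i ≠ k) : comp k (τ ⊗ₜ[ℝ] x) = 0 := by
  rw [comp_tmul, GradedAlgebra.proj_apply, DirectSum.decompose_of_mem_ne (fun i : ℕ => ⋀[ℝ]^i W) hτ h,
    TensorProduct.zero_tmul]

lemma comp_smul {i k : ℕ} {τ : ExteriorAlgebra ℝ W} (hτ : τ ∈ ⋀[ℝ]^i W) (h : i ≤ k)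
    (z : HL W M) : comp k (τ • z) = τ • comp (k - i) z := by
  induction z using TensorProduct.induction_on with
  | zero => simp
  | add z z' hz hz' => rw [smul_add, map_add, hz, hz', map_add, smul_add]
  | tmul σ x =>
    rw [TensorProduct.smul_tmul', comp_tmul, comp_tmul, TensorProduct.smul_tmul', smul_eq_mul,
      GradedAlgebra.proj_apply, GradedAlgebra.proj_apply, smul_eq_mul,
      DirectSum.coe_decompose_mul_of_left_mem_of_le (fun i : ℕ => ⋀[ℝ]^i W) hτ h]

lemma comp_smul_of_lt {i k : ℕ} {τ : ExteriorAlgebra ℝ W} (hτ : τ ∈ ⋀[ℝ]^i W) (h : k < i)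
    (z : HL W M) : comp k (τ • z) = 0 := by
  induction z using TensorProduct.induction_on with
  | zero => simp
  | add z z' hz hz' => rw [smul_add, map_add, hz, hz', add_zero]
  | tmul σ x =>
    rw [TensorProduct.smul_tmul', comp_tmul, smul_eq_mul, GradedAlgebra.proj_apply,
      DirectSum.coe_decompose_mul_of_left_mem_of_not_le (fun i : ℕ => ⋀[ℝ]^i W) hτ h.not_ge, TensorProduct.zero_tmul]

lemma comp_comp_ne {k m : ℕ} (h : m ≠ k) (z : HL W M) : comp k (comp m z) = 0 := by
  induction z using induction with
  | hadd z z' hz hz' => simp only [map_add, hz, hz', add_zero]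
  | h i τ hτ x =>
    by_cases h' : i = m
    · subst h'; rw [comp_tmul_same hτ, comp_tmul_ne hτ x h]
    · rw [comp_tmul_ne hτ x h', map_zero]

lemma algebraMapInv_eq_zero {i : ℕ} (hi : 1 ≤ i) {τ : ExteriorAlgebra ℝ W} (hτ : τ ∈ ⋀[ℝ]^i W) :
    ExteriorAlgebra.algebraMapInv τ = 0 := by
  obtain ⟨i, rfl⟩ := Nat.exists_eq_add_of_le' hi
  rw [ExteriorAlgebra.exteriorPower, pow_succ'] at hτ
  refine Submodule.mul_induction_on hτ ?_ fun x y hx hy => by rw [map_add, hx, hy, add_zero]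
  rintro _ ⟨w, rfl⟩ y -
  rw [map_mul, ExteriorAlgebra.algebraMapInv, ExteriorAlgebra.lift_ι_apply, LinearMap.zero_apply,
    zero_mul]

lemma mem_exteriorPower_zero {τ : ExteriorAlgebra ℝ W} (hτ : τ ∈ ⋀[ℝ]^0 W) :
    ∃ r : ℝ, τ = algebraMap ℝ _ r := by
  rw [ExteriorAlgebra.exteriorPower, pow_zero, Submodule.mem_one] at hτ
  exact hτ.imp fun _ h => h.symm

lemma mem_exteriorPower_one {τ : ExteriorAlgebra ℝ W} (hτ : τ ∈ ⋀[ℝ]^1 W) :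
    ∃ w : W, τ = ExteriorAlgebra.ι ℝ w := by
  rw [ExteriorAlgebra.exteriorPower, pow_one] at hτ
  exact hτ.imp fun _ h => h.symm

/-- `ιInv` is a component of the homomorphism to the trivial square-zero extension, where scalars
have no vector part and a product of two vectors is zero. -/
lemma ιInv_eq_zero {i : ℕ} (hi : i ≠ 1) {τ : ExteriorAlgebra ℝ W} (hτ : τ ∈ ⋀[ℝ]^i W) :
    ExteriorAlgebra.ιInv (R := ℝ) τ = 0 := by
  let _ : Module ℝᵐᵒᵖ W := Module.compHom _ ((RingHom.id ℝ).fromOpposite mul_comm)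
  have _ : IsCentralScalar ℝ W := ⟨fun r m => rfl⟩
  have hdef : ∀ σ : ExteriorAlgebra ℝ W, ExteriorAlgebra.ιInv (R := ℝ) σ =
    (ExteriorAlgebra.toTrivSqZeroExt σ).snd := fun σ => rfl
  rcases i with _ | _ | i
  · obtain ⟨r, rfl⟩ := mem_exteriorPower_zero hτ
    rw [hdef, AlgHom.commutes]
    rfl
  · exact absurd rfl hi
  · rw [ExteriorAlgebra.exteriorPower, pow_succ', pow_succ', ← mul_assoc] at hτ
    refine Submodule.mul_induction_on hτ (fun x hx y _ => ?_) fun x y hx hy => by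
      rw [map_add, hx, hy, add_zero]
    have h0 : ExteriorAlgebra.toTrivSqZeroExt x = 0 := by
      refine Submodule.mul_induction_on hx ?_ fun x y hx hy => by rw [map_add, hx, hy, add_zero]
      rintro _ ⟨w, rfl⟩ _ ⟨w', rfl⟩
      rw [map_mul, ExteriorAlgebra.toTrivSqZeroExt_ι, ExteriorAlgebra.toTrivSqZeroExt_ι,
        TrivSqZeroExt.inr_mul_inr]
    rw [hdef, map_mul, h0, zero_mul]
    rfl

lemma ιInv_ι (w : W) : ExteriorAlgebra.ιInv (R := ℝ) (ExteriorAlgebra.ι ℝ w) = w :=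
  ExteriorAlgebra.ι_leftInverse w

lemma one_mem_exteriorPower_zero : (1 : ExteriorAlgebra ℝ W) ∈ ⋀[ℝ]^0 W := by
  rw [ExteriorAlgebra.exteriorPower, pow_zero]
  exact Submodule.one_le.1 le_rfl

lemma ι_mem_exteriorPower_one (w : W) : ExteriorAlgebra.ι ℝ w ∈ ⋀[ℝ]^1 W := by
  rw [ExteriorAlgebra.exteriorPower, pow_one]
  exact ⟨w, rfl⟩

lemma comp_zero_eq (z : HL W M) : comp 0 z = up (coeffZero z) := by
  induction z using induction with
  | hadd z z' hz hz' => simp only [map_add, hz, hz', up, TensorProduct.tmul_add]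
  | h i τ hτ x =>
    rw [coeffZero_eq_coef, coef_tmul]
    rcases Nat.eq_zero_or_pos i with rfl | hi
    · obtain ⟨r, rfl⟩ := mem_exteriorPower_zero hτ
      rw [comp_tmul_same hτ, up, TensorProduct.tmul_smul,
        Algebra.algebraMap_eq_smul_one, ← TensorProduct.smul_tmul', AlgHom.toLinearMap_apply, map_smul, map_one, smul_eq_mul, mul_one]
    · rw [comp_tmul_ne hτ x hi.ne', AlgHom.toLinearMap_apply, algebraMapInv_eq_zero hi hτ, zero_smul, up,
        TensorProduct.tmul_zero]

lemma up_zero : up (0 : M) = (0 : HL W M) := TensorProduct.tmul_zero _ _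

lemma coeffZero_up (x : M) : coeffZero (up x : HL W M) = x := by
  rw [coeffZero_eq_coef, up, coef_tmul, AlgHom.toLinearMap_apply, map_one, one_smul]

lemma comp_one_eq {ι : Type*} [Fintype ι] (t : Module.Basis ι ℝ W) (z : HL W M) :
    comp 1 z = ∑ i, tx t i (coeffOne (t.coord i) z) := by
  induction z using induction with
  | hadd z z' hz hz' =>
    simp only [map_add, hz, hz', tx, TensorProduct.tmul_add, Finset.sum_add_distrib]
  | h i τ hτ x =>
    simp only [coeffOne_eq_coef, coef_tmul, LinearMap.comp_apply]
    by_cases hi : i = 1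
    · subst hi
      obtain ⟨w, rfl⟩ := mem_exteriorPower_one hτ
      rw [comp_tmul_same hτ]
      conv_lhs => rw [← t.sum_repr w, map_sum, TensorProduct.sum_tmul]
      refine Finset.sum_congr rfl fun i _ => ?_
      rw [tx, TensorProduct.tmul_smul, map_smul, TensorProduct.smul_tmul', ιInv_ι, Module.Basis.coord_apply]
    · rw [comp_tmul_ne hτ x hi, ιInv_eq_zero hi hτ]
      simp [tx]

lemma coeffOne_comp_one (l : W →ₗ[ℝ] ℝ) (z : HL W M) : coeffOne l (comp 1 z) = coeffOne l z := by
  induction z using induction with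
  | hadd z z' hz hz' => simp only [map_add, hz, hz']
  | h i τ hτ x =>
    by_cases hi : i = 1
    · subst hi; rw [comp_tmul_same hτ]
    · rw [comp_tmul_ne hτ x hi, map_zero, coeffOne_eq_coef, coef_tmul, LinearMap.comp_apply,
        ιInv_eq_zero hi hτ, map_zero, zero_smul]

lemma coeffOne_tx {ι : Type*} (t : Module.Basis ι ℝ W) (l : W →ₗ[ℝ] ℝ) (i : ι) (x : M) :
    coeffOne l (tx t i x) = l (t i) • x := by
  rw [coeffOne_eq_coef, tx, coef_tmul, LinearMap.comp_apply, ιInv_ι]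

lemma tmul_mem_piece {k j : ℕ} {τ : ExteriorAlgebra ℝ W} (hτ : τ ∈ ⋀[ℝ]^k W) {x : M}
    (hx : x ∈ G j) : τ ⊗ₜ[ℝ] x ∈ piece G W k j :=
  Submodule.subset_span ⟨τ, hτ, x, hx, rfl⟩

lemma piece_le {k j : ℕ} {P : Submodule ℝ (HL W M)}
    (h : ∀ τ ∈ ⋀[ℝ]^k W, ∀ x ∈ G j, τ ⊗ₜ[ℝ] x ∈ P) : piece G W k j ≤ P := by
  refine Submodule.span_le.2 ?_
  rintro _ ⟨τ, hτ, x, hx, rfl⟩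
  exact h τ hτ x hx

lemma up_mem_piece {j : ℕ} {x : M} (hx : x ∈ G j) : (up x : HL W M) ∈ piece G W 0 j :=
  tmul_mem_piece one_mem_exteriorPower_zero hx

lemma tx_mem_piece {ι : Type*} (t : Module.Basis ι ℝ W) (i : ι) {j : ℕ} {x : M}
    (hx : x ∈ G j) : tx t i x ∈ piece G W 1 j :=
  tmul_mem_piece (ι_mem_exteriorPower_one _) hx

lemma piece_le_degPart {k j n : ℕ} (h : k + j = n) : piece G W k j ≤ degPart G W n :=
  le_iSup₂_of_le (k, j) h le_rfl

lemma piece_le_parityPart {k j : ℕ} {i : ZMod 2} (h : ((k + j : ℕ) : ZMod 2) = i) :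
    piece G W k j ≤ parityPart G W i :=
  le_iSup₂_of_le (k, j) h le_rfl

lemma piece_le_filtPart {k j i : ℕ} (h : j ≤ i) : piece G W k j ≤ filtPart G W i :=
  le_iSup₂_of_le (k, j) h le_rfl

lemma degPart_le {n : ℕ} {P : Submodule ℝ (HL W M)}
    (h : ∀ k j, k + j = n → piece G W k j ≤ P) : degPart G W n ≤ P :=
  iSup₂_le fun p hp => h p.1 p.2 hp

lemma degPart_le_parityPart (n : ℕ) : degPart G W n ≤ parityPart G W (n : ZMod 2) :=
  degPart_le fun _ _ h => piece_le_parityPart (by rw [h])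

lemma comp_of_mem_piece {k j : ℕ} {z : HL W M} (hz : z ∈ piece G W k j) : comp k z = z := by
  have : piece G W k j ≤ LinearMap.ker (comp k - LinearMap.id) := piece_le fun τ hτ x _ => by
    rw [LinearMap.mem_ker, LinearMap.sub_apply, comp_tmul_same hτ, LinearMap.id_apply, sub_self]
  have h := this hz
  rwa [LinearMap.mem_ker, LinearMap.sub_apply, LinearMap.id_apply, sub_eq_zero] at h

lemma comp_of_mem_piece_ne {k j m : ℕ} (h : k ≠ m) {z : HL W M} (hz : z ∈ piece G W k j) :
    comp m z = 0 := by
  rw [← comp_of_mem_piece hz, comp_comp_ne h]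

lemma comp_mem_piece (k : ℕ) {n : ℕ} {z : HL W M} (hz : z ∈ degPart G W n) :
    comp k z ∈ piece G W k (n - k) := by
  have : degPart G W n ≤ (piece G W k (n - k)).comap (comp k) :=
    degPart_le fun i j hij => by
      intro y hy
      rw [Submodule.mem_comap]
      by_cases h : i = k
      · rw [← h, comp_of_mem_piece hy, ← hij, Nat.add_sub_cancel_left]; exact hy
      · rw [comp_of_mem_piece_ne h hy]; exact zero_mem _
  exact this hz

lemma comp_eq_zero_of_lt {n k : ℕ} (hk : n < k) {z : HL W M} (hz : z ∈ degPart G W n) :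
    comp k z = 0 := by
  have : degPart G W n ≤ LinearMap.ker (comp k) :=
    degPart_le fun i j hij y hy => comp_of_mem_piece_ne (by omega) hy
  exact this hz

lemma coef_mem_hGr (l : ExteriorAlgebra ℝ W →ₗ[ℝ] ℝ) {k j : ℕ} {z : HL W M}
    (hz : z ∈ piece G W k j) : coef l z ∈ G j := by
  have : piece G W k j ≤ (G j).comap (coef l) := piece_le fun τ _ x hx => by
    rw [Submodule.mem_comap, coef_tmul]; exact Submodule.smul_mem _ _ hx
  exact this hz

lemma coeffZero_smul (τ : ExteriorAlgebra ℝ W) (z : HL W M) :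
    coeffZero (τ • z) = ExteriorAlgebra.algebraMapInv (R := ℝ) τ • coeffZero z := by
  induction z using TensorProduct.induction_on with
  | zero => simp
  | add z z' hz hz' => rw [smul_add, map_add, hz, hz', map_add, smul_add]
  | tmul σ x =>
    rw [TensorProduct.smul_tmul', coeffZero_eq_coef, coeffZero_eq_coef, coef_tmul, coef_tmul,
      smul_eq_mul, AlgHom.toLinearMap_apply, AlgHom.toLinearMap_apply, map_mul, mul_smul]

/-- Elements of `Λ ⊗ M` of bounded degree are the sums of their components. -/
lemma eq_sum_comp {n : ℕ} {z : HL W M} (hz : z ∈ degPart G W n) :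
    z = ∑ k ∈ Finset.range (n + 1), comp k z := by
  have : degPart G W n ≤
      LinearMap.ker (LinearMap.id - ∑ k ∈ Finset.range (n + 1), comp k) :=
    degPart_le fun i j hij y hy => by
      rw [LinearMap.mem_ker, LinearMap.sub_apply, LinearMap.id_apply, LinearMap.sum_apply,
        Finset.sum_eq_single_of_mem i (Finset.mem_range.2 (by omega))
          (fun k _ hk => comp_of_mem_piece_ne hk.symm hy), comp_of_mem_piece hy, sub_self]
  have h := this hz
  rwa [LinearMap.mem_ker, LinearMap.sub_apply, LinearMap.id_apply, LinearMap.sum_apply,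
    sub_eq_zero] at h

end Grassmann

/-! ## Coefficients of the bracket of a deformation over an exterior algebra -/

lemma neg_one_pow_mul_val (i j : ℕ) : (-1 : ℝ) ^ (i * ((j : ZMod 2)).val) = (-1) ^ (i * j) := by
  rw [ZMod.val_natCast, pow_mul', pow_mul', ← neg_one_pow_eq_pow_mod_two]

lemma neg_one_pow_val_mul_val (i j : ℕ) :
    (-1 : ℝ) ^ (((i : ZMod 2)).val * ((j : ZMod 2)).val) = (-1) ^ (i * j) := by
  rw [neg_one_pow_mul_val, mul_comm, neg_one_pow_mul_val, mul_comm]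

namespace Grassmann

variable {W : Type*} [AddCommGroup W] [Module ℝ W] {M : Type*} [AddCommGroup M] [Module ℝ M]
variable {G : ℕ → Submodule ℝ M} {b : M →ₗ[ℝ] M →ₗ[ℝ] M}
variable {B : HL W M →ₗ[ℝ] HL W M →ₗ[ℝ] HL W M}

/-- A Lie superalgebra structure on `Λ^• W ⊗ M` that is `Λ^• W`-linear, graded, and reduces to the
bracket `b` of `M`. -/
structure IsDeformation (G : ℕ → Submodule ℝ M) (b : M →ₗ[ℝ] M →ₗ[ℝ] M)
    (B : HL W M →ₗ[ℝ] HL W M →ₗ[ℝ] HL W M) : Prop where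
  span : ⨆ j, G j = ⊤
  lie : IsLieSuperbracket (parityPart G W) B
  smul_left : ∀ (t : ExteriorAlgebra ℝ W) (x y : HL W M), B (t • x) y = t • B x y
  smul_right : ∀ (k : ℕ) (i : ZMod 2), ∀ t ∈ ⋀[ℝ]^k W, ∀ x ∈ parityPart G W i, ∀ y,
    B x (t • y) = (-1 : ℝ) ^ (k * i.val) • (t • B x y)
  graded : ∀ m n, ∀ x ∈ degPart G W m, ∀ y ∈ degPart G W n, B x y ∈ degPart G W (m + n)
  zeroth : ∀ x y : M, coeffZero (B (up x) (up y)) = b x y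

namespace IsDeformation

variable (hB : IsDeformation G b B)
include hB

lemma tmul_left (τ : ExteriorAlgebra ℝ W) (x : M) (z : HL W M) :
    B (τ ⊗ₜ[ℝ] x) z = τ • B (up x) z := by
  rw [tmul_eq_smul_up, hB.smul_left]

lemma tmul_right {i j : ℕ} {τ : ExteriorAlgebra ℝ W} (hτ : τ ∈ ⋀[ℝ]^i W) {x : M}
    (hx : x ∈ G j) (y : M) :
    B (up x) (τ ⊗ₜ[ℝ] y) = (-1 : ℝ) ^ (i * j) • τ • B (up x) (up y) := by
  rw [tmul_eq_smul_up, hB.smul_right i (j : ZMod 2) τ hτ _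
    (piece_le_parityPart (by simp) (up_mem_piece hx)), neg_one_pow_mul_val]

lemma up_up_mem {i j : ℕ} {x y : M} (hx : x ∈ G i) (hy : y ∈ G j) :
    B (up x) (up y) ∈ degPart G W (i + j) :=
  hB.graded i j _ (piece_le_degPart (zero_add _) (up_mem_piece hx)) _
    (piece_le_degPart (zero_add _) (up_mem_piece hy))

lemma comp_zero_up_up (x y : M) : comp 0 (B (up x) (up y)) = up (b x y) := by
  rw [comp_zero_eq, hB.zeroth]

/-- The augmentation of `Λ^• W` kills positive order, so the sign rule is invisible in the
order-zero coefficient. -/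
lemma coeffZero_bracket (z w : HL W M) :
    coeffZero (B z w) = b (coeffZero z) (coeffZero w) := by
  induction z using induction_homogeneous hB.span with
  | hadd z z' hz hz' => simp only [map_add, LinearMap.add_apply, hz, hz']
  | h i τ hτ j x hx =>
    induction w using induction with
    | hadd w w' hw hw' => simp only [map_add, hw, hw']
    | h k σ hσ y =>
      rw [hB.tmul_left, hB.tmul_right hσ hx, coeffZero_smul, map_smul, coeffZero_smul, hB.zeroth,
        tmul_eq_smul_up τ, tmul_eq_smul_up σ, coeffZero_smul, coeffZero_smul, coeffZero_up,
        coeffZero_up, map_smul, map_smul, LinearMap.smul_apply]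
      rcases Nat.eq_zero_or_pos k with rfl | hk
      · rw [zero_mul, pow_zero, one_smul, smul_comm]
      · rw [algebraMapInv_eq_zero hk hσ]; simp

lemma comp_left_eq_zero {m k : ℕ} (hm : m < k) (z : HL W M) (w : HL W M) :
    comp m (B (comp k z) w) = 0 := by
  induction z using induction with
  | hadd z z' hz hz' => simp only [map_add, LinearMap.add_apply, hz, hz', add_zero]
  | h i τ hτ x =>
    by_cases h : i = k
    · subst h
      rw [comp_tmul_same hτ, hB.tmul_left, comp_smul_of_lt hτ hm]
    · rw [comp_tmul_ne hτ x h, map_zero, LinearMap.zero_apply, map_zero]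

lemma comp_right_eq_zero {m k : ℕ} (hm : m < k) (z : HL W M) (w : HL W M) :
    comp m (B z (comp k w)) = 0 := by
  induction z using induction_homogeneous hB.span with
  | hadd z z' hz hz' => simp only [map_add, LinearMap.add_apply, hz, hz', add_zero]
  | h i τ hτ j x hx =>
    have key : ∀ m < k, comp m (B (up x) (comp k w)) = 0 := by
      intro m hm
      induction w using induction with
      | hadd z z' hz hz' => simp only [map_add, hz, hz', add_zero]
      | h i' τ' hτ' y =>
        by_cases h : i' = k
        · subst h
          rw [comp_tmul_same hτ', hB.tmul_right hτ' hx, map_smul, comp_smul_of_lt hτ' hm, smul_zero]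
        · rw [comp_tmul_ne hτ' y h, map_zero, map_zero]
    rw [hB.tmul_left]
    by_cases h : i ≤ m
    · rw [comp_smul hτ h, key _ (by omega), smul_zero]
    · rw [comp_smul_of_lt hτ (by omega)]

/-- A component of the bracket on `Λᵏ ⊗ 𝔥` vanishes when the corresponding component of the bracket
of elements of `𝔥` does. -/
lemma comp_left_of_comp_eq_zero {m : ℕ} {y : M} (h : ∀ x : M, comp m (B (up x) (up y)) = 0)
    (k : ℕ) (z : HL W M) : comp (k + m) (B (comp k z) (up y)) = 0 := by
  induction z using induction with
  | hadd z z' hz hz' => simp only [map_add, LinearMap.add_apply, hz, hz', add_zero]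
  | h i τ hτ x =>
    by_cases h' : i = k
    · subst h'
      rw [comp_tmul_same hτ, hB.tmul_left, comp_smul hτ (by omega), Nat.add_sub_cancel_left, h,
        smul_zero]
    · rw [comp_tmul_ne hτ x h', map_zero, LinearMap.zero_apply, map_zero]

lemma comp_right_of_comp_eq_zero {m j : ℕ} {x : M} (hx : x ∈ G j)
    (h : ∀ y : M, comp m (B (up x) (up y)) = 0)
    (k : ℕ) (z : HL W M) : comp (k + m) (B (up x) (comp k z)) = 0 := by
  induction z using induction with
  | hadd z z' hz hz' => simp only [map_add, hz, hz', add_zero]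
  | h i τ hτ y =>
    by_cases h' : i = k
    · subst h'
      rw [comp_tmul_same hτ, hB.tmul_right hτ hx, map_smul, comp_smul hτ (by omega),
        Nat.add_sub_cancel_left, h, smul_zero, smul_zero]
    · rw [comp_tmul_ne hτ y h', map_zero, map_zero]

lemma coef_comp_left (l : ExteriorAlgebra ℝ W →ₗ[ℝ] ℝ) (k : ℕ) (z : HL W M) (y : M) :
    coef l (comp k (B (comp k z) (up y))) = b (coef l (comp k z)) y := by
  induction z using induction with
  | hadd z z' hz hz' => simp only [map_add, LinearMap.add_apply, hz, hz']
  | h i τ hτ x =>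
    by_cases h : i = k
    · subst h
      rw [comp_tmul_same hτ, hB.tmul_left, comp_smul hτ le_rfl, Nat.sub_self, hB.comp_zero_up_up,
        ← tmul_eq_smul_up, coef_tmul, coef_tmul, map_smul, LinearMap.smul_apply]
    · simp [comp_tmul_ne hτ x h]

lemma coef_comp_right (l : ExteriorAlgebra ℝ W →ₗ[ℝ] ℝ) (k : ℕ) {j : ℕ} {x : M}
    (hx : x ∈ G j) (z : HL W M) :
    coef l (comp k (B (up x) (comp k z))) = (-1 : ℝ) ^ (k * j) • b x (coef l (comp k z)) := by
  induction z using induction with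
  | hadd z z' hz hz' => simp only [map_add, hz, hz', smul_add]
  | h i τ hτ y =>
    by_cases h : i = k
    · subst h
      rw [comp_tmul_same hτ, hB.tmul_right hτ hx, map_smul, comp_smul hτ le_rfl, Nat.sub_self,
        hB.comp_zero_up_up, ← tmul_eq_smul_up, map_smul, coef_tmul, coef_tmul, map_smul]
    · simp [comp_tmul_ne hτ y h]

/-- By linearity over `Λ^• W` the bracket never lowers the order, so only components of order at
most `k` contribute. -/
lemma comp_left (k : ℕ) (z w : HL W M) :
    comp k (B z w) = ∑ i ∈ Finset.range (k + 1), comp k (B (comp i z) w) := by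
  induction z using induction with
  | hadd z z' hz hz' => simp only [map_add, LinearMap.add_apply, hz, hz', Finset.sum_add_distrib]
  | h i τ hτ x =>
    have h0 : ∀ i' ∈ Finset.range (k + 1), i' ≠ i → comp k (B (comp i' (τ ⊗ₜ[ℝ] x)) w) = 0 :=
      fun i' _ h => by rw [comp_tmul_ne hτ x h.symm]; simp
    by_cases h : i ∈ Finset.range (k + 1)
    · rw [Finset.sum_eq_single_of_mem i h h0, comp_tmul_same hτ]
    · rw [Finset.sum_eq_zero fun i' hi' => h0 i' hi' (by rintro rfl; exact h hi'),
        ← comp_tmul_same hτ, hB.comp_left_eq_zero (by simpa using h)]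

lemma comp_right (k : ℕ) (z w : HL W M) :
    comp k (B z w) = ∑ i ∈ Finset.range (k + 1), comp k (B z (comp i w)) := by
  induction w using induction with
  | hadd w w' hw hw' => simp only [map_add, hw, hw', Finset.sum_add_distrib]
  | h i τ hτ x =>
    have h0 : ∀ i' ∈ Finset.range (k + 1), i' ≠ i → comp k (B z (comp i' (τ ⊗ₜ[ℝ] x))) = 0 :=
      fun i' _ h => by rw [comp_tmul_ne hτ x h.symm]; simp
    by_cases h : i ∈ Finset.range (k + 1)
    · rw [Finset.sum_eq_single_of_mem i h h0, comp_tmul_same hτ]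
    · rw [Finset.sum_eq_zero fun i' hi' => h0 i' hi' (by rintro rfl; exact h hi'),
        ← comp_tmul_same hτ, hB.comp_right_eq_zero (by simpa using h)]

lemma skew_up {m n : ℕ} {z w : HL W M} (hz : z ∈ degPart G W m) (hw : w ∈ degPart G W n) :
    B z w = -((-1 : ℝ) ^ (m * n) • B w z) := by
  rw [hB.lie.skew m n z (degPart_le_parityPart m hz) w (degPart_le_parityPart n hw),
    neg_one_pow_val_mul_val]

lemma jacobi_deg {m n : ℕ} {x y : HL W M} (hx : x ∈ degPart G W m) (hy : y ∈ degPart G W n)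
    (z : HL W M) : B x (B y z) = B (B x y) z + (-1 : ℝ) ^ (m * n) • B y (B x z) := by
  rw [hB.lie.jacobi m n x (degPart_le_parityPart m hx) y (degPart_le_parityPart n hy),
    neg_one_pow_val_mul_val]

end IsDeformation

end Grassmann

/-! ## The Jacobi identity and changes of trivialization, order by order -/

namespace Grassmann

variable {W : Type*} [AddCommGroup W] [Module ℝ W] {M : Type*} [AddCommGroup M] [Module ℝ M]
variable {G : ℕ → Submodule ℝ M} {b : M →ₗ[ℝ] M →ₗ[ℝ] M}
variable {B : HL W M →ₗ[ℝ] HL W M →ₗ[ℝ] HL W M}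

/-- The inclusion `x ↦ 1 ⊗ x` as a linear map. -/
def upL : M →ₗ[ℝ] HL W M := TensorProduct.mk ℝ _ _ 1

/-- The coefficients of the component of order `k` of a bracket. -/
def cf (B : HL W M →ₗ[ℝ] HL W M →ₗ[ℝ] HL W M) (l : ExteriorAlgebra ℝ W →ₗ[ℝ] ℝ) (k : ℕ) :
    M →ₗ[ℝ] M →ₗ[ℝ] M :=
  (B.compl₁₂ upL upL).compr₂ (coef l ∘ₗ comp k)

lemma cf_apply (l : ExteriorAlgebra ℝ W →ₗ[ℝ] ℝ) (k : ℕ) (x y : M) :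
    cf B l k x y = coef l (comp k (B (up x) (up y))) := rfl

attribute [irreducible] cf

namespace IsDeformation

variable (hB : IsDeformation G b B)
include hB

/-- A coefficient in `Λᵏ` accounts for degree `k`. For `k > i + j` the subtraction truncates, and
`cf_eq_zero_of_lt` covers that case. -/
lemma cf_mem (l : ExteriorAlgebra ℝ W →ₗ[ℝ] ℝ) (k : ℕ) {i j : ℕ} {x y : M} (hx : x ∈ G i)
    (hy : y ∈ G j) : cf B l k x y ∈ G (i + j - k) := by
  rw [cf_apply]
  exact coef_mem_hGr l (comp_mem_piece k (hB.up_up_mem hx hy))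

lemma comp_eq_zero_of_lt {k i j : ℕ} (h : i + j < k) {x y : M} (hx : x ∈ G i)
    (hy : y ∈ G j) : comp k (B (up x) (up y)) = 0 :=
  Grassmann.comp_eq_zero_of_lt h (hB.up_up_mem hx hy)

lemma cf_eq_zero_of_lt (l : ExteriorAlgebra ℝ W →ₗ[ℝ] ℝ) {k i j : ℕ} (h : i + j < k) {x y : M}
    (hx : x ∈ G i) (hy : y ∈ G j) : cf B l k x y = 0 := by
  rw [cf_apply, hB.comp_eq_zero_of_lt h hx hy, map_zero]

lemma cf_skew (l : ExteriorAlgebra ℝ W →ₗ[ℝ] ℝ) (k : ℕ) {i j : ℕ} {x y : M} (hx : x ∈ G i)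
    (hy : y ∈ G j) : cf B l k x y = -((-1 : ℝ) ^ (i * j) • cf B l k y x) := by
  rw [cf_apply, hB.skew_up (piece_le_degPart (zero_add _) (up_mem_piece hx))
    (piece_le_degPart (zero_add _) (up_mem_piece hy)), map_neg, map_smul, map_neg, map_smul, cf_apply]

lemma coef_left (l : ExteriorAlgebra ℝ W →ₗ[ℝ] ℝ) {k : ℕ} (hk : 1 ≤ k) (z : HL W M) (y : M) :
    coef l (comp k (B z (up y))) = cf B l k (coeffZero z) y + b (coef l (comp k z)) y
      + ∑ m ∈ Finset.Ico 1 k, coef l (comp k (B (comp m z) (up y))) := by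
  rw [hB.comp_left, Finset.sum_range_succ, Finset.range_eq_Ico, Finset.sum_eq_sum_Ico_succ_bot hk,
    map_add, map_add, hB.coef_comp_left, map_sum, comp_zero_eq, ← cf_apply, zero_add]
  abel

lemma coef_right (l : ExteriorAlgebra ℝ W →ₗ[ℝ] ℝ) {k : ℕ} (hk : 1 ≤ k) {i : ℕ} {x : M}
    (hx : x ∈ G i) (z : HL W M) :
    coef l (comp k (B (up x) z)) = cf B l k x (coeffZero z)
      + (-1 : ℝ) ^ (k * i) • b x (coef l (comp k z))
      + ∑ m ∈ Finset.Ico 1 k, coef l (comp k (B (up x) (comp m z))) := by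
  rw [hB.comp_right, Finset.sum_range_succ, Finset.range_eq_Ico, Finset.sum_eq_sum_Ico_succ_bot hk,
    map_add, map_add, hB.coef_comp_right l k hx, map_sum, comp_zero_eq, ← cf_apply, zero_add]
  abel

lemma coef_left_up (l : ExteriorAlgebra ℝ W →ₗ[ℝ] ℝ) {k : ℕ} (hk : 1 ≤ k) (x y z : M) :
    coef l (comp k (B (B (up x) (up y)) (up z))) = cf B l k (b x y) z + b (cf B l k x y) z
      + ∑ m ∈ Finset.Ico 1 k, coef l (comp k (B (comp m (B (up x) (up y))) (up z))) := by
  rw [hB.coef_left l hk, hB.zeroth, ← cf_apply]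

lemma coef_right_up (l : ExteriorAlgebra ℝ W →ₗ[ℝ] ℝ) {k : ℕ} (hk : 1 ≤ k) {i : ℕ} {x : M}
    (hx : x ∈ G i) (y z : M) :
    coef l (comp k (B (up x) (B (up y) (up z)))) = cf B l k x (b y z)
      + (-1 : ℝ) ^ (k * i) • b x (cf B l k y z)
      + ∑ m ∈ Finset.Ico 1 k, coef l (comp k (B (up x) (comp m (B (up y) (up z))))) := by
  rw [hB.coef_right l hk hx, hB.zeroth, ← cf_apply]

lemma jacobi_up {i j : ℕ} {x y : M} (hx : x ∈ G i) (hy : y ∈ G j) (z : HL W M) :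
    B (up x) (B (up y) z) = B (B (up x) (up y)) z + (-1 : ℝ) ^ (i * j) • B (up y) (B (up x) z) :=
  hB.jacobi_deg (piece_le_degPart (zero_add _) (up_mem_piece hx))
    (piece_le_degPart (zero_add _) (up_mem_piece hy)) z

/-- The part of order one of the Jacobi identity. -/
lemma jacobi_one (l : ExteriorAlgebra ℝ W →ₗ[ℝ] ℝ) {i j : ℕ} {x y : M} (hx : x ∈ G i) (hy : y ∈ G j)
    (z : M) : cf B l 1 x (b y z) + (-1 : ℝ) ^ i • b x (cf B l 1 y z) =
      cf B l 1 (b x y) z + b (cf B l 1 x y) z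
        + (-1 : ℝ) ^ (i * j) • (cf B l 1 y (b x z) + (-1 : ℝ) ^ j • b y (cf B l 1 x z)) := by
  have h := congrArg (fun w => coef l (comp 1 w)) (hB.jacobi_up hx hy (up z))
  simp only [map_add, map_smul, hB.coef_right_up l le_rfl hx, hB.coef_right_up l le_rfl hy,
    hB.coef_left_up l le_rfl, Finset.Ico_self, Finset.sum_empty, add_zero, one_mul] at h
  rw [h, smul_add]

/-- The part of order `k` of the Jacobi identity for a bracket without components of orders
between one and `k`. -/
lemma jacobi_of_comp_eq_zero (l : ExteriorAlgebra ℝ W →ₗ[ℝ] ℝ) {k : ℕ} (hk : 3 ≤ k)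
    (h0 : ∀ m ∈ Finset.Ico 2 k, ∀ x y : M, comp m (B (up x) (up y)) = 0) {i j : ℕ} {x y : M}
    (hx : x ∈ G i) (hy : y ∈ G j)
    (z : M) : cf B l k x (b y z) + (-1 : ℝ) ^ (k * i) • b x (cf B l k y z) =
      cf B l k (b x y) z + b (cf B l k x y) z
        + (-1 : ℝ) ^ (i * j) • (cf B l k y (b x z) + (-1 : ℝ) ^ (k * j) • b y (cf B l k x z)) := by
  -- The mixed terms combine orders `m` and `k - m`. As `3 ≤ k`, at least one of the two lies
  -- between `2` and `k - 1`, where the bracket has no component.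
  have hR : ∀ {i : ℕ} {x : M}, x ∈ G i → ∀ y z : M, ∑ m ∈ Finset.Ico 1 k,
      coef l (comp k (B (up x) (comp m (B (up y) (up z))))) = 0 := fun {i x} hx y z => by
    refine Finset.sum_eq_zero fun m hm => ?_
    rw [Finset.mem_Ico] at hm
    rcases eq_or_ne m 1 with rfl | h
    · obtain ⟨k, rfl⟩ := Nat.exists_eq_add_of_le hm.2.le
      rw [hB.comp_right_of_comp_eq_zero hx fun y => h0 _ (Finset.mem_Ico.2 (by omega)) _ _, map_zero]
    · rw [h0 m (Finset.mem_Ico.2 (by omega)), map_zero, map_zero, map_zero]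
  have hL : ∀ x y z : M, ∑ m ∈ Finset.Ico 1 k,
      coef l (comp k (B (comp m (B (up x) (up y))) (up z))) = 0 := fun x y z => by
    refine Finset.sum_eq_zero fun m hm => ?_
    rw [Finset.mem_Ico] at hm
    rcases eq_or_ne m 1 with rfl | h
    · obtain ⟨k, rfl⟩ := Nat.exists_eq_add_of_le hm.2.le
      rw [hB.comp_left_of_comp_eq_zero fun x => h0 _ (Finset.mem_Ico.2 (by omega)) _ _, map_zero]
    · rw [h0 m (Finset.mem_Ico.2 (by omega)), map_zero, LinearMap.zero_apply, map_zero, map_zero]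
  have h := congrArg (fun w => coef l (comp k w)) (hB.jacobi_up hx hy (up z))
  simp only [map_add, map_smul] at h
  rw [hB.coef_right_up l (by omega) hx, hB.coef_right_up l (by omega) hy,
    hB.coef_left_up l (by omega), hR hx, hR hy, hL, add_zero, add_zero, add_zero] at h
  exact h

end IsDeformation

lemma smul_mem_piece {i k j : ℕ} {τ : ExteriorAlgebra ℝ W} (hτ : τ ∈ ⋀[ℝ]^i W) {z : HL W M}
    (hz : z ∈ piece G W k j) : τ • z ∈ piece G W (i + k) j := by
  have : piece G W k j ≤
      (piece G W (i + k) j).comap (Algebra.lsmul ℝ ℝ (HL W M) τ) := piece_le fun σ hσ x hx => by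
    change τ • (σ ⊗ₜ[ℝ] x) ∈ piece G W (i + k) j
    rw [TensorProduct.smul_tmul', smul_eq_mul]
    refine tmul_mem_piece ?_ hx
    rw [ExteriorAlgebra.exteriorPower, pow_add]
    exact Submodule.mul_mem_mul hτ hσ
  exact this hz

/-- The `Λ`-linear extension of a linear map `M → Λ ⊗ M`. -/
def extend (n : M →ₗ[ℝ] HL W M) : HL W M →ₗ[ExteriorAlgebra ℝ W] HL W M :=
  TensorProduct.AlgebraTensorModule.lift
    (LinearMap.toSpanSingleton (ExteriorAlgebra ℝ W) (M →ₗ[ℝ] HL W M) n)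

lemma extend_tmul (n : M →ₗ[ℝ] HL W M) (τ : ExteriorAlgebra ℝ W) (x : M) :
    extend n (τ ⊗ₜ[ℝ] x) = τ • n x := by
  simp [extend]

lemma extend_up (n : M →ₗ[ℝ] HL W M) (x : M) : extend n (up x) = n x := by
  rw [up, extend_tmul, one_smul]

/-- A linear map `n : M → Λᵏ ⊗ M` that preserves the total degree. -/
structure IsShift (G : ℕ → Submodule ℝ M) (k : ℕ) (n : M →ₗ[ℝ] HL W M) : Prop where
  span : ⨆ j, G j = ⊤
  pos : 1 ≤ k
  mem : ∀ j, k ≤ j → ∀ x ∈ G j, n x ∈ piece G W k (j - k)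
  zero : ∀ j < k, ∀ x ∈ G j, n x = 0

namespace IsShift

variable {k : ℕ} {n : M →ₗ[ℝ] HL W M} (hn : IsShift G k n)
include hn

lemma comp_same (x : M) : comp k (n x) = n x := by
  have hx : x ∈ ⨆ j, G j := hn.span ▸ Submodule.mem_top
  induction hx using Submodule.iSup_induction' with
  | mem j x hx =>
    rcases le_or_gt k j with h | h
    · exact comp_of_mem_piece (hn.mem j h x hx)
    · rw [hn.zero j h x hx, map_zero]
  | zero => rw [map_zero, map_zero]
  | add x y _ _ hx hy => rw [map_add, map_add, hx, hy]

lemma extend_mem_piece {i j : ℕ} {P : Submodule ℝ (HL W M)}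
    (h : k ≤ j → piece G W (i + k) (j - k) ≤ P) {z : HL W M} (hz : z ∈ piece G W i j) :
    extend n z ∈ P := by
  have : piece G W i j ≤ P.comap ((extend n).restrictScalars ℝ) := piece_le fun τ hτ x hx => by
    change extend n (τ ⊗ₜ[ℝ] x) ∈ P
    rw [extend_tmul]
    rcases le_or_gt k j with h' | h'
    · exact h h' (smul_mem_piece hτ (hn.mem j h' x hx))
    · rw [hn.zero j h' x hx, smul_zero]
      exact zero_mem _
  exact this hz

lemma extend_mem_degPart {m : ℕ} {z : HL W M} (hz : z ∈ degPart G W m) :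
    extend n z ∈ degPart G W m := by
  have : degPart G W m ≤ (degPart G W m).comap ((extend n).restrictScalars ℝ) :=
    iSup₂_le fun p hp z hz => hn.extend_mem_piece (fun h => piece_le_degPart (by omega)) hz
  exact this hz

lemma extend_mem_parityPart {m : ZMod 2} {z : HL W M} (hz : z ∈ parityPart G W m) :
    extend n z ∈ parityPart G W m := by
  have : parityPart G W m ≤ (parityPart G W m).comap ((extend n).restrictScalars ℝ) :=
    iSup₂_le fun p hp z hz => hn.extend_mem_piece
      (fun h => piece_le_parityPart (by rw [← hp]; congr 1; omega)) hz
  exact this hz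

lemma extend_mem_filtPart {m : ℕ} {z : HL W M} (hz : z ∈ filtPart G W m) :
    extend n z ∈ filtPart G W m := by
  have : filtPart G W m ≤ (filtPart G W m).comap ((extend n).restrictScalars ℝ) :=
    iSup₂_le fun p hp z hz => hn.extend_mem_piece (fun h => piece_le_filtPart (by omega)) hz
  exact this hz

lemma comp_extend_of_lt {m : ℕ} (hm : m < k) (z : HL W M) : comp m (extend n z) = 0 := by
  induction z using induction with
  | hadd z z' hz hz' => rw [map_add, map_add, hz, hz', add_zero]
  | h i τ hτ x =>
    rw [extend_tmul]
    rcases le_or_gt i m with h | h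
    · rw [comp_smul hτ h, ← hn.comp_same, comp_comp_ne (by omega), smul_zero]
    · rw [comp_smul_of_lt hτ h]

lemma comp_extend (z : HL W M) : comp k (extend n z) = n (coeffZero z) := by
  induction z using induction with
  | hadd z z' hz hz' => rw [map_add, map_add, hz, hz', map_add, map_add]
  | h i τ hτ x =>
    rw [extend_tmul, coeffZero_eq_coef, coef_tmul, AlgHom.toLinearMap_apply]
    rcases Nat.eq_zero_or_pos i with rfl | hi
    · obtain ⟨r, rfl⟩ := mem_exteriorPower_zero hτ
      rw [AlgHom.commutes, algebraMap_smul, map_smul, hn.comp_same, map_smul, Algebra.algebraMap_self,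
        RingHom.id_apply]
    · rw [algebraMapInv_eq_zero hi hτ, zero_smul, map_zero]
      rcases le_or_gt i k with h | h
      · rw [comp_smul hτ h, ← hn.comp_same, comp_comp_ne (by have := hn.pos; omega), smul_zero]
      · rw [comp_smul_of_lt hτ h]

lemma coeffZero_extend (z : HL W M) : coeffZero (extend n z) = 0 := by
  rw [← coeffZero_up (W := W) (coeffZero (extend n z)), ← comp_zero_eq,
    hn.comp_extend_of_lt hn.pos, map_zero]

end IsShift

/-- The automorphism `1 + N` of `Λ ⊗ M` for the extension `N` of a linear map with `N² = 0`. -/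
def onePlus (n : M →ₗ[ℝ] HL W M) (h : ∀ x, extend n (n x) = 0) :
    HL W M ≃ₗ[ExteriorAlgebra ℝ W] HL W M :=
  have h2 : ∀ z, extend n (extend n z) = 0 := fun z => by
    induction z using induction with
    | hadd z z' hz hz' => rw [map_add, map_add, hz, hz', add_zero]
    | h i τ hτ x => rw [extend_tmul, map_smul, h, smul_zero]
  { toFun := fun z => z + extend n z
    map_add' := fun z z' => by rw [map_add]; abel
    map_smul' := fun τ z => by rw [map_smul, RingHom.id_apply, smul_add]
    invFun := fun z => z - extend n z
    left_inv := fun z => by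
      change z + extend n z - extend n (z + extend n z) = z
      rw [map_add, h2, add_zero, add_sub_cancel_right]
    right_inv := fun z => by
      change z - extend n z + extend n (z - extend n z) = z
      rw [map_sub, h2, sub_zero, sub_add_cancel] }

lemma onePlus_apply (n : M →ₗ[ℝ] HL W M) (h : ∀ x, extend n (n x) = 0) (z : HL W M) :
    onePlus n h z = z + extend n z := rfl

lemma onePlus_symm_apply (n : M →ₗ[ℝ] HL W M) (h : ∀ x, extend n (n x) = 0) (z : HL W M) :
    (onePlus n h).symm z = z - extend n z := rfl

lemma onePlus_mem_iff {n : M →ₗ[ℝ] HL W M} (h : ∀ x, extend n (n x) = 0) {P : Submodule ℝ (HL W M)}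
    (hP : ∀ z ∈ P, extend n z ∈ P) (z : HL W M) : onePlus n h z ∈ P ↔ z ∈ P := by
  refine ⟨fun hz => ?_, fun hz => P.add_mem hz (hP z hz)⟩
  have h1 := P.sub_mem hz (hP _ hz)
  rwa [← onePlus_symm_apply n h, LinearEquiv.symm_apply_apply] at h1

/-- The transport of a bracket along an automorphism. -/
def conj (Φ : HL W M ≃ₗ[ExteriorAlgebra ℝ W] HL W M) (B : HL W M →ₗ[ℝ] HL W M →ₗ[ℝ] HL W M) :
    HL W M →ₗ[ℝ] HL W M →ₗ[ℝ] HL W M :=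
  (B.compl₁₂ (Φ.symm.toLinearMap.restrictScalars ℝ) (Φ.symm.toLinearMap.restrictScalars ℝ)).compr₂
    (Φ.toLinearMap.restrictScalars ℝ)

lemma conj_apply (Φ : HL W M ≃ₗ[ExteriorAlgebra ℝ W] HL W M)
    (B : HL W M →ₗ[ℝ] HL W M →ₗ[ℝ] HL W M) (z w : HL W M) :
    conj Φ B z w = Φ (B (Φ.symm z) (Φ.symm w)) := rfl

lemma equiv_real_smul (Φ : HL W M ≃ₗ[ExteriorAlgebra ℝ W] HL W M) (c : ℝ) (z : HL W M) :
    Φ (c • z) = c • Φ z := (Φ.toLinearMap.restrictScalars ℝ).map_smul c z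

namespace IsDeformation

variable (hB : IsDeformation G b B)
include hB

lemma conj {Φ : HL W M ≃ₗ[ExteriorAlgebra ℝ W] HL W M}
    (hdeg : ∀ n z, Φ z ∈ degPart G W n ↔ z ∈ degPart G W n)
    (hpar : ∀ i z, Φ z ∈ parityPart G W i ↔ z ∈ parityPart G W i)
    (h0 : ∀ z, coeffZero (Φ z) = coeffZero z) : IsDeformation G b (conj Φ B) := by
  have hd : ∀ n z, z ∈ degPart G W n → Φ.symm z ∈ degPart G W n := fun n z hz => by
    rwa [← hdeg, Φ.apply_symm_apply]
  have hp : ∀ i z, z ∈ parityPart G W i → Φ.symm z ∈ parityPart G W i := fun n z hz => by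
    rwa [← hpar, Φ.apply_symm_apply]
  have hz : ∀ z, coeffZero (Φ.symm z) = coeffZero z := fun z => by
    rw [← h0, Φ.apply_symm_apply]
  exact
    { span := hB.span
      lie :=
        { even := fun i j x hx y hy => (hpar _ _).2 (hB.lie.even i j _ (hp _ _ hx) _ (hp _ _ hy))
          skew := fun i j x hx y hy => by
            rw [conj_apply, conj_apply, hB.lie.skew i j _ (hp _ _ hx) _ (hp _ _ hy), map_neg,
              equiv_real_smul]
          jacobi := fun i j x hx y hy z => by
            simp only [conj_apply, Φ.symm_apply_apply]
            rw [hB.lie.jacobi i j _ (hp _ _ hx) _ (hp _ _ hy), map_add, equiv_real_smul] }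
      smul_left := fun τ x y => by
        rw [conj_apply, conj_apply, map_smul, hB.smul_left, map_smul]
      smul_right := fun k i τ hτ x hx y => by
        rw [conj_apply, conj_apply, map_smul, hB.smul_right k i τ hτ _ (hp _ _ hx), equiv_real_smul,
          map_smul]
      graded := fun m n x hx y hy => (hdeg _ _).2 (hB.graded m n _ (hd _ _ hx) _ (hd _ _ hy))
      zeroth := fun x y => by
        rw [conj_apply, h0, hB.coeffZero_bracket, hz, hz, coeffZero_up, coeffZero_up] }

lemma conj_onePlus {k : ℕ} {n : M →ₗ[ℝ] HL W M} (hn : IsShift G k n)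
    (h : ∀ x, extend n (n x) = 0) : IsDeformation G b (Grassmann.conj (onePlus n h) B) :=
  hB.conj (fun _ => onePlus_mem_iff h fun _ => hn.extend_mem_degPart)
    (fun _ => onePlus_mem_iff h fun _ => hn.extend_mem_parityPart)
    fun z => by rw [onePlus_apply, map_add, hn.coeffZero_extend, add_zero]

lemma comp_conj_of_lt {k : ℕ} {n : M →ₗ[ℝ] HL W M} (hn : IsShift G k n)
    (h : ∀ x, extend n (n x) = 0) {m : ℕ} (hm : m < k) (x y : M) :
    comp m (Grassmann.conj (onePlus n h) B (up x) (up y)) = comp m (B (up x) (up y)) := by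
  rw [conj_apply, onePlus_symm_apply, onePlus_symm_apply, onePlus_apply, map_add,
    hn.comp_extend_of_lt hm, add_zero, extend_up, extend_up, ← hn.comp_same y, ← hn.comp_same x,
    map_sub, map_sub, LinearMap.map_sub₂, map_sub, hB.comp_left_eq_zero hm,
    hB.comp_right_eq_zero hm, sub_zero, sub_zero]

lemma comp_comp_comp_eq_zero {m k : ℕ} (hm : 1 ≤ m) (z w : HL W M) :
    comp k (B (comp k z) (comp m w)) = 0 := by
  induction z using induction with
  | hadd z z' hz hz' => simp only [map_add, LinearMap.add_apply, hz, hz', add_zero]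
  | h i τ hτ x =>
    by_cases h : i = k
    · subst h
      rw [comp_tmul_same hτ, hB.tmul_left, comp_smul hτ le_rfl, Nat.sub_self,
        hB.comp_right_eq_zero hm, smul_zero]
    · rw [comp_tmul_ne hτ x h, map_zero, LinearMap.zero_apply, map_zero]

/-- At order `k` the change of trivialization alters the bracket by the coboundary of `n`; terms
quadratic in `n` have higher order. -/
lemma cf_conj {k : ℕ} {n : M →ₗ[ℝ] HL W M} (hn : IsShift G k n)
    (h : ∀ x, extend n (n x) = 0) (l : ExteriorAlgebra ℝ W →ₗ[ℝ] ℝ) {i : ℕ} {x : M} (hx : x ∈ G i)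
    (y : M) : cf (Grassmann.conj (onePlus n h) B) l k x y =
      cf B l k x y - b (coef l (n x)) y - (-1 : ℝ) ^ (k * i) • b x (coef l (n y))
        + coef l (n (b x y)) := by
  have h1 : coef l (comp k (B (n x) (up y))) = b (coef l (n x)) y := by
    rw [← hn.comp_same x, hB.coef_comp_left]
  have h2 : coef l (comp k (B (up x) (n y))) = (-1 : ℝ) ^ (k * i) • b x (coef l (n y)) := by
    rw [← hn.comp_same y, hB.coef_comp_right l k hx]
  have h3 : comp k (B (n x) (n y)) = 0 := by
    rw [← hn.comp_same x, ← hn.comp_same y, hB.comp_comp_comp_eq_zero hn.pos]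
  have h4 : coeffZero (n x) = 0 := by rw [← extend_up, hn.coeffZero_extend]
  have h5 : coeffZero (n y) = 0 := by rw [← extend_up, hn.coeffZero_extend]
  have h6 : B (up x - n x) (up y - n y) =
      B (up x) (up y) - B (n x) (up y) - (B (up x) (n y) - B (n x) (n y)) := by
    rw [map_sub, LinearMap.map_sub₂, LinearMap.map_sub₂]
  rw [cf_apply, conj_apply, onePlus_symm_apply, onePlus_symm_apply, onePlus_apply, map_add,
    hn.comp_extend, hB.coeffZero_bracket, extend_up, extend_up, h6, map_sub coeffZero, map_sub coeffZero,
    coeffZero_up, coeffZero_up, h4, h5, sub_zero, sub_zero, map_sub, map_sub, map_sub, h3, sub_zero,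
    map_add, map_sub, map_sub, h1, h2, cf_apply]

end IsDeformation

end Grassmann

/-! ### Jacobi identities with a repeated odd argument -/

namespace Grassmann

variable {W : Type*} [AddCommGroup W] [Module ℝ W] {M : Type*} [AddCommGroup M] [Module ℝ M]
variable {G : ℕ → Submodule ℝ M} {b : M →ₗ[ℝ] M →ₗ[ℝ] M}
variable {B : HL W M →ₗ[ℝ] HL W M →ₗ[ℝ] HL W M}

namespace IsDeformation

variable (hB : IsDeformation G b B)
include hB

lemma jacobi_sq {i : ℕ} (hi : Odd i) {x : M} (hx : x ∈ G i) (z : HL W M) :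
    (2 : ℝ) • B (up x) (B (up x) z) = B (B (up x) (up x)) z := by
  have h := hB.jacobi_up hx hx z
  rw [(hi.mul hi).neg_one_pow, neg_one_smul, ← sub_eq_add_neg, eq_sub_iff_add_eq] at h
  rw [two_smul, h]

/-- `2 [x, [x, x]] = [[x, x], x] = -[x, [x, x]]`, so three times the expression vanishes. -/
lemma jacobi_cube {i : ℕ} (hi : Odd i) {x : M} (hx : x ∈ G i) :
    B (B (up x) (up x)) (up x) = 0 := by
  have h := hB.jacobi_sq hi hx (up x)
  rw [hB.skew_up (piece_le_degPart (zero_add _) (up_mem_piece hx)) (hB.up_up_mem hx hx),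
    Even.neg_one_pow ((Even.add_self i).mul_left i), one_smul, smul_neg, eq_comm,
    eq_neg_iff_add_eq_zero, ← one_smul ℝ (B (B (up x) (up x)) (up x)), smul_smul, ← add_smul] at h
  exact (smul_eq_zero.1 h).resolve_left (by norm_num)

lemma jacobi_even_odd {i : ℕ} (hi : Odd i) {a x : M} (ha : a ∈ G 0) (hx : x ∈ G i) :
    B (up a) (B (up x) (up x)) = (2 : ℝ) • B (B (up a) (up x)) (up x) := by
  have h := hB.up_up_mem ha hx
  rw [zero_add] at h
  rw [hB.jacobi_up ha hx, zero_mul, pow_zero, one_smul,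
    hB.skew_up (piece_le_degPart (zero_add _) (up_mem_piece hx)) h, (hi.mul hi).neg_one_pow,
    neg_one_smul, neg_neg, two_smul]

variable (l : ExteriorAlgebra ℝ W →ₗ[ℝ] ℝ)

lemma cf_comm {i j : ℕ} (h : Odd (i * j)) (k : ℕ) {x y : M} (hx : x ∈ G i) (hy : y ∈ G j) :
    cf B l k x y = cf B l k y x := by
  rw [hB.cf_skew l k hx hy, h.neg_one_pow, neg_one_smul, neg_neg]

variable {E : Type*} [AddCommGroup E] [Module ℝ E] (p : M →ₗ[ℝ] E)

lemma apply_cf_neg {i j : ℕ} (h : Even (i * j)) (k : ℕ) {x y : M} (hx : x ∈ G i) (hy : y ∈ G j) :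
    p (cf B l k x y) = -p (cf B l k y x) := by
  rw [hB.cf_skew l k hx hy, h.neg_one_pow, one_smul, map_neg]

lemma cube_one {i : ℕ} (hi : Odd i) {x c : M} (hx : x ∈ G i) (hc : b x x = c) {f : M → E}
    (hf : ∀ z, p (b z x) = f z) : p (cf B l 1 c x) + f (cf B l 1 x x) = 0 := by
  subst hc
  have h := congrArg (fun w => coef l (comp 1 w)) (hB.jacobi_cube hi hx)
  simp only [map_zero] at h
  rw [hB.coef_left_up l le_rfl, Finset.Ico_self, Finset.sum_empty, add_zero] at h
  rw [← hf, ← map_add, h, map_zero]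

/-- The order-two part of the identity has a single term built from two first-order components, and
`h0` says that it vanishes. What remains is linear in the second-order components. -/
lemma cube_two {i : ℕ} (hi : Odd i) {x c : M} (hx : x ∈ G i) (hc : b x x = c) {f : M → E}
    (hf : ∀ z, p (b z x) = f z) (h0 : comp 2 (B (comp 1 (B (up x) (up x))) (up x)) = 0) :
    p (cf B l 2 c x) + f (cf B l 2 x x) = 0 := by
  subst hc
  have h := congrArg (fun w => coef l (comp 2 w)) (hB.jacobi_cube hi hx)
  simp only [map_zero] at h
  rw [hB.coef_left_up l (by norm_num), Nat.Ico_succ_singleton, Finset.sum_singleton, h0, map_zero,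
    add_zero] at h
  rw [← hf, ← map_add, h, map_zero]

lemma sq_two {i : ℕ} (hi : Odd i) {x y c d : M} (hx : x ∈ G i) (hc : b x x = c) (hd : b x y = d)
    {f g : M → E} (hf : ∀ z, p (b x z) = f z) (hg : ∀ z, p (b z y) = g z)
    (h0 : (2 : ℝ) • comp 2 (B (up x) (comp 1 (B (up x) (up y))))
      - comp 2 (B (comp 1 (B (up x) (up x))) (up y)) = 0) :
    (2 : ℝ) • (p (cf B l 2 x d) + f (cf B l 2 x y)) = p (cf B l 2 c y) + g (cf B l 2 x x) := by
  subst hc hd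
  have h := congrArg (fun w => coef l (comp 2 w)) (hB.jacobi_sq hi hx (up y))
  simp only [map_smul] at h
  rw [hB.coef_left_up l (by norm_num), hB.coef_right_up l (by norm_num) hx, Nat.Ico_succ_singleton,
    Finset.sum_singleton, Finset.sum_singleton, Even.neg_one_pow (even_two_mul i), one_smul, smul_add,
    ← map_smul (coef l), sub_eq_zero.1 h0, add_left_inj] at h
  rw [← hf, ← hg, ← map_add, ← map_add, ← map_smul, h]

lemma even_odd_one {i : ℕ} (hi : Odd i) {a x c d : M} (ha : a ∈ G 0) (hx : x ∈ G i)
    (hc : b x x = c) (hd : b a x = d) {f g : M → E} (hf : ∀ z, p (b a z) = f z)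
    (hg : ∀ z, p (b z x) = g z) : p (cf B l 1 a c) + f (cf B l 1 x x) =
      (2 : ℝ) • (p (cf B l 1 d x) + g (cf B l 1 a x)) := by
  subst hc hd
  have h := congrArg (fun w => coef l (comp 1 w)) (hB.jacobi_even_odd hi ha hx)
  simp only [map_smul] at h
  rw [hB.coef_left_up l le_rfl, hB.coef_right_up l le_rfl ha, Finset.Ico_self, Finset.sum_empty,
    Finset.sum_empty, add_zero, add_zero, mul_zero, pow_zero, one_smul] at h
  rw [← hf, ← hg, ← map_add, ← map_add, ← map_smul, h]

lemma even_odd_two {i : ℕ} (hi : Odd i) {a x c d : M} (ha : a ∈ G 0) (hx : x ∈ G i)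
    (hc : b x x = c) (hd : b a x = d) {f : M → E} (hf : ∀ z, p (b a z) = f z)
    (hg : ∀ z, p (b z x) = 0)
    (h0 : (2 : ℝ) • comp 2 (B (comp 1 (B (up a) (up x))) (up x))
      - comp 2 (B (up a) (comp 1 (B (up x) (up x)))) = 0) :
    p (cf B l 2 a c) + f (cf B l 2 x x) = (2 : ℝ) • p (cf B l 2 d x) := by
  subst hc hd
  have h := congrArg (fun w => coef l (comp 2 w)) (hB.jacobi_even_odd hi ha hx)
  simp only [map_smul] at h
  rw [hB.coef_left_up l (by norm_num), hB.coef_right_up l (by norm_num) ha, Nat.Ico_succ_singleton,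
    Finset.sum_singleton, Finset.sum_singleton, mul_zero, pow_zero, one_smul, smul_add,
    ← map_smul (coef l) _ (comp 2 _), sub_eq_zero.1 h0, add_left_inj] at h
  rw [← hf, ← map_add, h, map_smul, map_add, hg, add_zero]

lemma jacobi_one_apply {i j : ℕ} {x y z c d e : M} (hx : x ∈ G i) (hy : y ∈ G j) (hc : b y z = c)
    (hd : b x y = d) (he : b x z = e) {f g h : M → E} (hf : ∀ w, p (b x w) = f w)
    (hg : ∀ w, p (b w z) = g w) (hh : ∀ w, p (b y w) = h w) :
    p (cf B l 1 x c) + (-1 : ℝ) ^ i • f (cf B l 1 y z) = p (cf B l 1 d z) + g (cf B l 1 x y)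
        + (-1 : ℝ) ^ (i * j) • (p (cf B l 1 y e) + (-1 : ℝ) ^ j • h (cf B l 1 x z)) := by
  subst hc hd he
  rw [← hf, ← hg, ← hh]
  simpa only [map_add, map_smul] using congrArg p (hB.jacobi_one l hx hy z)

lemma jacobi_apply_of_comp_eq_zero {k : ℕ} (hk : 3 ≤ k)
    (h0 : ∀ m ∈ Finset.Ico 2 k, ∀ x y : M, comp m (B (up x) (up y)) = 0) {i j : ℕ} {x y z : M}
    (hx : x ∈ G i) (hy : y ∈ G j) (hc : b y z = 0)
    (hd : b x y = 0) (he : b x z = 0) {f g h : M → E} (hf : ∀ w, p (b x w) = f w)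
    (hg : ∀ w, p (b w z) = g w) (hh : ∀ w, p (b y w) = h w) :
    (-1 : ℝ) ^ (k * i) • f (cf B l k y z) = g (cf B l k x y)
        + (-1 : ℝ) ^ (i * j + k * j) • h (cf B l k x z) := by
  rw [← hf, ← hg, ← hh]
  simpa only [hc, hd, he, map_add, map_smul, map_zero, LinearMap.zero_apply, zero_add, pow_add,
    mul_smul] using congrArg p (hB.jacobi_of_comp_eq_zero l hk h0 hx hy z)

lemma comp_eq_zero_of_cf {k : ℕ}
    (h : ∀ l, ∀ i j, i ≤ j → ∀ x ∈ G i, ∀ y ∈ G j, cf B l k x y = 0) (x y : M) :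
    comp k (B (up x) (up y)) = 0 := by
  refine coef_ext fun l => ?_
  rw [← cf_apply, map_zero]
  have hx : x ∈ ⨆ j, G j := hB.span ▸ Submodule.mem_top
  have hy : y ∈ ⨆ j, G j := hB.span ▸ Submodule.mem_top
  induction hx using Submodule.iSup_induction' with
  | zero => rw [map_zero, LinearMap.zero_apply]
  | add x x' _ _ hx hx' => rw [map_add, LinearMap.add_apply, hx, hx', add_zero]
  | mem i x hx =>
    induction hy using Submodule.iSup_induction' with
    | zero => rw [map_zero]
    | add y y' _ _ hy hy' => rw [map_add, hy, hy', add_zero]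
    | mem j y hy =>
      rcases le_total i j with hij | hij
      · exact h l i j hij x hx y hy
      · rw [hB.cf_skew l k hx hy, h l j i hij y hy x hx, smul_zero, neg_zero]

end IsDeformation

/-- A bracket whose components of order at least two vanish is determined by its first-order
components. -/
lemma eq_up_add_sum {ι : Type*} [Fintype ι] (t : Module.Basis ι ℝ W) {n : ℕ} {z : HL W M}
    (hz : z ∈ degPart G W n) (h : ∀ k, 2 ≤ k → comp k z = 0) :
    z = up (coeffZero z) + ∑ i, tx t i (coeffOne (t.coord i) z) := by
  have h1 := eq_sum_comp hz
  have h2 : ∑ k ∈ Finset.range (n + 1), comp k z = ∑ k ∈ Finset.range (n + 2), comp k z := by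
    rw [Finset.sum_range_succ _ (n + 1), comp_eq_zero_of_lt (Nat.lt_succ_self n) hz, add_zero]
  rw [h2, Finset.range_eq_Ico, ← Finset.sum_Ico_consecutive _ (Nat.zero_le 2) (by omega),
    Finset.sum_eq_zero (s := Finset.Ico 2 (n + 2)) fun k hk => h k (Finset.mem_Ico.1 hk).1, add_zero,
    ← Finset.range_eq_Ico, Finset.sum_range_succ, Finset.sum_range_one, comp_zero_eq,
    comp_one_eq t] at h1
  exact h1

lemma cf_one (B : HL W M →ₗ[ℝ] HL W M →ₗ[ℝ] HL W M) (l : W →ₗ[ℝ] ℝ) (x y : M) :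
    cf B (l ∘ₗ ExteriorAlgebra.ιInv (R := ℝ) (M := W)) 1 x y = coeffOne l (B (up x) (up y)) := by
  rw [cf_apply, ← coeffOne_eq_coef, coeffOne_comp_one]

end Grassmann

/-! ## Components of the bracket of a filtered deformation -/

section Dictionary

variable {S : Type*} [AddCommGroup S] [Module ℝ S] {h₀ : LieSubalgebra ℝ soV}

lemma inA_mem (A : h₀) : (inA A : H h₀ S) ∈ hGr h₀ S 0 := ⟨trivial, rfl, rfl⟩
lemma inS_mem (s : S) : inS h₀ s ∈ hGr h₀ S 1 := ⟨rfl, trivial, rfl⟩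
lemma inV_mem (v : V) : (inV h₀ v : H h₀ S) ∈ hGr h₀ S 2 := ⟨rfl, rfl, trivial⟩

lemma eq_inA {x : H h₀ S} (hx : x ∈ hGr h₀ S 0) : x = inA x.1 :=
  Prod.ext rfl (Prod.ext hx.2.1 hx.2.2)
lemma eq_inS {x : H h₀ S} (hx : x ∈ hGr h₀ S 1) : x = inS h₀ x.2.1 :=
  Prod.ext hx.1 (Prod.ext rfl hx.2.2)
lemma eq_inV {x : H h₀ S} (hx : x ∈ hGr h₀ S 2) : x = inV h₀ x.2.2 :=
  Prod.ext hx.1 (Prod.ext hx.2.1 rfl)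
lemma eq_zero_of_mem_hGr {j : ℕ} (hj : 3 ≤ j) {x : H h₀ S} (hx : x ∈ hGr h₀ S j) : x = 0 := by
  obtain ⟨j, rfl⟩ := Nat.exists_eq_add_of_le' hj
  exact hx

lemma sum_in (x : H h₀ S) : inA x.1 + inS h₀ x.2.1 + inV h₀ x.2.2 = x := by
  simp [inA, inS, inV]

lemma iSup_hGr : ⨆ j, hGr h₀ S j = ⊤ := by
  refine eq_top_iff.2 fun x _ => ?_
  rw [← sum_in x]
  exact add_mem (add_mem (Submodule.mem_iSup_of_mem 0 (inA_mem _))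
    (Submodule.mem_iSup_of_mem 1 (inS_mem _))) (Submodule.mem_iSup_of_mem 2 (inV_mem _))

/-- The projection `𝔥 → 𝔥₀ ⊂ 𝔰𝔬(V)`. -/
def pA : H h₀ S →ₗ[ℝ] soV := h₀.toSubmodule.subtype ∘ₗ LinearMap.fst ℝ h₀ (S × V)

/-- The projection `𝔥 → S`. -/
def pS : H h₀ S →ₗ[ℝ] S := LinearMap.fst ℝ S V ∘ₗ LinearMap.snd ℝ h₀ (S × V)

/-- The projection `𝔥 → V`. -/
def pV : H h₀ S →ₗ[ℝ] V := LinearMap.snd ℝ S V ∘ₗ LinearMap.snd ℝ h₀ (S × V)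

/-- The inclusion of `𝔥₀` in `𝔥`. -/
def iA : h₀ →ₗ[ℝ] H h₀ S := LinearMap.inl ℝ h₀ (S × V)

/-- The inclusion of `S` in `𝔥`. -/
def iS : S →ₗ[ℝ] H h₀ S := LinearMap.inr ℝ h₀ (S × V) ∘ₗ LinearMap.inl ℝ S V

/-- The inclusion of `V` in `𝔥`. -/
def iV : V →ₗ[ℝ] H h₀ S := LinearMap.inr ℝ h₀ (S × V) ∘ₗ LinearMap.inr ℝ S V

lemma eq_zero_of_pA {x : H h₀ S} (hx : x ∈ hGr h₀ S 0) (h : pA x = 0) : x = 0 := by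
  rw [eq_inA hx, show x.1 = 0 from Subtype.ext h]
  rfl
lemma eq_zero_of_pS {x : H h₀ S} (hx : x ∈ hGr h₀ S 1) (h : pS x = 0) : x = 0 := by
  rw [eq_inS hx, show x.2.1 = 0 from h]
  rfl
lemma eq_zero_of_pV {x : H h₀ S} (hx : x ∈ hGr h₀ S 2) (h : pV x = 0) : x = 0 := by
  rw [eq_inV hx, show x.2.2 = 0 from h]
  rfl

variable [Module Cl S] [IsScalarTower ℝ Cl S]

lemma coe_sub_add (A B : h₀) : ((A + B : h₀) : soV) = A + B := rfl

lemma coe_sub_smul (c : ℝ) (A : h₀) : ((c • A : h₀) : soV) = c • (A : soV) := rfl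

/-- The superbracket of `𝔥` as a bilinear map. -/
def brk (h₀ : LieSubalgebra ℝ soV) (ω : S →ₗ[ℝ] S →ₗ[ℝ] ℝ) : H h₀ S →ₗ[ℝ] H h₀ S →ₗ[ℝ] H h₀ S :=
  LinearMap.mk₂ ℝ (hBracket h₀ ω)
    (fun x x' y => by
      simp only [hBracket, ← kappaL_apply, ← spinL_apply, asEnd, Prod.fst_add, Prod.snd_add, add_lie,
        map_add, LinearMap.add_apply, coe_sub_add, coe_soV_add, Prod.mk_add_mk, Prod.mk.injEq]
      refine ⟨trivial, ?_, ?_⟩ <;> abel)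
    (fun c x y => by
      simp only [hBracket, ← kappaL_apply, ← spinL_apply, asEnd, Prod.smul_fst, Prod.smul_snd, smul_lie,
        map_smul, LinearMap.smul_apply, coe_sub_smul, coe_soV_smul, Prod.smul_mk, smul_add,
        smul_sub])
    (fun x y y' => by
      simp only [hBracket, ← kappaL_apply, ← spinL_apply, asEnd, Prod.fst_add, Prod.snd_add, lie_add,
        map_add, LinearMap.add_apply, coe_sub_add, coe_soV_add, Prod.mk_add_mk, Prod.mk.injEq]
      refine ⟨trivial, ?_, ?_⟩ <;> abel)
    (fun c x y => by
      simp only [hBracket, ← kappaL_apply, ← spinL_apply, asEnd, Prod.smul_fst, Prod.smul_snd, lie_smul,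
        map_smul, LinearMap.smul_apply, coe_sub_smul, coe_soV_smul, Prod.smul_mk, smul_add,
        smul_sub])

variable {ω : S →ₗ[ℝ] S →ₗ[ℝ] ℝ}

lemma asEnd_zero : asEnd (0 : h₀) = 0 := rfl

lemma brk_apply (x y : H h₀ S) : brk h₀ ω x y = hBracket h₀ ω x y := rfl

lemma spin_zero_end (s : S) : spin (0 : Module.End ℝ V) s = 0 := by
  rw [← spinL_apply, map_zero, LinearMap.zero_apply]

lemma spin_zero_vec (A : Module.End ℝ V) : spin A (0 : S) = 0 := by
  rw [← spinL_apply, map_zero]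

lemma brk_AA (A A' : h₀) : brk h₀ ω (inA A) (inA A') = inA ⁅A, A'⁆ := by
  simp [brk_apply, hBracket, inA, ← kappaL_apply, ← spinL_apply]

lemma brk_AS (A : h₀) (s : S) : brk h₀ ω (inA A) (inS h₀ s) = inS h₀ (spin (asEnd A) s) := by
  simp [brk_apply, hBracket, inA, inS, ← kappaL_apply, ← spinL_apply, asEnd_zero]

lemma brk_AV (A : h₀) (v : V) : brk h₀ ω (inA A) (inV h₀ v) = inV h₀ (asEnd A v) := by
  simp [brk_apply, hBracket, inA, inV, ← kappaL_apply, ← spinL_apply, asEnd_zero]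

lemma brk_SS (s s' : S) : brk h₀ ω (inS h₀ s) (inS h₀ s') = inV h₀ (kappaL ω s s') := by
  simp [brk_apply, hBracket, inS, inV, ← kappaL_apply, ← spinL_apply, asEnd_zero]

lemma brk_SV (s : S) (v : V) : brk h₀ ω (inS h₀ s) (inV h₀ v) = 0 := by
  simp [brk_apply, hBracket, inS, inV, ← kappaL_apply, ← spinL_apply, asEnd_zero]

lemma brk_VS (s : S) (v : V) : brk h₀ ω (inV h₀ v) (inS h₀ s) = 0 := by
  simp [brk_apply, hBracket, inS, inV, ← kappaL_apply, ← spinL_apply, asEnd_zero]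

lemma brk_VV (v w : V) : brk h₀ ω (inV h₀ v) (inV h₀ w) = 0 := by
  simp [brk_apply, hBracket, inV, ← kappaL_apply, ← spinL_apply, asEnd_zero]

lemma pV_brk_inS (s : S) (z : H h₀ S) : pV (brk h₀ ω (inS h₀ s) z) = kappaL ω s (pS z) := by
  change kappa ω s z.2.1 + (0 : Module.End ℝ V) z.2.2 - asEnd z.1 0 = _
  rw [LinearMap.zero_apply, map_zero, add_zero, sub_zero]
  rfl

lemma pV_brk_inS_right (s : S) (z : H h₀ S) :
    pV (brk h₀ ω z (inS h₀ s)) = kappaL ω (pS z) s := by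
  change kappa ω z.2.1 s + asEnd z.1 0 - (0 : Module.End ℝ V) z.2.2 = _
  rw [LinearMap.zero_apply, map_zero, add_zero, sub_zero]
  rfl

lemma pS_brk_inS (s : S) (z : H h₀ S) :
    pS (brk h₀ ω (inS h₀ s) z) = -spin (pA z : Module.End ℝ V) s := by
  change spin (0 : Module.End ℝ V) z.2.1 - spin (asEnd z.1) s = _
  rw [spin_zero_end, zero_sub]
  rfl

lemma pS_brk_inS_right (s : S) (z : H h₀ S) :
    pS (brk h₀ ω z (inS h₀ s)) = spin (pA z : Module.End ℝ V) s := by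
  change spin (asEnd z.1) s - spin (0 : Module.End ℝ V) z.2.1 = _
  rw [spin_zero_end, sub_zero]
  rfl

lemma pA_brk_inS (s : S) (z : H h₀ S) : pA (brk h₀ ω (inS h₀ s) z) = 0 := by
  change ((⁅(0 : h₀), z.1⁆ : h₀) : soV) = 0
  rw [zero_lie]
  rfl

lemma pA_brk_inS_right (s : S) (z : H h₀ S) : pA (brk h₀ ω z (inS h₀ s)) = 0 := by
  change ((⁅z.1, (0 : h₀)⁆ : h₀) : soV) = 0
  rw [lie_zero]
  rfl

lemma pV_brk_inV (v : V) (z : H h₀ S) :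
    pV (brk h₀ ω (inV h₀ v) z) = -(pA z : Module.End ℝ V) v := by
  change kappaL ω 0 z.2.1 + (0 : Module.End ℝ V) z.2.2 - asEnd z.1 v = _
  rw [LinearMap.zero_apply, map_zero, LinearMap.zero_apply, add_zero, zero_sub]
  rfl

lemma pV_brk_inV_right (v : V) (z : H h₀ S) :
    pV (brk h₀ ω z (inV h₀ v)) = (pA z : Module.End ℝ V) v := by
  change kappaL ω z.2.1 0 + asEnd z.1 v - (0 : Module.End ℝ V) z.2.2 = _
  rw [LinearMap.zero_apply, map_zero, zero_add, sub_zero]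
  rfl

lemma pS_brk_inV (v : V) (z : H h₀ S) : pS (brk h₀ ω (inV h₀ v) z) = 0 := by
  change spin (0 : Module.End ℝ V) z.2.1 - spin (asEnd z.1) 0 = _
  rw [spin_zero_end, spin_zero_vec, sub_zero]

lemma pS_brk_inV_right (v : V) (z : H h₀ S) : pS (brk h₀ ω z (inV h₀ v)) = 0 := by
  change spin (asEnd z.1) 0 - spin (0 : Module.End ℝ V) z.2.1 = _
  rw [spin_zero_end, spin_zero_vec, sub_zero]

lemma pA_brk_inV_right (v : V) (z : H h₀ S) : pA (brk h₀ ω z (inV h₀ v)) = 0 := by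
  change ((⁅z.1, (0 : h₀)⁆ : h₀) : soV) = 0
  rw [lie_zero]
  rfl

lemma pV_brk_inA (A : h₀) (z : H h₀ S) : pV (brk h₀ ω (inA A) z) = asEnd A (pV z) := by
  change kappaL ω 0 z.2.1 + asEnd A z.2.2 - asEnd z.1 0 = _
  rw [map_zero, map_zero, LinearMap.zero_apply, zero_add, sub_zero]
  rfl

lemma pS_brk_inA (A : h₀) (z : H h₀ S) : pS (brk h₀ ω (inA A) z) = spin (asEnd A) (pS z) := by
  change spin (asEnd A) z.2.1 - spin (asEnd z.1) 0 = _
  rw [spin_zero_vec, sub_zero]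
  rfl

lemma pA_brk_inA (A : h₀) (z : H h₀ S) : pA (brk h₀ ω (inA A) z) = ⁅(A : soV), pA z⁆ := rfl

attribute [irreducible] brk

variable {W : Type*} [AddCommGroup W] [Module ℝ W] {B : Br h₀ W S}

lemma IsFilteredDeformation.isDeformation (hB : IsFilteredDeformation ω B) :
    Grassmann.IsDeformation (hGr h₀ S) (brk h₀ ω) B where
  span := iSup_hGr
  lie := hB.lie
  smul_left := hB.smul_left
  smul_right := hB.smul_right
  graded := hB.graded
  zeroth := fun x y => (hB.zeroth x y).trans (brk_apply x y).symm

lemma isFilteredDeformation_of_isDeformation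
    (hB : Grassmann.IsDeformation (hGr h₀ S) (brk h₀ ω) B) : IsFilteredDeformation ω B where
  lie := hB.lie
  smul_left := hB.smul_left
  smul_right := hB.smul_right
  graded := hB.graded
  zeroth := fun x y => (hB.zeroth x y).trans (brk_apply x y)

lemma Isomorphic.trans {B B' B'' : Br h₀ W S} (h : Isomorphic B B') (h' : Isomorphic B' B'') :
    Isomorphic B B'' := by
  obtain ⟨Φ, h1, h2, h3⟩ := h
  obtain ⟨Ψ, k1, k2, k3⟩ := h'
  exact ⟨Φ.trans Ψ, fun x y => by simp only [LinearEquiv.trans_apply, h1, k1],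
    fun n x => by rw [LinearEquiv.trans_apply, k2, h2],
    fun i x => by rw [LinearEquiv.trans_apply, k3, h3]⟩

lemma isomorphic_conj_onePlus {k : ℕ} {n : H h₀ S →ₗ[ℝ] HL h₀ W S}
    (hn : Grassmann.IsShift (hGr h₀ S) k n) (h : ∀ x, Grassmann.extend n (n x) = 0) :
    Isomorphic B (Grassmann.conj (Grassmann.onePlus n h) B) :=
  ⟨Grassmann.onePlus n h, fun x y => by
      rw [Grassmann.conj_apply, LinearEquiv.symm_apply_apply, LinearEquiv.symm_apply_apply],
    fun _ => Grassmann.onePlus_mem_iff h fun _ => hn.extend_mem_degPart,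
    fun _ => Grassmann.onePlus_mem_iff h fun _ => hn.extend_mem_filtPart⟩

end Dictionary

/-! ## The Jacobi identity in low orders -/

section Orders

variable {S : Type*} [AddCommGroup S] [Module ℝ S] {h₀ : LieSubalgebra ℝ soV}
variable {W : Type*} [AddCommGroup W] [Module ℝ W]

/-- A component of the part of order `k` of a bracket. -/
def cpt {X Y Z : Type*} [AddCommGroup X] [Module ℝ X] [AddCommGroup Y] [Module ℝ Y] [AddCommGroup Z]
    [Module ℝ Z] (i : X →ₗ[ℝ] H h₀ S) (j : Y →ₗ[ℝ] H h₀ S) (p : H h₀ S →ₗ[ℝ] Z) (B : Br h₀ W S)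
    (l : ExteriorAlgebra ℝ W →ₗ[ℝ] ℝ) (k : ℕ) : X →ₗ[ℝ] Y →ₗ[ℝ] Z :=
  ((Grassmann.cf B l k).compl₁₂ i j).compr₂ p

lemma cpt_apply {X Y Z : Type*} [AddCommGroup X] [Module ℝ X] [AddCommGroup Y] [Module ℝ Y]
    [AddCommGroup Z] [Module ℝ Z] (i : X →ₗ[ℝ] H h₀ S) (j : Y →ₗ[ℝ] H h₀ S) (p : H h₀ S →ₗ[ℝ] Z)
    (B : Br h₀ W S) (l : ExteriorAlgebra ℝ W →ₗ[ℝ] ℝ) (k : ℕ) (x : X) (y : Y) :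
    cpt i j p B l k x y = p (Grassmann.cf B l k (i x) (j y)) := rfl

variable [Module Cl S] [IsScalarTower ℝ Cl S] {ω : S →ₗ[ℝ] S →ₗ[ℝ] ℝ} {B : Br h₀ W S}
variable (hB : IsFilteredDeformation ω B) (l : ExteriorAlgebra ℝ W →ₗ[ℝ] ℝ)
include hB

lemma cpt_SS_comm {Z : Type*} [AddCommGroup Z] [Module ℝ Z] (p : H h₀ S →ₗ[ℝ] Z) (k : ℕ) (s t : S) :
    cpt iS iS p B l k s t = cpt iS iS p B l k t s :=
  congrArg p (hB.isDeformation.cf_comm l (by decide) k (inS_mem s) (inS_mem t))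

lemma cpt_VS {Z : Type*} [AddCommGroup Z] [Module ℝ Z] (p : H h₀ S →ₗ[ℝ] Z) (k : ℕ) (s : S) (v : V) :
    cpt iV iS p B l k v s = -cpt iS iV p B l k s v :=
  hB.isDeformation.apply_cf_neg l p (by decide) k (inV_mem v) (inS_mem s)

lemma cpt_VV {Z : Type*} [AddCommGroup Z] [Module ℝ Z] (p : H h₀ S →ₗ[ℝ] Z) (k : ℕ) (v w : V) :
    cpt iV iV p B l k v w = -cpt iV iV p B l k w v :=
  hB.isDeformation.apply_cf_neg l p (by decide) k (inV_mem v) (inV_mem w)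

/-- The `V`-component of `[[s, s], s] = 0` at order one. -/
lemma spencer_cocycle (s : S) : kappaL ω (cpt iS iS pS B l 1 s s) s =
    cpt iS iV pV B l 1 s (kappaL ω s s) := by
  have h : cpt iV iS pV B l 1 (kappaL ω s s) s + kappaL ω (cpt iS iS pS B l 1 s s) s = 0 :=
    hB.isDeformation.cube_one l pV (by decide) (inS_mem s) (brk_SS s s) (pV_brk_inS_right s)
  rw [cpt_VS hB, neg_add_eq_zero] at h
  exact h.symm

/-- The `S`-component at order one of the Jacobi identity for `A`, `s`, `s`: the action of `A` on
the cocycle is a coboundary. -/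
lemma first_order_SS (A : h₀) (s : S) :
    spin (asEnd A) (cpt iS iS pS B l 1 s s) - (2 : ℝ) • cpt iS iS pS B l 1 (spin (asEnd A) s) s =
      (2 : ℝ) • spin (cpt iA iS pA B l 1 A s : Module.End ℝ V) s
        - cpt iA iV pS B l 1 A (kappaL ω s s) := by
  have h : cpt iA iV pS B l 1 A (kappaL ω s s) + spin (asEnd A) (cpt iS iS pS B l 1 s s) =
      (2 : ℝ) • (cpt iS iS pS B l 1 (spin (asEnd A) s) s
        + spin (cpt iA iS pA B l 1 A s : Module.End ℝ V) s) :=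
    hB.isDeformation.even_odd_one l pS (by decide) (inA_mem A) (inS_mem s) (brk_SS s s) (brk_AS A s)
      (pS_brk_inA A) (pS_brk_inS_right s)
  rw [smul_add] at h
  rw [sub_eq_sub_iff_add_eq_add, add_comm, h, add_comm]

lemma first_order_SV (A : h₀) (s : S) (v : V) :
    asEnd A (cpt iS iV pV B l 1 s v) - cpt iS iV pV B l 1 (spin (asEnd A) s) v
      - cpt iS iV pV B l 1 s (asEnd A v) =
      (cpt iA iS pA B l 1 A s : Module.End ℝ V) v - kappaL ω s (cpt iA iV pS B l 1 A v) := by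
  have h : cpt iA iV pV B l 1 A 0 + (-1 : ℝ) ^ 0 • asEnd A (cpt iS iV pV B l 1 s v) =
      cpt iS iV pV B l 1 (spin (asEnd A) s) v + (cpt iA iS pA B l 1 A s : Module.End ℝ V) v
      + (-1 : ℝ) ^ (0 * 1) • (cpt iS iV pV B l 1 s (asEnd A v)
        + (-1 : ℝ) ^ 1 • kappaL ω s (cpt iA iV pS B l 1 A v)) :=
    hB.isDeformation.jacobi_one_apply l pV (inA_mem A) (inS_mem s) (brk_SV s v) (brk_AS A s)
      (brk_AV A v) (pV_brk_inA A) (pV_brk_inV_right v) (pV_brk_inS s)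
  rw [map_zero, zero_add, zero_mul, pow_zero, one_smul, one_smul, pow_one, neg_one_smul] at h
  rw [h]
  abel

section SquareZero

variable (hF : FirstOrderSquareZero B)
include hF

lemma second_order_SSS (s : S) :
    spin (cpt iS iS pA B l 2 s s : Module.End ℝ V) s = -cpt iV iS pS B l 2 (kappaL ω s s) s := by
  have h : cpt iV iS pS B l 2 (kappaL ω s s) s
      + spin (cpt iS iS pA B l 2 s s : Module.End ℝ V) s = 0 :=
    hB.isDeformation.cube_two l pS (by decide) (inS_mem s) (brk_SS s s) (pS_brk_inS_right s)
      (hF.2.1 s)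
  exact eq_neg_of_add_eq_zero_right h

/-- The `V`-component at order two of `2 [s, [s, v]] = [[s, s], v]`; the square-zero condition for
`s`, `v` removes the quadratic terms. -/
lemma second_order_SSV (s : S) (v : V) :
    (cpt iS iS pA B l 2 s s : Module.End ℝ V) v =
      (-2 : ℝ) • kappaL ω s (cpt iV iS pS B l 2 v s) - cpt iV iV pV B l 2 (kappaL ω s s) v := by
  have h : (2 : ℝ) • (cpt iS iV pV B l 2 s 0 + kappaL ω s (cpt iS iV pS B l 2 s v)) =
      cpt iV iV pV B l 2 (kappaL ω s s) v + (cpt iS iS pA B l 2 s s : Module.End ℝ V) v :=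
    hB.isDeformation.sq_two l pV (by decide) (inS_mem s) (brk_SS s s) (brk_SV s v) (pV_brk_inS s)
      (pV_brk_inV_right v) (hF.2.2 s v)
  rw [map_zero, zero_add] at h
  rw [cpt_VS hB, map_neg, smul_neg, neg_smul, neg_neg, h, add_sub_cancel_left]

lemma second_order_ASS (A : h₀) (s : S) :
    cpt iA iV pA B l 2 A (kappaL ω s s) + ⁅(A : soV), cpt iS iS pA B l 2 s s⁆ =
      (2 : ℝ) • cpt iS iS pA B l 2 (spin (asEnd A) s) s :=
  hB.isDeformation.even_odd_two l pA (by decide) (inA_mem A) (inS_mem s) (brk_SS s s) (brk_AS A s)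
    (pA_brk_inA A) (pA_brk_inS_right s) (hF.1 A s)

end SquareZero

lemma third_order (h0 : ∀ x y : H h₀ S, comp 2 (B (up x) (up y)) = 0) (s : S) (v w : V) :
    kappaL ω s (-cpt iV iV pS B l 3 v w) = (cpt iS iV pA B l 3 s v : Module.End ℝ V) w
      - (cpt iS iV pA B l 3 s w : Module.End ℝ V) v := by
  have h : (-1 : ℝ) ^ (3 * 1) • kappaL ω s (cpt iV iV pS B l 3 v w) =
      (cpt iS iV pA B l 3 s v : Module.End ℝ V) w
        + (-1 : ℝ) ^ (1 * 2 + 3 * 2) • -(cpt iS iV pA B l 3 s w : Module.End ℝ V) v :=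
    hB.isDeformation.jacobi_apply_of_comp_eq_zero l pV le_rfl
      (fun m hm => by
        obtain rfl : m = 2 := by have := Finset.mem_Ico.1 hm; omega
        exact h0) (inS_mem s) (inV_mem v) (brk_VV v w) (brk_SV s v) (brk_SV s w) (pV_brk_inS s)
      (pV_brk_inV_right w) (pV_brk_inV v)
  norm_num at h
  rw [map_neg, h, sub_eq_add_neg]

/-- At order four the bracket of two vectors is `𝔥₀`-valued, and in the Jacobi identity for `v`,
`w`, `s` only its action on the spinor survives. -/
lemma fourth_order (h0 : ∀ m ∈ Finset.Ico 2 4, ∀ x y : H h₀ S, comp m (B (up x) (up y)) = 0)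
    (s : S) (v w : V) : spin (cpt iV iV pA B l 4 v w : Module.End ℝ V) s = 0 := by
  have h : (-1 : ℝ) ^ (4 * 2) • (0 : S) = spin (cpt iV iV pA B l 4 v w : Module.End ℝ V) s
        + (-1 : ℝ) ^ (2 * 2 + 4 * 2) • (0 : S) :=
    hB.isDeformation.jacobi_apply_of_comp_eq_zero l pS (by norm_num) h0
      (inV_mem v) (inV_mem w) (brk_VS s w) (brk_VV v w) (brk_VS s v) (pS_brk_inV v)
      (pS_brk_inS_right s) (pS_brk_inV w)
  rw [smul_zero, smul_zero, add_zero] at h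
  exact h.symm

end Orders

/-! ## Removing the components of higher order -/

section Higher

lemma sub_add_eq_zero_of_add_neg {E : Type*} [AddCommGroup E] [Module ℝ E] {x q r z : E}
    (h : x + -q = (2 : ℝ) • -r) (hz : z = r + r) : x - q + z = 0 := by
  rw [sub_eq_add_neg, h, hz, two_smul]
  abel

lemma eq_sub_of_sub_add_eq_zero {E : Type*} [AddCommGroup E] {x q r : E}
    (h : x - q + r = 0) : x = q - r := by
  rw [eq_sub_iff_add_eq, ← sub_eq_zero, ← h]
  abel

variable {S : Type*} [AddCommGroup S] [Module ℝ S] [Module Cl S] [IsScalarTower ℝ Cl S]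
variable [Module.Finite ℝ S]

lemma contr_map {E E' : Type*} [AddCommGroup E] [Module ℝ E] [AddCommGroup E'] [Module ℝ E']
    (ω : S →ₗ[ℝ] S →ₗ[ℝ] ℝ) (f : S →ₗ[ℝ] S →ₗ[ℝ] E) (g : E →ₗ[ℝ] E') (T : Module.End ℝ S) :
    g (contr ω f T) = contr ω (f.compr₂ g) T := by
  rw [contr_apply, contr_apply, map_sum]
  rfl

variable [IsSimpleModule Cl S]
variable {ω : S →ₗ[ℝ] S →ₗ[ℝ] ℝ} (hω : IsInvariantSymplectic ω)

include hω in
/-- The Dirac current is surjective. -/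
lemma eq_zero_of_kappaL {E : Type*} [AddCommGroup E] [Module ℝ E] {f : V →ₗ[ℝ] E}
    (h : ∀ s, f (kappaL ω s s) = 0) : f = 0 := by
  have h1 : ∀ s t, f (kappaL ω s t) = 0 := fun s t => by
    have h2 := h (s + t)
    simp only [map_add, LinearMap.add_apply, h, zero_add, add_zero] at h2
    rw [kappaL_comm hω t s, ← two_smul ℝ] at h2
    exact (smul_eq_zero.1 h2).resolve_left two_ne_zero
  refine LinearMap.ext fun c => ?_
  have h3 := congrArg f (contr_kappaL_cl hω c)
  rw [contr_apply, map_sum, Finset.sum_eq_zero fun i _ => h1 _ _, map_smul] at h3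
  exact (smul_eq_zero.1 h3.symm).resolve_left (by norm_num)

variable {h₀ : LieSubalgebra ℝ soV} {W : Type*} [AddCommGroup W] [Module ℝ W] {B : Br h₀ W S}
variable {n : V} (hn : 0 < eta n n) (hfix : ∀ A : h₀, asEnd A n = 0)

include hω hn hfix in
lemma exists_second_order_solution (hB : IsFilteredDeformation ω B) (hF : FirstOrderSquareZero B)
    (l : ExteriorAlgebra ℝ W →ₗ[ℝ] ℝ) : ∃ Z : V →ₗ[ℝ] soV,
      (∀ v s, cpt iV iS pS B l 2 v s = spin (Z v : Module.End ℝ V) s) ∧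
      (∀ s t, cpt iS iS pA B l 2 s t = -Z (kappaL ω s t)) ∧
      (∀ v w, cpt iV iV pV B l 2 v w = (Z v : Module.End ℝ V) w - (Z w : Module.End ℝ V) v) ∧
      ∀ A v, cpt iA iV pA B l 2 A v = ⁅(A : soV), Z v⁆ - Z (asEnd A v) := by
  obtain ⟨Z, -, h1, h2, h3⟩ := exists_second_order hω (γ := cpt iS iS pA B l 2)
    (β := cpt iV iS pS B l 2) (α := cpt iV iV pV B l 2) (cpt_SS_comm hB l pA 2)
    (second_order_SSS hB l hF) (second_order_SSV hB l hF) (cpt_VV hB l pV 2) hn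
    (fun s t => hfix _)
  refine ⟨Z, h1, h2, h3, fun A v => ?_⟩
  -- The Jacobi identity determines the component `𝔥₀ × V → 𝔥₀` only on Dirac currents `κ(s, s)`,
  -- which span `V`.
  have h4 : cpt iA iV pA B l 2 A - LieAlgebra.ad ℝ soV (A : soV) ∘ₗ Z + Z ∘ₗ asEnd A = 0 := by
    refine eq_zero_of_kappaL hω fun s => ?_
    have h5 := second_order_ASS hB l hF A s
    rw [h2, h2, lie_neg] at h5
    refine sub_add_eq_zero_of_add_neg h5 ?_
    change Z (asEnd A (kappaL ω s s)) = _
    rw [← map_add, ← kappaL_spin hω (A : soV) s s, kappaL_comm hω s]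
  exact eq_sub_of_sub_add_eq_zero (congrArg (fun f : V →ₗ[ℝ] soV => f v) h4)

/-- The change of trivialization of order two that is determined by a contraction of the part of
order two of a bracket. -/
def contrShift {M : Type*} [AddCommGroup M] [Module ℝ M] (ω : S →ₗ[ℝ] S →ₗ[ℝ] ℝ) (i : S →ₗ[ℝ] M)
    (q : M →ₗ[ℝ] Module.End ℝ S)
    (B : Grassmann.HL W M →ₗ[ℝ] Grassmann.HL W M →ₗ[ℝ] Grassmann.HL W M) :
    M →ₗ[ℝ] Grassmann.HL W M :=
  (-(1 / 32) : ℝ) • (contr ω (((B.compl₁₂ Grassmann.upL Grassmann.upL).compl₁₂ i i).compr₂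
    (Grassmann.comp 2))).comp q

section ContrShift

variable {M : Type*} [AddCommGroup M] [Module ℝ M] (ω : S →ₗ[ℝ] S →ₗ[ℝ] ℝ) {i : S →ₗ[ℝ] M}
variable {q : M →ₗ[ℝ] Module.End ℝ S}
variable {B : Grassmann.HL W M →ₗ[ℝ] Grassmann.HL W M →ₗ[ℝ] Grassmann.HL W M}

lemma contrShift_apply (x : M) : contrShift ω i q B x = (-(1 / 32) : ℝ) • contr ω
    (((B.compl₁₂ Grassmann.upL Grassmann.upL).compl₁₂ i i).compr₂ (Grassmann.comp 2)) (q x) := rfl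

lemma contrShift_eq_zero {x : M} (h : q x = 0) : contrShift ω i q B x = 0 := by
  rw [contrShift_apply, h, map_zero, smul_zero]

lemma contrShift_mem {P : Submodule ℝ (Grassmann.HL W M)}
    (h : ∀ s t, Grassmann.comp 2 (B (Grassmann.up (i s)) (Grassmann.up (i t))) ∈ P) (x : M) :
    contrShift ω i q B x ∈ P := by
  rw [contrShift_apply, contr_apply]
  exact P.smul_mem _ (P.sum_mem fun i _ => h _ _)

lemma apply_coef_contrShift {E : Type*} [AddCommGroup E] [Module ℝ E] (p : M →ₗ[ℝ] E)
    (l : ExteriorAlgebra ℝ W →ₗ[ℝ] ℝ) {f : S →ₗ[ℝ] S →ₗ[ℝ] E}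
    (h : ∀ s t, p (Grassmann.cf B l 2 (i s) (i t)) = f s t) (x : M) :
    p (Grassmann.coef l (contrShift ω i q B x)) = (-(1 / 32) : ℝ) • contr ω f (q x) := by
  rw [contrShift_apply, map_smul, map_smul, contr_apply, contr_apply, map_sum, map_sum]
  congr 1
  refine Finset.sum_congr rfl fun j _ => ?_
  rw [← h, Grassmann.cf_apply]
  rfl

variable {G : ℕ → Submodule ℝ M} {b : M →ₗ[ℝ] M →ₗ[ℝ] M}

lemma contrShift_mem_piece (hB : Grassmann.IsDeformation G b B) (hi : ∀ s, i s ∈ G 1) (x : M) :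
    contrShift ω i q B x ∈ Grassmann.piece G W 2 0 :=
  contrShift_mem ω (fun s t => Grassmann.comp_mem_piece 2 (hB.up_up_mem (hi s) (hi t))) x

lemma isShift_contrShift (hB : Grassmann.IsDeformation G b B) (hi : ∀ s, i s ∈ G 1)
    (hq : ∀ j < 2, ∀ x ∈ G j, q x = 0) (hG : ∀ j, 3 ≤ j → ∀ x ∈ G j, x = 0) :
    Grassmann.IsShift G 2 (contrShift ω i q B) where
  span := hB.span
  pos := one_le_two
  mem := fun j hj x hx => by
    rcases hj.eq_or_lt with rfl | hj
    · exact contrShift_mem_piece ω hB hi x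
    · rw [hG j hj x hx, map_zero]
      exact Submodule.zero_mem _
  zero := fun j hj x hx => contrShift_eq_zero ω (hq j hj x hx)

lemma extend_contrShift (hB : Grassmann.IsDeformation G b B) (hi : ∀ s, i s ∈ G 1)
    (hq : ∀ j < 2, ∀ x ∈ G j, q x = 0) (hG : ∀ j, 3 ≤ j → ∀ x ∈ G j, x = 0) (x : M) :
    Grassmann.extend (contrShift ω i q B) (contrShift ω i q B x) = 0 :=
  (Submodule.mem_bot ℝ).1 ((isShift_contrShift ω hB hi hq hG).extend_mem_piece (P := ⊥)
    (fun h => absurd h (by norm_num)) (contrShift_mem_piece ω hB hi x))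

end ContrShift

lemma cl_pV_eq_zero (j : ℕ) (hj : j < 2) (x : H h₀ S) (hx : x ∈ hGr h₀ S j) :
    (cl.comp pV) x = (0 : Module.End ℝ S) := by
  have h : pV x = 0 := by
    interval_cases j
    · exact hx.2.2
    · exact hx.2.2
  rw [LinearMap.comp_apply, h, map_zero]

/-- The change of trivialization of order two that is determined by the Dirac current. -/
def secondShift (ω : S →ₗ[ℝ] S →ₗ[ℝ] ℝ) (B : Br h₀ W S) : H h₀ S →ₗ[ℝ] HL h₀ W S :=
  contrShift ω iS (cl.comp pV) B

lemma isShift_secondShift (hB : IsFilteredDeformation ω B) :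
    Grassmann.IsShift (hGr h₀ S) 2 (secondShift ω B) :=
  isShift_contrShift ω hB.isDeformation inS_mem cl_pV_eq_zero fun _ hj _ => eq_zero_of_mem_hGr hj

lemma extend_secondShift (hB : IsFilteredDeformation ω B) (x : H h₀ S) :
    Grassmann.extend (secondShift ω B) (secondShift ω B x) = 0 :=
  extend_contrShift ω hB.isDeformation inS_mem cl_pV_eq_zero (fun _ hj _ => eq_zero_of_mem_hGr hj) x

include hω in
-- `Z` depends on the functional `l`, while the shift is one map into `Λ² ⊗ 𝔥₀`. Being a
-- contraction, it has the right coefficient along every `l` at once, by `contr_kappaL_cl`.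
lemma pA_coef_secondShift (l : ExteriorAlgebra ℝ W →ₗ[ℝ] ℝ) {Z : V →ₗ[ℝ] soV}
    (hZ : ∀ s t, cpt iS iS pA B l 2 s t = -Z (kappaL ω s t)) (x : H h₀ S) :
    pA (Grassmann.coef l (secondShift ω B x)) = Z (pV x) := by
  have h1 : pA (Grassmann.coef l (secondShift ω B x)) =
      (-(1 / 32) : ℝ) • contr ω ((kappaL ω).compr₂ (-Z)) (cl (pV x)) :=
    apply_coef_contrShift ω pA l hZ x
  have h2 := contr_map ω (kappaL ω) (-Z) (cl (pV x))
  rw [h1, ← h2, contr_kappaL_cl hω, map_smul, smul_smul,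
    show (-(1 / 32) : ℝ) * 32 = -1 by norm_num, neg_one_smul]
  exact neg_neg (Z (pV x))

end Higher

namespace Grassmann.IsDeformation

variable {W : Type*} [AddCommGroup W] [Module ℝ W] {M : Type*} [AddCommGroup M] [Module ℝ M]
variable {G : ℕ → Submodule ℝ M} {b : M →ₗ[ℝ] M →ₗ[ℝ] M}
variable {B : HL W M →ₗ[ℝ] HL W M →ₗ[ℝ] HL W M} (hB : IsDeformation G b B)
include hB

lemma apply_cf_conj_eq_zero (l : ExteriorAlgebra ℝ W →ₗ[ℝ] ℝ) {E : Type*} [AddCommGroup E]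
    [Module ℝ E] (p : M →ₗ[ℝ] E) {n : M →ₗ[ℝ] HL W M} (hn : IsShift G 2 n)
    (hN : ∀ x, extend n (n x) = 0) {i : ℕ} {x y c : M} (hx : x ∈ G i) (hc : b x y = c) {u v w : E}
    (hu : p (b (coef l (n x)) y) = u) (hv : p (b x (coef l (n y))) = v) (hw : p (coef l (n c)) = w)
    (h : p (cf B l 2 x y) + w = u + v) :
    p (cf (Grassmann.conj (onePlus n hN) B) l 2 x y) = 0 := by
  rw [hB.cf_conj hn hN l hx, map_add, map_sub, map_sub, map_smul, hc, hu, hv, hw,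
    Even.neg_one_pow (even_two_mul i), one_smul, ← sub_eq_zero.2 h]
  abel

end Grassmann.IsDeformation

lemma add_eq_zero_add_of_eq_sub {E : Type*} [AddCommGroup E] {a x y : E} (h : a = x - y) :
    a + y = 0 + x := by
  rw [h, sub_add_cancel, zero_add]

lemma add_eq_zero_add_zero_of_eq_neg {E : Type*} [AddCommGroup E] {a x : E} (h : a = -x) :
    a + x = 0 + 0 := by
  rw [h, neg_add_cancel, zero_add]

/-! ### Vanishing of all components of order at least two -/

section FirstOrderForm

variable {S : Type*} [AddCommGroup S] [Module ℝ S] [Module Cl S] [IsScalarTower ℝ Cl S]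
variable [IsSimpleModule Cl S]
variable {ω : S →ₗ[ℝ] S →ₗ[ℝ] ℝ} (hω : IsInvariantSymplectic ω)
variable {h₀ : LieSubalgebra ℝ soV} {W : Type*} [AddCommGroup W] [Module ℝ W] {B : Br h₀ W S}

lemma exists_inA {x : H h₀ S} (hx : x ∈ hGr h₀ S 0) : ∃ A : h₀, x = inA A := ⟨_, eq_inA hx⟩
lemma exists_inS {x : H h₀ S} (hx : x ∈ hGr h₀ S 1) : ∃ s : S, x = inS h₀ s := ⟨_, eq_inS hx⟩
lemma exists_inV {x : H h₀ S} (hx : x ∈ hGr h₀ S 2) : ∃ v : V, x = inV h₀ v := ⟨_, eq_inV hx⟩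

/-- A component of positive order of the bracket vanishes if it does on elements of `𝔥₀`, `S` and
`V`. -/
lemma comp_eq_zero_of_cpt (hB : IsFilteredDeformation ω B) {k : ℕ} (hk : 2 ≤ k)
    (h02 : ∀ l (A : h₀) (v : V), Grassmann.cf B l k (inA A) (inV h₀ v) = 0)
    (h11 : ∀ l (s t : S), Grassmann.cf B l k (inS h₀ s) (inS h₀ t) = 0)
    (h12 : ∀ l (s : S) (v : V), Grassmann.cf B l k (inS h₀ s) (inV h₀ v) = 0)
    (h22 : ∀ l (v w : V), Grassmann.cf B l k (inV h₀ v) (inV h₀ w) = 0)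
    (x y : H h₀ S) : comp k (B (up x) (up y)) = 0 := by
  refine hB.isDeformation.comp_eq_zero_of_cf (fun l i j hij x hx y hy => ?_) x y
  rcases lt_or_ge (i + j) k with hlt | hge
  · exact hB.isDeformation.cf_eq_zero_of_lt l hlt hx hy
  rcases le_or_gt 3 j with hj | hj
  · obtain rfl := eq_zero_of_mem_hGr hj hy
    exact LinearMap.map_zero _
  interval_cases j
  · omega
  · obtain rfl : i = 1 := by omega
    obtain ⟨s, rfl⟩ := exists_inS hx
    obtain ⟨t, rfl⟩ := exists_inS hy
    exact h11 l s t
  · obtain ⟨w, rfl⟩ := exists_inV hy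
    interval_cases i
    · obtain ⟨A, rfl⟩ := exists_inA hx
      exact h02 l A w
    · obtain ⟨s, rfl⟩ := exists_inS hx
      exact h12 l s w
    · obtain ⟨v, rfl⟩ := exists_inV hx
      exact h22 l v w

lemma comp_eq_zero_of_four_lt (hB : IsFilteredDeformation ω B) {k : ℕ} (hk : 4 < k)
    (x y : H h₀ S) : comp k (B (up x) (up y)) = 0 :=
  comp_eq_zero_of_cpt hB (by omega)
    (fun l A v => hB.isDeformation.cf_eq_zero_of_lt l (by omega) (inA_mem A) (inV_mem v))
    (fun l s t => hB.isDeformation.cf_eq_zero_of_lt l (by omega) (inS_mem s) (inS_mem t))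
    (fun l s v => hB.isDeformation.cf_eq_zero_of_lt l (by omega) (inS_mem s) (inV_mem v))
    (fun l v w => hB.isDeformation.cf_eq_zero_of_lt l (by omega) (inV_mem v) (inV_mem w)) x y

variable {n : V} (hn : 0 < eta n n) (hfix : ∀ A : h₀, asEnd A n = 0)

include hω hn hfix in
lemma comp_three_eq_zero (hB : IsFilteredDeformation ω B)
    (h2 : ∀ x y : H h₀ S, comp 2 (B (up x) (up y)) = 0) (x y : H h₀ S) :
    comp 3 (B (up x) (up y)) = 0 := by
  have : Module.Finite ℝ S := finite_spinor
  have h : ∀ l, (∀ v w, -cpt iV iV pS B l 3 v w = 0) ∧ ∀ s v, cpt iS iV pA B l 3 s v = 0 := fun l =>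
    third_order_eq_zero hω (σ := fun v w => -cpt iV iV pS B l 3 v w)
      (ρ := fun s v => cpt iS iV pA B l 3 s v) hn (fun s v => hfix _) (third_order hB l h2)
  refine comp_eq_zero_of_cpt hB (by norm_num)
    (fun l A v => hB.isDeformation.cf_eq_zero_of_lt l (by norm_num) (inA_mem A) (inV_mem v))
    (fun l s t => hB.isDeformation.cf_eq_zero_of_lt l (by norm_num) (inS_mem s) (inS_mem t))
    (fun l s v => ?_) (fun l v w => ?_) x y
  · exact eq_zero_of_pA (hB.isDeformation.cf_mem l 3 (inS_mem s) (inV_mem v)) ((h l).2 s v)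
  · exact eq_zero_of_pS (hB.isDeformation.cf_mem l 3 (inV_mem v) (inV_mem w))
      (neg_eq_zero.1 ((h l).1 v w))

lemma comp_four_eq_zero (hB : IsFilteredDeformation ω B)
    (h2 : ∀ x y : H h₀ S, comp 2 (B (up x) (up y)) = 0)
    (h3 : ∀ x y : H h₀ S, comp 3 (B (up x) (up y)) = 0) (x y : H h₀ S) :
    comp 4 (B (up x) (up y)) = 0 := by
  have := IsSimpleModule.nontrivial Cl S
  have h : ∀ m ∈ Finset.Ico 2 4, ∀ x y : H h₀ S, comp m (B (up x) (up y)) = 0 := fun m hm => by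
    have h4 := Finset.mem_Ico.1 hm
    obtain rfl | rfl : m = 2 ∨ m = 3 := by omega
    · exact h2
    · exact h3
  refine comp_eq_zero_of_cpt hB (by norm_num)
    (fun l A v => hB.isDeformation.cf_eq_zero_of_lt l (by norm_num) (inA_mem A) (inV_mem v))
    (fun l s t => hB.isDeformation.cf_eq_zero_of_lt l (by norm_num) (inS_mem s) (inS_mem t))
    (fun l s v => hB.isDeformation.cf_eq_zero_of_lt l (by norm_num) (inS_mem s) (inV_mem v))
    (fun l v w => ?_) x y
  exact eq_zero_of_pA (hB.isDeformation.cf_mem l 4 (inV_mem v) (inV_mem w))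
    (spinL_injective (S := S) (LinearMap.ext fun s => fourth_order hB l h s v w))

/-- The four formulas for the second-order components say that they form the coboundary of `Z`,
which is what the change of trivialization subtracts. -/
lemma comp_two_conj_eq_zero (hB : IsFilteredDeformation ω B) {m : H h₀ S →ₗ[ℝ] HL h₀ W S}
    (hm : Grassmann.IsShift (hGr h₀ S) 2 m) (hN : ∀ x, Grassmann.extend m (m x) = 0)
    (hZ : ∀ l, ∃ Z : V →ₗ[ℝ] soV,
      (∀ v s, cpt iV iS pS B l 2 v s = spin (Z v : Module.End ℝ V) s) ∧
      (∀ s t, cpt iS iS pA B l 2 s t = -Z (kappaL ω s t)) ∧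
      (∀ v w, cpt iV iV pV B l 2 v w = (Z v : Module.End ℝ V) w - (Z w : Module.End ℝ V) v) ∧
      (∀ A v, cpt iA iV pA B l 2 A v = ⁅(A : soV), Z v⁆ - Z (asEnd A v)) ∧
      ∀ x, pA (Grassmann.coef l (m x)) = Z (pV x)) (x y : H h₀ S) :
    comp 2 (Grassmann.conj (Grassmann.onePlus m hN) B (up x) (up y)) = 0 := by
  have hD := hB.isDeformation
  have hD' := hD.conj_onePlus hm hN
  refine comp_eq_zero_of_cpt (isFilteredDeformation_of_isDeformation hD') le_rfl
    (fun l A v => ?_) (fun l s t => ?_) (fun l s v => ?_) (fun l v w => ?_) x y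
  · obtain ⟨Z, -, -, -, h4, h5⟩ := hZ l
    exact eq_zero_of_pA (hD'.cf_mem l 2 (inA_mem A) (inV_mem v))
      (hD.apply_cf_conj_eq_zero l pA hm hN (inA_mem A) (brk_AV A v) (pA_brk_inV_right v _)
        ((pA_brk_inA A _).trans (congrArg (fun X => ⁅(A : soV), X⁆) (h5 _))) (h5 _)
        (add_eq_zero_add_of_eq_sub (h4 A v)))
  · obtain ⟨Z, -, h2, -, -, h5⟩ := hZ l
    exact eq_zero_of_pA (hD'.cf_mem l 2 (inS_mem s) (inS_mem t))
      (hD.apply_cf_conj_eq_zero l pA hm hN (inS_mem s) (brk_SS s t) (pA_brk_inS_right t _)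
        (pA_brk_inS s _) (h5 _) (add_eq_zero_add_zero_of_eq_neg (h2 s t)))
  · obtain ⟨Z, h1, -, -, -, h5⟩ := hZ l
    have h6 := cpt_VS hB l pS 2 s v
    rw [h1] at h6
    have h7 : pS (Grassmann.coef l (m 0)) = 0 := by
      rw [LinearMap.map_zero m, LinearMap.map_zero (Grassmann.coef l), LinearMap.map_zero pS]
    exact eq_zero_of_pS (hD'.cf_mem l 2 (inS_mem s) (inV_mem v))
      (hD.apply_cf_conj_eq_zero l pS hm hN (inS_mem s) (brk_SV s v) (pS_brk_inV_right v _)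
        ((pS_brk_inS s _).trans (congrArg (fun X : soV => -spin (X : Module.End ℝ V) s) (h5 _))) h7
        (by rw [add_zero, zero_add]; exact neg_eq_iff_eq_neg.1 h6.symm))
  · obtain ⟨Z, -, -, h3, -, h5⟩ := hZ l
    have h7 : pV (Grassmann.coef l (m 0)) = 0 := by
      rw [LinearMap.map_zero m, LinearMap.map_zero (Grassmann.coef l), LinearMap.map_zero pV]
    exact eq_zero_of_pV (hD'.cf_mem l 2 (inV_mem v) (inV_mem w))
      (hD.apply_cf_conj_eq_zero l pV hm hN (inV_mem v) (brk_VV v w)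
        ((pV_brk_inV_right w _).trans (congrArg (fun X : soV => (X : Module.End ℝ V) w) (h5 _)))
        ((pV_brk_inV v _).trans (congrArg (fun X : soV => -(X : Module.End ℝ V) v) (h5 _))) h7
        (by rw [add_zero, ← sub_eq_add_neg]; exact h3 v w))

include hω hn hfix in
/-- A deformation whose first-order part squares to zero is isomorphic to a deformation of first
order with the same first-order part. -/
theorem exists_isFirstOrder (hB : IsFilteredDeformation ω B) (hF : FirstOrderSquareZero B) :
    ∃ B' : Br h₀ W S, IsFilteredDeformation ω B' ∧ Isomorphic B B' ∧
      (∀ x y : H h₀ S, comp 1 (B' (up x) (up y)) = comp 1 (B (up x) (up y))) ∧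
      IsFirstOrder B' := by
  have : Module.Finite ℝ S := finite_spinor
  have hm := isShift_secondShift hB
  have hN := extend_secondShift hB
  have hB' := isFilteredDeformation_of_isDeformation (hB.isDeformation.conj_onePlus hm hN)
  refine ⟨_, hB', isomorphic_conj_onePlus hm hN,
    hB.isDeformation.comp_conj_of_lt hm hN one_lt_two, ?_⟩
  have h2 := comp_two_conj_eq_zero hB hm hN fun l => by
    obtain ⟨Z, h1, h2, h3, h4⟩ := exists_second_order_solution hω hn hfix hB hF l
    exact ⟨Z, h1, h2, h3, h4, pA_coef_secondShift hω l h2⟩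
  have h3 := comp_three_eq_zero hω hn hfix hB' h2
  have h4 := comp_four_eq_zero hB' h2 h3
  intro x y k hk
  rcases lt_or_ge 4 k with h | h
  · exact comp_eq_zero_of_four_lt hB' h x y
  · interval_cases k
    · exact h2 x y
    · exact h3 x y
    · exact h4 x y

end FirstOrderForm

/-! ## Changes of trivialization of order one -/

namespace Grassmann

variable {W : Type*} [AddCommGroup W] [Module ℝ W] {M : Type*} [AddCommGroup M] [Module ℝ M]
variable {G : ℕ → Submodule ℝ M} {b : M →ₗ[ℝ] M →ₗ[ℝ] M}
variable {B : HL W M →ₗ[ℝ] HL W M →ₗ[ℝ] HL W M}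
variable {ι : Type*} [Fintype ι] (t : Module.Basis ι ℝ W)

/-- The linear map `x ↦ ∑ᵢ tᵢ ⊗ fⁱ(x)`. -/
def firstShift (f : ι → M →ₗ[ℝ] M) : M →ₗ[ℝ] HL W M :=
  ∑ i, TensorProduct.mk ℝ (ExteriorAlgebra ℝ W) M (ExteriorAlgebra.ι ℝ (t i)) ∘ₗ f i

lemma firstShift_apply (f : ι → M →ₗ[ℝ] M) (x : M) : firstShift t f x = ∑ i, tx t i (f i x) := by
  rw [firstShift, LinearMap.sum_apply]
  rfl

/-- The coordinate functional on `Λ¹ W`, extended by zero to `Λ^• W`. -/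
def coordL (i : ι) : ExteriorAlgebra ℝ W →ₗ[ℝ] ℝ := t.coord i ∘ₗ ExteriorAlgebra.ιInv (R := ℝ) (M := W)

lemma coeffOne_sum_tx (x : ι → M) (i : ι) : coeffOne (t.coord i) (∑ j, tx t j (x j)) = x i := by
  classical
  rw [map_sum, Finset.sum_eq_single_of_mem i (Finset.mem_univ i) fun j _ hj => by
    rw [coeffOne_tx, Module.Basis.coord_apply, Module.Basis.repr_self, Finsupp.single_eq_of_ne hj.symm,
      zero_smul], coeffOne_tx, Module.Basis.coord_apply, Module.Basis.repr_self,
    Finsupp.single_eq_same, one_smul]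

lemma comp_one_eq_sum_iff (z : HL W M) (x : ι → M) :
    comp 1 z = ∑ i, tx t i (x i) ↔ ∀ i, coeffOne (t.coord i) z = x i := by
  refine ⟨fun h i => ?_, fun h => ?_⟩
  · rw [← coeffOne_comp_one, h, coeffOne_sum_tx]
  · rw [comp_one_eq t]
    exact Finset.sum_congr rfl fun i _ => by rw [h]

lemma cf_coordL (B : HL W M →ₗ[ℝ] HL W M →ₗ[ℝ] HL W M) (i : ι) (x y : M) :
    cf B (coordL t i) 1 x y = coeffOne (t.coord i) (B (up x) (up y)) := cf_one B _ x y

lemma coef_firstShift (f : ι → M →ₗ[ℝ] M) (i : ι) (x : M) :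
    coef (coordL t i) (firstShift t f x) = f i x := by
  rw [firstShift_apply]
  exact coeffOne_sum_tx t (fun j => f j x) i

variable {f : ι → M →ₗ[ℝ] M}

lemma isShift_firstShift (hG : ⨆ j, G j = ⊤) (h0 : ∀ i, ∀ x ∈ G 0, f i x = 0)
    (h : ∀ i j, ∀ x ∈ G (j + 1), f i x ∈ G j) : IsShift G 1 (firstShift t f) where
  span := hG
  pos := le_rfl
  mem := fun j hj x hx => by
    obtain ⟨j, rfl⟩ := Nat.exists_eq_add_of_le' hj
    rw [firstShift_apply, Nat.add_sub_cancel]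
    exact Submodule.sum_mem _ fun i _ => tx_mem_piece t i (h i j x hx)
  zero := fun j hj x hx => by
    obtain rfl : j = 0 := by omega
    rw [firstShift_apply]
    exact Finset.sum_eq_zero fun i _ => by rw [h0 i x hx, tx, TensorProduct.tmul_zero]

lemma extend_firstShift (h : ∀ i j x, f i (f j x) = 0) (x : M) :
    extend (firstShift t f) (firstShift t f x) = 0 := by
  rw [firstShift_apply, map_sum]
  refine Finset.sum_eq_zero fun j _ => ?_
  rw [tx, extend_tmul, firstShift_apply, Finset.sum_eq_zero fun i _ => by
    rw [h, tx, TensorProduct.tmul_zero], smul_zero]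

lemma IsDeformation.apply_cf_one_conj (hB : IsDeformation G b B) (l : ExteriorAlgebra ℝ W →ₗ[ℝ] ℝ)
    {E : Type*} [AddCommGroup E] [Module ℝ E] (p : M →ₗ[ℝ] E) {n : M →ₗ[ℝ] HL W M}
    (hn : IsShift G 1 n) (hN : ∀ x, extend n (n x) = 0) {x y c : M} (hx : x ∈ G 1)
    (hc : b x y = c) {u v w : E}
    (hu : p (b (coef l (n x)) y) = u) (hv : p (b x (coef l (n y))) = v) (hw : p (coef l (n c)) = w) :
    p (cf (Grassmann.conj (onePlus n hN) B) l 1 x y) = p (cf B l 1 x y) - u + v + w := by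
  rw [hB.cf_conj hn hN l hx, map_add, map_sub, map_sub, map_smul, hc, hu, hv, hw,
    one_mul, pow_one, neg_one_smul, sub_neg_eq_add]

end Grassmann

section FirstShift

variable {S : Type*} [AddCommGroup S] [Module ℝ S] [Module Cl S] [IsScalarTower ℝ Cl S]
variable {ω : S →ₗ[ℝ] S →ₗ[ℝ] ℝ}
variable {h₀ : LieSubalgebra ℝ soV} {W : Type*} [AddCommGroup W] [Module ℝ W] {B : Br h₀ W S}

lemma coe_soV_sub (A B : soV) : ((A - B : soV) : Module.End ℝ V) = A - B := rfl

/-- The coefficients of the infinitesimal deformation along `l` form the cocycle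
`∂(Z ⊗ φ) + ∂X + ∂Y`. -/
def IsCobdry (ω : S →ₗ[ℝ] S →ₗ[ℝ] ℝ) (B : Br h₀ W S) (l : ExteriorAlgebra ℝ W →ₗ[ℝ] ℝ)
    (φ : S →ₗ[ℝ] ℝ) (X : S →ₗ[ℝ] soV) (Y : V →ₗ[ℝ] S) : Prop :=
  cpt iS iS pS B l 1 = cobdrySS ω φ X Y ∧ cpt iS iV pV B l 1 = cobdrySV ω φ X Y

/-- A change of trivialization of order one shifts `X` and `Y` by its components, while `φ` stays
fixed. -/
lemma IsCobdry.conj (hB : IsFilteredDeformation ω B) {m : H h₀ S →ₗ[ℝ] HL h₀ W S}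
    (hm : Grassmann.IsShift (hGr h₀ S) 1 m) (hN : ∀ x, Grassmann.extend m (m x) = 0)
    {l : ExteriorAlgebra ℝ W →ₗ[ℝ] ℝ} {φ : S →ₗ[ℝ] ℝ} {X U : S →ₗ[ℝ] soV} {Y Z : V →ₗ[ℝ] S}
    (h : IsCobdry ω B l φ X Y) (hU : ∀ x, pA (Grassmann.coef l (m x)) = U (pS x))
    (hZ : ∀ x, pS (Grassmann.coef l (m x)) = Z (pV x)) :
    IsCobdry ω (Grassmann.conj (Grassmann.onePlus m hN) B) l φ (X - U) (Y - Z) := by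
  have hD := hB.isDeformation
  constructor
  · refine LinearMap.ext₂ fun s t => ?_
    have h1 : cpt iS iS pS (Grassmann.conj (Grassmann.onePlus m hN) B) l 1 s t =
        cpt iS iS pS B l 1 s t - spin (U s : Module.End ℝ V) t + -spin (U t : Module.End ℝ V) s
          + Z (kappaL ω s t) :=
      hD.apply_cf_one_conj l pS hm hN (inS_mem s) (brk_SS s t)
        ((pS_brk_inS_right t _).trans (congrArg (fun X : soV => spin (X : Module.End ℝ V) t) (hU _)))
        ((pS_brk_inS s _).trans (congrArg (fun X : soV => -spin (X : Module.End ℝ V) s) (hU _)))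
        (hZ _)
    rw [h1, h.1, cobdrySS_apply, cobdrySS_apply, LinearMap.sub_apply, LinearMap.sub_apply,
      LinearMap.sub_apply, coe_soV_sub, coe_soV_sub, ← spinL_apply, ← spinL_apply, ← spinL_apply,
      ← spinL_apply, ← spinL_apply, ← spinL_apply, map_sub, map_sub, LinearMap.sub_apply, LinearMap.sub_apply]
    abel
  · refine LinearMap.ext fun s => LinearMap.ext fun v => ?_
    have h0 : pV (Grassmann.coef l (m 0)) = 0 := by
      rw [LinearMap.map_zero m, LinearMap.map_zero (Grassmann.coef l), LinearMap.map_zero pV]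
    have h1 : cpt iS iV pV (Grassmann.conj (Grassmann.onePlus m hN) B) l 1 s v =
        cpt iS iV pV B l 1 s v - (U s : Module.End ℝ V) v + kappaL ω s (Z v) + 0 :=
      hD.apply_cf_one_conj l pV hm hN (inS_mem s) (brk_SV s v)
        ((pV_brk_inV_right v _).trans (congrArg (fun X : soV => (X : Module.End ℝ V) v) (hU _)))
        ((pV_brk_inS s _).trans (congrArg (kappaL ω s) (hZ _))) h0
    rw [h1, h.2, cobdrySV_apply, cobdrySV_apply, LinearMap.sub_apply, LinearMap.sub_apply,
      coe_soV_sub, LinearMap.sub_apply, map_sub]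
    abel

variable {ι : Type*} [Fintype ι] (t : Module.Basis ι ℝ W)

/-- Since all of `S` belongs to `𝔥`, every `Y : V → S` is realized by a change of trivialization and
can be removed. -/
lemma exists_isCobdry_zero (hB : IsFilteredDeformation ω B) {φ : ι → S →ₗ[ℝ] ℝ}
    {X : ι → S →ₗ[ℝ] soV} {Y : ι → V →ₗ[ℝ] S}
    (h : ∀ i, IsCobdry ω B (Grassmann.coordL t i) (φ i) (X i) (Y i)) :
    ∃ B' : Br h₀ W S, IsFilteredDeformation ω B' ∧ Isomorphic B B' ∧
      ∀ i, IsCobdry ω B' (Grassmann.coordL t i) (φ i) (X i) 0 := by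
  have hm : Grassmann.IsShift (hGr h₀ S) 1 (Grassmann.firstShift t fun i => iS ∘ₗ Y i ∘ₗ pV) :=
    Grassmann.isShift_firstShift t iSup_hGr
      (fun i x hx => by
        have h1 : pV x = 0 := hx.2.2
        rw [LinearMap.comp_apply, LinearMap.comp_apply, h1, map_zero, map_zero])
      fun i j x hx => by
        rcases j with _ | _ | j
        · have h1 : pV x = 0 := hx.2.2
          rw [LinearMap.comp_apply, LinearMap.comp_apply, h1, map_zero, map_zero]
          exact Submodule.zero_mem _
        · exact inS_mem _
        · rw [eq_zero_of_mem_hGr (by omega) hx, map_zero]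
          exact Submodule.zero_mem _
  have hN := Grassmann.extend_firstShift t (f := fun i => iS ∘ₗ Y i ∘ₗ pV (h₀ := h₀))
    fun i j x => by
      have h1 : pV (iS (h₀ := h₀) (Y j (pV x))) = 0 := rfl
      rw [LinearMap.comp_apply, LinearMap.comp_apply, LinearMap.comp_apply, LinearMap.comp_apply, h1,
        map_zero, map_zero]
  refine ⟨_, isFilteredDeformation_of_isDeformation (hB.isDeformation.conj_onePlus hm hN),
    isomorphic_conj_onePlus hm hN, fun i => ?_⟩
  have h1 := (h i).conj hB hm hN (U := 0) (Z := Y i)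
    (fun x => by rw [Grassmann.coef_firstShift]; rfl)
    (fun x => by rw [Grassmann.coef_firstShift]; rfl)
  rwa [sub_zero, sub_self] at h1

/-- Changes of trivialization reach only `𝔥₀`-valued maps on `S`, so `X` can be normalized modulo
`𝔥₀` but not removed. -/
lemma exists_isCobdry_sub (hB : IsFilteredDeformation ω B) {φ : ι → S →ₗ[ℝ] ℝ}
    {X : ι → S →ₗ[ℝ] soV} (U : ι → S →ₗ[ℝ] h₀)
    (h : ∀ i, IsCobdry ω B (Grassmann.coordL t i) (φ i) (X i) 0) :
    ∃ B' : Br h₀ W S, IsFilteredDeformation ω B' ∧ Isomorphic B B' ∧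
      ∀ i, IsCobdry ω B' (Grassmann.coordL t i) (φ i) (X i - h₀.toSubmodule.subtype ∘ₗ U i) 0 := by
  have hm : Grassmann.IsShift (hGr h₀ S) 1 (Grassmann.firstShift t fun i => iA ∘ₗ U i ∘ₗ pS) :=
    Grassmann.isShift_firstShift t iSup_hGr
      (fun i x hx => by
        have h1 : pS x = 0 := hx.2.1
        rw [LinearMap.comp_apply, LinearMap.comp_apply, h1, map_zero, map_zero])
      fun i j x hx => by
        rcases j with _ | _ | j
        · exact inA_mem _
        · have h1 : pS x = 0 := hx.2.1
          rw [LinearMap.comp_apply, LinearMap.comp_apply, h1, map_zero, map_zero]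
          exact Submodule.zero_mem _
        · rw [eq_zero_of_mem_hGr (by omega) hx, map_zero]
          exact Submodule.zero_mem _
  have hN := Grassmann.extend_firstShift t (f := fun i => iA ∘ₗ U i ∘ₗ pS (h₀ := h₀))
    fun i j x => by
      have h1 : pS (iA (S := S) (U j (pS x))) = 0 := rfl
      rw [LinearMap.comp_apply, LinearMap.comp_apply, LinearMap.comp_apply, LinearMap.comp_apply, h1,
        map_zero, map_zero]
  refine ⟨_, isFilteredDeformation_of_isDeformation (hB.isDeformation.conj_onePlus hm hN),
    isomorphic_conj_onePlus hm hN, fun i => ?_⟩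
  have h1 := (h i).conj hB hm hN (U := h₀.toSubmodule.subtype ∘ₗ U i) (Z := 0)
    (fun x => by rw [Grassmann.coef_firstShift]; rfl)
    (fun x => by rw [Grassmann.coef_firstShift]; rfl)
  rwa [sub_zero] at h1

end FirstShift

/-! ## Deformations of first order -/

namespace Grassmann

variable {W : Type*} [AddCommGroup W] [Module ℝ W] {M : Type*} [AddCommGroup M] [Module ℝ M]
variable {G : ℕ → Submodule ℝ M} {b : M →ₗ[ℝ] M →ₗ[ℝ] M}
variable {B : HL W M →ₗ[ℝ] HL W M →ₗ[ℝ] HL W M}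

lemma up_add (x y : M) : (up (x + y) : HL W M) = up x + up y := TensorProduct.tmul_add _ _ _

lemma up_sub (x y : M) : (up (x - y) : HL W M) = up x - up y := TensorProduct.tmul_sub _ _ _

lemma tx_zero {ι : Type*} (t : Module.Basis ι ℝ W) (i : ι) : tx t i (0 : M) = 0 :=
  TensorProduct.tmul_zero _ _

namespace IsDeformation

variable (hB : IsDeformation G b B)
include hB

lemma tmul_tmul_of_even {i : ℕ} (hi : Even i) (τ : ExteriorAlgebra ℝ W) {σ : ExteriorAlgebra ℝ W}
    (hσ : σ ∈ ⋀[ℝ]^i W) (x y : M) : B (τ ⊗ₜ[ℝ] x) (σ ⊗ₜ[ℝ] y) = (τ * σ) • B (up x) (up y) := by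
  rw [hB.tmul_left, mul_smul]
  congr 1
  have hx : x ∈ ⨆ j, G j := hB.span ▸ Submodule.mem_top
  induction hx using Submodule.iSup_induction' with
  | mem j x hx => rw [hB.tmul_right hσ hx, (hi.mul_right j).neg_one_pow, one_smul]
  | zero => rw [up_zero, map_zero, LinearMap.zero_apply, LinearMap.zero_apply, smul_zero]
  | add x x' _ _ hx hx' => rw [up_add, map_add, LinearMap.add_apply, LinearMap.add_apply, hx, hx', smul_add]

lemma eq_up_add_sum {ι : Type*} [Fintype ι] (t : Module.Basis ι ℝ W)
    (h : ∀ x y : M, ∀ k, 2 ≤ k → comp k (B (up x) (up y)) = 0) {i j : ℕ} {x y c : M} (hx : x ∈ G i)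
    (hy : y ∈ G j) (hc : b x y = c) :
    B (up x) (up y) = up c + ∑ i, tx t i (cf B (coordL t i) 1 x y) := by
  simp only [cf_coordL]
  rw [← hc, ← hB.zeroth]
  exact Grassmann.eq_up_add_sum t (hB.up_up_mem hx hy) (h x y)

lemma eq_up {ι : Type*} [Fintype ι] (t : Module.Basis ι ℝ W)
    (h : ∀ x y : M, ∀ k, 2 ≤ k → comp k (B (up x) (up y)) = 0) {i j : ℕ} {x y c : M} (hx : x ∈ G i)
    (hy : y ∈ G j) (hc : b x y = c) (h0 : ∀ i, cf B (coordL t i) 1 x y = 0) :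
    B (up x) (up y) = up c := by
  rw [hB.eq_up_add_sum t h hx hy hc, Finset.sum_eq_zero fun i _ => by rw [h0, tx_zero], add_zero]

lemma eq_sub_add {ι : Type*} [Fintype ι] (t : Module.Basis ι ℝ W)
    (h : ∀ x y : M, ∀ k, 2 ≤ k → comp k (B (up x) (up y)) = 0) {i j : ℕ} {x y c : M} (hx : x ∈ G i)
    (hy : y ∈ G j) (hc : b x y = c) {F : Type*} [AddCommGroup F] [Module ℝ F] (T : F →ₗ[ℝ] M)
    (r : ι → ℝ) (s : F) (d : ι → F)
    (h1 : comp 1 (B (up x) (up y)) = ∑ i, tx t i (T ((-2 * r i) • s + (2 : ℝ) • d i))) :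
    B (up x) (up y) = up c - (2 : ℝ) • ∑ i, tx t i (T (r i • s)) + (2 : ℝ) • ∑ i, tx t i (T (d i)) := by
  have h2 := (comp_one_eq_sum_iff t _ _).1 h1
  rw [hB.eq_up_add_sum t h hx hy hc]
  simp only [cf_coordL, h2, map_add, mul_smul, map_smul, tx, TensorProduct.tmul_add,
    TensorProduct.tmul_smul, Finset.sum_add_distrib, ← Finset.smul_sum]
  module

lemma eq_add {ι : Type*} [Fintype ι] (t : Module.Basis ι ℝ W)
    (h : ∀ x y : M, ∀ k, 2 ≤ k → comp k (B (up x) (up y)) = 0) {i j : ℕ} {x y : M} (hx : x ∈ G i)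
    (hy : y ∈ G j) (hc : b x y = 0) {F : Type*} [AddCommGroup F] [Module ℝ F] (T : F →ₗ[ℝ] M)
    (r : ι → ℝ) (s : F) (d : ι → F)
    (h1 : comp 1 (B (up x) (up y)) = ∑ i, tx t i (T ((-2 * r i) • s + d i))) :
    B (up x) (up y) = -(2 : ℝ) • ∑ i, tx t i (T (r i • s)) + ∑ i, tx t i (T (d i)) := by
  have h2 := (comp_one_eq_sum_iff t _ _).1 h1
  rw [hB.eq_up_add_sum t h hx hy hc, up_zero, zero_add]
  simp only [cf_coordL, h2, map_add, mul_smul, map_smul, tx, TensorProduct.tmul_add,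
    TensorProduct.tmul_smul, Finset.sum_add_distrib, ← Finset.smul_sum]

/-- The bracket of a deformation on sums of even elements. -/
lemma bracket_even {a a' v v' c d d' : M} (ha' : a' ∈ G 0) (hv : v ∈ G 2)
    (h1 : B (up a) (up a') = up c) (h2 : B (up a) (up v') = up d) (h3 : B (up a') (up v) = up d')
    (h4 : B (up v) (up v') = 0) : B (up (a + v)) (up (a' + v')) = up (c + (d - d')) := by
  have h5 : B (up v) (up a') = -up d' := by
    rw [hB.skew_up (piece_le_degPart (zero_add _) (up_mem_piece hv))
      (piece_le_degPart (zero_add _) (up_mem_piece ha')), h3, mul_zero, pow_zero, one_smul]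
  rw [up_add, up_add, LinearMap.map_add, LinearMap.map_add₂, LinearMap.map_add₂, h1, h2, h5, h4, up_add,
    up_sub]
  abel

end IsDeformation

end Grassmann

section FirstOrder

variable {S : Type*} [AddCommGroup S] [Module ℝ S] [Module Cl S] [IsScalarTower ℝ Cl S]
variable [IsSimpleModule Cl S]
variable {ω : S →ₗ[ℝ] S →ₗ[ℝ] ℝ} (hω : IsInvariantSymplectic ω)
variable {h₀ : LieSubalgebra ℝ soV} {W : Type*} [AddCommGroup W] [Module ℝ W] {B : Br h₀ W S}
variable {ι : Type*} [Fintype ι] (t : Module.Basis ι ℝ W)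

lemma eq_of_diag_eq {E : Type*} [AddCommGroup E] [Module ℝ E] {f g : S →ₗ[ℝ] S →ₗ[ℝ] E}
    (hf : ∀ s t, f s t = f t s) (hg : ∀ s t, g s t = g t s) (h : ∀ s, f s s = g s s) : f = g := by
  refine LinearMap.ext₂ fun s t => ?_
  have h1 := h (s + t)
  simp only [map_add, LinearMap.add_apply, h, hf t s, hg t s] at h1
  have h2 : (2 : ℝ) • f s t = (2 : ℝ) • g s t := by
    rw [two_smul, two_smul]
    linear_combination (norm := abel) h1
  exact smul_right_injective E (two_ne_zero (α := ℝ)) h2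

lemma eq_inS_of_pS {x : H h₀ S} (hx : x ∈ hGr h₀ S 1) {s : S} (h : pS x = s) : x = inS h₀ s :=
  (eq_inS hx).trans (congrArg (inS h₀) h)

lemma eq_inV_of_pV {x : H h₀ S} (hx : x ∈ hGr h₀ S 2) {v : V} (h : pV x = v) : x = inV h₀ v :=
  (eq_inV hx).trans (congrArg (inV h₀) h)

include hω in
lemma IsFilteredDeformation.hasInfinitesimalForm_iff (hB : IsFilteredDeformation ω B)
    {φ : ι → S →ₗ[ℝ] ℝ} {X : ι → S →ₗ[ℝ] soV} : HasInfinitesimalForm t B φ X ↔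
      ∀ i, IsCobdry ω B (Grassmann.coordL t i) (φ i) (X i) 0 := by
  have hSS : ∀ i s, cobdrySS ω (φ i) (X i) 0 s s =
      (-2 * φ i s) • s + (2 : ℝ) • spin (X i s : Module.End ℝ V) s := fun i s => by
    rw [cobdrySS_apply, LinearMap.zero_apply]
    module
  have hSV : ∀ i s v, cobdrySV ω (φ i) (X i) 0 s v =
      (-2 * φ i s) • v + (X i s : Module.End ℝ V) v := fun i s v => by
    rw [cobdrySV_apply, LinearMap.zero_apply, map_zero, sub_zero]
  constructor
  · rintro ⟨h1, h2⟩ i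
    constructor
    · refine eq_of_diag_eq (cpt_SS_comm hB _ _ _) (cobdrySS_comm hω _ _ _) fun s => ?_
      have h3 := (Grassmann.comp_one_eq_sum_iff t _ _).1 (h1 s) i
      rw [cpt_apply, Grassmann.cf_coordL, hSS]
      exact congrArg pS h3
    · refine LinearMap.ext₂ fun s v => ?_
      have h3 := (Grassmann.comp_one_eq_sum_iff t _ _).1 (h2 s v) i
      rw [cpt_apply, Grassmann.cf_coordL, hSV]
      exact congrArg pV h3
  · intro h
    refine ⟨fun s => (Grassmann.comp_one_eq_sum_iff t _ _).2 fun i => ?_,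
      fun s v => (Grassmann.comp_one_eq_sum_iff t _ _).2 fun i => ?_⟩
    · exact (Grassmann.cf_coordL t B i _ _).symm.trans
        (eq_inS_of_pS (hB.isDeformation.cf_mem (Grassmann.coordL t i) 1 (inS_mem s) (inS_mem s))
          ((LinearMap.congr_fun₂ (h i).1 s s).trans (hSS i s)))
    · exact (Grassmann.cf_coordL t B i _ _).symm.trans
        (eq_inV_of_pV (hB.isDeformation.cf_mem (Grassmann.coordL t i) 1 (inS_mem s) (inV_mem v))
          ((LinearMap.congr_fun₂ (h i).2 s v).trans (hSV i s v)))

include hω in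
lemma IsCobdry.invariance (hB : IsFilteredDeformation ω B) {l : ExteriorAlgebra ℝ W →ₗ[ℝ] ℝ}
    {φ : S →ₗ[ℝ] ℝ} {X : S →ₗ[ℝ] soV} {Y : V →ₗ[ℝ] S} (h : IsCobdry ω B l φ X Y) (A : h₀) (s : S)
    (v : V) : φ (spin (asEnd A) s) = 0 ∧
      cpt iA iS pA B l 1 A s = ⁅(A : soV), X s⁆ - X (spin (asEnd A) s) ∧
      cpt iA iV pS B l 1 A v = spin (asEnd A) (Y v) - Y (asEnd A v) := by
  have : Module.Finite ℝ S := finite_spinor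
  refine cobdry_invariance hω (A : soV) (cpt iA iS pA B l 1 A) (cpt iA iV pS B l 1 A)
    (fun s => ?_) (fun s v => ?_) s v
  · rw [← h.1]
    exact first_order_SS hB l A s
  · rw [← h.2]
    exact first_order_SV hB l A s v

lemma isFlat_of_hasFirstOrderBrackets (hB : IsFilteredDeformation ω B) {φ : ι → S →ₗ[ℝ] ℝ}
    {X : ι → S →ₗ[ℝ] soV} {θ : ι → h₀ → S → h₀} (h : HasFirstOrderBrackets ω t B φ X θ) :
    IsFlat B := by
  intro k l _ hl a _ b hb A A' v v'
  have h1 : ((A, 0, v) : H h₀ S) = inA A + inV h₀ v := by simp [inA, inV]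
  have h2 : ((A', 0, v') : H h₀ S) = inA A' + inV h₀ v' := by simp [inA, inV]
  have h3 : ((⁅A, A'⁆, 0, asEnd A v' - asEnd A' v) : H h₀ S) =
      inA ⁅A, A'⁆ + (inV h₀ (asEnd A v') - inV h₀ (asEnd A' v)) := by simp [inA, inV]
  rw [hB.isDeformation.tmul_tmul_of_even hl a hb, Grassmann.tmul_eq_smul_up, h1, h2, h3]
  exact congrArg (fun z => (a * b) • z) (hB.isDeformation.bracket_even (inA_mem A') (inV_mem v)
    (h.AA A A') (h.AV A v') (h.AV A' v) (h.VV v v'))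

include hω in
lemma hasFirstOrderBrackets (hB : IsFilteredDeformation ω B) (h1 : IsFirstOrder B)
    {φ : ι → S →ₗ[ℝ] ℝ} {X : ι → S →ₗ[ℝ] soV} (hX : HasInfinitesimalForm t B φ X) :
    HasFirstOrderBrackets ω t B φ X
      fun i A s => (Grassmann.cf B (Grassmann.coordL t i) 1 (inA A) (inS h₀ s)).1 := by
  have hD := hB.isDeformation
  have hI := (hB.hasInfinitesimalForm_iff hω t).1 hX
  constructor
  · exact fun A A' => hD.eq_up t h1 (inA_mem A) (inA_mem A') (brk_AA A A') fun i =>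
      hD.cf_eq_zero_of_lt _ (by norm_num) (inA_mem A) (inA_mem A')
  · refine fun A v => hD.eq_up t h1 (inA_mem A) (inV_mem v) (brk_AV A v) fun i =>
      eq_zero_of_pS (hD.cf_mem _ 1 (inA_mem A) (inV_mem v)) ?_
    -- The first-order part of `[A, v]` is determined by `Y`, which is zero in this normal form.
    have h2 := ((hI i).invariance hω hB A 0 v).2.2
    rw [LinearMap.zero_apply, LinearMap.zero_apply, spin_zero_vec, sub_zero] at h2
    exact h2
  · intro A s
    refine (hD.eq_up_add_sum t h1 (inA_mem A) (inS_mem s) (brk_AS A s)).trans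
      (congrArg (fun z => up (inS h₀ (spin (asEnd A) s)) + z) (Finset.sum_congr rfl fun i _ => ?_))
    exact congrArg (tx t i) (eq_inA (hD.cf_mem _ 1 (inA_mem A) (inS_mem s)))
  · exact fun s => hD.eq_sub_add t h1 (inS_mem s) (inS_mem s) (brk_SS s s) iS (fun i => φ i s) s
      (fun i => spin (X i s : Module.End ℝ V) s) (hX.1 s)
  · exact fun s v => hD.eq_add t h1 (inS_mem s) (inV_mem v) (brk_SV s v) iV (fun i => φ i s) v
      (fun i => (X i s : Module.End ℝ V) v) (hX.2 s v)
  · exact fun v w => (hD.eq_up t h1 (inV_mem v) (inV_mem w) (brk_VV v w) fun i =>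
      eq_zero_of_mem_hGr le_rfl (hD.cf_mem _ 1 (inV_mem v) (inV_mem w))).trans Grassmann.up_zero

include hω in
/-- A deformation whose infinitesimal deformation squares to zero is isomorphic to a deformation with
explicit brackets of first order. -/
theorem exists_hasFirstOrderBrackets (hB : IsFilteredDeformation ω B) {n : V} (hn : 0 < eta n n)
    (hfix : ∀ A : h₀, asEnd A n = 0) {φ : ι → S →ₗ[ℝ] ℝ} {X : ι → S →ₗ[ℝ] soV}
    (hX : HasInfinitesimalForm t B φ X) (hF : FirstOrderSquareZero B) :
    ∃ θ : ι → h₀ → S → h₀, (∀ i (A : h₀) (s : S), ((θ i A s : h₀) : soV) =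
      ⁅(A : soV), X i s⁆ - X i (spin (asEnd A) s)) ∧
      ∃ B' : Br h₀ W S, IsFilteredDeformation ω B' ∧ Isomorphic B B' ∧
        HasFirstOrderBrackets ω t B' φ X θ ∧ IsFirstOrder B' ∧ IsFlat B' := by
  obtain ⟨B', hB', hiso, h1, h2⟩ := exists_isFirstOrder hω hn hfix hB hF
  have hX' : HasInfinitesimalForm t B' φ X :=
    ⟨fun s => (h1 _ _).trans (hX.1 s), fun s v => (h1 _ _).trans (hX.2 s v)⟩
  have h3 := hasFirstOrderBrackets hω t hB' h2 hX'
  exact ⟨_, fun i A s => (((hB'.hasInfinitesimalForm_iff hω t).1 hX' i).invariance hω hB' A s 0).2.1,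
    B', hB', hiso, h3, h2, isFlat_of_hasFirstOrderBrackets t hB' h3⟩

include hω in
/-- The infinitesimal deformation is represented by `∂(Z ⊗ φ) + ∂X` after a change of trivialization,
and `X` may be taken to be orthogonal to `𝔥₀`. -/
lemma exists_hasInfinitesimalForm (hB : IsFilteredDeformation ω B) {n : V} (hn : 0 < eta n n)
    (hfix : ∀ A : h₀, asEnd A n = 0) :
    ∃ (φ : ι → S →ₗ[ℝ] ℝ) (X : ι → S →ₗ[ℝ] soV) (B' : Br h₀ W S), IsFilteredDeformation ω B' ∧
      Isomorphic B B' ∧ HasInfinitesimalForm t B' φ X ∧ ∀ i s, InPerp h₀ (X i s) := by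
  have : Module.Finite ℝ S := finite_spinor
  have h : ∀ i, ∃ (φ : S →ₗ[ℝ] ℝ) (X : S →ₗ[ℝ] soV) (Y : V →ₗ[ℝ] S),
      IsCobdry ω B (Grassmann.coordL t i) φ X Y := fun i =>
    exists_eq_cobdry hω (cpt_SS_comm hB _ _ _) (spencer_cocycle hB _)
  choose φ X Y h using h
  obtain ⟨P, hP⟩ := exists_projection hn hfix
  obtain ⟨B₁, hB₁, hi₁, h₁⟩ := exists_isCobdry_zero t hB h
  obtain ⟨B₂, hB₂, hi₂, h₂⟩ := exists_isCobdry_sub t hB₁ (fun i => P ∘ₗ X i) h₁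
  exact ⟨φ, _, B₂, hB₂, hi₁.trans hi₂, (hB₂.hasInfinitesimalForm_iff hω t).2 h₂, fun i s => hP (X i s)⟩

include hω in
/-- The stabilizer of a timelike deformation fixes a timelike vector. -/
lemma HasTimelikeDirection.exists_timelike (hB : IsFilteredDeformation ω B)
    (h : HasTimelikeDirection ω B) : ∃ n : V, 0 < eta n n ∧ ∀ A : h₀, asEnd A n = 0 := by
  obtain ⟨l, u, X, Y, hu, h1, h2⟩ := h
  have hI : IsCobdry ω B (l ∘ₗ ExteriorAlgebra.ιInv (R := ℝ) (M := W)) (ω u) X Y := by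
    constructor
    · refine eq_of_diag_eq (cpt_SS_comm hB _ _ _) (cobdrySS_comm hω _ _ _) fun s => ?_
      rw [cpt_apply, Grassmann.cf_one, cobdrySS_apply]
      refine (congrArg pS (h1 s)).trans ?_
      change (-2 * ω u s) • s + (2 : ℝ) • spin (X s : Module.End ℝ V) s - Y (kappaL ω s s) = _
      module
    · refine LinearMap.ext₂ fun s v => ?_
      rw [cpt_apply, Grassmann.cf_one, cobdrySV_apply]
      exact congrArg pV (h2 s v)
  refine ⟨kappa ω u u, hu, fun A => ?_⟩
  -- Invariance of `φ = ω(u, -)` under `A` means `A u = 0` by nondegeneracy, and equivariance of `κ`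
  -- then fixes `κ(u, u)`.
  have h3 : spin (asEnd A) u = 0 := eq_zero_of_omega hω fun s => by
    have h4 := hω.invariant _ (A : soV).2 u s
    rwa [(hI.invariance hω hB A s 0).1, add_zero] at h4
  have h5 := kappaL_spin hω (A : soV) u u
  rw [h3, map_zero, LinearMap.zero_apply, zero_add] at h5
  exact h5.symm.trans (map_zero _)

end FirstOrder

end Poincare11

end

/-! ### The theorem on filtered deformations -/

theorem theorem1p3 {S : Type*} [AddCommGroup S] [Module ℝ S] [Module Poincare11.Cl S]
    [IsScalarTower ℝ Poincare11.Cl S] [IsSimpleModule Poincare11.Cl S]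
    (ω : S →ₗ[ℝ] S →ₗ[ℝ] ℝ) (hω : Poincare11.IsInvariantSymplectic ω)
    (h₀ : LieSubalgebra ℝ Poincare11.soV)
    {W : Type*} [AddCommGroup W] [Module ℝ W] {ι : Type*} [Fintype ι] (t : Module.Basis ι ℝ W)
    (B : Poincare11.Br h₀ W S) (hB : Poincare11.IsFilteredDeformation ω B)
    (hc : Poincare11.IsCompactSubalgebra h₀ ∨ Poincare11.HasTimelikeDirection ω B) :
    (Poincare11.HasNilpotentDirection ω t B →
      ∃ (φ : ι → S →ₗ[ℝ] ℝ) (X : ι → S →ₗ[ℝ] Poincare11.soV),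
        (∀ i s, Poincare11.InPerp h₀ (X i s)) ∧
        (∀ i (A : h₀) (s : S),
          X i (Poincare11.spin (Poincare11.asEnd A) s) = ⁅(A : Poincare11.soV), X i s⁆) ∧
        ∃ B' : Poincare11.Br h₀ W S,
          Poincare11.IsFilteredDeformation ω B' ∧ Poincare11.Isomorphic B B' ∧
          Poincare11.HasFirstOrderBrackets ω t B' φ X (fun _ _ _ => 0) ∧
          Poincare11.IsFirstOrder B' ∧ Poincare11.IsFlat B') ∧
    (Poincare11.HasNilpotentRepresentative ω t B →
      ∃ (φ : ι → S →ₗ[ℝ] ℝ) (X : ι → S →ₗ[ℝ] Poincare11.soV) (θ : ι → h₀ → S → h₀),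
        (∀ i (A : h₀) (s : S), ((θ i A s : h₀) : Poincare11.soV) =
          ⁅(A : Poincare11.soV), X i s⁆ - X i (Poincare11.spin (Poincare11.asEnd A) s)) ∧
        ∃ B' : Poincare11.Br h₀ W S,
          Poincare11.IsFilteredDeformation ω B' ∧ Poincare11.Isomorphic B B' ∧
          Poincare11.HasFirstOrderBrackets ω t B' φ X θ ∧
          Poincare11.IsFirstOrder B' ∧ Poincare11.IsFlat B') := by
  obtain ⟨n, hn, hfix⟩ : ∃ n : Poincare11.V, 0 < Poincare11.eta n n ∧
      ∀ A : h₀, Poincare11.asEnd A n = 0 := by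
    rcases hc with hc | hc
    · exact hc.exists_timelike
    · exact hc.exists_timelike hω hB
  constructor
  · intro hnil
    obtain ⟨φ, X, B₁, hB₁, hi₁, hX, hperp⟩ :=
      Poincare11.exists_hasInfinitesimalForm hω t hB hn hfix
    obtain ⟨θ, hθ, B₂, hB₂, hi₂, hbr, h1, h2⟩ := Poincare11.exists_hasFirstOrderBrackets hω t hB₁
      hn hfix hX (hnil B₁ φ X hB₁ hi₁ hX hperp)
    -- `θ` is `𝔥₀`-valued, and for the canonical representative it also lies in `𝔥₀^⊥`. Its
    -- vanishing is the equivariance of `X`.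
    have hθ0 : ∀ i A s, θ i A s = 0 := fun i A s => Poincare11.InPerp.eq_zero hn hfix (by
      rw [hθ]
      exact ((hperp i s).lie A).sub (hperp i _))
    obtain rfl : θ = fun _ _ _ => 0 := funext fun i => funext fun A => funext fun s => hθ0 i A s
    exact ⟨φ, X, hperp, fun i A s => (sub_eq_zero.1 (hθ i A s).symm).symm, B₂, hB₂, hi₁.trans hi₂,
      hbr, h1, h2⟩
  · rintro ⟨B₁, φ, X, hB₁, hi₁, hX, hF⟩
    obtain ⟨θ, hθ, B₂, hB₂, hi₂, hbr, h1, h2⟩ := Poincare11.exists_hasFirstOrderBrackets hω t hB₁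
      hn hfix hX hF
    exact ⟨φ, X, θ, hθ, B₂, hB₂, hi₁.trans hi₂, hbr, h1, h2⟩
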